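/- **Combinatorial side.** A *graph* $\Gamma=(H,P,\sigma)$ consists of a finite set $H$ of half-edges, a partition $P$ of $H$ whose blocks are the *vertices*, and an involution $\sigma$ of $H$ whose orbits are the *edges*, such that a vertex containing a two-element edge (a *virtual* vertex) has exactly two half-edges; other vertices are *real*. It is *directed* if it carries $\mathrm{sgn}:H\to\{+,-\}$ taking both values on every two-element edge and on every vertex. For a vertex $v$, $In(v)$ and $Out(v)$ are the half-edges of $v$ of sign $+$ and $-$. A *leg* is a fixed point of $\sigma$ (a real leg) or a half-edge of a virtual vertex (a virtual leg); $In(\Gamma)$ and $Out(\Gamma)$ are the sets of legs of sign $+$ and $-$. Write $\bar h$ for the edge of $h$; the source (target) of an edge is the vertex, if any, of its half-edge of sign $-$ ($+$), and $e\to e'$ means that there is a directed path of edges beginning with $e$ and ending with $e'$. A *(combinatorial) progressive planar graph* is a directed graph with a linear order $\prec$ on its edges such that $(P_1)$ $e_1\to e_2$ implies $e_1\prec e_2$ for $e_1\ne e_2$; $(P_2)$ if $e_1\to e_2$ and $e_1\prec e_3\prec e_2$, then $e_3\to e_2$ or $e_1\to e_3$. Isomorphisms are bijections of half-edges that preserve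 $P$, $\sigma$, $\mathrm{sgn}$ and $\prec$. Let $\mathsf\Gamma$ be the set of isomorphism classes. The *tensor product* $\Gamma_1\otimes\Gamma_2$ is the disjoint union, with all edges of $\Gamma_1$ before all edges of $\Gamma_2$. If $Out(\Gamma_1)=\{o_1,\dots,o_n\}$ and $In(\Gamma_2)=\{i_1,\dots,i_n\}$, listed in the order of their edges, the *composition* $\Gamma_2\circ\Gamma_1$ is obtained from the disjoint union by grafting $o_k$ to $i_k$ for every $k$ (two real legs become the two halves of one edge; a real leg grafted with a virtual leg stays a leg and the virtual vertex disappears; if both legs are virtual, the two virtual vertices become one virtual vertex consisting of the two other half-edges). Its edges are ordered as $Q_1,\varepsilon_1,P_1,\dots,Q_n,\varepsilon_n,P_n$, where $\varepsilon_k$ is the edge obtained from $\overline{o_k}$ and $\overline{i_k}$, $Q_k$ consists of the edges of $\Gamma_1$ strictly between $\overline{o_{k-1}}$ and $\overline{o_k}$ (before $\overline{o_1}$ if $k=1$) and $P_k$ of the edges of $\Gamma_2$ strictly between $\overline{i_k}$ and $\overline{i_{k+1}}$ (after $\overline{i_n}$ if $k=n$), in the given orders. **Geometric side.** Let $a<b$.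 A *leveled progressive plane graph* $G[a,b]$ is a compact set $G\subset\mathbb R\times[a,b]$ with a finite subset $G_0\subset G$ of *nodes*, such that $G\setminus G_0$ has finitely many connected components (the *edges*), each of them an open arc whose two ends are nodes; every node is in the closure of an edge; the points of $G$ at the levels $a,b$ are nodes (the *outer* nodes; the others are *inner*), and each outer node is the end of exactly one edge; the second projection is injective on each edge. Edges are directed upwards. We also require that every inner node is the source of some edge and the target of some edge. The edges starting (ending) at an outer node form $dom(G)$ ($cod(G)$), ordered from left to right by these nodes; the incoming (outgoing) edges of an inner node are ordered from left to right just below (above) the node. A *deformation* is a continuous map $h:G\times[0,1]\to\mathbb R^2$ such that each $h(-,t)$ is an embedding whose image, with the images of the inner and outer nodes of $G$ as inner and outer nodes, is a leveled progressive plane graph between some levels $a(t)<b(t)$. Two leveled progressive plane graphs are isomorphic if some deformation starts with the inclusion of the first and ends with a homeomorphism onto the second (respecting nodes and levels). Let $\mathsf G$ be the set of isomorphism (deformation) classes. A graph is *boxed* if its levels are $-1,1$ and it lies in $(-1,1)\times[-1,1]$. Every class in $\mathsf G$ has a boxed representative. For boxed $G^1,G^2$, put $e_1=(1,0)$, $e_2=(0,1)$,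 $\tau(x,t)=(\frac x2,t)$, $\gamma(x,t)=(x,\frac t3)$. The tensor product $G^1\otimes G^2$ is $\tau((G^1-e_1)\sqcup(G^2+e_1))$ with the corresponding nodes. If $|cod(G^1)|=|dom(G^2)|=m$, the composition $G^2\circ G^1$ is $\gamma\big((G^1-2e_2)\sqcup[a_1,b_1]\sqcup\dots\sqcup[a_m,b_m]\sqcup(G^2+2e_2)\big)$, where $a_1,\dots,a_m$ are the top points of $G^1-2e_2$ and $b_1,\dots,b_m$ the bottom points of $G^2+2e_2$ from left to right; its inner nodes are the images of the inner nodes of $G^1-2e_2$ and $G^2+2e_2$. The *underlying combinatorial graph* of $G$ is the directed graph whose half-edges are the pairs $(x,e)$ of an inner node $x$ and an edge $e$ ending there (sign $+$) or starting there (sign $-$), together with $e^+,e^-$ for every edge $e$ that joins two outer nodes; its vertices are the inner nodes and the pairs $\{e^+,e^-\}$, and $\sigma$ exchanges the two half-edges of an edge that has two of them. **Theorem.** There is a unique bijection $\Phi:\mathsf\Gamma\to\mathsf G$ such that $\Phi[\Gamma]=[G]$ if and only if $\Gamma$ is isomorphic, as a directed graph, to the underlying combinatorial graph of $G$ by an isomorphism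 under which the order $\prec$ of $\Gamma$ induces the left-to-right orders of the incoming and of the outgoing edges of every inner node of $G$, of $dom(G)$ and of $cod(G)$. If $\Phi[\Gamma]=[G]$, then $|In(\Gamma)|=|dom(G)|$ and $|Out(\Gamma)|=|cod(G)|$. Tensor products and (when $|Out(\Gamma_1)|=|In(\Gamma_2)|$) compositions of progressive planar graphs are progressive planar graphs, those of boxed progressive plane graphs are boxed progressive plane graphs, and $$\Phi[\Gamma_1\otimes\Gamma_2]=\Phi[\Gamma_1]\otimes\Phi[\Gamma_2],\qquad \Phi[\Gamma_2\circ\Gamma_1]=\Phi[\Gamma_2]\circ\Phi[\Gamma_1],$$ where the operations on $\mathsf G$ are those induced by the operations on arbitrary boxed representatives. -/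

import Mathlib

open Set Topology Filter

noncomputable section

namespace TensorCalc

/-! ## Combinatorial progressive planar graphs -/

/-- The data of a combinatorial oriented graph: a type `H` of half-edges, the relation `P h k`
"`h` and `k` lie in the same vertex", the map `σ` whose orbits are the edges, and the
orientation `sgn` (`true` is `+`, `false` is `-`).  The axioms are in `IsDirectedGraph`. -/
structure GraphData where
  H : Type
  P : H → H → Prop
  σ : H → H
  sgn : H → Bool

namespace GraphData

variable (X : GraphData)

/-- Edges: orbits of `σ`. -/
def Edge : Type := Quot (fun h k : X.H => k = X.σ h)

variable {X}

/-- The edge of a half-edge. -/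
def edge (h : X.H) : X.Edge := Quot.mk _ h

/-- Virtual half-edges: those of a two-element edge that is contained in one vertex. -/
def IsVirtual (h : X.H) : Prop := X.σ h ≠ h ∧ X.P h (X.σ h)

/-- Legs: real legs (one-element edges) and virtual legs. -/
def IsLeg (h : X.H) : Prop := X.σ h = h ∨ IsVirtual h

/-- One step of a directed path: the target of `e` is the source of `f`. -/
def Step (e f : X.Edge) : Prop :=
  ∃ h k : X.H, edge h = e ∧ edge k = f ∧ X.sgn h = true ∧ X.sgn k = false ∧ X.P h k

/-- There is a directed path with first edge `e` and last edge `f`. -/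
def Path (e f : X.Edge) : Prop := Relation.ReflTransGen Step e f

variable (X)

/-- Input legs of the graph. -/
def inputs : Set X.H := {h | IsLeg h ∧ X.sgn h = true}

/-- Output legs of the graph. -/
def outputs : Set X.H := {h | IsLeg h ∧ X.sgn h = false}

/-- `X` is a finite directed graph: `P` is a partition, `σ` an involution, a virtual vertex has
degree two, the two half-edges of a two-element edge have opposite signs, and every vertex has
an input and an output. -/
structure IsDirectedGraph : Prop where
  finite : Finite X.H
  partition : Equivalence X.P
  involution : Function.Involutive X.σ
  virtual_degree : ∀ h : X.H, IsVirtual h → ∀ k, X.P h k → k = h ∨ k = X.σ h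
  orientation : ∀ h : X.H, X.σ h ≠ h → X.sgn (X.σ h) ≠ X.sgn h
  exists_in : ∀ h : X.H, ∃ k, X.P h k ∧ X.sgn k = true
  exists_out : ∀ h : X.H, ∃ k, X.P h k ∧ X.sgn k = false

variable {X}

/-- A bijection of half-edges that is an isomorphism of oriented graphs. -/
structure IsGraphIso {Y : GraphData} (φ : X.H ≃ Y.H) : Prop where
  map_P : ∀ h k, X.P h k ↔ Y.P (φ h) (φ k)
  map_σ : ∀ h, φ (X.σ h) = Y.σ (φ h)
  map_sgn : ∀ h, Y.sgn (φ h) = X.sgn h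

end GraphData

/-- An oriented graph with a relation `lt` (`≺`) on its set of edges. -/
structure PlanarData extends GraphData where
  lt : toGraphData.Edge → toGraphData.Edge → Prop

namespace PlanarData

open GraphData

/-- `≺` is a progressive planar structure on the directed graph `X`. -/
structure IsPlanar (X : PlanarData) : Prop extends X.IsDirectedGraph where
  linear : IsStrictTotalOrder X.Edge X.lt
  P1 : ∀ e f : X.Edge, e ≠ f → Path e f → X.lt e f
  P2 : ∀ e₁ e₂ e₃ : X.Edge, Path e₁ e₂ → X.lt e₁ e₃ → X.lt e₃ e₂ → Path e₃ e₂ ∨ Path e₁ e₃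

/-- Isomorphism: a bijection of half-edges that respects vertices, edges, orientation and the
order of the edges. -/
def Iso (X Y : PlanarData) : Prop :=
  ∃ φ : X.H ≃ Y.H, IsGraphIso φ ∧
    ∀ h k : X.H, X.lt (edge h) (edge k) ↔ Y.lt (edge (φ h)) (edge (φ k))

/-! ### Tensor product -/

/-- Tensor product: disjoint union, the edges of `X` before the edges of `Y`. -/
def tensor (X Y : PlanarData) : PlanarData where
  H := X.H ⊕ Y.H
  P x y := match x, y with
    | .inl h, .inl k => X.P h k
    | .inr h, .inr k => Y.P h k
    | _, _ => False
  σ := Sum.map X.σ Y.σ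
  sgn := Sum.elim X.sgn Y.sgn
  lt e f := ∃ x y : X.H ⊕ Y.H, Quot.mk _ x = e ∧ Quot.mk _ y = f ∧
    match x, y with
    | .inl h, .inl k => X.lt (edge h) (edge k)
    | .inr h, .inr k => Y.lt (edge h) (edge k)
    | .inl _, .inr _ => True
    | .inr _, .inl _ => False

/-! ### Composition

`comp Y X` is `Y ∘ X`: the `k`-th output of `X` is grafted to the `k`-th input of `Y`. -/

/-- `o` is an output of `X`, `i` is an input of `Y`, and they have the same position. -/
def Match (X Y : PlanarData) (o : X.H) (i : Y.H) : Prop :=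
  o ∈ X.outputs ∧ i ∈ Y.inputs ∧
    {o' ∈ X.outputs | X.lt (edge o') (edge o)}.ncard =
      {i' ∈ Y.inputs | Y.lt (edge i') (edge i)}.ncard

/-- The half-edges that disappear in the grafting of `o` and `i`: both legs if both are virtual;
the whole virtual edge if exactly one of them is virtual. -/
inductive Removed (X Y : PlanarData) : X.H ⊕ Y.H → Prop
  | out_leg (o : X.H) (i : Y.H) : Match X Y o i → IsVirtual o → Removed X Y (.inl o)
  | out_end (o : X.H) (i : Y.H) : Match X Y o i → IsVirtual o → ¬ IsVirtual i →
      Removed X Y (.inl (X.σ o))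
  | in_leg (o : X.H) (i : Y.H) : Match X Y o i → IsVirtual i → Removed X Y (.inr i)
  | in_end (o : X.H) (i : Y.H) : Match X Y o i → ¬ IsVirtual o → IsVirtual i →
      Removed X Y (.inr (Y.σ i))

/-- The two remaining ends of two grafted virtual edges; they form a new virtual vertex. -/
inductive VirtualGlued (X Y : PlanarData) : X.H ⊕ Y.H → X.H ⊕ Y.H → Prop
  | mk (o : X.H) (i : Y.H) : Match X Y o i → IsVirtual o → IsVirtual i →
      VirtualGlued X Y (.inl (X.σ o)) (.inr (Y.σ i))

/-- The pairs of half-edges that are joined to a new edge. -/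
inductive Glued (X Y : PlanarData) : X.H ⊕ Y.H → X.H ⊕ Y.H → Prop
  | real (o : X.H) (i : Y.H) : Match X Y o i → ¬ IsVirtual o → ¬ IsVirtual i →
      Glued X Y (.inl o) (.inr i)
  | virt (x y : X.H ⊕ Y.H) : VirtualGlued X Y x y → Glued X Y x y

/-- The edge of `X` (if any) that the half-edge `x` of `Y ∘ X` is part of, where the edge grafted
from the `k`-th output of `X` and the `k`-th input of `Y` counts as an edge of both. -/
def TraceFst (X Y : PlanarData) (x : X.H ⊕ Y.H) (e : X.Edge) : Prop :=
  match x with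
  | .inl h => edge h = e
  | .inr k => ∃ o i, Match X Y o i ∧ edge i = edge k ∧ edge o = e

/-- The edge of `Y` (if any) that the half-edge `x` of `Y ∘ X` is part of. -/
def TraceSnd (X Y : PlanarData) (x : X.H ⊕ Y.H) (f : Y.Edge) : Prop :=
  match x with
  | .inl h => ∃ o i, Match X Y o i ∧ edge o = edge h ∧ edge i = f
  | .inr k => edge k = f

/-- For an edge `e` of `X` and an edge `f` of `Y`: `e ≺ oₖ` and `iₖ ≺ f` for some `k`. -/
def Before (X Y : PlanarData) (e : X.Edge) (f : Y.Edge) : Prop :=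
  ∃ o i, Match X Y o i ∧ X.lt e (edge o) ∧ Y.lt (edge i) f

/-- The shuffled order `Q₁ ε₁ P₁ Q₂ ε₂ P₂ … Qₙ εₙ Pₙ` of the edges of `Y ∘ X`, where `εₖ` is the
`k`-th grafted edge, `Qₖ` consists of the old edges of `X` between `oₖ₋₁` and `oₖ`, and `Pₖ` of
the old edges of `Y` between `iₖ` and `iₖ₊₁`. Edges of `X`, and edges of `Y`, are compared as
before; an old edge `e` of `X` precedes an old edge `f` of `Y` iff `Before X Y e f`. -/
inductive CompLT (X Y : PlanarData) : X.H ⊕ Y.H → X.H ⊕ Y.H → Prop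
  | fst (x y) (e e' : X.Edge) : TraceFst X Y x e → TraceFst X Y y e' → X.lt e e' →
      CompLT X Y x y
  | snd (x y) (f f' : Y.Edge) : TraceSnd X Y x f → TraceSnd X Y y f' → Y.lt f f' →
      CompLT X Y x y
  | fst_snd (x y) (e : X.Edge) (f : Y.Edge) : (¬ ∃ f', TraceSnd X Y x f') →
      (¬ ∃ e', TraceFst X Y y e') → TraceFst X Y x e → TraceSnd X Y y f → Before X Y e f →
      CompLT X Y x y
  | snd_fst (x y) (f : Y.Edge) (e : X.Edge) : (¬ ∃ e', TraceFst X Y x e') →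
      (¬ ∃ f', TraceSnd X Y y f') → TraceSnd X Y x f → TraceFst X Y y e → ¬ Before X Y e f →
      CompLT X Y x y

open Classical in
/-- The composition `Y ∘ X`. -/
def comp (Y X : PlanarData) : PlanarData where
  H := {x : X.H ⊕ Y.H // ¬ Removed X Y x}
  P x y :=
    (match x.1, y.1 with
      | .inl h, .inl k => X.P h k
      | .inr h, .inr k => Y.P h k
      | _, _ => False) ∨
    VirtualGlued X Y x.1 y.1 ∨ VirtualGlued X Y y.1 x.1
  -- The glued half-edges are exchanged; a real leg grafted with a virtual one becomes (or stays)
  -- a leg; on all other half-edges `σ` is as before.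
  σ x :=
    if h : ∃ y : {x : X.H ⊕ Y.H // ¬ Removed X Y x}, Glued X Y x.1 y.1 ∨ Glued X Y y.1 x.1 then
      h.choose
    else if h' : ¬ Removed X Y (Sum.map X.σ Y.σ x.1) then ⟨_, h'⟩
    else x
  sgn x := Sum.elim X.sgn Y.sgn x.1
  lt e f := ∃ x y : {x : X.H ⊕ Y.H // ¬ Removed X Y x},
    Quot.mk _ x = e ∧ Quot.mk _ y = f ∧ CompLT X Y x.1 y.1

end PlanarData

/-- A combinatorial progressive planar graph. -/
structure PlanarGraph extends PlanarData where
  isPlanar : toPlanarData.IsPlanar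

instance PlanarGraph.setoid : Setoid PlanarGraph where
  r X Y := X.toPlanarData.Iso Y.toPlanarData
  iseqv :=
    { refl := fun X => ⟨Equiv.refl _, ⟨fun _ _ => Iff.rfl, fun _ => rfl, fun _ => rfl⟩,
        fun _ _ => Iff.rfl⟩
      symm := by
        rintro X Y ⟨φ, ⟨h1, h2, h3⟩, h4⟩
        refine ⟨φ.symm, ⟨fun h k => ?_, fun h => ?_, fun h => ?_⟩, fun h k => ?_⟩
        · rw [h1]; simp
        · rw [Equiv.symm_apply_eq, h2]; simp
        · rw [← h3]; simp
        · rw [h4]; simp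
      trans := by
        rintro X Y Z ⟨φ, ⟨h1, h2, h3⟩, h4⟩ ⟨ψ, ⟨k1, k2, k3⟩, k4⟩
        refine ⟨φ.trans ψ, ⟨fun h k => ?_, fun h => ?_, fun h => ?_⟩, fun h k => ?_⟩
        · rw [h1, k1]; rfl
        · simp [h2, k2]
        · simp [h3, k3]
        · rw [h4, k4]; rfl }

/-- Isomorphism classes of combinatorial progressive planar graphs. -/
abbrev PlanarClass : Type 1 := Quotient PlanarGraph.setoid

/-! ## Progressive plane graphs -/

/-- A subset of the plane with a set of nodes. -/
@[ext] structure PlaneGraph where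
  carrier : Set (ℝ × ℝ)
  nodes : Set (ℝ × ℝ)

namespace PlaneGraph

variable (G : PlaneGraph)

/-- (Open) edges: the connected components of the complement of the nodes. -/
def edges : Set (Set (ℝ × ℝ)) :=
  {e | ∃ p ∈ G.carrier \ G.nodes, e = connectedComponentIn (G.carrier \ G.nodes) p}

/-- Edges with target `x`. -/
def inEdges (x : ℝ × ℝ) : Set (Set (ℝ × ℝ)) :=
  {e ∈ G.edges | x ∈ closure e ∧ ∀ p ∈ e, p.2 < x.2}

/-- Edges with source `x`. -/
def outEdges (x : ℝ × ℝ) : Set (Set (ℝ × ℝ)) :=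
  {e ∈ G.edges | x ∈ closure e ∧ ∀ p ∈ e, x.2 < p.2}

/-- Outer nodes of a graph between the levels `a` and `b`. -/
def outer (a b : ℝ) : Set (ℝ × ℝ) := {p ∈ G.carrier | p.2 = a ∨ p.2 = b}

/-- Inner nodes of a graph between the levels `a` and `b`. -/
def inner (a b : ℝ) : Set (ℝ × ℝ) := G.nodes \ G.outer a b

/-- `G` is a leveled progressive plane graph between the levels `a` and `b`, in which every inner
node is the target of an edge and the source of an edge.  Finiteness of the nodes and of the set
of edges together with `pinned` amounts to compactness of `G`. -/
structure IsLeveled (a b : ℝ) : Prop where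
  lt : a < b
  nodes_subset : G.nodes ⊆ G.carrier
  nodes_finite : G.nodes.Finite
  edges_finite : G.edges.Finite
  /-- Every edge is an open arc whose closure is the arc together with two end nodes. -/
  pinned : ∀ e ∈ G.edges, ∃ γ : ℝ → ℝ × ℝ, ContinuousOn γ (Icc 0 1) ∧ InjOn γ (Ioo 0 1) ∧
    γ '' Ioo 0 1 = e ∧ γ 0 ∈ G.nodes ∧ γ 1 ∈ G.nodes
  not_isolated : ∀ x ∈ G.nodes, ∃ e ∈ G.edges, x ∈ closure e
  strip : ∀ p ∈ G.carrier, a ≤ p.2 ∧ p.2 ≤ b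
  outer_subset : G.outer a b ⊆ G.nodes
  outer_degree : ∀ x ∈ G.outer a b, ∃! e, e ∈ G.edges ∧ x ∈ closure e
  progressive : ∀ e ∈ G.edges, InjOn Prod.snd e
  inner_directed : ∀ x ∈ G.inner a b, (G.inEdges x).Nonempty ∧ (G.outEdges x).Nonempty

/-- The image of a plane graph under a map. -/
def image (f : ℝ × ℝ → ℝ × ℝ) : PlaneGraph := ⟨f '' G.carrier, f '' G.nodes⟩

/-- Left-to-right order of the edges that end in `x`, on lines just below `x`. -/
def leftBelow (x : ℝ × ℝ) (e f : Set (ℝ × ℝ)) : Prop :=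
  ∀ᶠ u in 𝓝[<] x.2, ∀ p ∈ e, ∀ q ∈ f, p.2 = u → q.2 = u → p.1 < q.1

/-- Left-to-right order of the edges that start in `x`, on lines just above `x`. -/
def leftAbove (x : ℝ × ℝ) (e f : Set (ℝ × ℝ)) : Prop :=
  ∀ᶠ u in 𝓝[>] x.2, ∀ p ∈ e, ∀ q ∈ f, p.2 = u → q.2 = u → p.1 < q.1

/-- The affine maps used for boxed graphs: `(x, t) ↦ ((x + c) / 2, t)`. -/
def tau (c : ℝ) (p : ℝ × ℝ) : ℝ × ℝ := ((p.1 + c) / 2, p.2)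

/-- `(x, t) ↦ (x, (t + c) / 3)`. -/
def gamma (c : ℝ) (p : ℝ × ℝ) : ℝ × ℝ := (p.1, (p.2 + c) / 3)

/-- Tensor product of boxed graphs: `G` and `K` side by side. -/
def tensor (G K : PlaneGraph) : PlaneGraph where
  carrier := tau (-1) '' G.carrier ∪ tau 1 '' K.carrier
  nodes := tau (-1) '' G.nodes ∪ tau 1 '' K.nodes

/-- Nodes (or other points) of `G` at level `u`. -/
def atLevel (u : ℝ) : Set (ℝ × ℝ) := {p ∈ G.carrier | p.2 = u}

/-- The segments that connect the `k`-th point of `G` at level `1` with the `k`-th point of `K`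
at level `-1`, for all `k`, in the composition of boxed graphs. -/
def connectors (G K : PlaneGraph) : Set (ℝ × ℝ) :=
  {z | ∃ p ∈ G.atLevel 1, ∃ q ∈ K.atLevel (-1),
    {p' ∈ G.atLevel 1 | p'.1 < p.1}.ncard = {q' ∈ K.atLevel (-1) | q'.1 < q.1}.ncard ∧
    z ∈ segment ℝ (gamma (-2) p) (gamma 2 q)}

/-- Composition `K ∘ G` of boxed graphs: `G` below `K`. -/
def comp (K G : PlaneGraph) : PlaneGraph where
  carrier := gamma (-2) '' G.carrier ∪ connectors G K ∪ gamma 2 '' K.carrier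
  nodes := gamma (-2) '' (G.inner (-1) 1) ∪ gamma 2 '' (K.inner (-1) 1) ∪
    (gamma (-2) '' G.atLevel (-1) ∪ gamma 2 '' K.atLevel 1)

end PlaneGraph

/-- Leveled progressive plane graphs (between some levels `lo < hi`). -/
structure LeveledGraph extends PlaneGraph where
  lo : ℝ
  hi : ℝ
  isLeveled : toPlaneGraph.IsLeveled lo hi

/-- A deformation of leveled progressive plane graphs that starts with the inclusion of `G` and
ends with a homeomorphism onto `K`. -/
def Deforms (G K : LeveledGraph) : Prop :=
  ∃ (h : ℝ → ℝ × ℝ → ℝ × ℝ) (a b : ℝ → ℝ),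
    ContinuousOn (Function.uncurry h) (Icc (0 : ℝ) 1 ×ˢ G.carrier) ∧
    (∀ t ∈ Icc (0 : ℝ) 1, IsEmbedding (G.carrier.domRestrict (h t)) ∧
      (G.image (h t)).IsLeveled (a t) (b t) ∧
      h t '' G.outer G.lo G.hi = (G.image (h t)).outer (a t) (b t)) ∧
    (∀ p ∈ G.carrier, h 0 p = p) ∧ a 0 = G.lo ∧ b 0 = G.hi ∧
    G.image (h 1) = K.toPlaneGraph ∧ a 1 = K.lo ∧ b 1 = K.hi


theorem Deforms.refl (G : LeveledGraph) : Deforms G G := by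
  refine ⟨fun _ p => p, fun _ => G.lo, fun _ => G.hi, continuous_snd.continuousOn, ?_,
    fun _ _ => rfl, rfl, rfl, ?_, rfl, rfl⟩
  · intro t _
    have : G.toPlaneGraph.image (fun p => p) = G.toPlaneGraph := by
      ext1 <;> simp [PlaneGraph.image]
    simp only [this]
    exact ⟨IsEmbedding.subtypeVal, G.isLeveled, by simp⟩
  · ext1 <;> simp [PlaneGraph.image]

theorem PlaneGraph.image_image (G : PlaneGraph) (f g : ℝ × ℝ → ℝ × ℝ) :
    (G.image f).image g = G.image (fun p => g (f p)) := by
  ext1 <;> simp [PlaneGraph.image, Set.image_image]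

theorem PlaneGraph.image_congr {G : PlaneGraph} (hG : G.nodes ⊆ G.carrier)
    {f g : ℝ × ℝ → ℝ × ℝ} (h : ∀ p ∈ G.carrier, f p = g p) : G.image f = G.image g := by
  ext1
  · exact Set.image_congr h
  · exact Set.image_congr fun p hp => h p (hG hp)

theorem Deforms.symm {G K : LeveledGraph} (H : Deforms G K) : Deforms K G := by
  obtain ⟨h, a, b, hc, ht, h0, ha0, hb0, h1, ha1, hb1⟩ := H
  have one : (1 : ℝ) ∈ Icc (0 : ℝ) 1 := by simp
  obtain ⟨he1, -, ho1⟩ := ht 1 one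
  have hC : h 1 '' G.carrier = K.carrier := congrArg PlaneGraph.carrier h1
  have hN : h 1 '' G.nodes = K.nodes := congrArg PlaneGraph.nodes h1
  have hO : h 1 '' G.outer G.lo G.hi = K.outer K.lo K.hi := by
    rw [ho1, h1, ha1, hb1]
  have hsub : G.nodes ⊆ G.carrier := G.isLeveled.nodes_subset
  have hosub : G.outer G.lo G.hi ⊆ G.carrier := fun p hp => hp.1
  have hr : range (G.carrier.domRestrict (h 1)) = K.carrier := by
    rw [← hC]; ext; simp
  let E : G.carrier ≃ₜ K.carrier := he1.toHomeomorph.trans (Homeomorph.setCongr hr)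
  have hE : ∀ p : G.carrier, (E p : ℝ × ℝ) = h 1 p := fun p => rfl
  classical
  let g : ℝ × ℝ → ℝ × ℝ := fun q => if hq : q ∈ K.carrier then E.symm ⟨q, hq⟩ else q
  have hgE : ∀ q : K.carrier, g q = E.symm q := fun q => by simp [g]
  have hg : ∀ p ∈ G.carrier, g (h 1 p) = p := by
    intro p hp
    have := hgE (E ⟨p, hp⟩)
    rwa [hE, Homeomorph.symm_apply_apply] at this
  have hgm : ∀ q ∈ K.carrier, g q ∈ G.carrier := by
    intro q hq
    have := hgE ⟨q, hq⟩
    rw [this]; exact (E.symm ⟨q, hq⟩).2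
  have hgc : ContinuousOn g K.carrier := by
    rw [continuousOn_iff_continuous_domRestrict]
    have : K.carrier.domRestrict g = fun q => (E.symm q : ℝ × ℝ) := by
      funext q; exact hgE q
    rw [this]; fun_prop
  have hfg : ∀ q ∈ K.carrier, h 1 (g q) = q := by
    intro q hq
    have := hE (E.symm ⟨q, hq⟩)
    rw [Homeomorph.apply_symm_apply, ← hgE] at this
    exact this.symm
  have key : ∀ (k : ℝ × ℝ → ℝ × ℝ) (S : Set (ℝ × ℝ)), S ⊆ G.carrier →
      (fun q => k (g q)) '' (h 1 '' S) = k '' S := by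
    intro k S hS
    rw [Set.image_image]
    exact Set.image_congr fun p hp => by rw [hg p (hS hp)]
  have himg : ∀ k : ℝ × ℝ → ℝ × ℝ, K.image (fun q => k (g q)) = G.image k := by
    intro k
    ext1
    · change _ '' K.carrier = _
      rw [← hC]; exact key k _ subset_rfl
    · change _ '' K.nodes = _
      rw [← hN]; exact key k _ hsub
  have hmem : ∀ t ∈ Icc (0 : ℝ) 1, 1 - t ∈ Icc (0 : ℝ) 1 := by
    rintro t ⟨h0, h1⟩; constructor <;> linarith
  refine ⟨fun t q => h (1 - t) (g q), fun t => a (1 - t), fun t => b (1 - t), ?_, ?_, ?_,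
    by simpa using ha1, by simpa using hb1, ?_, by simpa using ha0, by simpa using hb0⟩
  · have : ContinuousOn (fun z : ℝ × (ℝ × ℝ) => ((1 - z.1, g z.2) : ℝ × (ℝ × ℝ)))
        (Icc (0 : ℝ) 1 ×ˢ K.carrier) := by
      refine ContinuousOn.prodMk (by fun_prop) ?_
      exact hgc.comp continuousOn_snd fun z hz => hz.2
    exact hc.comp this fun z hz => ⟨hmem _ hz.1, hgm _ hz.2⟩
  · intro t htm
    obtain ⟨he, hl, ho⟩ := ht (1 - t) (hmem t htm)
    refine ⟨?_, ?_, ?_⟩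
    · have : K.carrier.domRestrict (fun q => h (1 - t) (g q)) =
          G.carrier.domRestrict (h (1 - t)) ∘ E.symm := by
        funext q
        simp [hgE q]
      rw [this]
      exact he.comp E.symm.isEmbedding
    · rw [himg]; exact hl
    · rw [himg, ← hO, key _ _ hosub]; exact ho
  · intro q hq
    simpa using hfg q hq
  · simp only [sub_self]
    rw [himg, PlaneGraph.image_congr hsub (g := fun p => p) h0]
    ext1 <;> simp [PlaneGraph.image]

theorem Deforms.trans {G K L : LeveledGraph} (H : Deforms G K) (H' : Deforms K L) :
    Deforms G L := by
  obtain ⟨h, a, b, hc, ht, h0, ha0, hb0, h1, ha1, hb1⟩ := H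
  obtain ⟨k, c, d, kc, kt, k0, hc0, hd0, k1, hc1, hd1⟩ := H'
  have one : (1 : ℝ) ∈ Icc (0 : ℝ) 1 := by simp
  obtain ⟨he1, -, ho1⟩ := ht 1 one
  have hC : h 1 '' G.carrier = K.carrier := congrArg PlaneGraph.carrier h1
  have hO : h 1 '' G.outer G.lo G.hi = K.outer K.lo K.hi := by
    rw [ho1, h1, ha1, hb1]
  have hm : ∀ p ∈ G.carrier, h 1 p ∈ K.carrier := fun p hp => hC ▸ mem_image_of_mem _ hp
  have himg : ∀ f : ℝ × ℝ → ℝ × ℝ, G.image (fun p => f (h 1 p)) = K.image f := by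
    intro f; rw [← h1, PlaneGraph.image_image]
  have hlt : ¬ (1 : ℝ) ≤ 1 / 2 := by norm_num
  refine ⟨fun t p => if t ≤ 1 / 2 then h (2 * t) p else k (2 * t - 1) (h 1 p),
    fun t => if t ≤ 1 / 2 then a (2 * t) else c (2 * t - 1),
    fun t => if t ≤ 1 / 2 then b (2 * t) else d (2 * t - 1), ?_, ?_, ?_, ?_, ?_, ?_, ?_, ?_⟩
  · have hcl1 : closure {z : ℝ × (ℝ × ℝ) | z.1 ≤ 1 / 2} ⊆ {z | z.1 ≤ 1 / 2} :=
      (isClosed_le continuous_fst continuous_const).closure_subset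
    have hcl2 : closure {z : ℝ × (ℝ × ℝ) | ¬ z.1 ≤ 1 / 2} ⊆ {z | 1 / 2 ≤ z.1} :=
      closure_minimal (fun z hz => (not_le.1 hz).le)
        (isClosed_le continuous_const continuous_fst)
    have h1c : ContinuousOn (h 1) G.carrier :=
      continuousOn_iff_continuous_domRestrict.2 he1.continuous
    refine ContinuousOn.if (p := fun z : ℝ × (ℝ × ℝ) => z.1 ≤ 1 / 2)
      (f := fun z => h (2 * z.1) z.2) (g := fun z => k (2 * z.1 - 1) (h 1 z.2)) ?_ ?_ ?_
    · rintro ⟨t, p⟩ ⟨⟨_, hp⟩, hf⟩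
      have e1 : t ≤ 1 / 2 := hcl1 (frontier_subset_closure hf)
      have e2 : 1 / 2 ≤ t := by
        rw [← frontier_compl] at hf
        exact hcl2 (frontier_subset_closure hf)
      have e : t = 1 / 2 := le_antisymm e1 e2
      subst e
      norm_num
      exact (k0 _ (hm p hp)).symm
    · have : ContinuousOn (fun z : ℝ × (ℝ × ℝ) => ((2 * z.1, z.2) : ℝ × (ℝ × ℝ)))
          ((Icc (0 : ℝ) 1 ×ˢ G.carrier) ∩ closure {z | z.1 ≤ 1 / 2}) := by fun_prop
      refine hc.comp this ?_
      rintro ⟨t, p⟩ ⟨⟨⟨t0, _⟩, hp⟩, hz⟩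
      have := hcl1 hz
      dsimp at this t0
      refine ⟨⟨?_, ?_⟩, hp⟩ <;> dsimp only <;> linarith
    · have : ContinuousOn (fun z : ℝ × (ℝ × ℝ) => ((2 * z.1 - 1, h 1 z.2) : ℝ × (ℝ × ℝ)))
          ((Icc (0 : ℝ) 1 ×ˢ G.carrier) ∩ closure {z | ¬ z.1 ≤ 1 / 2}) := by
        refine ContinuousOn.prodMk (by fun_prop) ?_
        exact h1c.comp continuousOn_snd fun z hz => hz.1.2
      refine kc.comp this ?_
      rintro ⟨t, p⟩ ⟨⟨⟨t0, t1⟩, hp⟩, hz⟩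
      have := hcl2 hz
      dsimp at this t1
      refine ⟨⟨?_, ?_⟩, hm p hp⟩ <;> dsimp only <;> linarith
  · rintro t ⟨t0, t1⟩
    by_cases hh : t ≤ 1 / 2
    · simp only [hh, if_true]
      exact ht (2 * t) ⟨by linarith, by linarith⟩
    · simp only [hh, if_false]
      obtain ⟨he, hl, ho⟩ := kt (2 * t - 1) ⟨by linarith, by linarith⟩
      refine ⟨?_, ?_, ?_⟩
      · exact he.comp (he1.codRestrict K.carrier fun p => hm p p.2)
      · rw [himg]; exact hl
      · rw [himg, ← ho, ← hO, Set.image_image]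
  · intro p hp
    have : (0 : ℝ) ≤ 1 / 2 := by norm_num
    simpa [this] using h0 p hp
  · simpa using ha0
  · simpa using hb0
  · simp only [hlt, if_false]
    rw [himg, ← k1]; norm_num
  · simp only [hlt, if_false]
    rw [← hc1]; norm_num
  · simp only [hlt, if_false]
    rw [← hd1]; norm_num

instance LeveledGraph.setoid : Setoid LeveledGraph where
  r := Deforms
  iseqv := ⟨Deforms.refl, Deforms.symm, Deforms.trans⟩

/-- Deformation classes of leveled progressive plane graphs. -/
abbrev PlaneClass : Type := Quotient LeveledGraph.setoid

/-- Boxed progressive plane graphs: between the levels `-1` and `1`, contained in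
`(-1, 1) × [-1, 1]`. -/
structure BoxedGraph extends LeveledGraph where
  lo_eq : lo = -1
  hi_eq : hi = 1
  boxed : ∀ p ∈ carrier, p.1 ∈ Ioo (-1 : ℝ) 1

namespace LeveledGraph

open GraphData

variable (G : LeveledGraph)

/-- Inner nodes. -/
def innerNodes : Set (ℝ × ℝ) := G.inner G.lo G.hi

/-- The domain: edges whose source is an outer node. -/
def dom : Set (Set (ℝ × ℝ)) := {e | ∃ x ∈ G.outer G.lo G.hi, e ∈ G.outEdges x}

/-- The codomain: edges whose target is an outer node. -/
def cod : Set (Set (ℝ × ℝ)) := {e | ∃ x ∈ G.outer G.lo G.hi, e ∈ G.inEdges x}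

/-- Left-to-right order of the domain. -/
def domLT (e f : Set (ℝ × ℝ)) : Prop :=
  ∃ x ∈ G.outer G.lo G.hi, ∃ y ∈ G.outer G.lo G.hi,
    e ∈ G.outEdges x ∧ f ∈ G.outEdges y ∧ x.1 < y.1

/-- Left-to-right order of the codomain. -/
def codLT (e f : Set (ℝ × ℝ)) : Prop :=
  ∃ x ∈ G.outer G.lo G.hi, ∃ y ∈ G.outer G.lo G.hi,
    e ∈ G.inEdges x ∧ f ∈ G.inEdges y ∧ x.1 < y.1

/-- The end of sign `s` (`+` is the target end, `-` the source end) of `e` lies at `x`. -/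
def EndAt (x : ℝ × ℝ) (e : Set (ℝ × ℝ)) (s : Bool) : Prop :=
  (s = true ∧ e ∈ G.inEdges x) ∨ (s = false ∧ e ∈ G.outEdges x)

/-- Unitary edges: both ends are outer nodes. -/
def IsUnitary (e : Set (ℝ × ℝ)) : Prop := e ∈ G.dom ∧ e ∈ G.cod

/-- `(e, s)` is a half-edge of the underlying combinatorial graph of `G`: its end lies at an inner
node, or `e` is unitary. -/
def IsHalfEdge (z : Set (ℝ × ℝ) × Bool) : Prop :=
  (∃ x ∈ G.innerNodes, G.EndAt x z.1 z.2) ∨ G.IsUnitary z.1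

open Classical in
/-- The underlying combinatorial oriented graph of `G`.  Vertices: for every inner node the set of
the half-edges that end there, and for every unitary edge the set of its two half-edges. -/
def toGraphData : GraphData where
  H := {z : Set (ℝ × ℝ) × Bool // G.IsHalfEdge z}
  P z w := (∃ x ∈ G.innerNodes, G.EndAt x z.1.1 z.1.2 ∧ G.EndAt x w.1.1 w.1.2) ∨
    (G.IsUnitary z.1.1 ∧ z.1.1 = w.1.1)
  σ z := if h : G.IsHalfEdge (z.1.1, !z.1.2) then ⟨_, h⟩ else z
  sgn z := z.1.2

/-- `φ` identifies the combinatorial planar graph `X` with the underlying combinatorial graph of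
the plane graph `G`: it is an isomorphism of oriented graphs for which the order of the edges of
`X` gives the left-to-right order of the inputs and of the outputs at every inner node
(polarization), and of the domain and of the codomain (anchor structure). -/
structure IsIdentification (X : PlanarGraph) (φ : X.H ≃ G.toGraphData.H) : Prop where
  iso : IsGraphIso (Y := G.toGraphData) φ
  polarized_in : ∀ x ∈ G.innerNodes, ∀ h k : X.H,
    (φ h).1.1 ∈ G.inEdges x → X.sgn h = true → (φ k).1.1 ∈ G.inEdges x → X.sgn k = true →
      (X.lt (edge h) (edge k) ↔ PlaneGraph.leftBelow x (φ h).1.1 (φ k).1.1)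
  polarized_out : ∀ x ∈ G.innerNodes, ∀ h k : X.H,
    (φ h).1.1 ∈ G.outEdges x → X.sgn h = false → (φ k).1.1 ∈ G.outEdges x → X.sgn k = false →
      (X.lt (edge h) (edge k) ↔ PlaneGraph.leftAbove x (φ h).1.1 (φ k).1.1)
  anchored_in : ∀ h ∈ X.inputs, ∀ k ∈ X.inputs,
    (X.lt (edge h) (edge k) ↔ G.domLT (φ h).1.1 (φ k).1.1)
  anchored_out : ∀ h ∈ X.outputs, ∀ k ∈ X.outputs,
    (X.lt (edge h) (edge k) ↔ G.codLT (φ h).1.1 (φ k).1.1)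

end LeveledGraph

end TensorCalc

end

/-! Half-edges are replaced by open graphs, whose edges have an optional source and an optional
target; an edge with neither stands for a virtual vertex. Plane graphs are replaced by drawings: the
level is injective on an edge, so an edge is the graph of a continuous function of the level
(`LeveledGraph.exists_drawing`). A combinatorial graph then underlies a plane graph exactly if it is
presented by the drawn open graph with an order `r` that is the left-to-right order at every level
(`underlies_iff`). What remains is the correspondence between planar orders and ordered drawings.

Rigidity: a planar order is determined by its restrictions to the outgoing edges of each vertex and
to the edges without source (`unique_of_out`). Two edges not joined by a path are compared through
the first edges on which paths to them separate, and axiom P2 carries the comparison along these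
paths.

From drawings to orders: a maximal directed path runs from the bottom level to the top level and is
a continuous function of the level. Let `e` and `f` not be joined by a path. Two maximal paths
through them cannot meet at levels between a point of `e` and a point of `f`, since a meeting point
would give a path from the lower edge to the higher one. By the intermediate value theorem "`e` is
left of `f`" is well defined, and paths together with this relation form a planar order
(`isPlanar_order`, `isOrdered_order`).

From orders to drawings: once the levels of the vertices are fixed, `e` is put at the sum of the
weights of all edges before `e`. The weights are chosen so that P2 makes them vanish exactly where
edges have to meet in a vertex (`isValid_toDrawing`). Two ordered drawings with the same levels are
joined by linear interpolation, and canonical drawings with different levels by moving the levels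
linearly; so all ordered drawings of one open graph are deformations of each other
(`Drawing.deforms`).

Conversely, a deformation preserves edges, vertices and directions, and it preserves the order of
two edges that begin at a common level, because these never meet just above it. By rigidity it
preserves the whole order (`exists_iso_of_deforms`). Hence "underlies" induces a bijection of
classes; its defining property already makes it unique, because every planar graph has a drawing.

The operations are carried out on drawings. The composite drawing is valid, so it has a planar
order; rigidity identifies the restrictions of this order to the two factors, and P2 identifies it
with the prescribed shuffle (`comp_order_mixed`). Planarity of the combinatorial composite is thus a
consequence of the geometry. -/

open Set Topology Filter

noncomputable section

namespace TensorCalc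

/-! ## Open directed graphs -/

/-- A directed graph whose edges may lack a source or a target. -/
structure OpenGraph where
  E : Type
  V : Type
  src : E → Option V
  tgt : E → Option V

namespace OpenGraph

variable {S : OpenGraph}

/-- The target of `e` is the source of `f`. -/
def Step (S : OpenGraph) (e f : S.E) : Prop := ∃ v, S.tgt e = some v ∧ S.src f = some v

/-- Directed paths of edges. -/
def Path (S : OpenGraph) : S.E → S.E → Prop := Relation.ReflTransGen S.Step

/-- The vertex at the end of sign `b` of `e`. -/
def fin (S : OpenGraph) (e : S.E) (b : Bool) : Option S.V := if b then S.tgt e else S.src e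

@[simp] theorem fin_true (e : S.E) : S.fin e true = S.tgt e := rfl
@[simp] theorem fin_false (e : S.E) : S.fin e false = S.src e := rfl

/-- `v` is an end of `e`. -/
def Inc (S : OpenGraph) (e : S.E) (v : S.V) : Prop := S.src e = some v ∨ S.tgt e = some v

/-- Edges without ends. -/
def Unitary (S : OpenGraph) (e : S.E) : Prop := S.src e = none ∧ S.tgt e = none

/-- A finite open graph in which every vertex has an incoming and an outgoing edge. -/
structure IsFlow (S : OpenGraph) : Prop where
  finite_E : Finite S.E
  finite_V : Finite S.V
  exists_in : ∀ v, ∃ e, S.tgt e = some v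
  exists_out : ∀ v, ∃ e, S.src e = some v

/-- Progressive planar orders on an open graph. -/
structure IsPlanar (S : OpenGraph) (r : S.E → S.E → Prop) : Prop extends S.IsFlow where
  irrefl : ∀ e, ¬ r e e
  trans : ∀ e f g, r e f → r f g → r e g
  total : ∀ e f, r e f ∨ e = f ∨ r f e
  step : ∀ e f, S.Step e f → r e f
  between : ∀ e₁ e₂ e₃, S.Path e₁ e₂ → r e₁ e₃ → r e₃ e₂ → S.Path e₃ e₂ ∨ S.Path e₁ e₃

theorem Path.refl (e : S.E) : S.Path e e := Relation.ReflTransGen.refl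

theorem Path.trans {e f g : S.E} (h : S.Path e f) (h' : S.Path f g) : S.Path e g :=
  Relation.ReflTransGen.trans h h'

theorem Step.path {e f : S.E} (h : S.Step e f) : S.Path e f := Relation.ReflTransGen.single h

theorem Path.cases_head {e f : S.E} (h : S.Path e f) : e = f ∨ ∃ g, S.Step e g ∧ S.Path g f :=
  Relation.ReflTransGen.cases_head h

theorem Path.cases_tail {e f : S.E} (h : S.Path e f) : e = f ∨ ∃ g, S.Path e g ∧ S.Step g f := by
  rcases Relation.ReflTransGen.cases_tail h with h | h
  · exact Or.inl h.symm
  · exact Or.inr h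

theorem Path.eq_of_src {e f : S.E} (h : S.Path e f) (hf : S.src f = none) : e = f := by
  rcases h.cases_tail with h | ⟨g, -, v, -, hv⟩
  · exact h
  · simp [hf] at hv

theorem Path.eq_of_tgt {e f : S.E} (h : S.Path e f) (he : S.tgt e = none) : e = f := by
  rcases h.cases_head with h | ⟨g, ⟨v, hv, -⟩, -⟩
  · exact h
  · simp [he] at hv

namespace IsPlanar

variable {r r' : S.E → S.E → Prop} (h : S.IsPlanar r) (h' : S.IsPlanar r')
include h

theorem asymm {e f : S.E} (a : r e f) (b : r f e) : False := h.irrefl _ (h.trans _ _ _ a b)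

theorem of_path {e f : S.E} (p : S.Path e f) : e = f ∨ r e f := by
  induction p with
  | refl => exact Or.inl rfl
  | tail _ s ih =>
    rcases ih with rfl | ih
    · exact Or.inr (h.step _ _ s)
    · exact Or.inr (h.trans _ _ _ ih (h.step _ _ s))

theorem lt_of_path_of_lt {e f g : S.E} (p : S.Path e f) (q : r f g) : r e g := by
  rcases h.of_path p with rfl | p
  · exact q
  · exact h.trans _ _ _ p q

theorem src_ne_tgt {e : S.E} {v : S.V} (hs : S.src e = some v) (ht : S.tgt e = some v) : False :=
  h.irrefl e (h.step e e ⟨v, ht, hs⟩)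

theorem wellFounded : WellFounded r := by
  have := h.finite_E
  have : IsTrans S.E r := ⟨h.trans⟩
  have : Std.Irrefl r := ⟨h.irrefl⟩
  exact Finite.wellFounded_of_trans_of_irrefl r

theorem wellFounded_swap : WellFounded (Function.swap r) := by
  have := h.finite_E
  have : IsTrans S.E (Function.swap r) := ⟨fun a b c x y => h.trans _ _ _ y x⟩
  have : Std.Irrefl (Function.swap r) := ⟨h.irrefl⟩
  exact Finite.wellFounded_of_trans_of_irrefl _

/-- Going back along incoming edges decreases `r`, so it stops, and it can only stop at an edge
without source. -/
theorem exists_input (e : S.E) : ∃ i, S.src i = none ∧ S.Path i e := by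
  induction e using h.wellFounded.induction with
  | _ e ih =>
    cases hs : S.src e with
    | none => exact ⟨e, hs, Path.refl e⟩
    | some v =>
      obtain ⟨f, hf⟩ := h.exists_in v
      have st : S.Step f e := ⟨v, hf, hs⟩
      obtain ⟨i, hi, p⟩ := ih f (h.step _ _ st)
      exact ⟨i, hi, p.trans st.path⟩

theorem exists_output (e : S.E) : ∃ o, S.tgt o = none ∧ S.Path e o := by
  induction e using h.wellFounded_swap.induction with
  | _ e ih =>
    cases hs : S.tgt e with
    | none => exact ⟨e, hs, Path.refl e⟩
    | some v =>
      obtain ⟨f, hf⟩ := h.exists_out v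
      have st : S.Step e f := ⟨v, hs, hf⟩
      obtain ⟨i, hi, p⟩ := ih f (h.step _ _ st)
      exact ⟨i, hi, st.path.trans p⟩

/-- If `f` came before `e`, then `o'` would lie strictly between the ends of the path from `o` to
`e`. Axiom P2 would give a path from `o'` to `e`, or one from `o` to `o'` and on to `f`; both are
excluded. -/
theorem lt_of_lt_of_paths {o o' e f : S.E} (p : S.Path o e) (p' : S.Path o' f)
    (n : ¬ S.Path o f) (n' : ¬ S.Path o' e) (l : r o o') : r e f := by
  rcases h.total e f with q | rfl | q
  · exact q
  · exact (n p).elim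
  · rcases h.between o e o' p l (h.lt_of_path_of_lt p' q) with q | q
    · exact (n' q).elim
    · exact (n (q.trans p')).elim

theorem lt_iff_of_paths {o o' e f : S.E} (p : S.Path o e) (p' : S.Path o' f)
    (n : ¬ S.Path o f) (n' : ¬ S.Path o' e) : r o o' ↔ r e f := by
  refine ⟨h.lt_of_lt_of_paths p p' n n', fun l => ?_⟩
  rcases h.total o o' with q | rfl | q
  · exact q
  · exact (n p').elim
  · exact (h.asymm l (h.lt_of_lt_of_paths p' p n' n q)).elim

include h' in
/-- A progressive planar order is determined by the orders of the outgoing edges of every vertex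
and of the edges without source. -/
theorem unique_of_out (out : ∀ e f v, S.src e = some v → S.src f = some v → r e f → r' e f)
    (inp : ∀ e f, S.src e = none → S.src f = none → r e f → r' e f) (e f : S.E) :
    r e f ↔ r' e f := by
  have key : ∀ e f, r e f → r' e f := by
    intro e f hl
    by_cases p : S.Path e f
    · rcases h'.of_path p with rfl | q
      · exact (h.irrefl _ hl).elim
      · exact q
    by_cases q : S.Path f e
    · rcases h.of_path q with rfl | q
      · exact (h.irrefl _ hl).elim
      · exact (h.asymm hl q).elim
    -- Let `g` be the last common predecessor in the order `r`. The paths from `g` to `e` and to `f`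
    -- leave `g` by edges `o` and `o'` with the same source, and maximality of `g` excludes paths
    -- from `o` to `f` and from `o'` to `e`.
    by_cases hc : ∃ g, S.Path g e ∧ S.Path g f
    · obtain ⟨g, ⟨ge, gf⟩, hmax⟩ := h.wellFounded_swap.has_min {g | S.Path g e ∧ S.Path g f} hc
      rcases ge.cases_head with rfl | ⟨o, so, oe⟩
      · exact (p gf).elim
      rcases gf.cases_head with rfl | ⟨o', so', of'⟩
      · exact (q ge).elim
      have n : ¬ S.Path o f := fun n => hmax o ⟨oe, n⟩ (h.step _ _ so)
      have n' : ¬ S.Path o' e := fun n => hmax o' ⟨n, of'⟩ (h.step _ _ so')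
      obtain ⟨v, hv, ho⟩ := so
      obtain ⟨w, hw, ho'⟩ := so'
      obtain rfl : v = w := by simpa [hv] using hw
      rw [← h'.lt_iff_of_paths oe of' n n']
      rw [← h.lt_iff_of_paths oe of' n n'] at hl
      exact out _ _ _ ho ho' hl
    -- Without a common predecessor, edges without source below `e` and below `f` take the place of
    -- `o` and `o'`.
    · push Not at hc
      obtain ⟨i, hi, pi⟩ := h.exists_input e
      obtain ⟨j, hj, pj⟩ := h.exists_input f
      have n : ¬ S.Path i f := hc i pi
      have n' : ¬ S.Path j e := fun n => hc j n pj
      rw [← h'.lt_iff_of_paths pi pj n n']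
      rw [← h.lt_iff_of_paths pi pj n n'] at hl
      exact inp _ _ hi hj hl
  -- An inclusion of total orders is an equality.
  refine ⟨key e f, fun hl => ?_⟩
  rcases h.total e f with q | rfl | q
  · exact q
  · exact (h'.irrefl _ hl).elim
  · exact (h'.asymm hl (key _ _ q)).elim

end IsPlanar

/-! ### Isomorphisms -/

/-- Isomorphisms of open graphs with relations on the edges. -/
structure Iso (S : OpenGraph) (r : S.E → S.E → Prop) (S' : OpenGraph)
    (r' : S'.E → S'.E → Prop) where
  onE : S.E ≃ S'.E
  onV : S.V ≃ S'.V
  src : ∀ e, S'.src (onE e) = (S.src e).map onV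
  tgt : ∀ e, S'.tgt (onE e) = (S.tgt e).map onV
  lt : ∀ e f, r e f ↔ r' (onE e) (onE f)

namespace Iso

variable {S S' : OpenGraph} {r : S.E → S.E → Prop} {r' : S'.E → S'.E → Prop} (i : Iso S r S' r')

/-- The inverse isomorphism. -/
def symm : Iso S' r' S r where
  onE := i.onE.symm
  onV := i.onV.symm
  src e := by
    obtain ⟨e, rfl⟩ := i.onE.surjective e
    rw [i.src, Equiv.symm_apply_apply, Option.map_map]
    simp
  tgt e := by
    obtain ⟨e, rfl⟩ := i.onE.surjective e
    rw [i.tgt, Equiv.symm_apply_apply, Option.map_map]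
    simp
  lt e f := by
    rw [i.lt]; simp

include i

theorem step_iff (e f : S.E) : S'.Step (i.onE e) (i.onE f) ↔ S.Step e f := by
  simp only [Step, i.src, i.tgt, Option.map_eq_some_iff]
  constructor
  · rintro ⟨v, ⟨a, h1, rfl⟩, b, h2, h3⟩
    rw [i.onV.injective h3] at h2
    exact ⟨a, h1, h2⟩
  · rintro ⟨v, h1, h2⟩
    exact ⟨_, ⟨v, h1, rfl⟩, v, h2, rfl⟩

theorem path {e f : S.E} (h : S.Path e f) : S'.Path (i.onE e) (i.onE f) :=
  Relation.ReflTransGen.lift i.onE (fun a b hab => (i.step_iff a b).2 hab) _ _ h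

theorem path_iff (e f : S.E) : S'.Path (i.onE e) (i.onE f) ↔ S.Path e f :=
  ⟨fun h => by simpa [symm] using i.symm.path h, i.path⟩

theorem isPlanar (h : S'.IsPlanar r') : S.IsPlanar r where
  finite_E := have := h.finite_E; Finite.of_equiv _ i.onE.symm
  finite_V := have := h.finite_V; Finite.of_equiv _ i.onV.symm
  exists_in v := by
    obtain ⟨e, he⟩ := h.exists_in (i.onV v)
    obtain ⟨e, rfl⟩ := i.onE.surjective e
    refine ⟨e, ?_⟩
    simpa [i.tgt] using he
  exists_out v := by
    obtain ⟨e, he⟩ := h.exists_out (i.onV v)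
    obtain ⟨e, rfl⟩ := i.onE.surjective e
    refine ⟨e, ?_⟩
    simpa [i.src] using he
  irrefl e := by rw [i.lt]; exact h.irrefl _
  trans e f g := by rw [i.lt, i.lt, i.lt]; exact h.trans _ _ _
  total e f := by
    rw [i.lt, i.lt, ← i.onE.injective.eq_iff]; exact h.total _ _
  step e f := by rw [i.lt, ← i.step_iff]; exact h.step _ _
  between a b c := by
    rw [i.lt, i.lt, ← i.path_iff, ← i.path_iff, ← i.path_iff]; exact h.between _ _ _

end Iso

end OpenGraph

/-- A bijection that is compatible with two surjections. -/
theorem exists_equiv_of_surjective {A B C : Type*} (f : A → B) (g : A → C)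
    (hf : Function.Surjective f) (hg : Function.Surjective g)
    (h : ∀ a a', f a = f a' ↔ g a = g a') : ∃ θ : B ≃ C, ∀ a, θ (f a) = g a := by
  choose s hs using hf
  choose t ht using hg
  refine ⟨⟨fun b => g (s b), fun c => f (t c), fun b => ?_, fun c => ?_⟩, fun a => ?_⟩
  · exact ((h _ _).2 (ht _)).trans (hs b)
  · exact ((h _ _).1 (hs _)).trans (ht c)
  · exact (h _ _).1 (hs _)

/-! ### Presentation of half-edge graphs by open graphs -/

open GraphData

namespace OpenGraph

/-- `(e, b)` is a half-edge: it ends at a vertex, or `e` has no ends. -/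
def IsHalf (S : OpenGraph) (e : S.E) (b : Bool) : Prop := (∃ v, S.fin e b = some v) ∨ S.Unitary e

/-- `(e, b)` and `(f, c)` belong to the same vertex, real or virtual. -/
def Near (S : OpenGraph) (e : S.E) (b : Bool) (f : S.E) (c : Bool) : Prop :=
  (∃ v, S.fin e b = some v ∧ S.fin f c = some v) ∨ (S.Unitary e ∧ e = f)

theorem Unitary.fin {S : OpenGraph} {e : S.E} (h : S.Unitary e) (b : Bool) : S.fin e b = none := by
  cases b
  · exact h.1
  · exact h.2

/-- This is what the half-edges of edges without ends are for: every edge is visible in the set of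
half-edges. -/
theorem isHalf_or (S : OpenGraph) (e : S.E) : ∃ b, S.IsHalf e b := by
  by_cases hu : S.Unitary e
  · exact ⟨true, Or.inr hu⟩
  · by_cases h : S.src e = none
    · have : S.tgt e ≠ none := fun h' => hu ⟨h, h'⟩
      obtain ⟨v, hv⟩ := Option.ne_none_iff_exists'.1 this
      exact ⟨true, Or.inl ⟨v, hv⟩⟩
    · obtain ⟨v, hv⟩ := Option.ne_none_iff_exists'.1 h
      exact ⟨false, Or.inl ⟨v, hv⟩⟩

/-- `ε` identifies the half-edges of `Z` with those of the open graph `S`. -/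
structure Presents (Z : GraphData) (S : OpenGraph) (ε : Z.H → S.E) : Prop where
  inj : ∀ h k, ε h = ε k → Z.sgn h = Z.sgn k → h = k
  half : ∀ e b, (∃ h, ε h = e ∧ Z.sgn h = b) ↔ S.IsHalf e b
  near : ∀ h k, Z.P h k ↔ S.Near (ε h) (Z.sgn h) (ε k) (Z.sgn k)
  σ_edge : ∀ h, ε (Z.σ h) = ε h
  -- With `inj` and `σ_edge` this determines `σ`: it exchanges the halves of an edge that has two of
  -- them and fixes the only half of any other edge.
  σ_ne : ∀ h, (∃ k, ε k = ε h ∧ Z.sgn k = !Z.sgn h) → Z.sgn (Z.σ h) = !Z.sgn h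

namespace Presents

variable {Z Z' : GraphData} {S : OpenGraph} {ε : Z.H → S.E} (p : Presents Z S ε)
include p

theorem isHalf (h : Z.H) : S.IsHalf (ε h) (Z.sgn h) := (p.half _ _).1 ⟨h, rfl, rfl⟩

theorem surjective : Function.Surjective ε := by
  intro e
  obtain ⟨b, hb⟩ := S.isHalf_or e
  obtain ⟨h, hh, -⟩ := (p.half _ _).2 hb
  exact ⟨h, hh⟩

theorem σ_eq_self (h : Z.H) (hn : ¬ S.IsHalf (ε h) (!Z.sgn h)) : Z.σ h = h := by
  refine p.inj _ _ (p.σ_edge h) ?_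
  by_contra hc
  refine hn ((p.half _ _).1 ⟨Z.σ h, p.σ_edge h, ?_⟩)
  revert hc
  cases Z.sgn (Z.σ h) <;> cases Z.sgn h <;> simp

theorem sgn_σ (h : Z.H) (hn : S.IsHalf (ε h) (!Z.sgn h)) : Z.sgn (Z.σ h) = !Z.sgn h :=
  p.σ_ne h ((p.half _ _).2 hn)

theorem σ_ne_self_iff (h : Z.H) : Z.σ h ≠ h ↔ S.IsHalf (ε h) (!Z.sgn h) := by
  refine ⟨fun hn => by_contra fun hc => hn (p.σ_eq_self h hc), fun hn he => ?_⟩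
  have := p.sgn_σ h hn
  rw [he] at this
  cases h' : Z.sgn h <;> simp [h'] at this

theorem eq_or_eq_σ {h k : Z.H} (he : ε h = ε k) : k = h ∨ k = Z.σ h := by
  by_cases hs : Z.sgn h = Z.sgn k
  · exact Or.inl (p.inj _ _ he hs).symm
  · right
    have hs' : Z.sgn k = !Z.sgn h := by
      revert hs; cases Z.sgn h <;> cases Z.sgn k <;> simp
    refine p.inj _ _ (by rw [p.σ_edge, he]) ?_
    rw [p.σ_ne h ⟨k, he.symm, hs'⟩, hs']

theorem involutive : Function.Involutive Z.σ := by
  intro h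
  rcases p.eq_or_eq_σ (p.σ_edge h) with e | e
  · rw [← e, ← e]
  · exact e.symm

theorem edge_eq_iff (h k : Z.H) : edge h = edge k ↔ ε h = ε k := by
  constructor
  · intro he
    have : ∀ e : Z.Edge, ∀ h, Quot.mk _ h = e →
        ε h = Quot.lift ε (fun a b hab => by rw [hab, p.σ_edge]) e := by
      rintro _ h rfl; rfl
    rw [this _ h rfl, this _ k rfl]
    exact congrArg _ he
  · intro he
    rcases p.eq_or_eq_σ he with rfl | rfl
    · rfl
    · exact Quot.sound rfl

variable (loop : ∀ e v, S.src e = some v → S.tgt e = some v → False)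
include loop

/-- A loop at a vertex of `S` would be a two-element edge within one vertex, hence virtual in `Z`;
this is why `loop` is needed. -/
theorem isVirtual_iff (h : Z.H) : IsVirtual h ↔ S.Unitary (ε h) := by
  constructor
  · rintro ⟨hn, hP⟩
    rw [p.near, p.σ_edge, p.sgn_σ h ((p.σ_ne_self_iff h).1 hn)] at hP
    rcases hP with ⟨v, h1, h2⟩ | ⟨hu, -⟩
    · exfalso
      cases hs : Z.sgn h <;> simp only [hs, Bool.not_true, Bool.not_false, fin_true, fin_false] at h1 h2
      · exact loop _ v h1 h2
      · exact loop _ v h2 h1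
    · exact hu
  · intro hu
    refine ⟨(p.σ_ne_self_iff h).2 (Or.inr hu), (p.near _ _).2 (Or.inr ⟨hu, (p.σ_edge h).symm⟩)⟩

/-- Real and virtual legs become the same thing: only the opposite end of the edge matters, and it
has to be free. -/
theorem isLeg_iff (h : Z.H) : IsLeg h ↔ S.fin (ε h) (!Z.sgn h) = none := by
  rw [IsLeg, p.isVirtual_iff loop]
  constructor
  · rintro (hs | hu)
    · have := (p.σ_ne_self_iff h).not.1 (not_not.2 hs)
      by_contra hc
      exact this (Or.inl (Option.ne_none_iff_exists'.1 hc))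
    · exact hu.fin _
  · intro hn
    by_cases hu : S.Unitary (ε h)
    · exact Or.inr hu
    · left
      apply p.σ_eq_self
      rintro (⟨v, hv⟩ | hc)
      · simp [hn] at hv
      · exact hu hc

theorem mem_inputs_iff (h : Z.H) : h ∈ Z.inputs ↔ Z.sgn h = true ∧ S.src (ε h) = none := by
  rw [inputs, mem_ofPred_eq, p.isLeg_iff loop, and_comm]
  refine and_congr_right fun hs => ?_
  simp [hs]

theorem mem_outputs_iff (h : Z.H) : h ∈ Z.outputs ↔ Z.sgn h = false ∧ S.tgt (ε h) = none := by
  rw [outputs, mem_ofPred_eq, p.isLeg_iff loop, and_comm]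
  refine and_congr_right fun hs => ?_
  simp [hs]

omit loop in
theorem exists_sgn_true {e : S.E} (he : S.src e = none) : ∃ h, ε h = e ∧ Z.sgn h = true := by
  rw [p.half]
  cases ht : S.tgt e with
  | none => exact Or.inr ⟨he, ht⟩
  | some v => exact Or.inl ⟨v, ht⟩

omit loop in
theorem exists_sgn_false {e : S.E} (he : S.tgt e = none) : ∃ h, ε h = e ∧ Z.sgn h = false := by
  rw [p.half]
  cases ht : S.src e with
  | none => exact Or.inr ⟨ht, he⟩
  | some v => exact Or.inl ⟨v, ht⟩

/-- An edge without source carries exactly one input. The predicate `q` will be "comes before a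
given edge", so that positions of legs become positions of edges. -/
theorem image_inputs (q : S.E → Prop) :
    {h ∈ Z.inputs | q (ε h)}.ncard = {e | S.src e = none ∧ q e}.ncard := by
  refine ncard_congr (fun h _ => ε h) ?_ ?_ ?_
  · rintro h ⟨hi, hq⟩
    exact ⟨((p.mem_inputs_iff loop h).1 hi).2, hq⟩
  · rintro h k ⟨hi, -⟩ ⟨ki, -⟩ he
    rw [p.mem_inputs_iff loop] at hi ki
    exact p.inj _ _ he (hi.1.trans ki.1.symm)
  · rintro e ⟨he, hq⟩
    obtain ⟨h, rfl, hs⟩ := p.exists_sgn_true he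
    exact ⟨h, ⟨(p.mem_inputs_iff loop h).2 ⟨hs, he⟩, hq⟩, rfl⟩

theorem image_outputs (q : S.E → Prop) :
    {h ∈ Z.outputs | q (ε h)}.ncard = {e | S.tgt e = none ∧ q e}.ncard := by
  refine ncard_congr (fun h _ => ε h) ?_ ?_ ?_
  · rintro h ⟨hi, hq⟩
    exact ⟨((p.mem_outputs_iff loop h).1 hi).2, hq⟩
  · rintro h k ⟨hi, -⟩ ⟨ki, -⟩ he
    rw [p.mem_outputs_iff loop] at hi ki
    exact p.inj _ _ he (hi.1.trans ki.1.symm)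
  · rintro e ⟨he, hq⟩
    obtain ⟨h, rfl, hs⟩ := p.exists_sgn_false he
    exact ⟨h, ⟨(p.mem_outputs_iff loop h).2 ⟨hs, he⟩, hq⟩, rfl⟩

end Presents

namespace Presents

variable {Z Z' : GraphData} {S : OpenGraph} {ε : Z.H → S.E}

theorem of_isGraphIso {ε' : Z'.H → S.E} (p : Presents Z' S ε') {φ : Z.H ≃ Z'.H}
    (h : IsGraphIso φ) : Presents Z S (fun x => ε' (φ x)) where
  inj a b e s := φ.injective (p.inj _ _ e (by rw [h.map_sgn, h.map_sgn, s]))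
  half e b := by
    rw [← p.half]
    constructor
    · rintro ⟨a, h1, h2⟩
      exact ⟨φ a, h1, by rw [h.map_sgn, h2]⟩
    · rintro ⟨a, h1, h2⟩
      exact ⟨φ.symm a, by simpa using h1, by rw [← h.map_sgn]; simpa using h2⟩
  near a b := by rw [h.map_P, p.near, h.map_sgn, h.map_sgn]
  σ_edge a := by rw [h.map_σ, p.σ_edge]
  σ_ne a := by
    rintro ⟨k, h1, h2⟩
    rw [← h.map_sgn, h.map_σ, ← h.map_sgn a]
    exact p.σ_ne _ ⟨φ k, h1, by rw [h.map_sgn, h.map_sgn, h2]⟩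

/-- A half-edge is determined by its edge and its sign, the pairs that occur depend on `S` only, and
so do `P` and `σ` in terms of these pairs. -/
theorem exists_isGraphIso {ε' : Z'.H → S.E} (p : Presents Z S ε) (p' : Presents Z' S ε') :
    ∃ φ : Z.H ≃ Z'.H, IsGraphIso φ ∧ ∀ h, ε' (φ h) = ε h := by
  have key : ∀ {Z Z' : GraphData} {ε : Z.H → S.E} {ε' : Z'.H → S.E} (_ : Presents Z S ε)
      (_ : Presents Z' S ε') (h : Z.H), ∃ k, ε' k = ε h ∧ Z'.sgn k = Z.sgn h :=
    fun p p' h => (p'.half _ _).2 ((p.half _ _).1 ⟨h, rfl, rfl⟩)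
  choose f hf hf' using key p p'
  choose g hg hg' using key p' p
  let φ : Z.H ≃ Z'.H := ⟨f, g, fun h => p.inj _ _ (by rw [hg, hf]) (by rw [hg', hf']),
    fun h => p'.inj _ _ (by rw [hf, hg]) (by rw [hf', hg'])⟩
  refine ⟨φ, ⟨fun h k => ?_, fun h => ?_, hf'⟩, hf⟩
  · rw [p.near, p'.near]
    change _ ↔ S.Near (ε' (f h)) _ (ε' (f k)) _
    rw [hf, hf]
    change _ ↔ S.Near _ (Z'.sgn (f h)) _ (Z'.sgn (f k))
    rw [hf', hf']
  · change f _ = Z'.σ (f h)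
    refine p'.inj _ _ (by rw [hf, p.σ_edge, p'.σ_edge, hf]) ?_
    rw [hf']
    by_cases hn : S.IsHalf (ε h) (!Z.sgn h)
    · rw [p.sgn_σ h hn, p'.sgn_σ (f h) (by rwa [hf, hf']), hf']
    · rw [p.σ_eq_self h hn, p'.σ_eq_self (f h) (by rwa [hf, hf']), hf']

/-- Two presentations of the same graph have isomorphic open graphs. -/
theorem exists_iso {S' : OpenGraph} {ε' : Z.H → S'.E} (p : Presents Z S ε)
    (p' : Presents Z S' ε') {r : S.E → S.E → Prop} {r' : S'.E → S'.E → Prop}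
    {q : S.E → S.E → Prop} {q' : S'.E → S'.E → Prop} (pl : S.IsPlanar q) (pl' : S'.IsPlanar q')
    (hr : ∀ h k, r (ε h) (ε k) ↔ r' (ε' h) (ε' k)) :
    ∃ i : Iso S r S' r', ∀ h, i.onE (ε h) = ε' h := by
  obtain ⟨θ, hθ⟩ := exists_equiv_of_surjective ε ε' p.surjective p'.surjective
    (fun h k => by rw [← p.edge_eq_iff, ← p'.edge_eq_iff])
  -- Virtuality is a property of `Z`, so both presentations agree on which edges have no ends. The
  -- orders `q` and `q'` exclude loops here; `r` and `r'` are arbitrary relations, which permits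
  -- deducing planarity of one from the other by transport.
  have un : ∀ h, S.Unitary (ε h) ↔ S'.Unitary (ε' h) := fun h => by
    rw [← p.isVirtual_iff (fun _ _ => pl.src_ne_tgt), p'.isVirtual_iff fun _ _ => pl'.src_ne_tgt]
  -- Every other half-edge lies at a vertex of `S` and at a vertex of `S'`. Both assignments `f` and
  -- `g` are surjective, and both have the kernel `Z.P`, so they induce the bijection `η` of
  -- vertices.
  have h1 : ∀ h : {h // ¬ S.Unitary (ε h)}, ∃ v, S.fin (ε h) (Z.sgn h) = some v :=
    fun h => (p.isHalf h.1).resolve_right h.2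
  have h2 : ∀ h : {h // ¬ S.Unitary (ε h)}, ∃ v, S'.fin (ε' h) (Z.sgn h) = some v :=
    fun h => (p'.isHalf h.1).resolve_right fun hc => h.2 ((un _).2 hc)
  choose f hf using h1
  choose g hg using h2
  have ex : ∀ {S : OpenGraph} {r : S.E → S.E → Prop} {ε : Z.H → S.E} (_ : Presents Z S ε)
      (_ : S.IsPlanar r) (v : S.V), ∃ h, S.fin (ε h) (Z.sgn h) = some v := by
    intro S r ε p pl v
    obtain ⟨e, he⟩ := pl.exists_in v
    obtain ⟨h, rfl, hs⟩ := (p.half e true).2 (Or.inl ⟨v, he⟩)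
    exact ⟨h, by rw [hs]; exact he⟩
  have fs : Function.Surjective f := by
    intro v
    obtain ⟨h, hh⟩ := ex p pl v
    have hu : ¬ S.Unitary (ε h) := fun hu => by simp [hu.fin] at hh
    exact ⟨⟨h, hu⟩, Option.some.inj ((hf ⟨h, hu⟩).symm.trans hh)⟩
  have gs : Function.Surjective g := by
    intro v
    obtain ⟨h, hh⟩ := ex p' pl' v
    have hu : ¬ S.Unitary (ε h) := fun hu => by simp [((un h).1 hu).fin] at hh
    exact ⟨⟨h, hu⟩, Option.some.inj ((hg ⟨h, hu⟩).symm.trans hh)⟩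
  have fk : ∀ h k, f h = f k ↔ Z.P h k := by
    intro h k
    rw [p.near, Near, hf, hf]
    simp [h.2, eq_comm]
  have gk : ∀ h k, g h = g k ↔ Z.P h k := by
    intro h k
    rw [p'.near, Near, hg, hg]
    have := h.2
    rw [un] at this
    simp [this, eq_comm]
  obtain ⟨η, hη⟩ := exists_equiv_of_surjective f g fs gs (fun h k => by rw [fk, gk])
  have hfin : ∀ e b, S'.fin (θ e) b = (S.fin e b).map η := by
    intro e b
    cases hv : S.fin e b with
    | some v =>
      obtain ⟨h, rfl, rfl⟩ := (p.half e b).2 (Or.inl ⟨v, hv⟩)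
      have hu : ¬ S.Unitary (ε h) := fun hu => by simp [hu.fin] at hv
      have h3 := hf ⟨h, hu⟩
      have h4 := hg ⟨h, hu⟩
      rw [hv, Option.some.injEq] at h3
      rw [hθ, h4, h3, ← hη]
      rfl
    | none =>
      cases hw : S'.fin (θ e) b with
      | none => rfl
      | some w =>
        exfalso
        -- This half-edge also belongs to `e`, whose end of that sign is free. So `e` has no ends,
        -- and then neither has `θ e`.
        obtain ⟨h, hh, rfl⟩ := (p'.half (θ e) b).2 (Or.inl ⟨w, hw⟩)
        obtain ⟨k, rfl⟩ := p.surjective e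
        rw [hθ, ← p'.edge_eq_iff, p.edge_eq_iff] at hh
        rw [← hh] at hv
        rcases p.isHalf h with ⟨v, hv'⟩ | hu
        · simp [hv] at hv'
        · rw [← hh, hθ, ((un h).1 hu).fin] at hw
          simp at hw
  refine ⟨⟨θ, η, fun e => hfin e false, fun e => hfin e true, fun e f => ?_⟩, hθ⟩
  obtain ⟨h, rfl⟩ := p.surjective e
  obtain ⟨k, rfl⟩ := p.surjective f
  rw [hθ, hθ]
  exact hr h k

end Presents

/-! ### Planar graphs given by half-edges and planar open graphs -/

/-- A presentation of an oriented graph with a relation on its edges. -/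
structure PresentsOrd (Z : PlanarData) (S : OpenGraph) (r : S.E → S.E → Prop) (ε : Z.H → S.E) :
    Prop extends Presents Z.toGraphData S ε where
  lt : ∀ h k, Z.lt (edge h) (edge k) ↔ r (ε h) (ε k)

namespace PresentsOrd

theorem iso {Z Z' : PlanarData} {S : OpenGraph} {r : S.E → S.E → Prop} {ε : Z.H → S.E}
    {ε' : Z'.H → S.E} (p : PresentsOrd Z S r ε) (p' : PresentsOrd Z' S r ε') : Z.Iso Z' := by
  obtain ⟨φ, h1, h2⟩ := p.exists_isGraphIso p'.toPresents
  exact ⟨φ, h1, fun h k => by rw [p.lt, p'.lt, h2, h2]⟩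

theorem of_iso {Z Z' : PlanarData} {S : OpenGraph} {r : S.E → S.E → Prop}
    {ε' : Z'.H → S.E} (p' : PresentsOrd Z' S r ε') (i : Z.Iso Z') :
    ∃ ε : Z.H → S.E, PresentsOrd Z S r ε := by
  obtain ⟨φ, h1, h2⟩ := i
  exact ⟨_, p'.toPresents.of_isGraphIso h1, fun h k => by rw [h2, p'.lt]⟩

theorem map_iso {Z : PlanarData} {S S' : OpenGraph} {r : S.E → S.E → Prop}
    {r' : S'.E → S'.E → Prop} {ε : Z.H → S.E} (p : PresentsOrd Z S r ε) (i : Iso S r S' r') :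
    PresentsOrd Z S' r' (fun h => i.onE (ε h)) := by
  have hfin : ∀ e b, S'.fin (i.onE e) b = (S.fin e b).map i.onV := by
    rintro e (_ | _)
    · exact i.src e
    · exact i.tgt e
  have hu : ∀ e, S'.Unitary (i.onE e) ↔ S.Unitary e := by
    intro e; simp [Unitary, i.src, i.tgt]
  have hh : ∀ e b, S'.IsHalf (i.onE e) b ↔ S.IsHalf e b := by
    intro e b
    rw [IsHalf, IsHalf, hu, hfin]
    refine or_congr_left ?_
    cases S.fin e b <;> simp
  refine ⟨⟨fun h k e s => p.inj _ _ (i.onE.injective e) s, fun e b => ?_, fun h k => ?_,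
    fun h => by rw [p.σ_edge], fun h => ?_⟩, fun h k => by rw [p.lt, i.lt]⟩
  · obtain ⟨e, rfl⟩ := i.onE.surjective e
    rw [hh, ← p.half]
    simp
  · rw [p.near, Near, Near, hu, hfin, hfin]
    simp only [EmbeddingLike.apply_eq_iff_eq]
    refine or_congr_left ?_
    cases S.fin (ε h) (Z.sgn h) <;> cases S.fin (ε k) (Z.sgn k) <;> simp
  · rintro ⟨k, h1, h2⟩
    exact p.σ_ne _ ⟨k, i.onE.injective h1, h2⟩

theorem isPlanar {Z : PlanarData} {S : OpenGraph} {r : S.E → S.E → Prop} {ε : Z.H → S.E}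
    (p : PresentsOrd Z S r ε) (pl : S.IsPlanar r) : Z.IsPlanar := by
  have loop : ∀ e v, S.src e = some v → S.tgt e = some v → False := fun _ _ => pl.src_ne_tgt
  -- A step through a virtual vertex leads from an edge without ends back to itself; it has no
  -- counterpart in `S`, but it does not change the existence of paths.
  have step : ∀ h k : Z.H, GraphData.Step (edge h) (edge k) → ε h = ε k ∨ S.Step (ε h) (ε k) := by
    rintro h k ⟨a, b, ha, hb, sa, sb, hP⟩
    rw [p.edge_eq_iff] at ha hb
    rw [p.near, sa, sb, ha, hb] at hP
    rcases hP with ⟨v, h1, h2⟩ | ⟨-, h2⟩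
    · exact Or.inr ⟨v, h1, h2⟩
    · exact Or.inl h2
  have path : ∀ h k : Z.H, GraphData.Path (edge h) (edge k) → S.Path (ε h) (ε k) := by
    intro h k hp
    have : ∀ e, GraphData.Path (edge h) e → ∀ k, edge k = e → S.Path (ε h) (ε k) := by
      intro e hp
      induction hp with
      | refl =>
        intro k hk
        rw [p.edge_eq_iff] at hk
        rw [hk]; exact Path.refl _
      | @tail b c _ st ih =>
        rintro k rfl
        obtain ⟨l, rfl⟩ := Quot.exists_rep b
        rcases step l k st with he | hs
        · rw [← he]; exact ih l rfl
        · exact (ih l rfl).trans hs.path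
    exact this _ hp _ rfl
  have path' : ∀ h k : Z.H, S.Path (ε h) (ε k) → GraphData.Path (edge h) (edge k) := by
    intro h k hp
    have : ∀ e, S.Path (ε h) e → ∀ k, ε k = e → GraphData.Path (edge h) (edge k) := by
      intro e hp
      induction hp with
      | refl =>
        intro k hk
        rw [(p.edge_eq_iff k h).2 hk]; exact Relation.ReflTransGen.refl
      | @tail b c _ st ih =>
        rintro k rfl
        obtain ⟨l, rfl⟩ := p.surjective b
        refine (ih l rfl).tail ?_
        obtain ⟨v, h1, h2⟩ := st
        obtain ⟨a, ha, sa⟩ := (p.half (ε l) true).2 (Or.inl ⟨v, h1⟩)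
        obtain ⟨b, hb, sb⟩ := (p.half (ε k) false).2 (Or.inl ⟨v, h2⟩)
        refine ⟨a, b, (p.edge_eq_iff _ _).2 ha, (p.edge_eq_iff _ _).2 hb, sa, sb, ?_⟩
        rw [p.near, sa, sb, ha, hb]
        exact Or.inl ⟨v, h1, h2⟩
    exact this _ hp _ rfl
  have ex : ∀ b, (∀ v, ∃ e, S.fin e b = some v) → ∀ h, ∃ k, Z.P h k ∧ Z.sgn k = b := by
    intro b hv h
    rcases p.isHalf h with ⟨v, hh⟩ | hu
    · obtain ⟨e, he⟩ := hv v
      obtain ⟨k, rfl, rfl⟩ := (p.half e b).2 (Or.inl ⟨v, he⟩)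
      exact ⟨k, (p.near _ _).2 (Or.inl ⟨v, hh, he⟩), rfl⟩
    · obtain ⟨k, hk, rfl⟩ := (p.half (ε h) b).2 (Or.inr hu)
      exact ⟨k, (p.near _ _).2 (Or.inr ⟨hu, hk.symm⟩), rfl⟩
  refine
    { finite := ?_
      partition := ⟨fun h => ?_, fun {h k} hP => ?_, fun {h k l} h1 h2 => ?_⟩
      involution := p.involutive
      virtual_degree := fun h hv k hP => ?_
      orientation := fun h hn => ?_
      exists_in := ex true pl.exists_in
      exists_out := ex false pl.exists_out
      linear := ?_
      P1 := ?_
      P2 := ?_ }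
  · have := pl.finite_E
    refine Finite.of_injective (fun h => (ε h, Z.sgn h)) fun h k e => ?_
    simp only [Prod.mk.injEq] at e
    exact p.inj _ _ e.1 e.2
  · rw [p.near]
    rcases p.isHalf h with ⟨v, hv⟩ | hu
    · exact Or.inl ⟨v, hv, hv⟩
    · exact Or.inr ⟨hu, rfl⟩
  · rw [p.near] at hP ⊢
    rcases hP with ⟨v, h1, h2⟩ | ⟨hu, he⟩
    · exact Or.inl ⟨v, h2, h1⟩
    · exact Or.inr ⟨he ▸ hu, he.symm⟩
  · rw [p.near] at h1 h2 ⊢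
    rcases h1 with ⟨v, h1, h1'⟩ | ⟨hu, he⟩
    · rcases h2 with ⟨w, h2, h2'⟩ | ⟨hu, he⟩
      · rw [h1'] at h2
        exact Or.inl ⟨v, h1, by rw [h2', h2]⟩
      · simp [hu.fin] at h1'
    · rcases h2 with ⟨w, h2, h2'⟩ | ⟨hu', he'⟩
      · rw [← he, hu.fin] at h2; simp at h2
      · exact Or.inr ⟨hu, he.trans he'⟩
  · rw [p.isVirtual_iff loop] at hv
    rw [p.near] at hP
    rcases hP with ⟨v, h1, -⟩ | ⟨-, he⟩
    · simp [hv.fin] at h1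
    · exact p.eq_or_eq_σ he
  · rw [p.sgn_σ h ((p.σ_ne_self_iff h).1 hn)]
    simp
  · have e1 : Std.Trichotomous Z.lt := by
      constructor
      intro a b h1 h2
      obtain ⟨h, rfl⟩ := Quot.exists_rep a
      obtain ⟨k, rfl⟩ := Quot.exists_rep b
      change edge h = edge k
      change ¬ Z.lt (edge h) (edge k) at h1
      change ¬ Z.lt (edge k) (edge h) at h2
      rw [p.lt] at h1 h2
      rw [p.edge_eq_iff]
      have := pl.total (ε h) (ε k)
      tauto
    have e2 : Std.Irrefl Z.lt := by
      constructor
      intro a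
      obtain ⟨h, rfl⟩ := Quot.exists_rep a
      change ¬ Z.lt (edge h) (edge h)
      rw [p.lt]
      exact pl.irrefl _
    have e3 : IsTrans Z.Edge Z.lt := by
      constructor
      intro a b c
      obtain ⟨h, rfl⟩ := Quot.exists_rep a
      obtain ⟨k, rfl⟩ := Quot.exists_rep b
      obtain ⟨l, rfl⟩ := Quot.exists_rep c
      change Z.lt (edge h) (edge k) → Z.lt (edge k) (edge l) → Z.lt (edge h) (edge l)
      rw [p.lt, p.lt, p.lt]
      exact pl.trans _ _ _
    exact { }
  · intro a b hn hp
    obtain ⟨h, rfl⟩ := Quot.exists_rep a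
    obtain ⟨k, rfl⟩ := Quot.exists_rep b
    change Z.lt (edge h) (edge k)
    rw [p.lt]
    refine (pl.of_path (path h k hp)).resolve_left fun he => hn ?_
    exact (p.edge_eq_iff h k).2 he
  · intro a b c hp h1 h2
    obtain ⟨h, rfl⟩ := Quot.exists_rep a
    obtain ⟨k, rfl⟩ := Quot.exists_rep b
    obtain ⟨l, rfl⟩ := Quot.exists_rep c
    rcases pl.between _ _ _ (path h k hp) ((p.lt h l).1 h1) ((p.lt l k).1 h2) with q | q
    · exact Or.inl (path' _ _ q)
    · exact Or.inr (path' _ _ q)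

end PresentsOrd

end OpenGraph

/-! ### The open graph of a combinatorial planar graph -/

namespace PlanarData

variable {X : PlanarData} (pl : X.IsPlanar)
include pl

/-- `Edge` is the quotient by the equivalence relation generated by `σ`; as `σ` is an involution,
the classes are just the pairs `{h, σ h}`. -/
theorem edge_eq_iff (h k : X.H) : edge h = edge k ↔ k = h ∨ k = X.σ h := by
  constructor
  · intro he
    have key : ∀ a b : X.H, Relation.EqvGen (fun h k : X.H => k = X.σ h) a b →
        b = a ∨ b = X.σ a := by
      intro a b hab
      induction hab with
      | rel a b h => exact Or.inr h
      | refl a => exact Or.inl rfl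
      | symm a b _ ih =>
        rcases ih with rfl | rfl
        · exact Or.inl rfl
        · exact Or.inr (pl.involution a).symm
      | trans a b c _ _ ih1 ih2 =>
        rcases ih1 with rfl | rfl
        · exact ih2
        · rcases ih2 with rfl | rfl
          · exact Or.inr rfl
          · exact Or.inl (pl.involution a)
    exact key _ _ (Quot.eqvGen_exact he)
  · rintro (rfl | rfl)
    · rfl
    · exact Quot.sound rfl

theorem isVirtual_σ {h : X.H} (hv : IsVirtual h) : IsVirtual (X.σ h) := by
  obtain ⟨h1, h2⟩ := hv
  refine ⟨?_, ?_⟩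
  · rw [pl.involution h]; exact h1.symm
  · rw [pl.involution h]; exact pl.partition.symm h2

theorem isVirtual_congr {h k : X.H} (he : edge h = edge k) : IsVirtual h ↔ IsVirtual k := by
  rcases (edge_eq_iff pl h k).1 he with rfl | rfl
  · rfl
  · exact ⟨isVirtual_σ pl, fun hv => by simpa [pl.involution h] using isVirtual_σ pl hv⟩

theorem isVirtual_of_P {h k : X.H} (hv : IsVirtual h) (hP : X.P h k) : IsVirtual k := by
  rcases pl.virtual_degree h hv k hP with rfl | rfl
  · exact hv
  · exact isVirtual_σ pl hv

theorem eq_of_sgn {h k : X.H} (he : edge h = edge k) (hs : X.sgn h = X.sgn k) : h = k := by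
  rcases (edge_eq_iff pl h k).1 he with rfl | rfl
  · rfl
  · by_contra hn
    exact pl.orientation h (Ne.symm hn) hs.symm

/-- Every planar graph is presented by an open graph. -/
theorem exists_presentsOrd : ∃ (S : OpenGraph) (r : S.E → S.E → Prop) (ε : X.H → S.E),
    S.IsPlanar r ∧ OpenGraph.PresentsOrd X S r ε := by
  classical
  -- The vertices of `S` are the real vertices. Virtual vertices are dropped, and their edges lose
  -- both ends.
  let R := {h : X.H // ¬ IsVirtual h}
  let st : Setoid R := ⟨fun h k => X.P h.1 k.1, fun h => pl.partition.refl _,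
    fun h => pl.partition.symm h, fun h k => pl.partition.trans h k⟩
  -- The choice is immaterial, because an edge has at most one half-edge of each sign.
  let F : X.Edge → Bool → Option (Quotient st) := fun e b =>
    if h : ∃ h : R, edge h.1 = e ∧ X.sgn h.1 = b then some ⟦h.choose⟧ else none
  have hF : ∀ e b v, F e b = some v ↔ ∃ h : R, edge h.1 = e ∧ X.sgn h.1 = b ∧ ⟦h⟧ = v := by
    intro e b v
    constructor
    · intro hh
      by_cases hx : ∃ h : R, edge h.1 = e ∧ X.sgn h.1 = b
      · simp only [F, dif_pos hx, Option.some.injEq] at hh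
        exact ⟨hx.choose, hx.choose_spec.1, hx.choose_spec.2, hh⟩
      · simp only [F, dif_neg hx] at hh
        exact (by simp at hh)
    · rintro ⟨h, h1, h2, rfl⟩
      have hx : ∃ h : R, edge h.1 = e ∧ X.sgn h.1 = b := ⟨h, h1, h2⟩
      simp only [F, dif_pos hx]
      congr 2
      exact Subtype.ext (eq_of_sgn pl (hx.choose_spec.1.trans h1.symm)
        (hx.choose_spec.2.trans h2.symm))
  have hFv : ∀ (h : X.H) b, IsVirtual h → F (edge h) b = none := by
    intro h b hv
    cases hx : F (edge h) b with
    | none => rfl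
    | some v =>
      obtain ⟨k, h1, -, -⟩ := (hF _ _ _).1 hx
      exact (k.2 ((isVirtual_congr pl h1).2 hv)).elim
  have hFr : ∀ (h : X.H) (hv : ¬ IsVirtual h), F (edge h) (X.sgn h) = some ⟦⟨h, hv⟩⟧ :=
    fun h hv => (hF _ _ _).2 ⟨⟨h, hv⟩, rfl, rfl, rfl⟩
  let S : OpenGraph := ⟨X.Edge, Quotient st, fun e => F e false, fun e => F e true⟩
  have hfin : ∀ e b, S.fin e b = F e b := by rintro e (_ | _) <;> rfl
  have hU : ∀ h : X.H, S.Unitary (edge h) ↔ IsVirtual h := by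
    intro h
    constructor
    · intro hu
      by_contra hv
      have := hu.fin (X.sgn h)
      rw [hfin, hFr h hv] at this
      simp at this
    · intro hv
      exact ⟨hFv _ _ hv, hFv _ _ hv⟩
  have hp : OpenGraph.Presents X.toGraphData S edge := by
    refine ⟨fun h k => eq_of_sgn pl, fun e b => ⟨?_, ?_⟩, fun h k => ⟨fun hP => ?_, ?_⟩,
      fun h => ((edge_eq_iff pl _ _).2 (Or.inr rfl)).symm, ?_⟩
    · rintro ⟨h, rfl, rfl⟩
      by_cases hv : IsVirtual h
      · exact Or.inr ((hU h).2 hv)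
      · exact Or.inl ⟨_, (hfin _ _).trans (hFr h hv)⟩
    · rintro (⟨v, hv⟩ | hu)
      · obtain ⟨h, h1, h2, -⟩ := (hF _ _ _).1 ((hfin _ _).symm.trans hv)
        exact ⟨h.1, h1, h2⟩
      · obtain ⟨h, rfl⟩ := Quot.exists_rep e
        have hv := (hU h).1 hu
        by_cases hs : X.sgn h = b
        · exact ⟨h, rfl, hs⟩
        · refine ⟨X.σ h, ((edge_eq_iff pl _ _).2 (Or.inr rfl)).symm, ?_⟩
          have := pl.orientation h hv.1
          revert this hs
          cases X.sgn h <;> cases X.sgn (X.σ h) <;> cases b <;> simp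
    · by_cases hv : IsVirtual h
      · exact Or.inr ⟨(hU h).2 hv, (edge_eq_iff pl _ _).2 (pl.virtual_degree h hv k hP)⟩
      · have hv' : ¬ IsVirtual k := fun hk => hv (isVirtual_of_P pl hk (pl.partition.symm hP))
        refine Or.inl ⟨_, (hfin _ _).trans (hFr h hv), (hfin _ _).trans ((hFr k hv').trans ?_)⟩
        exact congrArg some (Quotient.sound (pl.partition.symm hP))
    · rintro (⟨v, h1, h2⟩ | ⟨hu, he⟩)
      · obtain ⟨a, a1, a2, a3⟩ := (hF _ _ _).1 ((hfin _ _).symm.trans h1)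
        obtain ⟨b, b1, b2, b3⟩ := (hF _ _ _).1 ((hfin _ _).symm.trans h2)
        rw [← eq_of_sgn pl a1 a2, ← eq_of_sgn pl b1 b2]
        exact Quotient.exact (a3.trans b3.symm)
      · have hv := (hU h).1 hu
        rcases (edge_eq_iff pl _ _).1 he with rfl | rfl
        · exact pl.partition.refl _
        · exact hv.2
    · rintro h ⟨k, h1, h2⟩
      rcases (edge_eq_iff pl _ _).1 h1 with rfl | rfl
      · cases h' : X.sgn h <;> simp [h'] at h2
      · rw [pl.involution k, h2]
  have lin := pl.linear
  -- A step in `S` passes through a real vertex. If it led from an edge to itself, this vertex would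
  -- contain both halves of the edge and would be virtual.
  have step : ∀ e f : X.Edge, S.Step e f → e ≠ f ∧ Step e f := by
    rintro e f ⟨v, h1, h2⟩
    obtain ⟨a, a1, a2, a3⟩ := (hF _ _ _).1 h1
    obtain ⟨b, b1, b2, b3⟩ := (hF _ _ _).1 h2
    have hP : X.P a.1 b.1 := Quotient.exact (a3.trans b3.symm)
    refine ⟨?_, a.1, b.1, a1, b1, a2, b2, hP⟩
    rintro rfl
    rcases (edge_eq_iff pl _ _).1 (a1.trans b1.symm) with h | h
    · rw [h, a2] at b2; simp at b2
    · refine a.2 ⟨fun hc => ?_, h ▸ hP⟩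
      rw [h, hc, a2] at b2; simp at b2
  have step' : ∀ e f : X.Edge, Step e f → e = f ∨ S.Step e f := by
    rintro _ _ ⟨a, b, rfl, rfl, a2, b2, hP⟩
    by_cases hv : IsVirtual a
    · exact Or.inl ((edge_eq_iff pl _ _).2 (pl.virtual_degree _ hv _ hP))
    · have hv' : ¬ IsVirtual b := fun hk => hv (isVirtual_of_P pl hk (pl.partition.symm hP))
      refine Or.inr ⟨_, (hF _ _ _).2 ⟨⟨a, hv⟩, rfl, a2, rfl⟩, (hF _ _ _).2 ⟨⟨b, hv'⟩, rfl, b2, ?_⟩⟩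
      exact Quotient.sound (pl.partition.symm hP)
  have path : ∀ e f : X.Edge, S.Path e f → Path e f := fun e f =>
    Relation.ReflTransGen.mono (fun a b h => (step a b h).2) e f
  have path' : ∀ e f : X.Edge, Path e f → S.Path e f := by
    intro e f hp
    induction hp with
    | refl => exact OpenGraph.Path.refl _
    | tail _ st ih =>
      rcases step' _ _ st with rfl | st
      · exact ih
      · exact ih.trans st.path
  refine ⟨S, X.lt, edge, ⟨⟨?_, ?_, ?_, ?_⟩, ?_, ?_, ?_, ?_, ?_⟩, hp, fun _ _ => Iff.rfl⟩
  · have := pl.finite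
    exact Finite.of_surjective (fun h : X.H => edge h) fun e => Quot.exists_rep e
  · have := pl.finite
    exact inferInstanceAs (Finite (Quotient st))
  · intro v
    obtain ⟨h, rfl⟩ := Quotient.exists_rep v
    obtain ⟨k, h1, h2⟩ := pl.exists_in h.1
    have hv : ¬ IsVirtual k := fun hk => h.2 (isVirtual_of_P pl hk (pl.partition.symm h1))
    exact ⟨edge k, (hF _ _ _).2 ⟨⟨k, hv⟩, rfl, h2, Quotient.sound (pl.partition.symm h1)⟩⟩
  · intro v
    obtain ⟨h, rfl⟩ := Quotient.exists_rep v
    obtain ⟨k, h1, h2⟩ := pl.exists_out h.1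
    have hv : ¬ IsVirtual k := fun hk => h.2 (isVirtual_of_P pl hk (pl.partition.symm h1))
    exact ⟨edge k, (hF _ _ _).2 ⟨⟨k, hv⟩, rfl, h2, Quotient.sound (pl.partition.symm h1)⟩⟩
  · exact fun e => lin.irrefl e
  · exact fun e f g => lin.trans e f g
  · exact fun e f => trichotomous_of X.lt e f
  · intro e f st
    obtain ⟨h1, h2⟩ := step e f st
    exact pl.P1 e f h1 (Relation.ReflTransGen.single h2)
  · intro a b c hp h1 h2
    rcases pl.P2 a b c (path _ _ hp) h1 h2 with q | q
    · exact Or.inl (path' _ _ q)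
    · exact Or.inr (path' _ _ q)

end PlanarData

/-! ## Drawings of open graphs -/

/-- A drawing of an open graph between the levels `lo` and `hi`: the positions of the vertices, and
for every edge its first coordinate as a function of the level. -/
structure Drawing (S : OpenGraph) where
  lo : ℝ
  hi : ℝ
  pt : S.V → ℝ × ℝ
  x : S.E → ℝ → ℝ

namespace Drawing

variable {S : OpenGraph} (D : Drawing S)

/-- The level at which `e` begins. -/
def bot (e : S.E) : ℝ := (S.src e).elim D.lo fun v => (D.pt v).2

/-- The level at which `e` ends. -/
def top (e : S.E) : ℝ := (S.tgt e).elim D.hi fun v => (D.pt v).2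

/-- The point of `e` at level `u`. -/
def point (e : S.E) (u : ℝ) : ℝ × ℝ := (D.x e u, u)

/-- The closed arc of `e`. -/
def arc (e : S.E) : Set (ℝ × ℝ) := D.point e '' Icc (D.bot e) (D.top e)

/-- The open arc of `e`. -/
def openArc (e : S.E) : Set (ℝ × ℝ) := D.point e '' Ioo (D.bot e) (D.top e)

/-- The plane graph of a drawing. -/
def toPlane : PlaneGraph where
  carrier := ⋃ e, D.arc e
  nodes := {p | ∃ e, p = D.point e (D.bot e) ∨ p = D.point e (D.top e)}

/-- The conditions for `D` to be an embedding. -/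
structure IsValid : Prop where
  lt : D.lo < D.hi
  bounds : ∀ v, D.lo < (D.pt v).2 ∧ (D.pt v).2 < D.hi
  bot_lt_top : ∀ e, D.bot e < D.top e
  cont : ∀ e, ContinuousOn (D.x e) (Icc (D.bot e) (D.top e))
  x_src : ∀ e v, S.src e = some v → D.x e (D.pt v).2 = (D.pt v).1
  x_tgt : ∀ e v, S.tgt e = some v → D.x e (D.pt v).2 = (D.pt v).1
  -- Closed arcs meet only in a common vertex. As vertices lie strictly between `lo` and `hi`,
  -- distinct arcs are disjoint on the outer levels.
  disj : ∀ e f u, e ≠ f → u ∈ Icc (D.bot e) (D.top e) → u ∈ Icc (D.bot f) (D.top f) →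
    D.x e u = D.x f u → ∃ v, S.Inc e v ∧ S.Inc f v ∧ (D.pt v).2 = u

/-- At every level the edges are ordered from left to right by `r`. -/
def IsOrdered (r : S.E → S.E → Prop) : Prop :=
  ∀ e f u, r e f → u ∈ Icc (D.bot e) (D.top e) → u ∈ Icc (D.bot f) (D.top f) → D.x e u ≤ D.x f u

variable {D}

theorem bot_of_src {e : S.E} {v : S.V} (h : S.src e = some v) : D.bot e = (D.pt v).2 := by
  simp [bot, h]

theorem bot_of_none {e : S.E} (h : S.src e = none) : D.bot e = D.lo := by
  simp [bot, h]

theorem top_of_tgt {e : S.E} {v : S.V} (h : S.tgt e = some v) : D.top e = (D.pt v).2 := by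
  simp [top, h]

theorem top_of_none {e : S.E} (h : S.tgt e = none) : D.top e = D.hi := by
  simp [top, h]

theorem level_of_inc {e : S.E} {v : S.V} (h : S.Inc e v) :
    (D.pt v).2 = D.bot e ∨ (D.pt v).2 = D.top e :=
  h.imp (fun h => (bot_of_src h).symm) fun h => (top_of_tgt h).symm

@[simp] theorem point_snd (e : S.E) (u : ℝ) : (D.point e u).2 = u := rfl

theorem mem_arc_iff {e : S.E} {p : ℝ × ℝ} :
    p ∈ D.arc e ↔ p.2 ∈ Icc (D.bot e) (D.top e) ∧ D.x e p.2 = p.1 := by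
  constructor
  · rintro ⟨u, hu, rfl⟩; exact ⟨hu, rfl⟩
  · rintro ⟨h1, h2⟩; exact ⟨p.2, h1, Prod.ext h2 rfl⟩

theorem mem_openArc_iff {e : S.E} {p : ℝ × ℝ} :
    p ∈ D.openArc e ↔ p.2 ∈ Ioo (D.bot e) (D.top e) ∧ D.x e p.2 = p.1 := by
  constructor
  · rintro ⟨u, hu, rfl⟩; exact ⟨hu, rfl⟩
  · rintro ⟨h1, h2⟩; exact ⟨p.2, h1, Prod.ext h2 rfl⟩

theorem openArc_subset_arc (e : S.E) : D.openArc e ⊆ D.arc e := image_mono Ioo_subset_Icc_self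

namespace IsValid

variable (hD : D.IsValid)
include hD

theorem lo_le_bot (e : S.E) : D.lo ≤ D.bot e := by
  cases h : S.src e with
  | none => rw [bot_of_none h]
  | some v => rw [bot_of_src h]; exact (hD.bounds v).1.le

theorem top_le_hi (e : S.E) : D.top e ≤ D.hi := by
  cases h : S.tgt e with
  | none => rw [top_of_none h]
  | some v => rw [top_of_tgt h]; exact (hD.bounds v).2.le

theorem bot_eq_lo_iff (e : S.E) : D.bot e = D.lo ↔ S.src e = none := by
  cases h : S.src e with
  | none => simp [bot_of_none h]
  | some v => rw [bot_of_src h]; simp [(hD.bounds v).1.ne']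

theorem top_eq_hi_iff (e : S.E) : D.top e = D.hi ↔ S.tgt e = none := by
  cases h : S.tgt e with
  | none => simp [top_of_none h]
  | some v => rw [top_of_tgt h]; simp [(hD.bounds v).2.ne]

theorem bot_mem (e : S.E) : D.bot e ∈ Icc (D.bot e) (D.top e) :=
  left_mem_Icc.2 (hD.bot_lt_top e).le

theorem top_mem (e : S.E) : D.top e ∈ Icc (D.bot e) (D.top e) :=
  right_mem_Icc.2 (hD.bot_lt_top e).le

theorem point_bot {e : S.E} {v : S.V} (h : S.src e = some v) :
    D.point e (D.bot e) = D.pt v := by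
  rw [bot_of_src h]; exact Prod.ext (hD.x_src e v h) rfl

theorem point_top {e : S.E} {v : S.V} (h : S.tgt e = some v) :
    D.point e (D.top e) = D.pt v := by
  rw [top_of_tgt h]; exact Prod.ext (hD.x_tgt e v h) rfl

/-- A level strictly inside `e` is not the level of an end of `e`, so the meeting point allowed by
`disj` cannot occur there. -/
theorem eq_of_x_eq {e f : S.E} {u : ℝ} (he : u ∈ Ioo (D.bot e) (D.top e))
    (hf : u ∈ Icc (D.bot f) (D.top f)) (h : D.x e u = D.x f u) : e = f := by
  by_contra hn
  obtain ⟨v, h1, -, h2⟩ := hD.disj e f u hn (Ioo_subset_Icc_self he) hf h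
  rcases level_of_inc (D := D) h1 with h | h
  · exact he.1.ne (h ▸ h2)
  · exact he.2.ne (h ▸ h2.symm)

theorem eq_of_mem {e f : S.E} {p : ℝ × ℝ} (he : p ∈ D.openArc e) (hf : p ∈ D.arc f) : e = f := by
  rw [mem_openArc_iff] at he
  rw [mem_arc_iff] at hf
  exact hD.eq_of_x_eq he.1 hf.1 (he.2.trans hf.2.symm)

theorem continuousOn_point (e : S.E) : ContinuousOn (D.point e) (Icc (D.bot e) (D.top e)) :=
  (hD.cont e).prodMk continuousOn_id

theorem isCompact_arc (e : S.E) : IsCompact (D.arc e) :=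
  isCompact_Icc.image_of_continuousOn (hD.continuousOn_point e)

theorem closure_openArc (e : S.E) : closure (D.openArc e) = D.arc e := by
  refine Subset.antisymm (closure_minimal (openArc_subset_arc e) (hD.isCompact_arc e).isClosed) ?_
  have h := hD.continuousOn_point e
  rw [← closure_Ioo (hD.bot_lt_top e).ne] at h
  have := h.image_closure
  rwa [closure_Ioo (hD.bot_lt_top e).ne] at this

theorem isPreconnected_openArc (e : S.E) : IsPreconnected (D.openArc e) :=
  isPreconnected_Ioo.image _ ((hD.continuousOn_point e).mono Ioo_subset_Icc_self)

theorem openArc_nonempty (e : S.E) : (D.openArc e).Nonempty :=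
  (nonempty_Ioo.2 (hD.bot_lt_top e)).image _

theorem openArc_injective : Function.Injective D.openArc := by
  intro e f h
  obtain ⟨p, hp⟩ := hD.openArc_nonempty e
  exact hD.eq_of_mem hp (openArc_subset_arc f (h ▸ hp))

theorem carrier_diff : D.toPlane.carrier \ D.toPlane.nodes = ⋃ e, D.openArc e := by
  ext p
  simp only [toPlane, Set.mem_sdiff, mem_iUnion, mem_ofPred_eq, not_exists]
  constructor
  · rintro ⟨⟨e, he⟩, hn⟩
    refine ⟨e, ?_⟩
    rw [mem_arc_iff] at he
    rw [mem_openArc_iff]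
    have h1 := hn e
    refine ⟨⟨lt_of_le_of_ne he.1.1 fun h => h1 (Or.inl ?_),
      lt_of_le_of_ne he.1.2 fun h => h1 (Or.inr ?_)⟩, he.2⟩
    · exact Prod.ext (by rw [h]; exact he.2.symm) h.symm
    · exact Prod.ext (by rw [← h]; exact he.2.symm) h
  · rintro ⟨e, he⟩
    refine ⟨⟨e, openArc_subset_arc e he⟩, fun f hf => ?_⟩
    have hp : p ∈ D.arc f := by
      rcases hf with rfl | rfl
      · exact ⟨_, hD.bot_mem f, rfl⟩
      · exact ⟨_, hD.top_mem f, rfl⟩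
    obtain rfl := hD.eq_of_mem he hp
    rw [mem_openArc_iff] at he
    rcases hf with rfl | rfl
    · exact he.1.1.ne rfl
    · exact he.1.2.ne rfl

variable (fl : S.IsFlow)
include fl

/-- The component is covered by two closed sets, the arc of `e` and the union of the other arcs.
They are disjoint on it, because its points lie on open arcs; a connected set lies in one of the
two. -/
theorem connectedComponentIn_eq {e : S.E} {p : ℝ × ℝ} (hp : p ∈ D.openArc e) :
    connectedComponentIn (D.toPlane.carrier \ D.toPlane.nodes) p = D.openArc e := by
  have := fl.finite_E
  have hsub : D.openArc e ⊆ D.toPlane.carrier \ D.toPlane.nodes := by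
    rw [hD.carrier_diff]; exact subset_iUnion _ e
  refine Subset.antisymm ?_
    ((hD.isPreconnected_openArc e).subset_connectedComponentIn hp hsub)
  set C := connectedComponentIn (D.toPlane.carrier \ D.toPlane.nodes) p with hC
  have hCs : C ⊆ ⋃ e, D.openArc e := by
    rw [← hD.carrier_diff]; exact connectedComponentIn_subset _ _
  have hpC : p ∈ C := mem_connectedComponentIn (hsub hp)
  have hpre : IsPreconnected C := isPreconnected_connectedComponentIn
  have h1 : IsClosed (D.arc e) := (hD.isCompact_arc e).isClosed
  have h2 : IsClosed (⋃ f : {f // f ≠ e}, D.arc f) :=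
    isClosed_iUnion_of_finite fun f => (hD.isCompact_arc f).isClosed
  have hdis : ∀ q ∈ C, q ∈ D.arc e → q ∈ D.openArc e := by
    intro q hq hqe
    obtain ⟨f, hf⟩ := mem_iUnion.1 (hCs hq)
    exact hD.eq_of_mem hf hqe ▸ hf
  have := isPreconnected_iff_subset_of_disjoint_closed.1 hpre _ _ h1 h2 (fun q hq => by
    obtain ⟨f, hf⟩ := mem_iUnion.1 (hCs hq)
    by_cases hfe : f = e
    · exact Or.inl (hfe ▸ openArc_subset_arc f hf)
    · exact Or.inr (mem_iUnion.2 ⟨⟨f, hfe⟩, openArc_subset_arc f hf⟩)) (by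
    rw [eq_empty_iff_forall_notMem]
    rintro q ⟨hq, hqe, hqf⟩
    obtain ⟨⟨f, hfe⟩, hf⟩ := mem_iUnion.1 hqf
    exact hfe (hD.eq_of_mem (hdis q hq hqe) hf).symm)
  rcases this with h | h
  · exact fun q hq => hdis q hq (h hq)
  · obtain ⟨⟨f, hfe⟩, hf⟩ := mem_iUnion.1 (h hpC)
    exact (hfe (hD.eq_of_mem hp hf).symm).elim

theorem edges_eq : D.toPlane.edges = range D.openArc := by
  ext A
  simp only [PlaneGraph.edges, mem_ofPred_eq, mem_range]
  constructor
  · rintro ⟨p, hp, rfl⟩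
    rw [hD.carrier_diff] at hp
    obtain ⟨e, he⟩ := mem_iUnion.1 hp
    exact ⟨e, (hD.connectedComponentIn_eq fl he).symm⟩
  · rintro ⟨e, rfl⟩
    obtain ⟨p, hp⟩ := hD.openArc_nonempty e
    exact ⟨p, by rw [hD.carrier_diff]; exact mem_iUnion.2 ⟨e, hp⟩,
      (hD.connectedComponentIn_eq fl hp).symm⟩

theorem openArc_mem_edges (e : S.E) : D.openArc e ∈ D.toPlane.edges := by
  rw [hD.edges_eq fl]; exact mem_range_self e

theorem mem_inEdges_iff (e : S.E) (p : ℝ × ℝ) :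
    D.openArc e ∈ D.toPlane.inEdges p ↔ p = D.point e (D.top e) := by
  simp only [PlaneGraph.inEdges, mem_ofPred_eq, hD.openArc_mem_edges fl, hD.closure_openArc,
    true_and]
  constructor
  · rintro ⟨⟨u, hu, rfl⟩, h⟩
    by_contra hn
    have hlt : u < D.top e := lt_of_le_of_ne hu.2 fun h => hn (by rw [h])
    -- The point of the open arc halfway up to the top would lie above `p`.
    have := h (D.point e ((u + D.top e) / 2)) ⟨_, ⟨by linarith [hu.1], by linarith⟩, rfl⟩
    simp at this
    linarith
  · rintro rfl
    refine ⟨⟨_, hD.top_mem e, rfl⟩, ?_⟩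
    rintro p ⟨u, hu, rfl⟩
    exact hu.2

theorem mem_outEdges_iff (e : S.E) (p : ℝ × ℝ) :
    D.openArc e ∈ D.toPlane.outEdges p ↔ p = D.point e (D.bot e) := by
  simp only [PlaneGraph.outEdges, mem_ofPred_eq, hD.openArc_mem_edges fl, hD.closure_openArc,
    true_and]
  constructor
  · rintro ⟨⟨u, hu, rfl⟩, h⟩
    by_contra hn
    have hlt : D.bot e < u := lt_of_le_of_ne hu.1 fun h => hn (by rw [← h])
    have := h (D.point e ((u + D.bot e) / 2)) ⟨_, ⟨by linarith, by linarith [hu.2]⟩, rfl⟩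
    simp at this
    linarith
  · rintro rfl
    refine ⟨⟨_, hD.bot_mem e, rfl⟩, ?_⟩
    rintro p ⟨u, hu, rfl⟩
    exact hu.1

omit fl in
theorem mem_outer_iff (p : ℝ × ℝ) : p ∈ D.toPlane.outer D.lo D.hi ↔
    ∃ e, (S.src e = none ∧ p = D.point e (D.bot e)) ∨ (S.tgt e = none ∧ p = D.point e (D.top e)) := by
  simp only [PlaneGraph.outer, toPlane, mem_ofPred_eq, mem_iUnion]
  constructor
  · rintro ⟨⟨e, u, hu, rfl⟩, h | h⟩
    · have h1 : D.bot e = D.lo := le_antisymm (h ▸ hu.1) (hD.lo_le_bot e)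
      exact ⟨e, Or.inl ⟨(hD.bot_eq_lo_iff e).1 h1, by rw [h1, ← h]; rfl⟩⟩
    · have h1 : D.top e = D.hi := le_antisymm (hD.top_le_hi e) (h ▸ hu.2)
      exact ⟨e, Or.inr ⟨(hD.top_eq_hi_iff e).1 h1, by rw [h1, ← h]; rfl⟩⟩
  · rintro ⟨e, ⟨h, rfl⟩ | ⟨h, rfl⟩⟩
    · exact ⟨⟨e, _, hD.bot_mem e, rfl⟩, Or.inl (bot_of_none h)⟩
    · exact ⟨⟨e, _, hD.top_mem e, rfl⟩, Or.inr (top_of_none h)⟩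

theorem inner_eq : D.toPlane.inner D.lo D.hi = range D.pt := by
  ext p
  simp only [PlaneGraph.inner, Set.mem_sdiff]
  constructor
  · rintro ⟨⟨e, rfl | rfl⟩, hn⟩
    · cases h : S.src e with
      | none => exact (hn ((hD.mem_outer_iff _).2 ⟨e, Or.inl ⟨h, rfl⟩⟩)).elim
      | some v => exact ⟨v, (hD.point_bot h).symm⟩
    · cases h : S.tgt e with
      | none => exact (hn ((hD.mem_outer_iff _).2 ⟨e, Or.inr ⟨h, rfl⟩⟩)).elim
      | some v => exact ⟨v, (hD.point_top h).symm⟩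
  · rintro ⟨v, rfl⟩
    obtain ⟨e, he⟩ := fl.exists_in v
    refine ⟨⟨e, Or.inr (hD.point_top he).symm⟩, fun h => ?_⟩
    have := hD.bounds v
    rcases h.2 with h | h
    · exact this.1.ne' h
    · exact this.2.ne h

/-- If two vertices had the same position, incoming edges of them would meet at their tops. The
common vertex supplied by `disj` lies at the top level of both edges, so it is the target of both.
-/
theorem pt_injective : Function.Injective D.pt := by
  intro v w h
  obtain ⟨e, he⟩ := fl.exists_in v
  obtain ⟨f, hf⟩ := fl.exists_in w
  by_cases hef : e = f
  · subst hef; exact Option.some.inj (he.symm.trans hf)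
  have h1 : D.top e = D.top f := by rw [top_of_tgt he, top_of_tgt hf, h]
  have h2 : D.x e (D.top e) = D.x f (D.top e) := by
    have := hD.point_top he
    rw [h, ← hD.point_top hf, ← h1] at this
    exact congrArg Prod.fst this
  have key : ∀ e v z, S.tgt e = some v → S.Inc e z → (D.pt z).2 = D.top e → z = v := by
    rintro e v z hv (hz | hz) hl
    · rw [← bot_of_src hz] at hl
      exact ((hD.bot_lt_top e).ne hl).elim
    · exact Option.some.inj (hz.symm.trans hv)
  obtain ⟨z, z1, z2, z3⟩ := hD.disj e f _ hef (hD.top_mem e) (h1 ▸ hD.top_mem f) h2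
  rw [← key e v z he z1 z3, key f w z hf z2 (z3.trans h1)]

theorem point_bot_eq_pt_iff (e : S.E) (v : S.V) :
    D.pt v = D.point e (D.bot e) ↔ S.src e = some v := by
  constructor
  · intro h
    cases hs : S.src e with
    | none =>
      have := congrArg Prod.snd h
      rw [point_snd, bot_of_none hs] at this
      exact ((hD.bounds v).1.ne' this).elim
    | some w =>
      rw [hD.point_bot hs] at h
      rw [hD.pt_injective fl h]
  · intro h
    exact (hD.point_bot h).symm

theorem point_top_eq_pt_iff (e : S.E) (v : S.V) :
    D.pt v = D.point e (D.top e) ↔ S.tgt e = some v := by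
  constructor
  · intro h
    cases hs : S.tgt e with
    | none =>
      have := congrArg Prod.snd h
      rw [point_snd, top_of_none hs] at this
      exact ((hD.bounds v).2.ne this).elim
    | some w =>
      rw [hD.point_top hs] at h
      rw [hD.pt_injective fl h]
  · intro h
    exact (hD.point_top h).symm

omit fl in
theorem eq_of_point_bot_eq {e f : S.E} (he : S.src e = none) (hf : S.src f = none)
    (h : D.x e D.lo = D.x f D.lo) : e = f := by
  by_contra hn
  obtain ⟨v, -, -, hv⟩ := hD.disj e f D.lo hn (by rw [← bot_of_none he]; exact hD.bot_mem e)
    (by rw [← bot_of_none hf]; exact hD.bot_mem f) h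
  exact (hD.bounds v).1.ne' hv

omit fl in
theorem eq_of_point_top_eq {e f : S.E} (he : S.tgt e = none) (hf : S.tgt f = none)
    (h : D.x e D.hi = D.x f D.hi) : e = f := by
  by_contra hn
  obtain ⟨v, -, -, hv⟩ := hD.disj e f D.hi hn (by rw [← top_of_none he]; exact hD.top_mem e)
    (by rw [← top_of_none hf]; exact hD.top_mem f) h
  exact (hD.bounds v).2.ne hv

/-- The plane graph of a valid drawing is a leveled progressive plane graph. -/
theorem isLeveled : D.toPlane.IsLeveled D.lo D.hi where
  lt := hD.lt
  nodes_subset := by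
    rintro p ⟨e, rfl | rfl⟩
    · exact mem_iUnion.2 ⟨e, _, hD.bot_mem e, rfl⟩
    · exact mem_iUnion.2 ⟨e, _, hD.top_mem e, rfl⟩
  nodes_finite := by
    have := fl.finite_E
    have : D.toPlane.nodes = range (fun e => D.point e (D.bot e)) ∪
        range (fun e => D.point e (D.top e)) := by
      ext p
      simp only [toPlane, mem_ofPred_eq, mem_union, mem_range, exists_or, eq_comm]
    rw [this]
    exact (finite_range _).union (finite_range _)
  edges_finite := by
    have := fl.finite_E
    rw [hD.edges_eq fl]; exact finite_range _
  pinned := by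
    rw [hD.edges_eq fl]
    rintro _ ⟨e, rfl⟩
    have hlt := hD.bot_lt_top e
    refine ⟨fun s => D.point e (D.bot e + s * (D.top e - D.bot e)), ?_, ?_, ?_, ?_, ?_⟩
    · refine (hD.continuousOn_point e).comp (by fun_prop) ?_
      rintro s ⟨h0, h1⟩
      constructor <;> nlinarith
    · intro s _ s' _ h
      have := congrArg Prod.snd h
      simp only [point_snd, add_right_inj, mul_eq_mul_right_iff, sub_eq_zero] at this
      exact this.resolve_right hlt.ne'
    · ext p
      constructor
      · rintro ⟨s, ⟨h0, h1⟩, rfl⟩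
        exact ⟨_, ⟨by nlinarith, by nlinarith⟩, rfl⟩
      · rintro ⟨u, ⟨h0, h1⟩, rfl⟩
        refine ⟨(u - D.bot e) / (D.top e - D.bot e), ⟨div_pos (by linarith) (by linarith), ?_⟩, ?_⟩
        · rw [div_lt_one (by linarith)]; linarith
        · have : D.top e - D.bot e ≠ 0 := by linarith
          simp only
          congr 1
          field_simp
          ring
    · exact ⟨e, Or.inl (by simp)⟩
    · exact ⟨e, Or.inr (by simp)⟩
  not_isolated := by
    rintro p ⟨e, he⟩
    refine ⟨_, hD.openArc_mem_edges fl e, ?_⟩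
    rw [hD.closure_openArc]
    rcases he with rfl | rfl
    · exact ⟨_, hD.bot_mem e, rfl⟩
    · exact ⟨_, hD.top_mem e, rfl⟩
  strip := by
    intro p hp
    obtain ⟨e, u, hu, rfl⟩ := mem_iUnion.1 hp
    exact ⟨(hD.lo_le_bot e).trans hu.1, hu.2.trans (hD.top_le_hi e)⟩
  outer_subset := by
    intro p hp
    obtain ⟨e, ⟨-, h⟩ | ⟨-, h⟩⟩ := (hD.mem_outer_iff p).1 hp
    · exact ⟨e, Or.inl h⟩
    · exact ⟨e, Or.inr h⟩
  outer_degree := by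
    intro p hp
    rw [hD.edges_eq fl]
    obtain ⟨e, he⟩ := (hD.mem_outer_iff p).1 hp
    have hpe : p ∈ D.arc e := by
      rcases he with ⟨-, rfl⟩ | ⟨-, rfl⟩
      · exact ⟨_, hD.bot_mem e, rfl⟩
      · exact ⟨_, hD.top_mem e, rfl⟩
    refine ⟨_, ⟨mem_range_self e, by rw [hD.closure_openArc]; exact hpe⟩, ?_⟩
    rintro _ ⟨⟨f, rfl⟩, hf⟩
    rw [hD.closure_openArc] at hf
    by_contra hn
    have hn' : e ≠ f := fun h => hn (by rw [h])
    rw [mem_arc_iff] at hpe hf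
    obtain ⟨v, -, -, hv⟩ := hD.disj e f p.2 hn' hpe.1 hf.1 (hpe.2.trans hf.2.symm)
    rcases hp.2 with h | h
    · exact (hD.bounds v).1.ne' (hv.trans h)
    · exact (hD.bounds v).2.ne (hv.trans h)
  progressive := by
    rw [hD.edges_eq fl]
    rintro _ ⟨e, rfl⟩
    rintro _ ⟨u, -, rfl⟩ _ ⟨w, -, rfl⟩ h
    simp only [point_snd] at h
    rw [h]
  inner_directed := by
    rw [hD.inner_eq fl]
    rintro _ ⟨v, rfl⟩
    obtain ⟨e, he⟩ := fl.exists_in v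
    obtain ⟨f, hf⟩ := fl.exists_out v
    exact ⟨⟨_, (hD.mem_inEdges_iff fl e _).2 (hD.point_top he).symm⟩,
      ⟨_, (hD.mem_outEdges_iff fl f _).2 (hD.point_bot hf).symm⟩⟩

/-- The leveled progressive plane graph of a valid drawing. -/
def toLeveled : LeveledGraph where
  toPlaneGraph := D.toPlane
  lo := D.lo
  hi := D.hi
  isLeveled := hD.isLeveled fl

end IsValid

end Drawing

/-! ### The underlying combinatorial graph of a drawing -/

open GraphData OpenGraph

namespace Drawing

namespace IsValid

variable {S : OpenGraph} {D : Drawing S} (hD : D.IsValid) (fl : S.IsFlow)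
include hD fl

theorem exists_of_mem_edges {A : Set (ℝ × ℝ)} (h : A ∈ D.toPlane.edges) :
    ∃ e, D.openArc e = A := by
  rw [hD.edges_eq fl] at h; exact h

theorem openArc_mem_dom_iff (e : S.E) :
    D.openArc e ∈ (hD.toLeveled fl).dom ↔ S.src e = none := by
  constructor
  · rintro ⟨p, hp, he⟩
    rw [show (hD.toLeveled fl).toPlaneGraph = D.toPlane from rfl, hD.mem_outEdges_iff fl] at he
    subst he
    rw [← hD.bot_eq_lo_iff]
    rcases hp.2 with h | h
    · exact h
    · have := hD.bot_lt_top e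
      have := hD.top_le_hi e
      change D.bot e = D.hi at h
      linarith
  · intro h
    exact ⟨_, (hD.mem_outer_iff _).2 ⟨e, Or.inl ⟨h, rfl⟩⟩, (hD.mem_outEdges_iff fl _ _).2 rfl⟩

theorem openArc_mem_cod_iff (e : S.E) :
    D.openArc e ∈ (hD.toLeveled fl).cod ↔ S.tgt e = none := by
  constructor
  · rintro ⟨p, hp, he⟩
    rw [show (hD.toLeveled fl).toPlaneGraph = D.toPlane from rfl, hD.mem_inEdges_iff fl] at he
    subst he
    rw [← hD.top_eq_hi_iff]
    rcases hp.2 with h | h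
    · have := hD.bot_lt_top e
      have := hD.lo_le_bot e
      change D.top e = D.lo at h
      linarith
    · exact h
  · intro h
    exact ⟨_, (hD.mem_outer_iff _).2 ⟨e, Or.inr ⟨h, rfl⟩⟩, (hD.mem_inEdges_iff fl _ _).2 rfl⟩

theorem dom_eq : (hD.toLeveled fl).dom = D.openArc '' {e | S.src e = none} := by
  ext A
  constructor
  · intro hA
    obtain ⟨e, rfl⟩ : ∃ e, D.openArc e = A := by
      obtain ⟨p, -, hp⟩ := hA
      exact hD.exists_of_mem_edges fl hp.1
    exact ⟨e, (hD.openArc_mem_dom_iff fl e).1 hA, rfl⟩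
  · rintro ⟨e, he, rfl⟩
    exact (hD.openArc_mem_dom_iff fl e).2 he

theorem cod_eq : (hD.toLeveled fl).cod = D.openArc '' {e | S.tgt e = none} := by
  ext A
  constructor
  · intro hA
    obtain ⟨e, rfl⟩ : ∃ e, D.openArc e = A := by
      obtain ⟨p, -, hp⟩ := hA
      exact hD.exists_of_mem_edges fl hp.1
    exact ⟨e, (hD.openArc_mem_cod_iff fl e).1 hA, rfl⟩
  · rintro ⟨e, he, rfl⟩
    exact (hD.openArc_mem_cod_iff fl e).2 he

theorem endAt_iff (v : S.V) (e : S.E) (b : Bool) :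
    (hD.toLeveled fl).EndAt (D.pt v) (D.openArc e) b ↔ S.fin e b = some v := by
  rw [LeveledGraph.EndAt, show (hD.toLeveled fl).toPlaneGraph = D.toPlane from rfl,
    hD.mem_inEdges_iff fl, hD.mem_outEdges_iff fl, hD.point_bot_eq_pt_iff fl,
    hD.point_top_eq_pt_iff fl]
  cases b <;> simp

theorem innerNodes_eq : (hD.toLeveled fl).innerNodes = range D.pt := hD.inner_eq fl

theorem isUnitary_iff (e : S.E) : (hD.toLeveled fl).IsUnitary (D.openArc e) ↔ S.Unitary e := by
  rw [LeveledGraph.IsUnitary, hD.openArc_mem_dom_iff, hD.openArc_mem_cod_iff, Unitary]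

theorem isHalfEdge_iff (e : S.E) (b : Bool) :
    (hD.toLeveled fl).IsHalfEdge (D.openArc e, b) ↔ S.IsHalf e b := by
  simp [LeveledGraph.IsHalfEdge, hD.innerNodes_eq fl, hD.endAt_iff fl, hD.isUnitary_iff fl, IsHalf]

theorem exists_of_isHalfEdge (z : (hD.toLeveled fl).toGraphData.H) :
    ∃ e, D.openArc e = z.1.1 := by
  apply hD.exists_of_mem_edges fl
  rcases z.2 with ⟨x, -, h⟩ | ⟨⟨x, -, h⟩, -⟩
  · rcases h with ⟨-, h⟩ | ⟨-, h⟩ <;> exact h.1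
  · exact h.1

/-- The edge of a half-edge of the underlying combinatorial graph. -/
def edgeOf (z : (hD.toLeveled fl).toGraphData.H) : S.E := (hD.exists_of_isHalfEdge fl z).choose

theorem openArc_edgeOf (z : (hD.toLeveled fl).toGraphData.H) :
    D.openArc (hD.edgeOf fl z) = z.1.1 := (hD.exists_of_isHalfEdge fl z).choose_spec

theorem edgeOf_eq_iff (z : (hD.toLeveled fl).toGraphData.H) (e : S.E) :
    hD.edgeOf fl z = e ↔ z.1.1 = D.openArc e := by
  rw [← hD.openArc_edgeOf fl z, hD.openArc_injective.eq_iff]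

theorem presents : Presents (hD.toLeveled fl).toGraphData S (hD.edgeOf fl) where
  inj z w h s := by
    refine Subtype.ext (Prod.ext ?_ s)
    rw [← hD.openArc_edgeOf fl z, h, hD.openArc_edgeOf fl w]
  half e b := by
    rw [← hD.isHalfEdge_iff fl]
    constructor
    · rintro ⟨z, rfl, rfl⟩
      rw [hD.openArc_edgeOf fl]
      exact z.2
    · intro h
      exact ⟨⟨_, h⟩, (hD.edgeOf_eq_iff fl _ _).2 rfl, rfl⟩
  near z w := by
    obtain ⟨e, he⟩ : ∃ e, e = hD.edgeOf fl z := ⟨_, rfl⟩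
    obtain ⟨f, hf⟩ : ∃ e, e = hD.edgeOf fl w := ⟨_, rfl⟩
    have h1 := (hD.edgeOf_eq_iff fl _ _).1 he.symm
    have h2 := (hD.edgeOf_eq_iff fl _ _).1 hf.symm
    rw [← he, ← hf]
    simp only [LeveledGraph.toGraphData]
    rw [h1, h2, hD.isUnitary_iff fl, hD.innerNodes_eq fl, hD.openArc_injective.eq_iff, Near]
    simp [hD.endAt_iff fl]
  σ_edge z := by
    rw [hD.edgeOf_eq_iff fl, hD.openArc_edgeOf fl]
    by_cases h : (hD.toLeveled fl).IsHalfEdge (z.1.1, !z.1.2)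
    · have e : (hD.toLeveled fl).toGraphData.σ z = ⟨(z.1.1, !z.1.2), h⟩ := dif_pos h
      rw [e]
    · exact congrArg (fun w : (hD.toLeveled fl).toGraphData.H => w.1.1) (dif_neg h)
  σ_ne z := by
    rintro ⟨k, h1, h2⟩
    rw [hD.edgeOf_eq_iff fl, hD.openArc_edgeOf fl] at h1
    have : (hD.toLeveled fl).IsHalfEdge (z.1.1, !z.1.2) := by
      rw [← h1]
      change (hD.toLeveled fl).IsHalfEdge (k.1.1, !(hD.toLeveled fl).toGraphData.sgn z)
      rw [← h2]; exact k.2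
    exact congrArg (fun w : (hD.toLeveled fl).toGraphData.H => w.1.2) (dif_pos this)

omit fl in
theorem lt_of_isOrdered {r : S.E → S.E → Prop} (ho : D.IsOrdered r) (irr : ∀ e, ¬ r e e)
    {e f : S.E} (h : r e f) {u : ℝ} (he : u ∈ Ioo (D.bot e) (D.top e))
    (hf : u ∈ Icc (D.bot f) (D.top f)) : D.x e u < D.x f u := by
  refine lt_of_le_of_ne (ho e f u h (Ioo_subset_Icc_self he) hf) fun h' => ?_
  obtain rfl := hD.eq_of_x_eq he hf h'
  exact irr _ h

variable {r : S.E → S.E → Prop} (pl : S.IsPlanar r) (ho : D.IsOrdered r)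
include ho pl

omit fl in
-- Just below the node both open arcs are present, and there the weak inequality of `IsOrdered` is
-- strict. A single such level decides the order.
theorem leftBelow_iff {e f : S.E} {v : S.V} (he : S.tgt e = some v) (hf : S.tgt f = some v) :
    PlaneGraph.leftBelow (D.pt v) (D.openArc e) (D.openArc f) ↔ r e f := by
  have te := top_of_tgt (D := D) he
  have tf := top_of_tgt (D := D) hf
  have be := hD.bot_lt_top e
  have bf := hD.bot_lt_top f
  have ev : ∀ᶠ u in 𝓝[<] (D.pt v).2, u ∈ Ioo (D.bot e) (D.top e) ∧ u ∈ Ioo (D.bot f) (D.top f) := by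
    rw [te] at be ⊢
    rw [tf] at bf ⊢
    exact inter_mem (Ioo_mem_nhdsLT be) (Ioo_mem_nhdsLT bf)
  constructor
  · intro h
    obtain ⟨u, hu, hue, huf⟩ := (h.and ev).exists
    have := hu _ ⟨u, hue, rfl⟩ _ ⟨u, huf, rfl⟩ rfl rfl
    rcases pl.total e f with q | rfl | q
    · exact q
    · exact (lt_irrefl _ this).elim
    · exact (lt_asymm this (hD.lt_of_isOrdered ho pl.irrefl q huf (Ioo_subset_Icc_self hue))).elim
  · intro h
    refine ev.mono ?_
    rintro u - _ ⟨u1, h1, rfl⟩ _ ⟨u2, h2, rfl⟩ e1 e2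
    simp only [point_snd] at e1 e2
    subst e1 e2
    exact hD.lt_of_isOrdered ho pl.irrefl h h1 (Ioo_subset_Icc_self h2)

omit fl in
theorem leftAbove_iff {e f : S.E} {v : S.V} (he : S.src e = some v) (hf : S.src f = some v) :
    PlaneGraph.leftAbove (D.pt v) (D.openArc e) (D.openArc f) ↔ r e f := by
  have te := bot_of_src (D := D) he
  have tf := bot_of_src (D := D) hf
  have be := hD.bot_lt_top e
  have bf := hD.bot_lt_top f
  have ev : ∀ᶠ u in 𝓝[>] (D.pt v).2, u ∈ Ioo (D.bot e) (D.top e) ∧ u ∈ Ioo (D.bot f) (D.top f) := by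
    rw [te] at be ⊢
    rw [tf] at bf ⊢
    exact inter_mem (Ioo_mem_nhdsGT be) (Ioo_mem_nhdsGT bf)
  constructor
  · intro h
    obtain ⟨u, hu, hue, huf⟩ := (h.and ev).exists
    have := hu _ ⟨u, hue, rfl⟩ _ ⟨u, huf, rfl⟩ rfl rfl
    rcases pl.total e f with q | rfl | q
    · exact q
    · exact (lt_irrefl _ this).elim
    · exact (lt_asymm this (hD.lt_of_isOrdered ho pl.irrefl q huf (Ioo_subset_Icc_self hue))).elim
  · intro h
    refine ev.mono ?_
    rintro u - _ ⟨u1, h1, rfl⟩ _ ⟨u2, h2, rfl⟩ e1 e2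
    simp only [point_snd] at e1 e2
    subst e1 e2
    exact hD.lt_of_isOrdered ho pl.irrefl h h1 (Ioo_subset_Icc_self h2)

omit fl in
theorem x_lo_lt_iff {e f : S.E} (he : S.src e = none) (hf : S.src f = none) :
    D.x e D.lo < D.x f D.lo ↔ r e f := by
  have me : D.lo ∈ Icc (D.bot e) (D.top e) := bot_of_none (D := D) he ▸ hD.bot_mem e
  have mf : D.lo ∈ Icc (D.bot f) (D.top f) := bot_of_none (D := D) hf ▸ hD.bot_mem f
  constructor
  · intro h
    rcases pl.total e f with q | rfl | q
    · exact q
    · exact (lt_irrefl _ h).elim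
    · exact (h.not_ge (ho _ _ _ q mf me)).elim
  · intro h
    refine lt_of_le_of_ne (ho _ _ _ h me mf) fun h' => ?_
    exact pl.irrefl _ (hD.eq_of_point_bot_eq he hf h' ▸ h)

omit fl in
theorem x_hi_lt_iff {e f : S.E} (he : S.tgt e = none) (hf : S.tgt f = none) :
    D.x e D.hi < D.x f D.hi ↔ r e f := by
  have me : D.hi ∈ Icc (D.bot e) (D.top e) := top_of_none (D := D) he ▸ hD.top_mem e
  have mf : D.hi ∈ Icc (D.bot f) (D.top f) := top_of_none (D := D) hf ▸ hD.top_mem f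
  constructor
  · intro h
    rcases pl.total e f with q | rfl | q
    · exact q
    · exact (lt_irrefl _ h).elim
    · exact (h.not_ge (ho _ _ _ q mf me)).elim
  · intro h
    refine lt_of_le_of_ne (ho _ _ _ h me mf) fun h' => ?_
    exact pl.irrefl _ (hD.eq_of_point_top_eq he hf h' ▸ h)

theorem domLT_iff {e f : S.E} (he : S.src e = none) (hf : S.src f = none) :
    (hD.toLeveled fl).domLT (D.openArc e) (D.openArc f) ↔ r e f := by
  rw [← hD.x_lo_lt_iff pl ho he hf, LeveledGraph.domLT,
    show (hD.toLeveled fl).toPlaneGraph = D.toPlane from rfl]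
  simp only [hD.mem_outEdges_iff fl]
  constructor
  · rintro ⟨_, -, _, -, rfl, rfl, h⟩
    rw [bot_of_none he, bot_of_none hf] at h
    exact h
  · intro h
    refine ⟨_, (hD.mem_outer_iff _).2 ⟨e, Or.inl ⟨he, rfl⟩⟩, _,
      (hD.mem_outer_iff _).2 ⟨f, Or.inl ⟨hf, rfl⟩⟩, rfl, rfl, ?_⟩
    rw [bot_of_none he, bot_of_none hf]
    exact h

theorem codLT_iff {e f : S.E} (he : S.tgt e = none) (hf : S.tgt f = none) :
    (hD.toLeveled fl).codLT (D.openArc e) (D.openArc f) ↔ r e f := by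
  rw [← hD.x_hi_lt_iff pl ho he hf, LeveledGraph.codLT,
    show (hD.toLeveled fl).toPlaneGraph = D.toPlane from rfl]
  simp only [hD.mem_inEdges_iff fl]
  constructor
  · rintro ⟨_, -, _, -, rfl, rfl, h⟩
    rw [top_of_none he, top_of_none hf] at h
    exact h
  · intro h
    refine ⟨_, (hD.mem_outer_iff _).2 ⟨e, Or.inr ⟨he, rfl⟩⟩, _,
      (hD.mem_outer_iff _).2 ⟨f, Or.inr ⟨hf, rfl⟩⟩, rfl, rfl, ?_⟩
    rw [top_of_none he, top_of_none hf]
    exact h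

omit fl in
/-- A planar graph that is presented by the drawn open graph is identified with the underlying
combinatorial graph of the drawing. -/
theorem exists_isIdentification {X : PlanarGraph} {ε : X.H → S.E}
    (p : PresentsOrd X.toPlanarData S r ε) :
    ∃ φ : X.H ≃ (hD.toLeveled pl.toIsFlow).toGraphData.H,
      (hD.toLeveled pl.toIsFlow).IsIdentification X φ := by
  have fl := pl.toIsFlow
  have loop : ∀ e v, S.src e = some v → S.tgt e = some v → False := fun _ _ => pl.src_ne_tgt
  obtain ⟨φ, h1, h2⟩ := p.exists_isGraphIso (hD.presents fl)
  have h3 : ∀ h, (φ h).1.1 = D.openArc (ε h) := fun h => (hD.edgeOf_eq_iff fl _ _).1 (h2 h)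
  refine ⟨φ, h1, ?_, ?_, ?_, ?_⟩
  · rw [hD.innerNodes_eq fl]
    rintro _ ⟨v, rfl⟩ h k a - b -
    rw [h3] at a b ⊢
    rw [h3]
    have a := (hD.point_top_eq_pt_iff fl _ _).1 ((hD.mem_inEdges_iff fl _ _).1 a)
    have b := (hD.point_top_eq_pt_iff fl _ _).1 ((hD.mem_inEdges_iff fl _ _).1 b)
    rw [hD.leftBelow_iff pl ho a b, p.lt]
  · rw [hD.innerNodes_eq fl]
    rintro _ ⟨v, rfl⟩ h k a - b -
    rw [h3] at a b ⊢
    rw [h3]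
    have a := (hD.point_bot_eq_pt_iff fl _ _).1 ((hD.mem_outEdges_iff fl _ _).1 a)
    have b := (hD.point_bot_eq_pt_iff fl _ _).1 ((hD.mem_outEdges_iff fl _ _).1 b)
    rw [hD.leftAbove_iff pl ho a b, p.lt]
  · intro h hh k hk
    rw [p.mem_inputs_iff loop] at hh hk
    rw [h3, h3, hD.domLT_iff fl pl ho hh.2 hk.2, p.lt]
  · intro h hh k hk
    rw [p.mem_outputs_iff loop] at hh hk
    rw [h3, h3, hD.codLT_iff fl pl ho hh.2 hk.2, p.lt]

omit fl in
/-- A planar graph that is identified with the underlying combinatorial graph of a drawing is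
presented by the drawn open graph. -/
theorem exists_presentsOrd {X : PlanarGraph}
    {φ : X.H ≃ (hD.toLeveled pl.toIsFlow).toGraphData.H}
    (hφ : (hD.toLeveled pl.toIsFlow).IsIdentification X φ) :
    ∃ ε : X.H → S.E, PresentsOrd X.toPlanarData S r ε := by
  have fl := pl.toIsFlow
  have loop : ∀ e v, S.src e = some v → S.tgt e = some v → False := fun _ _ => pl.src_ne_tgt
  have p := (hD.presents fl).of_isGraphIso hφ.iso
  set ε : X.H → S.E := fun h => hD.edgeOf fl (φ h) with hε
  have h3 : ∀ h, (φ h).1.1 = D.openArc (ε h) := fun h => (hD.edgeOf_eq_iff fl _ _).1 rfl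
  -- The order of `X`, transported to the edges of `S`, is the relation `q`. It is planar since `X`
  -- is presented by some planar open graph, and `S` with `q` is isomorphic to that one.
  obtain ⟨S', r', ε', pl', p'⟩ := PlanarData.exists_presentsOrd X.isPlanar
  let q : S.E → S.E → Prop := fun e f => ∃ h k, ε h = e ∧ ε k = f ∧ X.lt (edge h) (edge k)
  have hq : ∀ h k, q (ε h) (ε k) ↔ X.lt (edge h) (edge k) := by
    intro h k
    constructor
    · rintro ⟨h', k', e1, e2, hl⟩
      rwa [(p.edge_eq_iff _ _).2 e1, (p.edge_eq_iff _ _).2 e2] at hl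
    · intro hl
      exact ⟨h, k, rfl, rfl, hl⟩
  obtain ⟨i, -⟩ := p.exists_iso p'.toPresents (r := q) (r' := r') pl pl'
    (fun h k => by rw [hq, p'.lt])
  have plq : S.IsPlanar q := i.isPlanar pl'
  -- By rigidity `q` has to be compared with `r` only on the outgoing edges of a vertex and on the
  -- edges without source. There both are left-to-right orders.
  have key := pl.unique_of_out plq (fun e f v he hf hl => ?_) (fun e f he hf hl => ?_)
  · exact ⟨ε, p, fun h k => by rw [key, hq]⟩
  · obtain ⟨h, rfl, hs⟩ := (p.half e false).2 (Or.inl ⟨v, he⟩)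
    obtain ⟨k, rfl, ks⟩ := (p.half f false).2 (Or.inl ⟨v, hf⟩)
    rw [hq, hφ.polarized_out (D.pt v) (by rw [hD.innerNodes_eq fl]; exact ⟨v, rfl⟩) h k _ hs _ ks,
      h3, h3, hD.leftAbove_iff pl ho he hf]
    · exact hl
    · rw [h3]; exact (hD.mem_outEdges_iff fl _ _).2 (hD.point_bot he).symm
    · rw [h3]; exact (hD.mem_outEdges_iff fl _ _).2 (hD.point_bot hf).symm
  · obtain ⟨h, rfl, hs⟩ := p.exists_sgn_true he
    obtain ⟨k, rfl, ks⟩ := p.exists_sgn_true hf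
    rw [hq, hφ.anchored_in h ((p.mem_inputs_iff loop _).2 ⟨hs, he⟩) k
      ((p.mem_inputs_iff loop _).2 ⟨ks, hf⟩), h3, h3, hD.domLT_iff fl pl ho he hf]
    exact hl

end IsValid

end Drawing

/-! ### The planar order of a drawing -/

open OpenGraph

namespace Drawing

variable {S : OpenGraph} (D : Drawing S)

open Classical in
/-- The first coordinate of a chain of edges at level `u`. -/
def val (T : Set S.E) (u : ℝ) : ℝ :=
  if h : ∃ e ∈ T, u ∈ Icc (D.bot e) (D.top e) then D.x h.choose u else 0

/-- Edges that are not connected by a directed path. -/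
def Par (S : OpenGraph) (e f : S.E) : Prop := ¬ S.Path e f ∧ ¬ S.Path f e

/-- `e` and `f` are not connected by a directed path, and a maximal path through `f` runs on the
right of `e`. -/
def Left (e f : S.E) : Prop := Par S e f ∧ ∃ T T', IsMaxChain S.Path T ∧ IsMaxChain S.Path T' ∧
  e ∈ T ∧ f ∈ T' ∧ ∃ v ∈ Ioo (D.bot e) (D.top e), D.val T v < D.val T' v

/-- The progressive planar order of a drawing. -/
def order (e f : S.E) : Prop := e ≠ f ∧ (S.Path e f ∨ D.Left e f)

namespace IsValid

variable {D}
variable (hD : D.IsValid)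

theorem top_eq_bot_of_step {e f : S.E} (h : S.Step e f) : D.top e = D.bot f := by
  obtain ⟨v, h1, h2⟩ := h
  rw [top_of_tgt h1, bot_of_src h2]

include hD

theorem eq_or_le_of_path {e f : S.E} (h : S.Path e f) : e = f ∨ D.top e ≤ D.bot f := by
  induction h with
  | refl => exact Or.inl rfl
  | tail _ st ih =>
    right
    rcases ih with rfl | ih
    · exact (top_eq_bot_of_step (D := D) st).le
    · rw [← top_eq_bot_of_step (D := D) st]
      exact ih.trans (hD.bot_lt_top _).le

theorem path_antisymm {e f : S.E} (h : S.Path e f) (h' : S.Path f e) : e = f := by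
  rcases hD.eq_or_le_of_path h with h | h
  · exact h
  rcases hD.eq_or_le_of_path h' with h' | h'
  · exact h'.symm
  have := hD.bot_lt_top e
  have := hD.bot_lt_top f
  linarith

theorem step_of_path {e f : S.E} {u : ℝ} (h : S.Path e f) (he : u ∈ Icc (D.bot e) (D.top e))
    (hf : u ∈ Icc (D.bot f) (D.top f)) : e = f ∨ S.Step e f ∧ u = D.top e ∧ u = D.bot f := by
  rcases h.cases_head with h | ⟨g, st, p⟩
  · exact Or.inl h
  have h1 := top_eq_bot_of_step (D := D) st
  rcases hD.eq_or_le_of_path p with rfl | h2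
  · exact Or.inr ⟨st, le_antisymm he.2 (h1.trans_le hf.1), le_antisymm (he.2.trans_eq h1) hf.1⟩
  · have := hD.bot_lt_top g
    linarith [he.2, hf.1]

theorem x_eq_of_path {e f : S.E} {u : ℝ} (h : S.Path e f) (he : u ∈ Icc (D.bot e) (D.top e))
    (hf : u ∈ Icc (D.bot f) (D.top f)) : D.x e u = D.x f u := by
  rcases hD.step_of_path h he hf with rfl | ⟨⟨v, h1, h2⟩, h3, -⟩
  · rfl
  · rw [h3, top_of_tgt h1, hD.x_tgt e v h1, hD.x_src f v h2]

/-- The choice in `val` is immaterial: two distinct edges of a chain that are present at the same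
level meet there in a common vertex. -/
theorem val_eq {T : Set S.E} (hT : IsChain S.Path T) {e : S.E} {u : ℝ} (he : e ∈ T)
    (hu : u ∈ Icc (D.bot e) (D.top e)) : D.val T u = D.x e u := by
  have h : ∃ e ∈ T, u ∈ Icc (D.bot e) (D.top e) := ⟨e, he, hu⟩
  rw [val, dif_pos h]
  obtain ⟨h1, h2⟩ := h.choose_spec
  by_cases hn : h.choose = e
  · rw [hn]
  rcases hT h1 he hn with p | p
  · exact hD.x_eq_of_path p h2 hu
  · exact (hD.x_eq_of_path p hu h2).symm

omit hD in
theorem mem_of_comparable {T : Set S.E} (hT : IsMaxChain S.Path T) {g : S.E}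
    (h : ∀ a ∈ T, S.Path a g ∨ S.Path g a) : g ∈ T := by
  have := hT.2 (hT.1.insert fun b hb _ => (h b hb).symm) (subset_insert g T)
  rw [this]; exact mem_insert _ _

omit hD in
theorem path_or_path {T : Set S.E} (hT : IsMaxChain S.Path T) {e f : S.E} (he : e ∈ T)
    (hf : f ∈ T) : S.Path e f ∨ S.Path f e := by
  by_cases h : e = f
  · subst h; exact Or.inl (OpenGraph.Path.refl e)
  · exact hT.1 he hf h

omit hD in
theorem exists_maxChain {e f : S.E} (h : S.Path e f) :
    ∃ T, IsMaxChain S.Path T ∧ e ∈ T ∧ f ∈ T := by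
  have hc : IsChain S.Path {e, f} := by
    rintro a (rfl | rfl) b (rfl | rfl) hab
    · exact (hab rfl).elim
    · exact Or.inl h
    · exact Or.inr h
    · exact (hab rfl).elim
  obtain ⟨T, hT, hs⟩ := hc.exists_maxChain
  exact ⟨T, hT, hs (by simp), hs (by simp)⟩

variable (fl : S.IsFlow)
include fl

/-- A gap in a chain could be filled. If level `u` is missed, the last edge of `T` that ends below
`u` has a target, because `u ≤ hi`. An edge leaving this target towards the first edge of `T` above
`u`, or any edge leaving it if there is no such edge of `T`, is comparable with all of `T`, so it
belongs to `T`; this contradicts the choice. If no edge of `T` ends below `u`, an edge entering the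
source of the lowest edge of `T` does the same. -/
theorem exists_mem {T : Set S.E} (hT : IsMaxChain S.Path T) (hne : T.Nonempty) {u : ℝ}
    (hu : u ∈ Icc D.lo D.hi) : ∃ e ∈ T, u ∈ Icc (D.bot e) (D.top e) := by
  by_contra! hn
  have := fl.finite_E
  have hor : ∀ e ∈ T, D.top e < u ∨ u < D.bot e := by
    intro e he
    by_contra! hc
    exact hn e he ⟨hc.2, hc.1⟩
  have up : ∀ e ∈ T, ∀ f ∈ T, D.bot e < D.top f → S.Path e f := by
    intro e he f hf h
    rcases path_or_path hT he hf with p | p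
    · exact p
    · rcases hD.eq_or_le_of_path p with rfl | h'
      · exact OpenGraph.Path.refl _
      · linarith
  by_cases hA : {e ∈ T | D.top e < u}.Nonempty
  · obtain ⟨e, ⟨he, heu⟩, hmax⟩ := (toFinite {e ∈ T | D.top e < u}).exists_maximalFor D.top _ hA
    have hmax : ∀ a ∈ T, D.top a < u → D.top a ≤ D.top e := by
      intro a ha hau
      rcases le_total (D.top a) (D.top e) with h | h
      · exact h
      · exact hmax ⟨ha, hau⟩ h
    obtain ⟨v, hv⟩ : ∃ v, S.tgt e = some v := by
      cases h : S.tgt e with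
      | none => rw [top_of_none h] at heu; linarith [hu.2]
      | some v => exact ⟨v, rfl⟩
    obtain ⟨g, hg, hgB⟩ : ∃ g, S.Step e g ∧ ∀ b ∈ T, u < D.bot b → S.Path g b := by
      by_cases hB : {e ∈ T | u < D.bot e}.Nonempty
      · obtain ⟨b, ⟨hb, hbu⟩, hmin⟩ :=
          (toFinite {e ∈ T | u < D.bot e}).exists_minimalFor D.bot _ hB
        have hlt := hD.bot_lt_top b
        have hlt' := hD.bot_lt_top e
        rcases (up e he b hb (by linarith)).cases_head with rfl | ⟨g, hg, p⟩
        · linarith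
        · refine ⟨g, hg, fun c hc hcu => p.trans (up b hb c hc ?_)⟩
          rcases le_total (D.bot b) (D.bot c) with h | h
          · exact h.trans_lt (hD.bot_lt_top c)
          · exact (hmin ⟨hc, hcu⟩ h).trans_lt (hD.bot_lt_top c)
      · obtain ⟨g, hg⟩ := fl.exists_out v
        exact ⟨g, ⟨v, hv, hg⟩, fun b hb hbu => (hB ⟨b, hb, hbu⟩).elim⟩
    have hgT : g ∈ T := mem_of_comparable hT fun a ha => by
      rcases hor a ha with h | h
      · refine Or.inl ((up a ha e he ?_).trans hg.path)
        exact (hD.bot_lt_top a).trans_le (hmax a ha h)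
      · exact Or.inr (hgB a ha h)
    have h1 := top_eq_bot_of_step (D := D) hg
    have h2 := hD.bot_lt_top g
    rcases hor g hgT with h | h
    · linarith [hmax g hgT h]
    · linarith
  · have hB : ∀ a ∈ T, u < D.bot a := fun a ha =>
      (hor a ha).resolve_left fun h => hA ⟨a, ha, h⟩
    obtain ⟨b, hb, hmin⟩ := (toFinite T).exists_minimalFor D.bot _ hne
    obtain ⟨v, hv⟩ : ∃ v, S.src b = some v := by
      cases h : S.src b with
      | none => have := hB b hb; rw [bot_of_none h] at this; linarith [hu.1]
      | some v => exact ⟨v, rfl⟩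
    obtain ⟨g, hg⟩ := fl.exists_in v
    have st : S.Step g b := ⟨v, hg, hv⟩
    have h1 := top_eq_bot_of_step (D := D) st
    have h2 := hD.bot_lt_top g
    have hgT : g ∈ T := mem_of_comparable hT fun c hc => by
      refine Or.inr (st.path.trans (up b hb c hc ?_))
      rcases le_total (D.bot b) (D.bot c) with h | h
      · exact h.trans_lt (hD.bot_lt_top c)
      · exact (hmin hc h).trans_lt (hD.bot_lt_top c)
    have := hmin hgT (by linarith)
    linarith

/-- The function is glued from continuous functions on finitely many closed intervals, which cover
everything by `exists_mem`. -/
theorem continuousOn_val {T : Set S.E} (hT : IsMaxChain S.Path T) (hne : T.Nonempty) :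
    ContinuousOn (D.val T) (Icc D.lo D.hi) := by
  have := fl.finite_E
  have h : ContinuousOn (D.val T) (⋃ e : T, Icc (D.bot e) (D.top e)) :=
    (locallyFinite_of_finite _).continuousOn_iUnion (fun _ => isClosed_Icc) fun e =>
      (hD.cont e).congr fun u hu => hD.val_eq hT.1 e.2 hu
  refine h.mono fun u hu => ?_
  obtain ⟨e, he, hue⟩ := hD.exists_mem fl hT hne hu
  exact mem_iUnion.2 ⟨⟨e, he⟩, hue⟩

/-- One can climb from `e` along `T` to the meeting point at level `w`, change over, and climb along
`T'` to `f`. -/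
theorem path_of_val_eq {T T' : Set S.E} (hT : IsMaxChain S.Path T) (hT' : IsMaxChain S.Path T')
    {e f : S.E} (he : e ∈ T) (hf : f ∈ T') {v w u : ℝ} (hv : v ∈ Ioo (D.bot e) (D.top e))
    (hu : u ∈ Ioo (D.bot f) (D.top f)) (hvw : v < w) (hwu : w < u)
    (hval : D.val T w = D.val T' w) : S.Path e f := by
  have hw : w ∈ Icc D.lo D.hi :=
    ⟨by linarith [hv.1, hD.lo_le_bot e], by linarith [hu.2, hD.top_le_hi f]⟩
  obtain ⟨g, hg, hgw⟩ := hD.exists_mem fl hT ⟨e, he⟩ hw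
  obtain ⟨g', hg', hgw'⟩ := hD.exists_mem fl hT' ⟨f, hf⟩ hw
  have p : S.Path e g := by
    rcases path_or_path hT he hg with p | p
    · exact p
    · rcases hD.eq_or_le_of_path p with rfl | h
      · exact OpenGraph.Path.refl _
      · linarith [hv.1, hgw.2]
  have p' : S.Path g' f := by
    rcases path_or_path hT' hg' hf with p | p
    · exact p
    · rcases hD.eq_or_le_of_path p with rfl | h
      · exact OpenGraph.Path.refl _
      · linarith [hu.2, hgw'.1]
  rw [hD.val_eq hT.1 hg hgw, hD.val_eq hT'.1 hg' hgw'] at hval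
  by_cases hgg : g = g'
  · subst hgg; exact p.trans p'
  obtain ⟨z, z1, z2, z3⟩ := hD.disj g g' w hgg hgw hgw' hval
  -- If `z` is the source of `g`, the path from `e` to `g` has an earlier edge arriving in `z`. The
  -- case `g = e` is impossible, because `z` lies above the level `v` inside `e`.
  obtain ⟨k, k1, k2⟩ : ∃ k, S.Path e k ∧ S.tgt k = some z := by
    rcases z1 with z1 | z1
    · rcases p.cases_tail with rfl | ⟨k, k1, y, y1, y2⟩
      · rw [bot_of_src z1] at hv
        linarith [hv.1]
      · rw [z1] at y2
        exact ⟨k, k1, y1.trans y2.symm⟩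
    · exact ⟨g, p, z1⟩
  obtain ⟨l, l1, l2⟩ : ∃ l, S.Path l f ∧ S.src l = some z := by
    rcases z2 with z2 | z2
    · exact ⟨g', p', z2⟩
    · rcases p'.cases_head with rfl | ⟨k, ⟨y, y1, y2⟩, k1⟩
      · rw [top_of_tgt z2] at hu
        linarith [hu.2]
      · rw [z2] at y1
        exact ⟨k, k1, y2.trans y1.symm⟩
  exact (k1.trans (Step.path ⟨z, k2, l2⟩)).trans l1

/-- An interior point of `e` lies on no other edge, so `e` itself would belong to `T'` and be
comparable with `f`. -/
theorem notMem_Ioo_of_val_eq {T T' : Set S.E} (hT : IsMaxChain S.Path T)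
    (hT' : IsMaxChain S.Path T') {e f : S.E} (he : e ∈ T) (hf : f ∈ T') (hp : Par S e f) {w : ℝ}
    (hval : D.val T w = D.val T' w) : w ∉ Ioo (D.bot e) (D.top e) := by
  intro hw
  have hw' : w ∈ Icc D.lo D.hi :=
    ⟨by linarith [hw.1, hD.lo_le_bot e], by linarith [hw.2, hD.top_le_hi e]⟩
  obtain ⟨g', hg', hgw'⟩ := hD.exists_mem fl hT' ⟨f, hf⟩ hw'
  rw [hD.val_eq hT.1 he (Ioo_subset_Icc_self hw), hD.val_eq hT'.1 hg' hgw'] at hval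
  obtain rfl := hD.eq_of_x_eq hw hgw' hval
  rcases path_or_path hT' hg' hf with p | p
  · exact hp.1 p
  · exact hp.2 p

omit hD fl in
theorem Par.symm {e f : S.E} (h : Par S e f) : Par S f e := ⟨h.2, h.1⟩

/-- At the levels `a` and `b` the chains are inside `e` and `f`. Strictly between them, a meeting
point would give a path from the lower of the two edges to the higher one. -/
theorem val_ne {T T' : Set S.E} (hT : IsMaxChain S.Path T) (hT' : IsMaxChain S.Path T')
    {e f : S.E} (he : e ∈ T) (hf : f ∈ T') (hp : Par S e f) {a b w : ℝ}
    (ha : a ∈ Ioo (D.bot e) (D.top e)) (hb : b ∈ Ioo (D.bot f) (D.top f)) (hw : w ∈ uIcc a b) :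
    D.val T w ≠ D.val T' w := by
  intro hval
  have h1 := hD.notMem_Ioo_of_val_eq fl hT hT' he hf hp hval
  have h2 := hD.notMem_Ioo_of_val_eq fl hT' hT hf he (Par.symm hp) hval.symm
  have ha' : a ≠ w := fun h => h1 (h ▸ ha)
  have hb' : b ≠ w := fun h => h2 (h ▸ hb)
  rcases mem_uIcc.1 hw with ⟨l1, l2⟩ | ⟨l1, l2⟩
  · exact hp.1 (hD.path_of_val_eq fl hT hT' he hf ha hb (lt_of_le_of_ne l1 ha')
      (lt_of_le_of_ne l2 hb'.symm) hval)
  · exact hp.2 (hD.path_of_val_eq fl hT' hT hf he hb ha (lt_of_le_of_ne l1 hb')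
      (lt_of_le_of_ne l2 ha'.symm) hval.symm)

/-- The difference of the two chains is continuous and has no zero between `a` and `b`, so it keeps
its sign. -/
theorem val_lt_of_val_lt {T T' : Set S.E} (hT : IsMaxChain S.Path T) (hT' : IsMaxChain S.Path T')
    {e f : S.E} (he : e ∈ T) (hf : f ∈ T') (hp : Par S e f) {a b w w' : ℝ}
    (ha : a ∈ Ioo (D.bot e) (D.top e)) (hb : b ∈ Ioo (D.bot f) (D.top f)) (hw : w ∈ uIcc a b)
    (hw' : w' ∈ uIcc a b) (h : D.val T w < D.val T' w) : D.val T w' < D.val T' w' := by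
  by_contra! hn
  have hsub : uIcc w w' ⊆ uIcc a b := uIcc_subset_uIcc hw hw'
  have ha' : a ∈ Icc D.lo D.hi :=
    ⟨by linarith [ha.1, hD.lo_le_bot e], by linarith [ha.2, hD.top_le_hi e]⟩
  have hb' : b ∈ Icc D.lo D.hi :=
    ⟨by linarith [hb.1, hD.lo_le_bot f], by linarith [hb.2, hD.top_le_hi f]⟩
  have hc : ContinuousOn (fun u => D.val T' u - D.val T u) (uIcc w w') :=
    ((hD.continuousOn_val fl hT' ⟨f, hf⟩).sub (hD.continuousOn_val fl hT ⟨e, he⟩)).mono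
      (hsub.trans (ordConnected_Icc.uIcc_subset ha' hb'))
  obtain ⟨z, hz, hz0⟩ := intermediate_value_uIcc hc (show (0 : ℝ) ∈ _ from
    mem_uIcc.2 (Or.inr ⟨by linarith, by linarith⟩))
  exact hD.val_ne fl hT hT' he hf hp ha hb (hsub hz) (sub_eq_zero.1 hz0).symm

omit fl in
theorem mid_mem (e : S.E) : (D.bot e + D.top e) / 2 ∈ Ioo (D.bot e) (D.top e) := by
  have := hD.bot_lt_top e
  constructor <;> linarith

/-- The definition of `Left` does not depend on the choices in it. The chains are exchanged one
after the other: a chain through `e` at a level inside `e`, where its value is that of `e`, and then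
a chain through `f` at a level inside `f`. In between, the inequality is carried along by
`val_lt_of_val_lt`. -/
theorem left_iff {T T' : Set S.E} (hT : IsMaxChain S.Path T) (hT' : IsMaxChain S.Path T')
    {e f : S.E} (he : e ∈ T) (hf : f ∈ T') (hp : Par S e f) {a b w : ℝ}
    (ha : a ∈ Ioo (D.bot e) (D.top e)) (hb : b ∈ Ioo (D.bot f) (D.top f)) (hw : w ∈ uIcc a b) :
    D.Left e f ↔ D.val T w < D.val T' w := by
  have ha' := Ioo_subset_Icc_self ha
  have hb' := Ioo_subset_Icc_self hb
  constructor
  · rintro ⟨-, T₁, T₁', hT₁, hT₁', he₁, hf₁, v, hv, hl⟩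
    rw [hD.val_eq hT₁.1 he₁ (Ioo_subset_Icc_self hv), ← hD.val_eq hT.1 he (Ioo_subset_Icc_self hv)]
      at hl
    have h1 := hD.val_lt_of_val_lt fl hT hT₁' he hf₁ hp hv hb left_mem_uIcc right_mem_uIcc hl
    rw [hD.val_eq hT₁'.1 hf₁ hb', ← hD.val_eq hT'.1 hf hb'] at h1
    exact hD.val_lt_of_val_lt fl hT hT' he hf hp ha hb right_mem_uIcc hw h1
  · intro hl
    exact ⟨hp, T, T', hT, hT', he, hf, a, ha,
      hD.val_lt_of_val_lt fl hT hT' he hf hp ha hb hw left_mem_uIcc hl⟩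

theorem left_total {e f : S.E} (hp : Par S e f) : D.Left e f ∨ D.Left f e := by
  obtain ⟨T, hT, he, -⟩ := exists_maxChain (OpenGraph.Path.refl e)
  obtain ⟨T', hT', hf, -⟩ := exists_maxChain (OpenGraph.Path.refl f)
  have ha := hD.mid_mem e
  have hb := hD.mid_mem f
  rw [hD.left_iff fl hT hT' he hf hp ha hb left_mem_uIcc,
    hD.left_iff fl hT' hT hf he (Par.symm hp) hb ha right_mem_uIcc]
  exact lt_or_gt_of_ne (hD.val_ne fl hT hT' he hf hp ha hb left_mem_uIcc)

theorem left_of_path_left {e f g : S.E} (h : S.Path e f) (h' : D.Left f g) (hp : Par S e g) :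
    D.Left e g := by
  obtain ⟨T, hT, he, hf⟩ := exists_maxChain h
  obtain ⟨T', hT', hg, -⟩ := exists_maxChain (OpenGraph.Path.refl g)
  have h1 := (hD.left_iff fl hT hT' hf hg h'.1 (hD.mid_mem f) (hD.mid_mem g) right_mem_uIcc).1 h'
  exact (hD.left_iff fl hT hT' he hg hp (hD.mid_mem e) (hD.mid_mem g) right_mem_uIcc).2 h1

theorem left_of_left_path {e f g : S.E} (h : D.Left e f) (h' : S.Path f g) (hp : Par S e g) :
    D.Left e g := by
  obtain ⟨T, hT, he, -⟩ := exists_maxChain (OpenGraph.Path.refl e)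
  obtain ⟨T', hT', hf, hg⟩ := exists_maxChain h'
  have h1 := (hD.left_iff fl hT hT' he hf h.1 (hD.mid_mem e) (hD.mid_mem f) left_mem_uIcc).1 h
  exact (hD.left_iff fl hT hT' he hg hp (hD.mid_mem e) (hD.mid_mem g) left_mem_uIcc).2 h1

/-- At a level inside `f`, a chain through both `e` and `g` would pass on the left and on the right
of `f`. -/
theorem not_path_of_left_left {e f g : S.E} (h : D.Left e f) (h' : D.Left f g) (T : Set S.E)
    (hT : IsMaxChain S.Path T) (he : e ∈ T) (hg : g ∈ T) : False := by
  obtain ⟨T', hT', hf, -⟩ := exists_maxChain (OpenGraph.Path.refl f)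
  have h1 := (hD.left_iff fl hT hT' he hf h.1 (hD.mid_mem e) (hD.mid_mem f) right_mem_uIcc).1 h
  have h2 := (hD.left_iff fl hT' hT hf hg h'.1 (hD.mid_mem f) (hD.mid_mem g) left_mem_uIcc).1 h'
  exact lt_asymm h1 h2

/-- If `g` were left of `e`, the relation would be cyclic. Choose a level inside each of the three
edges; the middle one of these levels lies in all three intervals between them, and there the values
of three chains would increase cyclically. -/
theorem left_trans {e f g : S.E} (h : D.Left e f) (h' : D.Left f g) : D.Left e g := by
  have hp : Par S e g := by
    constructor <;> intro p
    · obtain ⟨T, hT, he, hg⟩ := exists_maxChain p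
      exact hD.not_path_of_left_left fl h h' T hT he hg
    · obtain ⟨T, hT, hg, he⟩ := exists_maxChain p
      exact hD.not_path_of_left_left fl h h' T hT he hg
  rcases hD.left_total fl hp with q | q
  · exact q
  exfalso
  obtain ⟨T₁, hT₁, he, -⟩ := exists_maxChain (OpenGraph.Path.refl e)
  obtain ⟨T₂, hT₂, hf, -⟩ := exists_maxChain (OpenGraph.Path.refl f)
  obtain ⟨T₃, hT₃, hg, -⟩ := exists_maxChain (OpenGraph.Path.refl g)
  have ha := hD.mid_mem e
  have hb := hD.mid_mem f
  have hc := hD.mid_mem g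
  generalize (D.bot e + D.top e) / 2 = a at ha
  generalize (D.bot f + D.top f) / 2 = b at hb
  generalize (D.bot g + D.top g) / 2 = c at hc
  obtain ⟨w, w1, w2, w3⟩ : ∃ w, w ∈ uIcc a b ∧ w ∈ uIcc b c ∧ w ∈ uIcc c a := by
    simp only [mem_uIcc]
    rcases le_total a b with h1 | h1 <;> rcases le_total b c with h2 | h2 <;>
      rcases le_total c a with h3 | h3
    · exact ⟨a, by grind⟩
    · exact ⟨b, by grind⟩
    · exact ⟨a, by grind⟩
    · exact ⟨c, by grind⟩
    · exact ⟨c, by grind⟩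
    · exact ⟨a, by grind⟩
    · exact ⟨b, by grind⟩
    · exact ⟨b, by grind⟩
  have h1 := (hD.left_iff fl hT₁ hT₂ he hf h.1 ha hb w1).1 h
  have h2 := (hD.left_iff fl hT₂ hT₃ hf hg h'.1 hb hc w2).1 h'
  have h3 := (hD.left_iff fl hT₃ hT₁ hg he q.1 hc ha w3).1 q
  linarith

omit hD fl in
theorem Left.ne {e f : S.E} (h : D.Left e f) : e ≠ f := by
  rintro rfl
  exact h.1.1 (OpenGraph.Path.refl e)

/-- In the mixed cases a path from `g` back to `e` would connect the two edges that are related by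
`Left`. Hence either there is a path from `e` to `g`, or the relation `Left` extends along the given
path. -/
theorem order_trans {e f g : S.E} (h : D.order e f) (h' : D.order f g) : D.order e g := by
  obtain ⟨n, h⟩ := h
  obtain ⟨n', h'⟩ := h'
  rcases h with h | h <;> rcases h' with h' | h'
  · refine ⟨?_, Or.inl (h.trans h')⟩
    rintro rfl
    exact n (hD.path_antisymm h h')
  · by_cases p : S.Path e g
    · refine ⟨?_, Or.inl p⟩
      rintro rfl
      exact h'.1.2 h
    · have hp : Par S e g := ⟨p, fun q => h'.1.2 (q.trans h)⟩
      have := hD.left_of_path_left fl h h' hp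
      exact ⟨Left.ne this, Or.inr this⟩
  · by_cases p : S.Path e g
    · refine ⟨?_, Or.inl p⟩
      rintro rfl
      exact h.1.2 h'
    · have hp : Par S e g := ⟨p, fun q => h.1.2 (h'.trans q)⟩
      have := hD.left_of_left_path fl h h' hp
      exact ⟨Left.ne this, Or.inr this⟩
  · have := hD.left_trans fl h h'
    exact ⟨Left.ne this, Or.inr this⟩

/-- The order of a drawing is a progressive planar order. -/
theorem isPlanar_order : S.IsPlanar D.order where
  toIsFlow := fl
  irrefl e h := h.1 rfl
  trans e f g := hD.order_trans fl
  total e f := by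
    by_cases h : e = f
    · exact Or.inr (Or.inl h)
    by_cases p : S.Path e f
    · exact Or.inl ⟨h, Or.inl p⟩
    by_cases q : S.Path f e
    · exact Or.inr (Or.inr ⟨Ne.symm h, Or.inl q⟩)
    rcases hD.left_total fl ⟨p, q⟩ with l | l
    · exact Or.inl ⟨h, Or.inr l⟩
    · exact Or.inr (Or.inr ⟨Ne.symm h, Or.inr l⟩)
  step e f h := by
    refine ⟨?_, Or.inl h.path⟩
    rintro rfl
    exact (hD.bot_lt_top e).ne' (top_eq_bot_of_step (D := D) h)
  -- Otherwise `e₃` is right of `e₁` and left of `e₂`, although these two lie on one chain.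
  between e₁ e₂ e₃ p h h' := by
    by_contra! hn
    have h1 := h.2.resolve_left hn.2
    have h2 := h'.2.resolve_left hn.1
    obtain ⟨T, hT, a, b⟩ := exists_maxChain p
    exact hD.not_path_of_left_left fl h1 h2 T hT a b

/-- Levels inside `e` are covered by `left_iff`. The ends of `e` follow by continuity of the chains,
which leaves a weak inequality. -/
theorem isOrdered_order : D.IsOrdered D.order := by
  rintro e f u ⟨-, p | l⟩ he hf
  · exact (hD.x_eq_of_path p he hf).le
  · obtain ⟨T, hT, hTe, -⟩ := exists_maxChain (OpenGraph.Path.refl e)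
    obtain ⟨T', hT', hTf, -⟩ := exists_maxChain (OpenGraph.Path.refl f)
    rw [← hD.val_eq hT.1 hTe he, ← hD.val_eq hT'.1 hTf hf]
    have hsub : Ioo (D.bot e) (D.top e) ⊆ Icc D.lo D.hi := fun u hu =>
      ⟨by linarith [hu.1, hD.lo_le_bot e], by linarith [hu.2, hD.top_le_hi e]⟩
    have hu : u ∈ Icc D.lo D.hi :=
      ⟨by linarith [he.1, hD.lo_le_bot e], by linarith [he.2, hD.top_le_hi e]⟩
    refine ContinuousWithinAt.closure_le (s := Ioo (D.bot e) (D.top e)) ?_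
      (((hD.continuousOn_val fl hT ⟨e, hTe⟩) u hu).mono hsub)
      (((hD.continuousOn_val fl hT' ⟨f, hTf⟩) u hu).mono hsub) fun w hw => ?_
    · rw [closure_Ioo (hD.bot_lt_top e).ne]; exact he
    · exact ((hD.left_iff fl hT hT' hTe hTf l.1 hw (hD.mid_mem f) left_mem_uIcc).1 l).le

end IsValid

end Drawing

/-! ### Leveled progressive plane graphs are drawings -/

open OpenGraph

/-- Continuity gives weak inequalities at the ends; two interior points between `x` and `y` make
them strict. -/
theorem strictMonoOn_Icc_of_Ioo {f : ℝ → ℝ} {a b : ℝ} (hc : ContinuousOn f (Icc a b))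
    (hm : StrictMonoOn f (Ioo a b)) : StrictMonoOn f (Icc a b) := by
  have h1 : ∀ x ∈ Icc a b, ∀ p ∈ Ioo a b, x < p → f x ≤ f p := by
    intro x hx p hp hxp
    refine ContinuousWithinAt.closure_le (s := Ioo a p) ?_
      ((hc x hx).mono fun y hy => ⟨hy.1.le, hy.2.le.trans hp.2.le⟩) continuousWithinAt_const ?_
    · rw [closure_Ioo hp.1.ne]; exact ⟨hx.1, hxp.le⟩
    · exact fun y hy => (hm ⟨hy.1, hy.2.trans hp.2⟩ hp hy.2).le
  have h2 : ∀ x ∈ Icc a b, ∀ p ∈ Ioo a b, p < x → f p ≤ f x := by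
    intro x hx p hp hxp
    refine ContinuousWithinAt.closure_le (s := Ioo p b) ?_ continuousWithinAt_const
      ((hc x hx).mono fun y hy => ⟨hp.1.le.trans hy.1.le, hy.2.le⟩) ?_
    · rw [closure_Ioo hp.2.ne]; exact ⟨hxp.le, hx.2⟩
    · exact fun y hy => (hm hp ⟨hp.1.trans hy.1, hy.2⟩ hy.1).le
  intro x hx y hy hxy
  obtain ⟨p, hp1, hp2⟩ := exists_between hxy
  obtain ⟨q, hq1, hq2⟩ := exists_between hp2
  have hp : p ∈ Ioo a b := ⟨hx.1.trans_lt hp1, hp2.trans_le hy.2⟩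
  have hq : q ∈ Ioo a b := ⟨hp.1.trans hq1, hq2.trans_le hy.2⟩
  exact ((h1 x hx p hp hp1).trans_lt (hm hp hq hq1)).trans_le (h2 y hy q hq hq2)

/-- An ascending path is the graph of a function of the level. -/
theorem exists_graph_of_strictMonoOn {γ : ℝ → ℝ × ℝ} (hc : ContinuousOn γ (Icc 0 1))
    (hm : StrictMonoOn (fun s => (γ s).2) (Ioo 0 1)) :
    (γ 0).2 < (γ 1).2 ∧ ∃ x : ℝ → ℝ, ContinuousOn x (Icc (γ 0).2 (γ 1).2) ∧
      x (γ 0).2 = (γ 0).1 ∧ x (γ 1).2 = (γ 1).1 ∧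
      γ '' Ioo 0 1 = (fun u => (x u, u)) '' Ioo (γ 0).2 (γ 1).2 := by
  have hc2 : ContinuousOn (fun s => (γ s).2) (Icc 0 1) := continuous_snd.comp_continuousOn hc
  have hm' := strictMonoOn_Icc_of_Ioo hc2 hm
  have m0 : (0 : ℝ) ∈ Icc (0 : ℝ) 1 := by simp
  have m1 : (1 : ℝ) ∈ Icc (0 : ℝ) 1 := by simp
  have hmaps : ∀ s ∈ Icc (0 : ℝ) 1, (γ s).2 ∈ Icc (γ 0).2 (γ 1).2 := fun s hs =>
    ⟨hm'.monotoneOn m0 hs hs.1, hm'.monotoneOn hs m1 hs.2⟩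
  have hsurj : ∀ u ∈ Icc (γ 0).2 (γ 1).2, ∃ s ∈ Icc (0 : ℝ) 1, (γ s).2 = u :=
    intermediate_value_Icc zero_le_one hc2
  -- The level is a continuous bijection from a compact space to a Hausdorff space, so its inverse
  -- is continuous. The function `x` is this inverse followed by the first coordinate of `γ`.
  let E : Icc (0 : ℝ) 1 ≃ Icc (γ 0).2 (γ 1).2 :=
    Equiv.ofBijective (fun s => ⟨(γ s).2, hmaps s s.2⟩)
      ⟨fun s t h => Subtype.ext (hm'.injOn s.2 t.2 (congrArg Subtype.val h)), fun u => by
        obtain ⟨s, hs, h⟩ := hsurj u u.2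
        exact ⟨⟨s, hs⟩, Subtype.ext h⟩⟩
  have hE : Continuous E := (continuousOn_iff_continuous_domRestrict.1 hc2).subtype_mk _
  let F := hE.homeoOfEquivCompactToT2
  classical
  let x : ℝ → ℝ := fun u => if hu : u ∈ Icc (γ 0).2 (γ 1).2 then (γ (F.symm ⟨u, hu⟩)).1 else 0
  have hx : ∀ s ∈ Icc (0 : ℝ) 1, x (γ s).2 = (γ s).1 := by
    intro s hs
    simp only [x, dif_pos (hmaps s hs)]
    have : F.symm ⟨(γ s).2, hmaps s hs⟩ = ⟨s, hs⟩ := F.symm_apply_eq.2 rfl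
    rw [this]
  refine ⟨hm' m0 m1 one_pos, x, ?_, hx 0 m0, hx 1 m1, ?_⟩
  · rw [continuousOn_iff_continuous_domRestrict]
    have : (Icc (γ 0).2 (γ 1).2).domRestrict x = fun u => ((Icc (0 : ℝ) 1).domRestrict γ (F.symm u)).1 := by
      funext u
      simp only [x, domRestrict_apply, dif_pos u.2]
    rw [this]
    exact continuous_fst.comp ((continuousOn_iff_continuous_domRestrict.1 hc).comp F.symm.continuous)
  · have himg := ContinuousOn.image_Ioo_of_strictMonoOn zero_le_one hc2 hm'
    rw [← himg, image_image]
    refine image_congr fun s hs => ?_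
    rw [hx s (Ioo_subset_Icc_self hs)]

/-- Along a parametrized edge the level is continuous and injective on the open interval, hence
strictly monotone. A descending parametrization is reversed. -/
theorem PlaneGraph.IsLeveled.exists_graph {G : PlaneGraph} {a b : ℝ} (hG : G.IsLeveled a b)
    {e : Set (ℝ × ℝ)} (he : e ∈ G.edges) : ∃ (s t : ℝ) (x : ℝ → ℝ), s < t ∧
      ContinuousOn x (Icc s t) ∧ (x s, s) ∈ G.nodes ∧ (x t, t) ∈ G.nodes ∧
      e = (fun u => (x u, u)) '' Ioo s t := by
  obtain ⟨γ, hc, hi, rfl, h0, h1⟩ := hG.pinned e he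
  have hc2 : ContinuousOn (fun s => (γ s).2) (Icc 0 1) := continuous_snd.comp_continuousOn hc
  have hinj : InjOn (fun s => (γ s).2) (Ioo 0 1) := fun s hs t ht h =>
    hi hs ht (hG.progressive _ he (mem_image_of_mem _ hs) (mem_image_of_mem _ ht) h)
  rcases ContinuousOn.strictMonoOn_of_injOn_Ioo one_pos (hc2.mono Ioo_subset_Icc_self) hinj with
    hm | hm
  · obtain ⟨h2, x, h3, h4, h5, h6⟩ := exists_graph_of_strictMonoOn hc hm
    exact ⟨_, _, x, h2, h3, by rw [h4]; exact h0, by rw [h5]; exact h1, h6⟩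
  · have hc' : ContinuousOn (fun s => γ (1 - s)) (Icc 0 1) :=
      hc.comp (by fun_prop) fun s hs => ⟨by linarith [hs.2], by linarith [hs.1]⟩
    have hm' : StrictMonoOn (fun s => (γ (1 - s)).2) (Ioo 0 1) := fun s hs t ht hst =>
      hm ⟨by linarith [ht.2], by linarith [ht.1]⟩ ⟨by linarith [hs.2], by linarith [hs.1]⟩
        (by linarith)
    obtain ⟨h2, x, h3, h4, h5, h6⟩ := exists_graph_of_strictMonoOn hc' hm'
    simp only [sub_zero, sub_self] at h2 h3 h4 h5 h6
    refine ⟨_, _, x, h2, h3, by rw [h4]; exact h1, by rw [h5]; exact h0, ?_⟩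
    rw [← h6]
    ext p
    constructor
    · rintro ⟨s, hs, rfl⟩
      exact ⟨1 - s, ⟨by linarith [hs.2], by linarith [hs.1]⟩, by simp⟩
    · rintro ⟨s, hs, rfl⟩
      exact ⟨1 - s, ⟨by linarith [hs.2], by linarith [hs.1]⟩, rfl⟩

/-- Every leveled progressive plane graph is the graph of a valid drawing. -/
theorem LeveledGraph.exists_drawing (G : LeveledGraph) :
    ∃ (S : OpenGraph) (fl : S.IsFlow) (D : Drawing S) (hD : D.IsValid), hD.toLeveled fl = G := by
  classical
  have hG := G.isLeveled
  choose s t x hlt hc hs ht he using fun e : {e // e ∈ G.edges} => hG.exists_graph e.2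
  have hnode : ∀ p ∈ G.nodes, p ∉ G.innerNodes → p ∈ G.outer G.lo G.hi := by
    intro p hp hn
    by_contra h
    exact hn ⟨hp, h⟩
  have hsub : ∀ e : {e // e ∈ G.edges}, e.1 ⊆ G.carrier \ G.nodes := by
    rintro ⟨e, p, hp, rfl⟩
    exact connectedComponentIn_subset _ _
  have hdis : ∀ (e f : {e // e ∈ G.edges}) p, p ∈ e.1 → p ∈ f.1 → e = f := by
    rintro ⟨e, p, hp, rfl⟩ ⟨f, q, hq, rfl⟩ r h1 h2
    exact Subtype.ext ((connectedComponentIn_eq h1).trans (connectedComponentIn_eq h2).symm)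
  have hclos : ∀ e : {e // e ∈ G.edges},
      closure e.1 = (fun u => (x e u, u)) '' Icc (s e) (t e) := by
    intro e
    have h1 : ContinuousOn (fun u => (x e u, u)) (Icc (s e) (t e)) := (hc e).prodMk continuousOn_id
    refine Subset.antisymm (closure_minimal ?_
      (isCompact_Icc.image_of_continuousOn h1).isClosed) ?_
    · conv_lhs => rw [he e]
      exact image_mono Ioo_subset_Icc_self
    · rw [← closure_Ioo (hlt e).ne] at h1
      have := h1.image_closure
      rwa [closure_Ioo (hlt e).ne, ← he e] at this
  -- Only inner nodes become vertices; an edge that begins or ends at an outer node has a free end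
  -- there.
  let S : OpenGraph :=
    { E := {e // e ∈ G.edges}
      V := {p // p ∈ G.innerNodes}
      src := fun e => if h : (x e (s e), s e) ∈ G.innerNodes then some ⟨_, h⟩ else none
      tgt := fun e => if h : (x e (t e), t e) ∈ G.innerNodes then some ⟨_, h⟩ else none }
  let D : Drawing S := ⟨G.lo, G.hi, Subtype.val, x⟩
  have hsrc : ∀ e v, S.src e = some v ↔ v.1 = (x e (s e), s e) := by
    intro e v
    by_cases h : (x e (s e), s e) ∈ G.innerNodes
    · simp only [S, dif_pos h, Option.some.injEq]
      rw [Subtype.ext_iff, eq_comm]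
    · simp only [S, dif_neg h, reduceCtorEq, false_iff]
      exact fun hv => h (hv ▸ v.2)
  have htgt : ∀ e v, S.tgt e = some v ↔ v.1 = (x e (t e), t e) := by
    intro e v
    by_cases h : (x e (t e), t e) ∈ G.innerNodes
    · simp only [S, dif_pos h, Option.some.injEq]
      rw [Subtype.ext_iff, eq_comm]
    · simp only [S, dif_neg h, reduceCtorEq, false_iff]
      exact fun hv => h (hv ▸ v.2)
  have hbot : ∀ e, D.bot e = s e := by
    intro e
    by_cases h : (x e (s e), s e) ∈ G.innerNodes
    · rw [Drawing.bot_of_src ((hsrc e ⟨_, h⟩).2 rfl)]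
    · rw [Drawing.bot_of_none (D := D) (dif_neg h)]
      -- A lower end that is not an inner node lies on an outer level. This cannot be the upper
      -- level, as the other end of the edge lies still higher.
      rcases (hnode _ (hs e) h).2 with h | h
      · exact h.symm
      · have h1 := (hG.strip _ (hG.nodes_subset (ht e))).2
        have h2 := hlt e
        dsimp only at h h1
        linarith
  have htop : ∀ e, D.top e = t e := by
    intro e
    by_cases h : (x e (t e), t e) ∈ G.innerNodes
    · rw [Drawing.top_of_tgt ((htgt e ⟨_, h⟩).2 rfl)]
    · rw [Drawing.top_of_none (D := D) (dif_neg h)]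
      rcases (hnode _ (ht e) h).2 with h | h
      · have h1 := (hG.strip _ (hG.nodes_subset (hs e))).1
        have h2 := hlt e
        dsimp only at h h1
        linarith
      · exact h.symm
  have harc : ∀ e : S.E, D.arc e = closure e.1 := by
    intro e
    rw [Drawing.arc, hbot, htop, hclos]
    rfl
  have hend : ∀ (e : S.E) u, u ∈ Icc (s e) (t e) → (x e u, u) ∈ G.nodes → u = s e ∨ u = t e := by
    intro e u hu hn
    by_contra! hcon
    refine (hsub e (he e ▸ ⟨u, ⟨lt_of_le_of_ne hu.1 hcon.1.symm, lt_of_le_of_ne hu.2 hcon.2⟩,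
      rfl⟩)).2 hn
  have hnodeEnd : ∀ (e : S.E) u, u ∈ Icc (s e) (t e) → (x e u, u) ∉ e.1 → (x e u, u) ∈ G.nodes := by
    intro e u hu hn
    by_cases h1 : u = s e
    · rw [h1]; exact hs e
    by_cases h2 : u = t e
    · rw [h2]; exact ht e
    refine (hn ?_).elim
    have : e.1 = _ := he e
    rw [this]
    exact ⟨u, ⟨lt_of_le_of_ne hu.1 (Ne.symm h1), lt_of_le_of_ne hu.2 h2⟩, rfl⟩
  have hD : D.IsValid :=
    { lt := hG.lt
      bounds := by
        rintro ⟨v, hv1, hv2⟩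
        have h1 := hG.strip v (hG.nodes_subset hv1)
        have h2 : v.2 ≠ G.lo := fun h => hv2 ⟨hG.nodes_subset hv1, Or.inl h⟩
        have h3 : v.2 ≠ G.hi := fun h => hv2 ⟨hG.nodes_subset hv1, Or.inr h⟩
        exact ⟨lt_of_le_of_ne h1.1 h2.symm, lt_of_le_of_ne h1.2 h3⟩
      bot_lt_top := fun e => by rw [hbot, htop]; exact hlt e
      cont := fun e => by rw [hbot, htop]; exact hc e
      x_src := fun e v h => by
        rw [hsrc] at h
        change x e v.1.2 = v.1.1
        rw [h]
      x_tgt := fun e v h => by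
        rw [htgt] at h
        change x e v.1.2 = v.1.1
        rw [h]
      disj := by
        intro e f u hne hue huf hx
        rw [hbot, htop] at hue huf
        change x e u = x f u at hx
        -- Open edges are disjoint components, so a common point of two closed edges is a node. It
        -- is an inner node, because an outer node lies on only one edge.
        have hpn : (x e u, u) ∈ G.nodes := by
          by_cases h1 : (x e u, u) ∈ e.1
          · by_cases h2 : (x f u, u) ∈ f.1
            · rw [hx] at h1
              exact (hne (hdis e f _ h1 h2)).elim
            · rw [hx]; exact hnodeEnd f u huf h2
          · exact hnodeEnd e u hue h1
        have he' := hend e u hue hpn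
        have hf' := hend f u huf (hx ▸ hpn)
        have hin : (x e u, u) ∈ G.innerNodes := by
          by_contra hcon
          obtain ⟨g, -, hg⟩ := hG.outer_degree _ (hnode _ hpn hcon)
          have h1 := hg e.1 ⟨e.2, by rw [hclos]; exact ⟨u, hue, rfl⟩⟩
          have h2 := hg f.1 ⟨f.2, by rw [hclos, hx]; exact ⟨u, huf, rfl⟩⟩
          exact hne (Subtype.ext (h1.trans h2.symm))
        have key : ∀ f : S.E, x e u = x f u → u = s f ∨ u = t f → S.Inc f ⟨_, hin⟩ := by
          rintro f hx (h | h)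
          · exact Or.inl ((hsrc f _).2 (by rw [← h, ← hx]))
          · exact Or.inr ((htgt f _).2 (by rw [← h, ← hx]))
        exact ⟨⟨_, hin⟩, key e rfl he', key f hx hf', rfl⟩ }
  have fl : S.IsFlow :=
    { finite_E := hG.edges_finite.to_subtype
      finite_V := (hG.nodes_finite.subset Set.sdiff_subset).to_subtype
      exists_in := by
        intro v
        obtain ⟨e, he1, he2, he3⟩ := (hG.inner_directed v.1 v.2).1
        refine ⟨⟨e, he1⟩, (htgt _ _).2 ?_⟩
        rw [hclos ⟨e, he1⟩] at he2
        obtain ⟨u, hu, hv⟩ := he2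
        have h1 : u = t ⟨e, he1⟩ := by
          by_contra hn
          have hlt' : u < t ⟨e, he1⟩ := lt_of_le_of_ne hu.2 hn
          obtain ⟨w, hw1, hw2⟩ := exists_between hlt'
          have := he3 (x ⟨e, he1⟩ w, w)
            ((he ⟨e, he1⟩).symm.subset ⟨w, ⟨hu.1.trans_lt hw1, hw2⟩, rfl⟩)
          rw [← hv] at this
          exact lt_asymm this hw1
        rw [← hv, ← h1]
      exists_out := by
        intro v
        obtain ⟨e, he1, he2, he3⟩ := (hG.inner_directed v.1 v.2).2
        refine ⟨⟨e, he1⟩, (hsrc _ _).2 ?_⟩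
        rw [hclos ⟨e, he1⟩] at he2
        obtain ⟨u, hu, hv⟩ := he2
        have h1 : u = s ⟨e, he1⟩ := by
          by_contra hn
          have hlt' : s ⟨e, he1⟩ < u := lt_of_le_of_ne hu.1 (Ne.symm hn)
          obtain ⟨w, hw1, hw2⟩ := exists_between hlt'
          have := he3 (x ⟨e, he1⟩ w, w)
            ((he ⟨e, he1⟩).symm.subset ⟨w, ⟨hw1, hw2.trans_le hu.2⟩, rfl⟩)
          rw [← hv] at this
          exact lt_asymm this hw2
        rw [← hv, ← h1] }
  have hplane : D.toPlane = G.toPlaneGraph := by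
    ext p
    · simp only [Drawing.toPlane, mem_iUnion]
      constructor
      · rintro ⟨e, h⟩
        rw [harc, hclos] at h
        obtain ⟨u, hu, rfl⟩ := h
        by_cases h1 : (x e u, u) ∈ e.1
        · exact (hsub e h1).1
        · exact hG.nodes_subset (hnodeEnd e u hu h1)
      · intro hp
        by_cases hn : p ∈ G.nodes
        · obtain ⟨e, he1, he2⟩ := hG.not_isolated p hn
          exact ⟨⟨e, he1⟩, by rw [harc]; exact he2⟩
        · refine ⟨⟨_, p, ⟨hp, hn⟩, rfl⟩, ?_⟩
          rw [harc]
          exact subset_closure (mem_connectedComponentIn ⟨hp, hn⟩)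
    · simp only [Drawing.toPlane, mem_ofPred_eq, hbot, htop]
      constructor
      · rintro ⟨e, rfl | rfl⟩
        · exact hs e
        · exact ht e
      · intro hn
        obtain ⟨e, he1, he2⟩ := hG.not_isolated p hn
        rw [hclos ⟨e, he1⟩] at he2
        obtain ⟨u, hu, rfl⟩ := he2
        refine ⟨⟨e, he1⟩, (hend ⟨e, he1⟩ u hu hn).imp ?_ ?_⟩ <;> rintro rfl <;> rfl
  refine ⟨S, fl, D, hD, ?_⟩
  rcases G with ⟨G, lo, hi, h⟩
  simp only [Drawing.IsValid.toLeveled, LeveledGraph.mk.injEq]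
  exact ⟨hplane, rfl, rfl⟩

/-! ### Families of drawings as deformations -/

open OpenGraph

namespace Drawing

variable {S : OpenGraph}

/-- The arc of `e`, parametrized by `[0, 1]`. -/
def path (D : Drawing S) (e : S.E) (l : ℝ) : ℝ × ℝ :=
  D.point e (D.bot e + l * (D.top e - D.bot e))

theorem path_zero (D : Drawing S) (e : S.E) : D.path e 0 = D.point e (D.bot e) := by simp [path]

theorem path_one (D : Drawing S) (e : S.E) : D.path e 1 = D.point e (D.top e) := by simp [path]

theorem mem_nodes_iff (D : Drawing S) (p : ℝ × ℝ) :
    p ∈ D.toPlane.nodes ↔ ∃ e, p = D.path e 0 ∨ p = D.path e 1 := by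
  simp only [path_zero, path_one]; rfl

namespace IsValid

variable {D : Drawing S} (hD : D.IsValid)
include hD

theorem level_mem {e : S.E} {l : ℝ} (hl : l ∈ Icc (0 : ℝ) 1) :
    D.bot e + l * (D.top e - D.bot e) ∈ Icc (D.bot e) (D.top e) := by
  have := hD.bot_lt_top e
  constructor <;> nlinarith [hl.1, hl.2]

theorem arc_eq_image (e : S.E) : D.arc e = D.path e '' Icc 0 1 := by
  have hlt := hD.bot_lt_top e
  ext p
  constructor
  · rintro ⟨u, ⟨h0, h1⟩, rfl⟩
    refine ⟨(u - D.bot e) / (D.top e - D.bot e), ⟨div_nonneg (by linarith) (by linarith), ?_⟩, ?_⟩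
    · rw [div_le_one (by linarith)]; linarith
    · have : D.top e - D.bot e ≠ 0 := by linarith
      rw [path]
      congr 1
      field_simp
      ring
  · rintro ⟨l, hl, rfl⟩
    exact ⟨_, hD.level_mem hl, rfl⟩

theorem mem_carrier_iff (p : ℝ × ℝ) :
    p ∈ D.toPlane.carrier ↔ ∃ e, ∃ l ∈ Icc (0 : ℝ) 1, D.path e l = p := by
  simp only [toPlane, mem_iUnion, hD.arc_eq_image, mem_image]

theorem isCompact_carrier (fl : S.IsFlow) : IsCompact D.toPlane.carrier := by
  have := fl.finite_E
  exact isCompact_iUnion hD.isCompact_arc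

theorem path_inj {e : S.E} {l m : ℝ} (h : D.path e l = D.path e m) : l = m := by
  have h1 := congrArg Prod.snd h
  simp only [path, point_snd, add_right_inj, mul_eq_mul_right_iff, sub_eq_zero] at h1
  exact h1.resolve_right (hD.bot_lt_top e).ne'

theorem param_of_inc {e : S.E} {v : S.V} (hv : S.Inc e v) {l : ℝ}
    (hl : (D.pt v).2 = D.bot e + l * (D.top e - D.bot e)) :
    (S.src e = some v ∧ l = 0) ∨ (S.tgt e = some v ∧ l = 1) := by
  have hlt := hD.bot_lt_top e
  rcases hv with hv | hv
  · rw [← bot_of_src hv] at hl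
    refine Or.inl ⟨hv, ?_⟩
    have : l * (D.top e - D.bot e) = 0 := by linarith
    exact (mul_eq_zero.1 this).resolve_right (by linarith)
  · rw [← top_of_tgt hv] at hl
    refine Or.inr ⟨hv, ?_⟩
    have : (l - 1) * (D.top e - D.bot e) = 0 := by linarith
    have := (mul_eq_zero.1 this).resolve_right (by linarith)
    linarith

theorem path_eq_pt {D' : Drawing S} (hD' : D'.IsValid) {e : S.E} {v : S.V} (hv : S.Inc e v) {l : ℝ}
    (hl : (D.pt v).2 = D.bot e + l * (D.top e - D.bot e)) : D'.path e l = D'.pt v := by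
  rcases hD.param_of_inc hv hl with ⟨h, rfl⟩ | ⟨h, rfl⟩
  · rw [path_zero, hD'.point_bot h]
  · rw [path_one, hD'.point_top h]

/-- Coincidences of points are the same for all valid drawings. -/
theorem path_eq_path {D' : Drawing S} (hD' : D'.IsValid) {e f : S.E} {l m : ℝ}
    (hl : l ∈ Icc (0 : ℝ) 1) (hm : m ∈ Icc (0 : ℝ) 1) (h : D.path e l = D.path f m) :
    D'.path e l = D'.path f m := by
  by_cases hef : e = f
  · subst hef
    rw [hD.path_inj h]
  have h2 := congrArg Prod.snd h
  simp only [path, point_snd] at h2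
  obtain ⟨v, v1, v2, v3⟩ := hD.disj e f _ hef (hD.level_mem hl) (h2 ▸ hD.level_mem hm)
    (by conv_rhs => rw [h2]
        exact congrArg Prod.fst h)
  rw [hD.path_eq_pt hD' v1 v3, hD.path_eq_pt hD' v2 (v3.trans h2)]

end IsValid

/-- A continuous family of valid drawings is a deformation. -/
theorem deforms_of_family (fl : S.IsFlow) (D : ℝ → Drawing S)
    (hD : ∀ t ∈ Icc (0 : ℝ) 1, (D t).IsValid)
    (hc : ∀ e, ContinuousOn (fun z : ℝ × ℝ => (D z.1).path e z.2) (Icc 0 1 ×ˢ Icc 0 1))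
    (h0 : (0 : ℝ) ∈ Icc (0 : ℝ) 1) (h1 : (1 : ℝ) ∈ Icc (0 : ℝ) 1) :
    Deforms ((hD 0 h0).toLeveled fl) ((hD 1 h1).toLeveled fl) := by
  classical
  have := fl.finite_E
  -- A point moves with its edge and its parameter in `[0, 1]`. A node may have several such
  -- descriptions, but by `path_eq_path` they lead to the same point in every drawing.
  let h : ℝ → ℝ × ℝ → ℝ × ℝ := fun t p =>
    if hp : ∃ z : S.E × ℝ, z.2 ∈ Icc (0 : ℝ) 1 ∧ (D 0).path z.1 z.2 = p then
      (D t).path hp.choose.1 hp.choose.2 else p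
  have hspec : ∀ t ∈ Icc (0 : ℝ) 1, ∀ e, ∀ l ∈ Icc (0 : ℝ) 1,
      h t ((D 0).path e l) = (D t).path e l := by
    intro t ht e l hl
    have hp : ∃ z : S.E × ℝ, z.2 ∈ Icc (0 : ℝ) 1 ∧ (D 0).path z.1 z.2 = (D 0).path e l :=
      ⟨(e, l), hl, rfl⟩
    simp only [h, dif_pos hp]
    exact (hD 0 h0).path_eq_path (hD t ht) hp.choose_spec.1 hl hp.choose_spec.2
  have himg : ∀ t ∈ Icc (0 : ℝ) 1, (D 0).toPlane.image (h t) = (D t).toPlane := by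
    intro t ht
    ext p
    · simp only [PlaneGraph.image, mem_image, (hD t ht).mem_carrier_iff,
        (hD 0 h0).mem_carrier_iff]
      constructor
      · rintro ⟨_, ⟨e, l, hl, rfl⟩, rfl⟩
        exact ⟨e, l, hl, (hspec t ht e l hl).symm⟩
      · rintro ⟨e, l, hl, rfl⟩
        exact ⟨_, ⟨e, l, hl, rfl⟩, hspec t ht e l hl⟩
    · simp only [PlaneGraph.image, mem_image, mem_nodes_iff]
      constructor
      · rintro ⟨_, ⟨e, rfl | rfl⟩, rfl⟩
        · exact ⟨e, Or.inl (hspec t ht e 0 h0)⟩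
        · exact ⟨e, Or.inr (hspec t ht e 1 h1)⟩
      · rintro ⟨e, rfl | rfl⟩
        · exact ⟨_, ⟨e, Or.inl rfl⟩, hspec t ht e 0 h0⟩
        · exact ⟨_, ⟨e, Or.inr rfl⟩, hspec t ht e 1 h1⟩
  have hcont : ContinuousOn (Function.uncurry h) (Icc (0 : ℝ) 1 ×ˢ (D 0).toPlane.carrier) := by
    have heq : Icc (0 : ℝ) 1 ×ˢ (D 0).toPlane.carrier = ⋃ e, Icc (0 : ℝ) 1 ×ˢ (D 0).arc e := by
      rw [toPlane, prod_iUnion]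
    rw [heq]
    refine (locallyFinite_of_finite _).continuousOn_iUnion
      (fun e => isClosed_Icc.prod ((hD 0 h0).isCompact_arc e).isClosed) fun e => ?_
    have hlt := (hD 0 h0).bot_lt_top e
    -- On one arc the parameter is an affine function of the level, so `h` is there the given
    -- continuous family. Finitely many closed arcs cover the graph.
    have h2 : ContinuousOn (fun z : ℝ × (ℝ × ℝ) =>
        (D z.1).path e ((z.2.2 - (D 0).bot e) / ((D 0).top e - (D 0).bot e)))
        (Icc (0 : ℝ) 1 ×ˢ (D 0).arc e) := by
      refine (hc e).comp (f := fun z : ℝ × (ℝ × ℝ) =>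
        (z.1, (z.2.2 - (D 0).bot e) / ((D 0).top e - (D 0).bot e))) (by fun_prop) ?_
      rintro ⟨t, p⟩ ⟨ht, hp⟩
      rw [mem_arc_iff] at hp
      refine ⟨ht, div_nonneg ?_ (by linarith), ?_⟩
      · linarith [hp.1.1]
      · dsimp only
        rw [div_le_one (by linarith)]; linarith [hp.1.2]
    refine h2.congr ?_
    rintro ⟨t, p⟩ ⟨ht, hp⟩
    dsimp only at ht hp
    rw [(hD 0 h0).arc_eq_image] at hp
    obtain ⟨l, hl, rfl⟩ := hp
    simp only [Function.uncurry_apply_pair]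
    rw [hspec t ht e l hl]
    congr 1
    simp only [path, point_snd]
    have : (D 0).top e - (D 0).bot e ≠ 0 := by linarith
    field_simp
    ring
  refine ⟨h, fun t => (D t).lo, fun t => (D t).hi, hcont, ?_, ?_, rfl, rfl, himg 1 h1, rfl, rfl⟩
  · intro t ht
    refine ⟨?_, ?_, ?_⟩
    -- An injective continuous map from a compact space to a Hausdorff space is an embedding.
    -- Injectivity is `path_eq_path` read backwards.
    · have : CompactSpace ((hD 0 h0).toLeveled fl).carrier :=
        isCompact_iff_compactSpace.1 ((hD 0 h0).isCompact_carrier fl)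
      have hcr : Continuous (((hD 0 h0).toLeveled fl).carrier.domRestrict (h t)) := by
        rw [← continuousOn_iff_continuous_domRestrict]
        exact hcont.comp (f := fun p => (t, p)) (by fun_prop) fun p hp => ⟨ht, hp⟩
      refine (hcr.isClosedEmbedding ?_).isEmbedding
      rintro ⟨p, hp⟩ ⟨q, hq⟩ hpq
      have hp' := ((hD 0 h0).mem_carrier_iff p).1 hp
      have hq' := ((hD 0 h0).mem_carrier_iff q).1 hq
      obtain ⟨e, l, hl, rfl⟩ := hp'
      obtain ⟨f, m, hm, rfl⟩ := hq'
      simp only [domRestrict_apply] at hpq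
      rw [hspec t ht e l hl, hspec t ht f m hm] at hpq
      exact Subtype.ext ((hD t ht).path_eq_path (hD 0 h0) hl hm hpq)
    · change ((D 0).toPlane.image (h t)).IsLeveled _ _
      rw [himg t ht]
      exact (hD t ht).isLeveled fl
    · change h t '' (D 0).toPlane.outer _ _ = ((D 0).toPlane.image (h t)).outer _ _
      rw [himg t ht]
      ext p
      simp only [mem_image]
      change (∃ q, q ∈ (D 0).toPlane.outer (D 0).lo (D 0).hi ∧ _) ↔ _
      rw [(hD t ht).mem_outer_iff]
      simp only [(hD 0 h0).mem_outer_iff, ← path_zero, ← path_one]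
      constructor
      · rintro ⟨_, ⟨e, ⟨he, rfl⟩ | ⟨he, rfl⟩⟩, rfl⟩
        · exact ⟨e, Or.inl ⟨he, hspec t ht e 0 h0⟩⟩
        · exact ⟨e, Or.inr ⟨he, hspec t ht e 1 h1⟩⟩
      · rintro ⟨e, ⟨he, rfl⟩ | ⟨he, rfl⟩⟩
        · exact ⟨_, ⟨e, Or.inl ⟨he, rfl⟩⟩, hspec t ht e 0 h0⟩
        · exact ⟨_, ⟨e, Or.inr ⟨he, rfl⟩⟩, hspec t ht e 1 h1⟩
  · intro p hp
    obtain ⟨e, l, hl, rfl⟩ := ((hD 0 h0).mem_carrier_iff p).1 hp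
    exact hspec 0 h0 e l hl

/-- Linear interpolation of two drawings with the same levels. -/
def interp (D D' : Drawing S) (t : ℝ) : Drawing S where
  lo := D.lo
  hi := D.hi
  pt v := ((1 - t) * (D.pt v).1 + t * (D'.pt v).1, (D.pt v).2)
  x e u := (1 - t) * D.x e u + t * D'.x e u

/-- Two ordered drawings with the same levels are deformations of each other. -/
theorem deforms_of_levels_eq {r : S.E → S.E → Prop} (pl : S.IsPlanar r) {D D' : Drawing S}
    (hD : D.IsValid) (hD' : D'.IsValid) (ho : D.IsOrdered r) (ho' : D'.IsOrdered r)
    (hlo : D.lo = D'.lo) (hhi : D.hi = D'.hi) (hpt : ∀ v, (D.pt v).2 = (D'.pt v).2) :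
    Deforms (hD.toLeveled pl.toIsFlow) (hD'.toLeveled pl.toIsFlow) := by
  have b1 : ∀ t e, (interp D D' t).bot e = D.bot e := fun t e => by
    cases h : S.src e <;> simp [bot, h, interp]
  have t1 : ∀ t e, (interp D D' t).top e = D.top e := fun t e => by
    cases h : S.tgt e <;> simp [top, h, interp]
  have b2 : ∀ e, D'.bot e = D.bot e := fun e => by
    cases h : S.src e <;> simp [bot, h, hlo, hpt]
  have t2 : ∀ e, D'.top e = D.top e := fun e => by
    cases h : S.tgt e <;> simp [top, h, hhi, hpt]
  have hcD' : ∀ e, ContinuousOn (D'.x e) (Icc (D.bot e) (D.top e)) := fun e => by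
    rw [← b2, ← t2]; exact hD'.cont e
  have hval : ∀ t ∈ Icc (0 : ℝ) 1, (interp D D' t).IsValid := by
    rintro t ⟨ht0, ht1⟩
    refine
      { lt := hD.lt
        bounds := hD.bounds
        bot_lt_top := fun e => by rw [b1, t1]; exact hD.bot_lt_top e
        cont := fun e => by
          rw [b1, t1]
          exact (continuousOn_const.mul (hD.cont e)).add (continuousOn_const.mul (hcD' e))
        x_src := fun e v h => by
          simp only [interp]
          rw [hD.x_src e v h, hpt, hD'.x_src e v h]
        x_tgt := fun e v h => by
          simp only [interp]
          rw [hD.x_tgt e v h, hpt, hD'.x_tgt e v h]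
        disj := ?_ }
    have key : ∀ e f u, r e f → u ∈ Icc (D.bot e) (D.top e) → u ∈ Icc (D.bot f) (D.top f) →
        (1 - t) * D.x e u + t * D'.x e u = (1 - t) * D.x f u + t * D'.x f u →
        ∃ v, S.Inc e v ∧ S.Inc f v ∧ (D.pt v).2 = u := by
      intro e f u hr he hf hx
      have hne : e ≠ f := fun h => pl.irrefl _ (h ▸ hr)
      have he' : u ∈ Icc (D'.bot e) (D'.top e) := by rwa [b2, t2]
      have hf' : u ∈ Icc (D'.bot f) (D'.top f) := by rwa [b2, t2]
      have l1 := ho e f u hr he hf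
      have l2 := ho' e f u hr he' hf'
      -- The first coordinates are ordered in the same way in both drawings. For `t < 1`, equality
      -- of the convex combinations therefore forces equality in `D`; for `t = 1` it is equality in
      -- `D'`.
      rcases ht1.lt_or_eq with ht | rfl
      · refine hD.disj e f u hne he hf (le_antisymm l1 ?_)
        nlinarith [mul_le_mul_of_nonneg_left l2 ht0]
      · obtain ⟨v, v1, v2, v3⟩ := hD'.disj e f u hne he' hf' (by linarith)
        exact ⟨v, v1, v2, (hpt v).trans v3⟩
    intro e f u hne he hf hx
    rw [b1, t1] at he hf
    rcases pl.total e f with h | h | h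
    · exact key e f u h he hf hx
    · exact (hne h).elim
    · obtain ⟨v, v1, v2, v3⟩ := key f e u h hf he hx.symm
      exact ⟨v, v2, v1, v3⟩
  have hc : ∀ e, ContinuousOn (fun z : ℝ × ℝ => (interp D D' z.1).path e z.2)
      (Icc 0 1 ×ˢ Icc 0 1) := by
    intro e
    simp only [path, b1, t1, point]
    have hm : MapsTo (fun z : ℝ × ℝ => D.bot e + z.2 * (D.top e - D.bot e)) (Icc 0 1 ×ˢ Icc 0 1)
        (Icc (D.bot e) (D.top e)) := fun z hz => hD.level_mem hz.2
    have c0 : ContinuousOn (fun z : ℝ × ℝ => D.bot e + z.2 * (D.top e - D.bot e))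
      (Icc 0 1 ×ˢ Icc 0 1) := by fun_prop
    have c1 := (hD.cont e).comp c0 hm
    have c2 := (hcD' e).comp c0 hm
    refine ContinuousOn.prodMk ?_ c0
    simp only [interp]
    exact (ContinuousOn.mul (by fun_prop) c1).add (ContinuousOn.mul (by fun_prop) c2)
  have h := deforms_of_family pl.toIsFlow (interp D D') hval hc (by simp) (by simp)
  have e0 : interp D D' 0 = D := by
    cases D; simp [interp]
  have e1 : interp D D' 1 = D' := by
    cases D; cases D'
    simp only [interp, mk.injEq] at *
    refine ⟨hlo, hhi, funext fun v => Prod.ext (by simp) (hpt v), by simp⟩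
  have g0 : (hval 0 (by simp)).toLeveled pl.toIsFlow = hD.toLeveled pl.toIsFlow := by
    congr 1
  have g1 : (hval 1 (by simp)).toLeveled pl.toIsFlow = hD'.toLeveled pl.toIsFlow := by
    congr 1
  rwa [g0, g1] at h

end Drawing

open OpenGraph

/-! ## Canonical drawings -/

/-- Levels for the vertices of an open graph, with a lower bound for the heights of the edges. -/
structure Heights (S : OpenGraph) where
  lo : ℝ
  hi : ℝ
  gap : ℝ
  y : S.V → ℝ

namespace Heights

variable {S : OpenGraph} (H : Heights S) (r : S.E → S.E → Prop)

/-- The level at which `e` begins. -/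
def bot (e : S.E) : ℝ := (S.src e).elim H.lo H.y

/-- The level at which `e` ends. -/
def top (e : S.E) : ℝ := (S.tgt e).elim H.hi H.y

/-- The levels of the ends of every edge differ by at least `gap`. -/
structure IsAdmissible : Prop where
  gap_pos : 0 < H.gap
  lt : H.lo < H.hi
  bounds : ∀ v, H.lo < H.y v ∧ H.y v < H.hi
  gap_le : ∀ e, H.gap ≤ H.top e - H.bot e

open Classical in
/-- The last outgoing edge of a vertex has positive weight already below that vertex. -/
def below (e : S.E) : ℝ :=
  if S.src e = none ∨ ∀ f, S.src f = S.src e → ¬ r e f then H.gap else 0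

open Classical in
/-- Edges without target have positive weight at the level `hi`. -/
def above (e : S.E) : ℝ := if S.tgt e = none then H.gap else 0

/-- The width of a strip that is reserved for `e`. -/
def weight (e : S.E) (u : ℝ) : ℝ := max 0 (min (u - H.bot e + H.below r e) (H.top e - u + H.above e))

open Classical in
/-- The first coordinate of `e` at level `u`. -/
def pos [Fintype S.E] (e : S.E) (u : ℝ) : ℝ := ∑ f, if r f e then H.weight r f u else 0

open Classical in
/-- The canonical drawing with given levels. -/
def toDrawing [Fintype S.E] : Drawing S where
  lo := H.lo
  hi := H.hi
  pt v := (if h : ∃ e, S.tgt e = some v then H.pos r h.choose (H.y v) else 0, H.y v)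
  x := H.pos r

variable {H r}

theorem bot_of_src {e : S.E} {v : S.V} (h : S.src e = some v) : H.bot e = H.y v := by
  simp [bot, h]

theorem top_of_tgt {e : S.E} {v : S.V} (h : S.tgt e = some v) : H.top e = H.y v := by
  simp [top, h]

theorem below_nonneg (hH : H.IsAdmissible) (e : S.E) : 0 ≤ H.below r e := by
  unfold below; split_ifs
  · exact hH.gap_pos.le
  · exact le_rfl

theorem below_le (hH : H.IsAdmissible) (e : S.E) : H.below r e ≤ H.gap := by
  unfold below; split_ifs
  · exact le_rfl
  · exact hH.gap_pos.le

theorem above_nonneg (hH : H.IsAdmissible) (e : S.E) : 0 ≤ H.above e := by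
  unfold above; split_ifs
  · exact hH.gap_pos.le
  · exact le_rfl

theorem weight_nonneg (e : S.E) (u : ℝ) : 0 ≤ H.weight r e u := le_max_left _ _

theorem weight_pos_iff (e : S.E) (u : ℝ) : 0 < H.weight r e u ↔
    0 < u - H.bot e + H.below r e ∧ 0 < H.top e - u + H.above e := by
  simp [weight]

theorem weight_eq_zero {e : S.E} {u : ℝ}
    (h : u - H.bot e + H.below r e ≤ 0 ∨ H.top e - u + H.above e ≤ 0) : H.weight r e u = 0 := by
  by_contra hn
  have := (weight_pos_iff e u).1 (lt_of_le_of_ne (weight_nonneg e u) (Ne.symm hn))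
  rcases h with h | h
  · linarith [this.1]
  · linarith [this.2]

theorem bot_lt_top (hH : H.IsAdmissible) (e : S.E) : H.bot e < H.top e := by
  linarith [hH.gap_le e, hH.gap_pos]

theorem eq_or_le_of_path (hH : H.IsAdmissible) {e f : S.E} (h : S.Path e f) :
    e = f ∨ H.top e ≤ H.bot f := by
  have hs : ∀ e f, S.Step e f → H.top e = H.bot f := by
    rintro e f ⟨v, h1, h2⟩
    rw [top_of_tgt h1, bot_of_src h2]
  induction h with
  | refl => exact Or.inl rfl
  | tail _ st ih =>
    right
    rcases ih with rfl | ih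
    · exact (hs _ _ st).le
    · rw [← hs _ _ st]
      exact ih.trans (bot_lt_top hH _).le

variable (pl : S.IsPlanar r) (hH : H.IsAdmissible)

include pl in
theorem exists_in_le {e : S.E} {v : S.V} (he : S.Inc e v) :
    ∃ a, S.tgt a = some v ∧ (a = e ∨ r a e) := by
  rcases he with he | he
  · obtain ⟨a, ha⟩ := pl.exists_in v
    exact ⟨a, ha, Or.inr (pl.step _ _ ⟨v, ha, he⟩)⟩
  · exact ⟨e, he, Or.inl rfl⟩

include pl in
theorem exists_out_ge {e : S.E} {v : S.V} (he : S.Inc e v) :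
    ∃ o, S.src o = some v ∧ (e = o ∨ r e o) := by
  rcases he with he | he
  · exact ⟨e, he, Or.inl rfl⟩
  · obtain ⟨a, ha⟩ := pl.exists_out v
    exact ⟨a, ha, Or.inr (pl.step _ _ ⟨v, he, ha⟩)⟩

include pl in
/-- An edge strictly between an incoming and an outgoing edge of `v` has a target before `v` or a
source after `v`. -/
theorem before_or_after {a o f : S.E} {v : S.V} (ha : S.tgt a = some v) (ho : S.src o = some v)
    (h1 : r a f) (h2 : r f o) :
    (∃ g, S.Path f g ∧ S.tgt g = some v) ∨ ∃ g, S.Path g f ∧ S.src g = some v := by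
  rcases pl.between a o f (Step.path ⟨v, ha, ho⟩) h1 h2 with p | p
  · left
    rcases p.cases_tail with rfl | ⟨g, pg, w, hw, hw'⟩
    · exact (pl.irrefl _ h2).elim
    · exact ⟨g, pg, hw.trans (hw'.symm.trans ho)⟩
  · right
    rcases p.cases_head with rfl | ⟨g, ⟨w, hw, hw'⟩, pg⟩
    · exact (pl.irrefl _ h1).elim
    · exact ⟨g, pg, hw'.trans (hw.symm.trans ha)⟩

include pl hH

/-- By P2, `f` either leads to an edge with target `v` or is reached from one with source `v`. In
the first case `f` has a target and ends at or below the level of `v`. In the second case either `f`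
begins in `v` and is not its last outgoing edge, so that `below` is `0`, or `f` begins higher by at
least `gap`, which compensates `below`. -/
theorem weight_between {e e' f : S.E} {v : S.V} (he : S.Inc e v) (he' : S.Inc e' v)
    (h1 : f = e ∨ r e f) (h2 : r f e') : H.weight r f (H.y v) = 0 := by
  obtain ⟨a, ha, hae⟩ := exists_in_le pl he
  obtain ⟨o, ho, heo⟩ := exists_out_ge pl he'
  have hfo : r f o := by
    rcases heo with rfl | h
    · exact h2
    · exact pl.trans _ _ _ h2 h
  have haf : f = a ∨ r a f := by
    rcases hae with rfl | h
    · exact h1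
    · rcases h1 with rfl | h1
      · exact Or.inr h
      · exact Or.inr (pl.trans _ _ _ h h1)
  have before : ∀ g, S.Path f g → S.tgt g = some v → H.weight r f (H.y v) = 0 := by
    intro g p hg
    apply weight_eq_zero
    right
    have hn : S.tgt f ≠ none := by
      intro hn
      rw [p.eq_of_tgt hn, hg] at hn
      simp at hn
    rw [above, if_neg hn]
    rw [← top_of_tgt hg]
    rcases eq_or_le_of_path hH p with rfl | h
    · simp
    · linarith [bot_lt_top hH g]
  rcases haf with rfl | haf
  · exact before f (OpenGraph.Path.refl f) ha
  rcases before_or_after pl ha ho haf hfo with ⟨g, p, hg⟩ | ⟨g, p, hg⟩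
  · exact before g p hg
  · apply weight_eq_zero
    left
    rw [← bot_of_src hg]
    rcases eq_or_le_of_path hH p with rfl | h
    · have : ¬ (S.src g = none ∨ ∀ f, S.src f = S.src g → ¬ r g f) := by
        push Not
        exact ⟨by rw [hg]; simp, o, by rw [ho, hg], hfo⟩
      rw [below, if_neg this]
      simp
    · have h3 := below_le (r := r) hH f
      have h4 := hH.gap_le g
      linarith

variable [Fintype S.E]

omit hH in
theorem pos_mono {e f : S.E} (h : r e f) (u : ℝ) : H.pos r e u ≤ H.pos r f u := by
  refine Finset.sum_le_sum fun g _ => ?_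
  by_cases h1 : r g e
  · rw [if_pos h1, if_pos (pl.trans _ _ _ h1 h)]
  · rw [if_neg h1]
    split_ifs
    · exact weight_nonneg _ _
    · exact le_rfl

omit hH in
-- The difference of the two positions is the sum of the nonnegative weights of the edges from `e`,
-- included, to `f`, excluded.
theorem weight_eq_zero_of_pos_eq {e f g : S.E} (h : r e f) {u : ℝ}
    (hp : H.pos r e u = H.pos r f u) (h1 : ¬ r g e) (h2 : r g f) : H.weight r g u = 0 := by
  by_contra hn
  refine hp.not_lt (Finset.sum_lt_sum (fun k _ => ?_) ⟨g, Finset.mem_univ _, ?_⟩)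
  · by_cases h1 : r k e
    · rw [if_pos h1, if_pos (pl.trans _ _ _ h1 h)]
    · rw [if_neg h1]
      split_ifs
      · exact weight_nonneg _ _
      · exact le_rfl
  · rw [if_neg h1, if_pos h2]
    exact lt_of_le_of_ne (weight_nonneg _ _) (Ne.symm hn)

/-- All the weights that make up the difference of the positions vanish at the level of `v`, by
`weight_between`. -/
theorem pos_eq_of_inc {e f : S.E} {v : S.V} (he : S.Inc e v) (hf : S.Inc f v) :
    H.pos r e (H.y v) = H.pos r f (H.y v) := by
  have key : ∀ e f, S.Inc e v → S.Inc f v → r e f → H.pos r e (H.y v) = H.pos r f (H.y v) := by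
    intro e f he hf h
    refine Finset.sum_congr rfl fun g _ => ?_
    by_cases h1 : r g e
    · rw [if_pos h1, if_pos (pl.trans _ _ _ h1 h)]
    · rw [if_neg h1]
      split_ifs with h2
      · have : g = e ∨ r e g := by
          rcases pl.total g e with h | h | h
          · exact (h1 h).elim
          · exact Or.inl h
          · exact Or.inr h
        exact (weight_between pl hH he hf this h2).symm
      · rfl
  rcases pl.total e f with h | rfl | h
  · exact key _ _ he hf h
  · rfl
  · exact (key _ _ hf he h).symm

/-- Equal positions force the weight of `e` itself to vanish at `u`. A free end is excluded by its
additional `gap`, so `u` is the level of an end `v` of `e`. The last outgoing edge `o` of `v` has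
positive weight there, so it does not come before `f`. Thus `f` lies between an incoming edge of `v`
and `o`, or is `o`; P2 places it before or after `v`, and as it is present at the level of `v`, it
ends or begins in `v`. -/
theorem exists_inc_of_pos_eq {e f : S.E} {u : ℝ} (h : r e f)
    (he : u ∈ Icc (H.bot e) (H.top e)) (hf : u ∈ Icc (H.bot f) (H.top f))
    (hp : H.pos r e u = H.pos r f u) : ∃ v, S.Inc e v ∧ S.Inc f v ∧ H.y v = u := by
  have hw := weight_eq_zero_of_pos_eq pl h hp (pl.irrefl e) h
  obtain ⟨v, hev, hv⟩ : ∃ v, S.Inc e v ∧ H.y v = u := by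
    have h1 : ¬ (0 < u - H.bot e + H.below r e ∧ 0 < H.top e - u + H.above e) := by
      rw [← weight_pos_iff, hw]; exact lt_irrefl _
    by_cases h2 : 0 < u - H.bot e + H.below r e
    · have h3 : ¬ 0 < H.top e - u + H.above e := fun h3 => h1 ⟨h2, h3⟩
      have h4 := above_nonneg hH e
      have h5 : u = H.top e := by linarith [he.2]
      cases ht : S.tgt e with
      | none =>
        rw [above, if_pos ht] at h3
        linarith [hH.gap_pos]
      | some v => exact ⟨v, Or.inr ht, by rw [h5, top_of_tgt ht]⟩
    · have h4 := below_nonneg (r := r) hH e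
      have h5 : u = H.bot e := by linarith [he.1]
      cases ht : S.src e with
      | none =>
        rw [below, if_pos (Or.inl ht)] at h2
        linarith [hH.gap_pos]
      | some v => exact ⟨v, Or.inl ht, by rw [h5, bot_of_src ht]⟩
  obtain ⟨a, ha, hae⟩ := exists_in_le pl hev
  -- A minimal element for the reversed order is the last outgoing edge, the one to which `below`
  -- gives positive weight already at `v`.
  obtain ⟨o, ho, hmax⟩ := pl.wellFounded_swap.has_min {o | S.src o = some v} (pl.exists_out v)
  have hmax : ∀ f, S.src f = some v → ¬ r o f := fun f hf hl => hmax f hf hl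
  have hoe : ¬ r o e := by
    rcases hev with hs | ht
    · exact hmax e hs
    · exact fun hl => pl.asymm hl (pl.step _ _ ⟨v, ht, ho⟩)
  have hwo : 0 < H.weight r o u := by
    rw [weight_pos_iff, bot_of_src ho, hv, below,
      if_pos (Or.inr fun f hf => hmax f (hf.trans ho))]
    have h1 := hH.gap_le o
    have h2 := above_nonneg hH o
    have h3 := hH.gap_pos
    rw [bot_of_src ho, hv] at h1
    constructor <;> linarith
  have hof : ¬ r o f := fun hl => hwo.ne' (weight_eq_zero_of_pos_eq pl h hp hoe hl)
  refine ⟨v, hev, ?_, hv⟩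
  rcases pl.total o f with hl | rfl | hl
  · exact (hof hl).elim
  · exact Or.inl ho
  have haf : r a f := by
    rcases hae with rfl | hae
    · exact h
    · exact pl.trans _ _ _ hae h
  rcases before_or_after pl ha ho haf hl with ⟨g, p, hg⟩ | ⟨g, p, hg⟩
  · rcases eq_or_le_of_path hH p with rfl | h'
    · exact Or.inr hg
    · have := bot_lt_top hH g
      rw [top_of_tgt hg] at this
      linarith [hf.2]
  · rcases eq_or_le_of_path hH p with rfl | h'
    · exact Or.inl hg
    · have := bot_lt_top hH g
      rw [bot_of_src hg] at this
      linarith [hf.1]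

omit pl hH in
theorem toDrawing_bot (e : S.E) : (H.toDrawing r).bot e = H.bot e := by
  cases h : S.src e <;> simp [Drawing.bot, bot, h, toDrawing]

omit pl hH in
theorem toDrawing_top (e : S.E) : (H.toDrawing r).top e = H.top e := by
  cases h : S.tgt e <;> simp [Drawing.top, top, h, toDrawing]

omit pl hH in
theorem continuous_pos (e : S.E) : Continuous (H.pos r e) := by
  unfold pos weight
  refine continuous_finsetSum _ fun f _ => ?_
  split_ifs
  · fun_prop
  · exact continuous_const

theorem isValid_toDrawing : (H.toDrawing r).IsValid := by
  have hpt : ∀ e v, S.Inc e v → H.pos r e (H.y v) = ((H.toDrawing r).pt v).1 := by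
    intro e v he
    have h := pl.exists_in v
    simp only [toDrawing, dif_pos h]
    exact pos_eq_of_inc pl hH he (Or.inr h.choose_spec)
  refine
    { lt := hH.lt
      bounds := hH.bounds
      bot_lt_top := fun e => by rw [toDrawing_bot, toDrawing_top]; exact bot_lt_top hH e
      cont := fun e => (continuous_pos e).continuousOn
      x_src := fun e v h => hpt e v (Or.inl h)
      x_tgt := fun e v h => hpt e v (Or.inr h)
      disj := ?_ }
  intro e f u hne he hf hx
  rw [toDrawing_bot, toDrawing_top] at he hf
  rcases pl.total e f with h | h | h
  · exact exists_inc_of_pos_eq pl hH h he hf hx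
  · exact (hne h).elim
  · obtain ⟨v, v1, v2, v3⟩ := exists_inc_of_pos_eq pl hH h hf he hx.symm
    exact ⟨v, v2, v1, v3⟩

omit hH in
theorem isOrdered_toDrawing : (H.toDrawing r).IsOrdered r := fun _ _ u h _ _ => pos_mono pl h u

end Heights

/-! ### Existence of drawings and their uniqueness up to deformation -/

namespace Drawing

variable {S : OpenGraph} {r : S.E → S.E → Prop}

theorem _root_.TensorCalc.exists_pos_le {α : Type*} [Finite α] (f : α → ℝ) (hf : ∀ a, 0 < f a) :
    ∃ c > 0, ∀ a, c ≤ f a := by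
  cases isEmpty_or_nonempty α
  · exact ⟨1, one_pos, fun a => isEmptyElim a⟩
  · obtain ⟨a, ha⟩ := Finite.exists_min f
    exact ⟨f a, hf a, ha⟩

/-- Any two ordered drawings of an open graph are deformations of each other. -/
theorem deforms (pl : S.IsPlanar r) {D D' : Drawing S} (hD : D.IsValid) (hD' : D'.IsValid)
    (ho : D.IsOrdered r) (ho' : D'.IsOrdered r) :
    Deforms (hD.toLeveled pl.toIsFlow) (hD'.toLeveled pl.toIsFlow) := by
  have := pl.finite_E
  let := Fintype.ofFinite S.E
  obtain ⟨c, c0, hc⟩ := exists_pos_le (fun e => min (D.top e - D.bot e) (D'.top e - D'.bot e))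
    fun e => lt_min (by linarith [hD.bot_lt_top e]) (by linarith [hD'.bot_lt_top e])
  -- The levels move linearly from those of `D` to those of `D'`. The bound `c` serves all times at
  -- once, since the heights of the edges are interpolated as well.
  let H : ℝ → Heights S := fun t =>
    { lo := (1 - t) * D.lo + t * D'.lo
      hi := (1 - t) * D.hi + t * D'.hi
      gap := c
      y := fun v => (1 - t) * (D.pt v).2 + t * (D'.pt v).2 }
  have hbot : ∀ t e, (H t).bot e = (1 - t) * D.bot e + t * D'.bot e := fun t e => by
    cases h : S.src e <;> simp [bot, Heights.bot, h, H]
  have htop : ∀ t e, (H t).top e = (1 - t) * D.top e + t * D'.top e := fun t e => by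
    cases h : S.tgt e <;> simp [top, Heights.top, h, H]
  have conv : ∀ t ∈ Icc (0 : ℝ) 1, ∀ a b a' b' : ℝ, a < b → a' < b' →
      (1 - t) * a + t * a' < (1 - t) * b + t * b' := by
    rintro t ⟨t0, t1⟩ a b a' b' h h'
    rcases t1.lt_or_eq with t1 | rfl
    · nlinarith [mul_pos (sub_pos.2 t1) (sub_pos.2 h), mul_nonneg t0 (sub_pos.2 h').le]
    · linarith
  have hadm : ∀ t ∈ Icc (0 : ℝ) 1, (H t).IsAdmissible := by
    intro t ht
    refine
      { gap_pos := c0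
        lt := conv t ht _ _ _ _ hD.lt hD'.lt
        bounds := fun v => ⟨conv t ht _ _ _ _ (hD.bounds v).1 (hD'.bounds v).1,
          conv t ht _ _ _ _ (hD.bounds v).2 (hD'.bounds v).2⟩
        gap_le := fun e => ?_ }
    rw [hbot, htop]
    have h1 := (hc e).trans (min_le_left _ _)
    have h2 := (hc e).trans (min_le_right _ _)
    change c ≤ _
    nlinarith [mul_le_mul_of_nonneg_left h1 (sub_nonneg.2 ht.2),
      mul_le_mul_of_nonneg_left h2 ht.1]
  have m0 : (0 : ℝ) ∈ Icc (0 : ℝ) 1 := by simp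
  have m1 : (1 : ℝ) ∈ Icc (0 : ℝ) 1 := by simp
  -- The deformation has three stages: at fixed levels from `D` to a canonical drawing, through
  -- canonical drawings while the levels move, and at fixed levels to `D'`. In the middle stage the
  -- combinatorial conditions in the weights do not depend on `t`, so the positions are continuous
  -- in `t`.
  have hmid : Deforms ((Heights.isValid_toDrawing pl (hadm 0 m0)).toLeveled pl.toIsFlow)
      ((Heights.isValid_toDrawing pl (hadm 1 m1)).toLeveled pl.toIsFlow) := by
    refine deforms_of_family pl.toIsFlow (fun t => (H t).toDrawing r)
      (fun t ht => Heights.isValid_toDrawing pl (hadm t ht)) (fun e => ?_) m0 m1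
    refine Continuous.continuousOn ?_
    simp only [path, point, Heights.toDrawing_bot, Heights.toDrawing_top, hbot, htop]
    refine Continuous.prodMk ?_ (by fun_prop)
    have hgap : ∀ t, (H t).gap = c := fun _ => rfl
    simp only [Heights.toDrawing, Heights.pos, Heights.weight, hbot, htop, Heights.below,
      Heights.above, hgap]
    refine continuous_finsetSum _ fun f _ => ?_
    split_ifs <;> fun_prop
  have h0 := deforms_of_levels_eq pl hD (Heights.isValid_toDrawing pl (hadm 0 m0)) ho
    (Heights.isOrdered_toDrawing pl) (by simp [Heights.toDrawing, H])
    (by simp [Heights.toDrawing, H]) (by simp [Heights.toDrawing, H])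
  have h1 := deforms_of_levels_eq pl (Heights.isValid_toDrawing pl (hadm 1 m1)) hD'
    (Heights.isOrdered_toDrawing pl) ho' (by simp [Heights.toDrawing, H])
    (by simp [Heights.toDrawing, H]) (by simp [Heights.toDrawing, H])
  exact (h0.trans hmid).trans h1

/-- Rescaling of the first coordinate. -/
def scale (D : Drawing S) (c : ℝ) : Drawing S where
  lo := D.lo
  hi := D.hi
  pt v := (c * (D.pt v).1, (D.pt v).2)
  x e u := c * D.x e u

theorem IsValid.scale {D : Drawing S} (hD : D.IsValid) {c : ℝ} (hc : 0 < c) :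
    (D.scale c).IsValid where
  lt := hD.lt
  bounds := hD.bounds
  bot_lt_top := hD.bot_lt_top
  cont e := continuousOn_const.mul (hD.cont e)
  x_src e v h := congrArg (c * ·) (hD.x_src e v h)
  x_tgt e v h := congrArg (c * ·) (hD.x_tgt e v h)
  disj e f u hne he hf hx := hD.disj e f u hne he hf (mul_left_cancel₀ hc.ne' hx)

theorem IsOrdered.scale {D : Drawing S} (ho : D.IsOrdered r) {c : ℝ} (hc : 0 < c) :
    (D.scale c).IsOrdered r :=
  fun e f u h he hf => mul_le_mul_of_nonneg_left (ho e f u h he hf) hc.le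

/-- Every planar open graph has a drawing in the box. -/
theorem exists_boxed (pl : S.IsPlanar r) : ∃ (D : Drawing S) (_ : D.IsValid), D.IsOrdered r ∧
    D.lo = -1 ∧ D.hi = 1 ∧ ∀ p ∈ D.toPlane.carrier, p.1 ∈ Ioo (-1 : ℝ) 1 := by
  classical
  have := pl.finite_E
  let := Fintype.ofFinite S.E
  let rk : S.E → ℕ := fun e => (Finset.univ.filter fun f => r f e).card
  have rk_lt : ∀ e f, r e f → rk e < rk f := by
    intro e f h
    refine Finset.card_lt_card (Finset.ssubset_iff_of_subset (fun g hg => ?_) |>.2 ⟨e, ?_, ?_⟩)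
    · simp only [Finset.mem_filter, Finset.mem_univ, true_and] at hg ⊢
      exact pl.trans _ _ _ hg h
    · simpa using h
    · simpa using pl.irrefl e
  have rk_le : ∀ e, rk e + 1 ≤ Fintype.card S.E := fun e =>
    Finset.card_lt_univ_of_notMem (x := e) (by simpa using pl.irrefl e)
  -- The height of a vertex is one more than the largest rank of an incoming edge. Outgoing edges
  -- come later in `r`, so heights increase along edges.
  let g : S.V → ℕ := fun v => (Finset.univ.filter fun e => S.tgt e = some v).sup fun e => rk e + 1
  have hg1 : ∀ e v, S.tgt e = some v → rk e + 1 ≤ g v := fun e v h =>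
    Finset.le_sup (f := fun e => rk e + 1) (by simpa using h)
  have hg2 : ∀ e v, S.src e = some v → g v ≤ rk e := fun e v h =>
    Finset.sup_le fun f hf => rk_lt f e (pl.step _ _ ⟨v, by simpa using hf, h⟩)
  have hg3 : ∀ v, 1 ≤ g v := fun v => by
    obtain ⟨e, he⟩ := pl.exists_in v
    exact (Nat.le_add_left _ _).trans (hg1 e v he)
  have hg4 : ∀ v, g v ≤ Fintype.card S.E := fun v => Finset.sup_le fun f _ => rk_le f
  -- The heights lie between `1` and the number of edges; dividing by one more than that number
  -- keeps all levels strictly between `-1` and `1`.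
  set n : ℝ := (Fintype.card S.E : ℝ) + 1 with hn
  have n0 : 0 < n := by positivity
  let y : S.V → ℝ := fun v => -1 + 2 * (g v / n)
  have hg1' : ∀ v, (0 : ℝ) < g v := fun v => by exact_mod_cast hg3 v
  have hg4' : ∀ v, (g v : ℝ) < n := fun v => by
    have : (g v : ℝ) ≤ Fintype.card S.E := by exact_mod_cast hg4 v
    linarith
  have hy : ∀ v, -1 < y v ∧ y v < 1 := fun v => by
    have h1 : 0 < g v / n := div_pos (hg1' v) n0
    have h2 : g v / n < 1 := (div_lt_one n0).2 (hg4' v)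
    constructor <;> simp only [y] <;> linarith
  let B : S.E → ℝ := fun e => (S.src e).elim (-1) y
  let T : S.E → ℝ := fun e => (S.tgt e).elim 1 y
  have hBT : ∀ e, 0 < T e - B e := by
    intro e
    cases hs : S.src e with
    | none =>
      cases ht : S.tgt e with
      | none => simp [B, T, hs, ht]
      | some w => simp only [B, T, hs, ht, Option.elim]; linarith [(hy w).1]
    | some v =>
      cases ht : S.tgt e with
      | none => simp only [B, T, hs, ht, Option.elim]; linarith [(hy v).2]
      | some w =>
        simp only [B, T, hs, ht, Option.elim, y]
        have h1 : (g v : ℝ) < g w := by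
          exact_mod_cast (hg2 e v hs).trans_lt (hg1 e w ht)
        have := div_lt_div_of_pos_right h1 n0
        linarith
  obtain ⟨c, c0, hc⟩ := exists_pos_le _ hBT
  let H : Heights S := ⟨-1, 1, c, y⟩
  have hH : H.IsAdmissible := ⟨c0, by norm_num [H], hy, hc⟩
  have hD := Heights.isValid_toDrawing pl hH
  -- The drawing is compact, so its first coordinates are bounded and can be scaled into the box.
  obtain ⟨M, hM⟩ := ((hD.isCompact_carrier pl.toIsFlow).image continuous_fst).isBounded.exists_norm_le
  have hM0 : 0 < |M| + 1 := by positivity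
  have hs : 0 < (|M| + 1)⁻¹ := inv_pos.2 hM0
  refine ⟨_, hD.scale hs, (Heights.isOrdered_toDrawing pl).scale hs, rfl, rfl, ?_⟩
  intro p hp
  obtain ⟨e, u, hu, rfl⟩ := mem_iUnion.1 hp
  have := hM ((H.toDrawing r).x e u) ⟨_, mem_iUnion.2 ⟨e, u, hu, rfl⟩, rfl⟩
  rw [Real.norm_eq_abs] at this
  have h2 : |(H.toDrawing r).x e u| < |M| + 1 := by linarith [le_abs_self M]
  obtain ⟨h3, h4⟩ := abs_lt.1 h2
  change (|M| + 1)⁻¹ * (H.toDrawing r).x e u ∈ _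
  rw [inv_mul_eq_div]
  constructor
  · rw [lt_div_iff₀ hM0]; linarith
  · rw [div_lt_one hM0]; exact h4

end Drawing

/-! ## Deformations preserve the combinatorial structure -/

/-- Continuity of `a` and `b` need not be known. The set is the projection to the time axis of the
compact set of all `(t, l, m)` for which `p t l` and `q t m` are at level `u t` and the first is not
to the right of the second. -/
theorem isClosed_setOf_le_of_moving {p q : ℝ → ℝ → ℝ × ℝ} {u a b : ℝ → ℝ}
    (hp : ContinuousOn (Function.uncurry p) (Icc (0 : ℝ) 1 ×ˢ Icc (0 : ℝ) 1))
    (hq : ContinuousOn (Function.uncurry q) (Icc (0 : ℝ) 1 ×ˢ Icc (0 : ℝ) 1))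
    (hu : ContinuousOn u (Icc 0 1))
    (exa : ∀ t ∈ Icc (0 : ℝ) 1, ∃ l ∈ Icc (0 : ℝ) 1, p t l = (a t, u t))
    (exb : ∀ t ∈ Icc (0 : ℝ) 1, ∃ l ∈ Icc (0 : ℝ) 1, q t l = (b t, u t))
    (una : ∀ t ∈ Icc (0 : ℝ) 1, ∀ l ∈ Icc (0 : ℝ) 1, (p t l).2 = u t → (p t l).1 = a t)
    (unb : ∀ t ∈ Icc (0 : ℝ) 1, ∀ l ∈ Icc (0 : ℝ) 1, (q t l).2 = u t → (q t l).1 = b t) :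
    IsClosed {t ∈ Icc (0 : ℝ) 1 | a t ≤ b t} := by
  let Q : Set (ℝ × ℝ × ℝ) := Icc (0 : ℝ) 1 ×ˢ (Icc (0 : ℝ) 1 ×ˢ Icc (0 : ℝ) 1)
  have hQ : IsCompact Q := isCompact_Icc.prod (isCompact_Icc.prod isCompact_Icc)
  let F : ℝ × ℝ × ℝ → ℝ × ℝ × ℝ := fun z =>
    ((p z.1 z.2.1).2 - u z.1, (q z.1 z.2.2).2 - u z.1, (p z.1 z.2.1).1 - (q z.1 z.2.2).1)
  have hp' : ContinuousOn (fun z : ℝ × ℝ × ℝ => p z.1 z.2.1) Q :=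
    hp.comp (f := fun z : ℝ × ℝ × ℝ => (z.1, z.2.1)) (by fun_prop) fun z hz => ⟨hz.1, hz.2.1⟩
  have hq' : ContinuousOn (fun z : ℝ × ℝ × ℝ => q z.1 z.2.2) Q :=
    hq.comp (f := fun z : ℝ × ℝ × ℝ => (z.1, z.2.2)) (by fun_prop) fun z hz => ⟨hz.1, hz.2.2⟩
  have hu' : ContinuousOn (fun z : ℝ × ℝ × ℝ => u z.1) Q :=
    hu.comp (f := fun z : ℝ × ℝ × ℝ => z.1) (by fun_prop) fun z hz => hz.1
  have hF : ContinuousOn F Q :=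
    ((continuous_snd.comp_continuousOn hp').sub hu').prodMk
      (((continuous_snd.comp_continuousOn hq').sub hu').prodMk
        ((continuous_fst.comp_continuousOn hp').sub (continuous_fst.comp_continuousOn hq')))
  have hcl : IsClosed {w : ℝ × ℝ × ℝ | w.1 = 0 ∧ w.2.1 = 0 ∧ w.2.2 ≤ 0} :=
    (isClosed_eq continuous_fst continuous_const).inter
      ((isClosed_eq (continuous_fst.comp continuous_snd) continuous_const).inter
        (isClosed_le (continuous_snd.comp continuous_snd) continuous_const))
  have hK := hF.preimage_isClosed_of_isClosed hQ.isClosed hcl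
  have hK' := (hQ.of_isClosed_subset hK inter_subset_left).image continuous_fst
  convert hK'.isClosed using 1
  ext t
  constructor
  · rintro ⟨ht, hle⟩
    obtain ⟨l, hl, hl'⟩ := exa t ht
    obtain ⟨m, hm, hm'⟩ := exb t ht
    exact ⟨(t, l, m), ⟨⟨ht, hl, hm⟩, by simpa [F, hl', hm'] using hle⟩, rfl⟩
  · rintro ⟨⟨t, l, m⟩, ⟨⟨ht, hl, hm⟩, h1, h2, h3⟩, rfl⟩
    dsimp only [F] at h1 h2 h3 ht hl hm
    refine ⟨ht, ?_⟩
    have h1 := una t ht l hl (by linarith)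
    have h2 := unb t ht m hm (by linarith)
    linarith

/-- Two moving curves that never meet at the level `u t` keep their order at this level. -/
theorem lt_of_moving {p q : ℝ → ℝ → ℝ × ℝ} {u a b : ℝ → ℝ}
    (hp : ContinuousOn (Function.uncurry p) (Icc (0 : ℝ) 1 ×ˢ Icc (0 : ℝ) 1))
    (hq : ContinuousOn (Function.uncurry q) (Icc (0 : ℝ) 1 ×ˢ Icc (0 : ℝ) 1))
    (hu : ContinuousOn u (Icc 0 1))
    (exa : ∀ t ∈ Icc (0 : ℝ) 1, ∃ l ∈ Icc (0 : ℝ) 1, p t l = (a t, u t))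
    (exb : ∀ t ∈ Icc (0 : ℝ) 1, ∃ l ∈ Icc (0 : ℝ) 1, q t l = (b t, u t))
    (una : ∀ t ∈ Icc (0 : ℝ) 1, ∀ l ∈ Icc (0 : ℝ) 1, (p t l).2 = u t → (p t l).1 = a t)
    (unb : ∀ t ∈ Icc (0 : ℝ) 1, ∀ l ∈ Icc (0 : ℝ) 1, (q t l).2 = u t → (q t l).1 = b t)
    (ne : ∀ t ∈ Icc (0 : ℝ) 1, a t ≠ b t) (h : a 0 ≤ b 0) : a 1 < b 1 := by
  by_contra hn
  have m0 : (0 : ℝ) ∈ Icc (0 : ℝ) 1 := by simp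
  have m1 : (1 : ℝ) ∈ Icc (0 : ℝ) 1 := by simp
  -- The sets of times with `a ≤ b` and with `b ≤ a` are closed and cover `[0, 1]`. If both were
  -- nonempty, connectedness would give a time with `a = b`.
  obtain ⟨t, ht, h1, h2⟩ := isPreconnected_closed_iff.1 (isPreconnected_Icc (a := (0 : ℝ)) (b := 1))
    _ _ (isClosed_setOf_le_of_moving hp hq hu exa exb una unb)
    (isClosed_setOf_le_of_moving hq hp hu exb exa unb una)
    (fun t ht => (le_total (a t) (b t)).imp (fun h => ⟨ht, h⟩) fun h => ⟨ht, h⟩)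
    ⟨0, m0, m0, h⟩ ⟨1, m1, m1, not_lt.1 hn⟩
  exact ne t ht (le_antisymm h1.2 h2.2)

namespace Drawing

theorem path_mem_arc {S : OpenGraph} {D : Drawing S} (hD : D.IsValid) (e : S.E) {l : ℝ}
    (hl : l ∈ Icc (0 : ℝ) 1) : D.path e l ∈ D.arc e := by
  rw [hD.arc_eq_image]; exact mem_image_of_mem _ hl

theorem path_mem_carrier {S : OpenGraph} {D : Drawing S} (hD : D.IsValid) (e : S.E) {l : ℝ}
    (hl : l ∈ Icc (0 : ℝ) 1) : D.path e l ∈ D.toPlane.carrier :=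
  mem_iUnion.2 ⟨e, path_mem_arc hD e hl⟩

theorem continuousOn_path {S : OpenGraph} {D : Drawing S} (hD : D.IsValid) (e : S.E) :
    ContinuousOn (D.path e) (Icc 0 1) :=
  (hD.continuousOn_point e).comp (by fun_prop) fun _ hl => hD.level_mem hl

variable {S S' : OpenGraph} {D : Drawing S} {D' : Drawing S'}

/-- A homeomorphism that maps nodes to nodes maps arcs to arcs and end points to end points. -/
theorem exists_equiv_edges (fl : S.IsFlow) (fl' : S'.IsFlow) (hD : D.IsValid) (hD' : D'.IsValid)
    {f : ℝ × ℝ → ℝ × ℝ} (hf : IsEmbedding (D.toPlane.carrier.domRestrict f))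
    (him : D.toPlane.image f = D'.toPlane) :
    ∃ θ : S.E ≃ S'.E, (∀ e, ∀ l ∈ Icc (0 : ℝ) 1, f (D.path e l) ∈ D'.arc (θ e)) ∧
      ∀ e, (f (D.path e 0) = D'.path (θ e) 0 ∧ f (D.path e 1) = D'.path (θ e) 1) ∨
        (f (D.path e 0) = D'.path (θ e) 1 ∧ f (D.path e 1) = D'.path (θ e) 0) := by
  have hC : f '' D.toPlane.carrier = D'.toPlane.carrier := congrArg PlaneGraph.carrier him
  have hN : f '' D.toPlane.nodes = D'.toPlane.nodes := congrArg PlaneGraph.nodes him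
  have hsub : D.toPlane.nodes ⊆ D.toPlane.carrier := (hD.isLeveled fl).nodes_subset
  have hsub' : D'.toPlane.nodes ⊆ D'.toPlane.carrier := (hD'.isLeveled fl').nodes_subset
  have hinj : InjOn f D.toPlane.carrier := injOn_iff_injective.2 hf.injective
  have hcont : ContinuousOn f D.toPlane.carrier :=
    continuousOn_iff_continuous_domRestrict.2 hf.continuous
  have hdiff : f '' (D.toPlane.carrier \ D.toPlane.nodes) = D'.toPlane.carrier \ D'.toPlane.nodes := by
    rw [hinj.image_sdiff_subset hsub, hC, hN]
  have hopen : ∀ e, D.openArc e ⊆ D.toPlane.carrier \ D.toPlane.nodes := fun e => by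
    rw [hD.carrier_diff]; exact subset_iUnion _ e
  have hopen' : ∀ e, D'.openArc e ⊆ D'.toPlane.carrier \ D'.toPlane.nodes := fun e => by
    rw [hD'.carrier_diff]; exact subset_iUnion _ e
  -- Edges are components of the complement of the nodes, and the image of an edge is connected and
  -- avoids nodes.
  have h1 : ∀ e, ∃ e', f '' D.openArc e ⊆ D'.openArc e' := by
    intro e
    have hpre := (hD.isPreconnected_openArc e).image f
      (hcont.mono ((hopen e).trans Set.sdiff_subset))
    obtain ⟨p, hp⟩ := hD.openArc_nonempty e
    have hmem : f p ∈ D'.toPlane.carrier \ D'.toPlane.nodes := by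
      rw [← hdiff]; exact mem_image_of_mem _ (hopen e hp)
    have hmem' := hmem
    rw [hD'.carrier_diff] at hmem'
    obtain ⟨e', he'⟩ := mem_iUnion.1 hmem'
    refine ⟨e', ?_⟩
    rw [← hD'.connectedComponentIn_eq fl' he']
    refine hpre.subset_connectedComponentIn (mem_image_of_mem _ hp) ?_
    rw [← hdiff]
    exact image_mono (hopen e)
  -- For the inverse direction the embedding property is used: the preimage of a connected set in
  -- the image is connected.
  have h2 : ∀ e', ∃ e, D'.openArc e' ⊆ f '' D.openArc e := by
    intro e'
    let s : Set D.toPlane.carrier := {p | f p ∈ D'.openArc e'}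
    have hs : D.toPlane.carrier.domRestrict f '' s = D'.openArc e' := by
      ext q
      constructor
      · rintro ⟨p, hp, rfl⟩; exact hp
      · intro hq
        have := (hopen' e' hq).1
        rw [← hC] at this
        obtain ⟨p, hp, rfl⟩ := this
        exact ⟨⟨p, hp⟩, hq, rfl⟩
    have hpre : IsPreconnected s := by
      rw [← hf.isInducing.isPreconnected_image, hs]
      exact hD'.isPreconnected_openArc e'
    have hpre' : IsPreconnected (Subtype.val '' s) :=
      hpre.image _ continuous_subtype_val.continuousOn
    have hss : Subtype.val '' s ⊆ D.toPlane.carrier \ D.toPlane.nodes := by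
      rintro _ ⟨p, hp, rfl⟩
      exact ⟨p.2, fun hn => (hopen' e' hp).2 (hN ▸ mem_image_of_mem _ hn)⟩
    obtain ⟨q, hq⟩ := hD'.openArc_nonempty e'
    rw [← hs] at hq
    obtain ⟨p, hp, rfl⟩ := hq
    have hp' : (p : ℝ × ℝ) ∈ ⋃ e, D.openArc e := by
      rw [← hD.carrier_diff]; exact hss (mem_image_of_mem _ hp)
    obtain ⟨e, he⟩ := mem_iUnion.1 hp'
    refine ⟨e, ?_⟩
    have hsub := hpre'.subset_connectedComponentIn (mem_image_of_mem _ hp) hss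
    rw [hD.connectedComponentIn_eq fl he] at hsub
    rw [← hs]
    rintro _ ⟨p, hp, rfl⟩
    exact ⟨p, hsub (mem_image_of_mem _ hp), rfl⟩
  choose θ hθ using h1
  choose ψ hψ using h2
  have hψθ : ∀ e, ψ (θ e) = e := by
    intro e
    obtain ⟨p, hp⟩ := hD.openArc_nonempty e
    obtain ⟨p', hp', h⟩ := hψ _ (hθ e (mem_image_of_mem f hp))
    have := hinj (hopen _ hp').1 (hopen _ hp).1 h
    subst this
    exact hD.eq_of_mem hp' (D.openArc_subset_arc e hp)
  have hθψ : ∀ e, θ (ψ e) = e := by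
    intro e
    obtain ⟨p, hp⟩ := hD'.openArc_nonempty e
    exact hD'.eq_of_mem (hθ _ (hψ e hp)) (D'.openArc_subset_arc e hp)
  have harc : ∀ e, ∀ l ∈ Icc (0 : ℝ) 1, f (D.path e l) ∈ D'.arc (θ e) := by
    intro e l hl
    rw [← hD'.closure_openArc]
    refine closure_mono (hθ e) (ContinuousWithinAt.mem_closure_image ?_ ?_)
    · exact (hcont _ (path_mem_carrier hD e hl)).mono ((hopen e).trans Set.sdiff_subset)
    · rw [hD.closure_openArc]; exact path_mem_arc hD e hl
  have m0 : (0 : ℝ) ∈ Icc (0 : ℝ) 1 := by simp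
  have m1 : (1 : ℝ) ∈ Icc (0 : ℝ) 1 := by simp
  have hend : ∀ e l, l ∈ Icc (0 : ℝ) 1 → D.path e l ∈ D.toPlane.nodes →
      f (D.path e l) = D'.path (θ e) 0 ∨ f (D.path e l) = D'.path (θ e) 1 := by
    intro e l hl hn
    obtain ⟨u, hu, h⟩ := harc e l hl
    have hn' : D'.point (θ e) u ∉ D'.openArc (θ e) := fun hm => (hopen' _ hm).2 <| by
      rw [h, ← hN]; exact mem_image_of_mem _ hn
    rw [path_zero, path_one, ← h]
    rcases hu.1.eq_or_lt with h1 | h1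
    · exact Or.inl (by rw [← h1])
    rcases hu.2.eq_or_lt with h2 | h2
    · exact Or.inr (by rw [h2])
    · exact (hn' ⟨u, ⟨h1, h2⟩, rfl⟩).elim
  have hne : ∀ e, f (D.path e 0) ≠ f (D.path e 1) := fun e h => by
    have := hD.path_inj (hinj (path_mem_carrier hD e m0) (path_mem_carrier hD e m1) h)
    norm_num at this
  refine ⟨⟨θ, ψ, hψθ, hθψ⟩, harc, fun e => ?_⟩
  have n0 : D.path e 0 ∈ D.toPlane.nodes := ⟨e, Or.inl (D.path_zero e)⟩
  have n1 : D.path e 1 ∈ D.toPlane.nodes := ⟨e, Or.inr (D.path_one e)⟩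
  -- The two ends have distinct images. At this stage `f` may still turn an arc upside down.
  rcases hend e 0 m0 n0 with h0 | h0 <;> rcases hend e 1 m1 n1 with h1 | h1
  · exact (hne e (h0.trans h1.symm)).elim
  · exact Or.inl ⟨h0, h1⟩
  · exact Or.inr ⟨h0, h1⟩
  · exact (hne e (h0.trans h1.symm)).elim

theorem exists_equiv_vertices (hD : D.IsValid) (hD' : D'.IsValid) (fl : S.IsFlow) (fl' : S'.IsFlow)
    {f : ℝ × ℝ → ℝ × ℝ} (hf : InjOn f D.toPlane.carrier) (him : D.toPlane.image f = D'.toPlane)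
    (hout : f '' D.toPlane.outer D.lo D.hi = D'.toPlane.outer D'.lo D'.hi) :
    ∃ η : S.V ≃ S'.V, ∀ v, f (D.pt v) = D'.pt (η v) := by
  have hN : f '' D.toPlane.nodes = D'.toPlane.nodes := congrArg PlaneGraph.nodes him
  have hsub : D.toPlane.nodes ⊆ D.toPlane.carrier := (hD.isLeveled fl).nodes_subset
  have hr : f '' range D.pt = range D'.pt := by
    rw [← hD.inner_eq fl, ← hD'.inner_eq fl', PlaneGraph.inner, PlaneGraph.inner,
      (hf.mono hsub).image_sdiff_subset (hD.isLeveled fl).outer_subset, hN, hout]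
  have hmem : ∀ v, D.pt v ∈ D.toPlane.carrier := fun v => hsub (by
    have : D.pt v ∈ D.toPlane.inner D.lo D.hi := by rw [hD.inner_eq fl]; exact mem_range_self v
    exact this.1)
  have h1 : ∀ v, ∃ w, f (D.pt v) = D'.pt w := fun v => by
    have : f (D.pt v) ∈ range D'.pt := hr ▸ mem_image_of_mem _ (mem_range_self v)
    obtain ⟨w, hw⟩ := this
    exact ⟨w, hw.symm⟩
  choose η hη using h1
  refine ⟨Equiv.ofBijective η ⟨fun v w h => ?_, fun w => ?_⟩, hη⟩
  · exact hD.pt_injective fl (hf (hmem v) (hmem w) (by rw [hη, hη, h]))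
  · have : D'.pt w ∈ f '' range D.pt := hr ▸ mem_range_self w
    obtain ⟨_, ⟨v, rfl⟩, hv⟩ := this
    exact ⟨v, hD'.pt_injective fl' ((hη v).symm.trans hv)⟩

variable {r : S.E → S.E → Prop} {r' : S'.E → S'.E → Prop}

/-- A deformation of ordered drawings gives an isomorphism of planar open graphs. -/
theorem exists_iso_of_deforms (pl : S.IsPlanar r) (pl' : S'.IsPlanar r') (hD : D.IsValid)
    (hD' : D'.IsValid) (ho : D.IsOrdered r) (ho' : D'.IsOrdered r')
    (H : Deforms (hD.toLeveled pl.toIsFlow) (hD'.toLeveled pl'.toIsFlow)) :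
    Nonempty (OpenGraph.Iso S r S' r') := by
  obtain ⟨h, a, b, hc, ht, h0, ha0, hb0, him, ha1, hb1⟩ := H
  have m0 : (0 : ℝ) ∈ Icc (0 : ℝ) 1 := by simp
  have m1 : (1 : ℝ) ∈ Icc (0 : ℝ) 1 := by simp
  change ContinuousOn _ (Icc (0 : ℝ) 1 ×ˢ D.toPlane.carrier) at hc
  change ∀ p ∈ D.toPlane.carrier, _ at h0
  change D.toPlane.image (h 1) = D'.toPlane at him
  change a 1 = D'.lo at ha1
  change b 1 = D'.hi at hb1
  change ∀ t ∈ Icc (0 : ℝ) 1, IsEmbedding (D.toPlane.carrier.domRestrict (h t)) ∧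
      (D.toPlane.image (h t)).IsLeveled (a t) (b t) ∧
      h t '' D.toPlane.outer D.lo D.hi = (D.toPlane.image (h t)).outer (a t) (b t) at ht
  -- At every time the image is again a drawing, of an open graph that may depend on `t`.
  have hframe : ∀ t ∈ Icc (0 : ℝ) 1, ∃ (T : OpenGraph) (_ : T.IsFlow) (C : Drawing T),
      C.IsValid ∧ D.toPlane.image (h t) = C.toPlane ∧ C.lo = a t ∧ C.hi = b t := by
    intro t htt
    obtain ⟨T, fl, C, hC, he⟩ := LeveledGraph.exists_drawing ⟨_, a t, b t, (ht t htt).2.1⟩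
    exact ⟨T, fl, C, hC, (congrArg LeveledGraph.toPlaneGraph he).symm,
      congrArg LeveledGraph.lo he, congrArg LeveledGraph.hi he⟩
  have hpc : ∀ e, ContinuousOn (Function.uncurry fun t l => h t (D.path e l))
      (Icc (0 : ℝ) 1 ×ˢ Icc (0 : ℝ) 1) := by
    intro e
    refine hc.comp (f := fun z : ℝ × ℝ => (z.1, D.path e z.2)) ?_ fun z hz =>
      ⟨hz.1, path_mem_carrier hD e hz.2⟩
    exact continuousOn_fst.prodMk ((continuousOn_path hD e).comp continuousOn_snd fun z hz => hz.2)
  have hlc : ∀ e, ∀ l ∈ Icc (0 : ℝ) 1, ContinuousOn (fun t => (h t (D.path e l)).2) (Icc 0 1) :=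
    fun e l hl => continuous_snd.comp_continuousOn
      ((hpc e).comp (f := fun t : ℝ => (t, l)) (by fun_prop) fun t ht => ⟨ht, hl⟩)
  -- No edge can be turned over: the difference of the levels of its ends is continuous in time,
  -- positive at the start, and never zero.
  have hup : ∀ t ∈ Icc (0 : ℝ) 1, ∀ e, (h t (D.path e 0)).2 < (h t (D.path e 1)).2 := by
    intro t htt e
    by_contra hn
    have hcont : ContinuousOn (fun s => (h s (D.path e 1)).2 - (h s (D.path e 0)).2) (Icc 0 t) :=
      ((hlc e 1 m1).sub (hlc e 0 m0)).mono (Icc_subset_Icc_right htt.2)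
    have := intermediate_value_Icc' htt.1 hcont
    obtain ⟨s, hs, hs0⟩ := this (show (0 : ℝ) ∈ _ from ⟨by linarith, by
      rw [h0 _ (path_mem_carrier hD e m0), h0 _ (path_mem_carrier hD e m1)]
      have := hD.bot_lt_top e
      simp only [path_zero, path_one, point_snd]
      linarith⟩)
    have hs' : s ∈ Icc (0 : ℝ) 1 := ⟨hs.1, hs.2.trans htt.2⟩
    obtain ⟨T, fl, C, hC, he, -⟩ := hframe s hs'
    obtain ⟨θ, -, hθ⟩ := exists_equiv_edges pl.toIsFlow fl hD hC (ht s hs').1 he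
    have hlt := hC.bot_lt_top (θ e)
    rcases hθ e with ⟨h1, h2⟩ | ⟨h1, h2⟩ <;>
    · simp only [h1, h2] at hs0
      simp only [path_zero, path_one, point_snd] at hs0
      linarith
  have hends : ∀ t ∈ Icc (0 : ℝ) 1, ∀ (T : OpenGraph) (C : Drawing T), C.IsValid → ∀ θ : S.E ≃ T.E,
      (∀ e, (h t (D.path e 0) = C.path (θ e) 0 ∧ h t (D.path e 1) = C.path (θ e) 1) ∨
        (h t (D.path e 0) = C.path (θ e) 1 ∧ h t (D.path e 1) = C.path (θ e) 0)) →
      ∀ e, h t (D.path e 0) = C.path (θ e) 0 ∧ h t (D.path e 1) = C.path (θ e) 1 := by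
    intro t htt T C hC θ hθ e
    rcases hθ e with h1 | ⟨h1, h2⟩
    · exact h1
    · have := hup t htt e
      rw [h1, h2] at this
      simp only [path_zero, path_one, point_snd] at this
      exact (lt_asymm this (hC.bot_lt_top _)).elim
  obtain ⟨θ, harc, hθ⟩ := exists_equiv_edges pl.toIsFlow pl'.toIsFlow hD hD' (ht 1 m1).1 him
  have hθ := hends 1 m1 S' D' hD' θ hθ
  have hout := (ht 1 m1).2.2
  rw [him, ha1, hb1] at hout
  obtain ⟨η, hη⟩ := exists_equiv_vertices hD hD' pl.toIsFlow pl'.toIsFlow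
    (injOn_iff_injective.2 (ht 1 m1).1.injective) him hout
  have hinner' : ∀ w, D'.pt w ∉ D'.toPlane.outer D'.lo D'.hi := fun w hw => by
    have : D'.pt w ∈ D'.toPlane.inner D'.lo D'.hi := by
      rw [hD'.inner_eq pl'.toIsFlow]; exact mem_range_self w
    exact this.2 hw
  have hsrc : ∀ e, S'.src (θ e) = (S.src e).map η := by
    intro e
    cases hs : S.src e with
    | some v =>
      have := (hθ e).1
      rw [path_zero, path_zero, hD.point_bot hs, hη] at this
      simpa using (hD'.point_bot_eq_pt_iff pl'.toIsFlow _ _).1 this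
    | none =>
      have hm : D.path e 0 ∈ D.toPlane.outer D.lo D.hi :=
        (hD.mem_outer_iff _).2 ⟨e, Or.inl ⟨hs, path_zero _ _⟩⟩
      have := hout ▸ mem_image_of_mem (h 1) hm
      rw [(hθ e).1] at this
      cases hw : S'.src (θ e) with
      | none => rfl
      | some w =>
        rw [path_zero, hD'.point_bot hw] at this
        exact (hinner' w this).elim
  have htgt : ∀ e, S'.tgt (θ e) = (S.tgt e).map η := by
    intro e
    cases hs : S.tgt e with
    | some v =>
      have := (hθ e).2
      rw [path_one, path_one, hD.point_top hs, hη] at this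
      simpa using (hD'.point_top_eq_pt_iff pl'.toIsFlow _ _).1 this
    | none =>
      have hm : D.path e 1 ∈ D.toPlane.outer D.lo D.hi :=
        (hD.mem_outer_iff _).2 ⟨e, Or.inr ⟨hs, path_one _ _⟩⟩
      have := hout ▸ mem_image_of_mem (h 1) hm
      rw [(hθ e).2] at this
      cases hw : S'.tgt (θ e) with
      | none => rfl
      | some w =>
        rw [path_one, hD'.point_top hw] at this
        exact (hinner' w this).elim
  -- Edges whose bottoms are level at all times can be compared at one moving level at which both
  -- are present throughout: halfway between the common bottom and the lower top.
  have hlt : ∀ e f, (∀ t ∈ Icc (0 : ℝ) 1, (h t (D.path e 0)).2 = (h t (D.path f 0)).2) →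
      r e f → r' (θ e) (θ f) := by
    intro e f hlev hef
    have hne : e ≠ f := by rintro rfl; exact pl.irrefl _ hef
    let u : ℝ → ℝ := fun t =>
      ((h t (D.path e 0)).2 + min (h t (D.path e 1)).2 (h t (D.path f 1)).2) / 2
    have hu : ContinuousOn u (Icc 0 1) :=
      (((hlc e 0 m0).add ((hlc e 1 m1).inf (hlc f 1 m1))).div_const 2)
    have hu1 : ∀ t ∈ Icc (0 : ℝ) 1, (h t (D.path e 0)).2 < u t ∧ u t < (h t (D.path e 1)).2 := by
      intro t htt
      have h1 := hup t htt e
      have h2 := hup t htt f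
      rw [← hlev t htt] at h2
      have h3 := lt_min h1 h2
      have h4 := min_le_left (h t (D.path e 1)).2 (h t (D.path f 1)).2
      simp only [u]
      constructor <;> linarith
    have hu2 : ∀ t ∈ Icc (0 : ℝ) 1, (h t (D.path f 0)).2 < u t ∧ u t < (h t (D.path f 1)).2 := by
      intro t htt
      have h1 := hup t htt e
      have h2 := hup t htt f
      rw [← hlev t htt] at h2 ⊢
      have h3 := lt_min h1 h2
      have h4 := min_le_right (h t (D.path e 1)).2 (h t (D.path f 1)).2
      simp only [u]
      constructor <;> linarith
    have hex : ∀ g, (∀ t ∈ Icc (0 : ℝ) 1, (h t (D.path g 0)).2 < u t ∧ u t < (h t (D.path g 1)).2) →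
        ∀ t ∈ Icc (0 : ℝ) 1, ∃ l ∈ Icc (0 : ℝ) 1, (h t (D.path g l)).2 = u t := by
      intro g hg t htt
      have hcont : ContinuousOn (fun l => (h t (D.path g l)).2) (Icc 0 1) :=
        continuous_snd.comp_continuousOn
          ((hpc g).comp (f := fun l : ℝ => (t, l)) (by fun_prop) fun l hl => ⟨htt, hl⟩)
      obtain ⟨l, hl, hl'⟩ := intermediate_value_Icc zero_le_one hcont
        ⟨(hg t htt).1.le, (hg t htt).2.le⟩
      exact ⟨l, hl, hl'⟩
    have hpos : ∀ t ∈ Icc (0 : ℝ) 1, ∀ (T : OpenGraph) (C : Drawing T) (θ : S.E ≃ T.E),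
        (∀ e, ∀ l ∈ Icc (0 : ℝ) 1, h t (D.path e l) ∈ C.arc (θ e)) →
        ∀ g, ∀ l ∈ Icc (0 : ℝ) 1, (h t (D.path g l)).2 = u t →
          (h t (D.path g l)).1 = C.x (θ g) (u t) := by
      intro t _ T C θ hθ g l hl hl'
      obtain ⟨s, hs, he⟩ := hθ g l hl
      rw [← he] at hl' ⊢
      simp only [point_snd] at hl'
      rw [hl']; rfl
    -- At the level `u t` each of the two moving edges has exactly one position, and the positions
    -- differ, since a level inside both edges is not that of a common vertex.
    have hex1 : ∀ t ∈ Icc (0 : ℝ) 1, ∃ x y, x ≠ y ∧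
        (∀ l ∈ Icc (0 : ℝ) 1, (h t (D.path e l)).2 = u t → (h t (D.path e l)).1 = x) ∧
        (∀ l ∈ Icc (0 : ℝ) 1, (h t (D.path f l)).2 = u t → (h t (D.path f l)).1 = y) := by
      intro t htt
      obtain ⟨T, fl, C, hC, he, -⟩ := hframe t htt
      obtain ⟨θ, h1, h2⟩ := exists_equiv_edges pl.toIsFlow fl hD hC (ht t htt).1 he
      have h2 := hends t htt T C hC θ h2
      refine ⟨C.x (θ e) (u t), C.x (θ f) (u t), fun hx => ?_, hpos t htt T C θ h1 e,
        hpos t htt T C θ h1 f⟩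
      have b1 := hu1 t htt
      have b2 := hu2 t htt
      rw [(h2 _).1, (h2 _).2] at b1 b2
      simp only [path_zero, path_one, point_snd] at b1 b2
      exact hne (θ.injective (hC.eq_of_x_eq b1 (Ioo_subset_Icc_self b2) hx))
    choose! x y hxy hx hy using hex1
    have hexx : ∀ t ∈ Icc (0 : ℝ) 1, ∃ l ∈ Icc (0 : ℝ) 1, h t (D.path e l) = (x t, u t) :=
      fun t htt => by
        obtain ⟨l, hl, hl'⟩ := hex e hu1 t htt
        exact ⟨l, hl, Prod.ext (hx t htt l hl hl') hl'⟩
    have hexy : ∀ t ∈ Icc (0 : ℝ) 1, ∃ l ∈ Icc (0 : ℝ) 1, h t (D.path f l) = (y t, u t) :=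
      fun t htt => by
        obtain ⟨l, hl, hl'⟩ := hex f hu2 t htt
        exact ⟨l, hl, Prod.ext (hy t htt l hl hl') hl'⟩
    have key := lt_of_moving (hpc e) (hpc f) hu hexx hexy hx hy hxy
    have start : x 0 ≤ y 0 := by
      have hid : ∀ g, ∀ l ∈ Icc (0 : ℝ) 1, h 0 (D.path g l) ∈ D.arc ((Equiv.refl _) g) := by
        intro g l hl
        rw [h0 _ (path_mem_carrier hD g hl)]
        exact path_mem_arc hD g hl
      obtain ⟨l, hl, hl'⟩ := hexx 0 m0
      obtain ⟨m, hm, hm'⟩ := hexy 0 m0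
      have e1 := hpos 0 m0 S D (Equiv.refl _) hid e l hl (by rw [hl'])
      have e2 := hpos 0 m0 S D (Equiv.refl _) hid f m hm (by rw [hm'])
      rw [hl'] at e1
      rw [hm'] at e2
      change x 0 = D.x e (u 0) at e1
      change y 0 = D.x f (u 0) at e2
      rw [e1, e2]
      have b1 := hu1 0 m0
      have b2 := hu2 0 m0
      rw [h0 _ (path_mem_carrier hD _ m0), h0 _ (path_mem_carrier hD _ m1)] at b1 b2
      simp only [path_zero, path_one, point_snd] at b1 b2
      exact ho e f _ hef (Ioo_subset_Icc_self b1) (Ioo_subset_Icc_self b2)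
    have fin := key start
    obtain ⟨l, hl, hl'⟩ := hexx 1 m1
    obtain ⟨m, hm, hm'⟩ := hexy 1 m1
    have e1 := hpos 1 m1 S' D' θ harc e l hl (by rw [hl'])
    have e2 := hpos 1 m1 S' D' θ harc f m hm (by rw [hm'])
    rw [hl'] at e1
    rw [hm'] at e2
    change x 1 = D'.x (θ e) (u 1) at e1
    change y 1 = D'.x (θ f) (u 1) at e2
    rw [e1, e2] at fin
    have b1 := hu1 1 m1
    have b2 := hu2 1 m1
    rw [(hθ _).1, (hθ _).2] at b1 b2
    simp only [path_zero, path_one, point_snd] at b1 b2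
    rcases pl'.total (θ e) (θ f) with q | q | q
    · exact q
    · exact (hne (θ.injective q)).elim
    · exact (not_le.2 fin (ho' _ _ _ q (Ioo_subset_Icc_self b2) (Ioo_subset_Icc_self b1))).elim
  have i : OpenGraph.Iso S (fun e f => r' (θ e) (θ f)) S' r' := ⟨θ, η, hsrc, htgt, fun _ _ => Iff.rfl⟩
  -- By rigidity only pairs that begin at a common level need to be compared: outgoing edges of a
  -- vertex, and edges without source, whose bottoms stay on the lower outer level.
  have hr := pl.unique_of_out (i.isPlanar pl')
    (fun e f v he hf => hlt e f fun t _ => by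
      rw [path_zero, path_zero, hD.point_bot he, hD.point_bot hf])
    (fun e f he hf => hlt e f fun t htt => by
      obtain ⟨T, fl, C, hC, him, hlo, hhi⟩ := hframe t htt
      obtain ⟨χ, -, hχ⟩ := exists_equiv_edges pl.toIsFlow fl hD hC (ht t htt).1 him
      have hχ := hends t htt T C hC χ hχ
      have hout := (ht t htt).2.2
      rw [him, ← hlo, ← hhi] at hout
      have : ∀ g, S.src g = none → (h t (D.path g 0)).2 = C.lo := by
        intro g hg
        have hm : D.path g 0 ∈ D.toPlane.outer D.lo D.hi :=
          (hD.mem_outer_iff _).2 ⟨g, Or.inl ⟨hg, path_zero _ _⟩⟩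
        have := hout ▸ mem_image_of_mem (h t) hm
        rw [(hχ g).1, path_zero] at this ⊢
        rcases this.2 with h1 | h1
        · exact h1
        · exact absurd h1 (ne_of_lt ((hC.bot_lt_top _).trans_le (hC.top_le_hi _)))
      rw [this e he, this f hf])
  exact ⟨⟨θ, η, hsrc, htgt, hr⟩⟩

end Drawing

open GraphData PlaneGraph

/-! ## Tensor products -/

namespace OpenGraph

/-- The disjoint union of open graphs. -/
abbrev sum (S T : OpenGraph) : OpenGraph where
  E := S.E ⊕ T.E
  V := S.V ⊕ T.V
  src := Sum.elim (fun e => (S.src e).map Sum.inl) fun e => (T.src e).map Sum.inr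
  tgt := Sum.elim (fun e => (S.tgt e).map Sum.inl) fun e => (T.tgt e).map Sum.inr

variable {S T : OpenGraph} {r : S.E → S.E → Prop} {r' : T.E → T.E → Prop}

theorem sum_step {a b : S.E ⊕ T.E} (h : (S.sum T).Step a b) :
    (∃ e f, a = .inl e ∧ b = .inl f ∧ S.Step e f) ∨ ∃ e f, a = .inr e ∧ b = .inr f ∧ T.Step e f := by
  obtain ⟨v, h1, h2⟩ := h
  rcases a with e | e <;> rcases b with f | f <;>
    simp only [Sum.elim_inl, Sum.elim_inr, Option.map_eq_some_iff] at h1 h2 <;>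
    obtain ⟨v, h1, rfl⟩ := h1 <;> obtain ⟨w, h2, h3⟩ := h2 <;> cases h3
  · exact Or.inl ⟨e, f, rfl, rfl, v, h1, h2⟩
  · exact Or.inr ⟨e, f, rfl, rfl, v, h1, h2⟩

theorem sum_step_inl {e f : S.E} (h : S.Step e f) : (S.sum T).Step (.inl e) (.inl f) := by
  obtain ⟨v, h1, h2⟩ := h
  exact ⟨.inl v, by simp [sum, h1], by simp [sum, h2]⟩

theorem sum_step_inr {e f : T.E} (h : T.Step e f) : (S.sum T).Step (.inr e) (.inr f) := by
  obtain ⟨v, h1, h2⟩ := h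
  exact ⟨.inr v, by simp [sum, h1], by simp [sum, h2]⟩

theorem sum_path {a b : S.E ⊕ T.E} (h : (S.sum T).Path a b) :
    (∃ e f, a = .inl e ∧ b = .inl f ∧ S.Path e f) ∨ ∃ e f, a = .inr e ∧ b = .inr f ∧ T.Path e f := by
  induction h with
  | refl =>
    rcases a with e | e
    · exact Or.inl ⟨e, e, rfl, rfl, Path.refl e⟩
    · exact Or.inr ⟨e, e, rfl, rfl, Path.refl e⟩
  | tail _ s ih =>
    rcases ih with ⟨e, f, rfl, rfl, p⟩ | ⟨e, f, rfl, rfl, p⟩ <;>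
      rcases sum_step s with ⟨e', f', h, rfl, s⟩ | ⟨e', f', h, rfl, s⟩ <;> cases h
    · exact Or.inl ⟨_, _, rfl, rfl, p.trans s.path⟩
    · exact Or.inr ⟨_, _, rfl, rfl, p.trans s.path⟩

theorem sum_path_inl {e f : S.E} (h : S.Path e f) : (S.sum T).Path (.inl e) (.inl f) :=
  Relation.ReflTransGen.lift (Sum.inl : S.E → S.E ⊕ T.E) (fun _ _ => sum_step_inl) _ _ h

theorem sum_path_inr {e f : T.E} (h : T.Path e f) : (S.sum T).Path (.inr e) (.inr f) :=
  Relation.ReflTransGen.lift (Sum.inr : T.E → S.E ⊕ T.E) (fun _ _ => sum_step_inr) _ _ h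

/-- Paths stay in one summand, and so does every edge that is between two edges of that summand in
the lexicographic order. -/
theorem IsPlanar.sum (pl : S.IsPlanar r) (pl' : T.IsPlanar r') :
    (S.sum T).IsPlanar (Sum.Lex r r') where
  finite_E := have := pl.finite_E; have := pl'.finite_E; inferInstanceAs (Finite (S.E ⊕ T.E))
  finite_V := have := pl.finite_V; have := pl'.finite_V; inferInstanceAs (Finite (S.V ⊕ T.V))
  exists_in v := by
    rcases v with v | v
    · obtain ⟨e, he⟩ := pl.exists_in v
      exact ⟨.inl e, by simp [OpenGraph.sum, he]⟩
    · obtain ⟨e, he⟩ := pl'.exists_in v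
      exact ⟨.inr e, by simp [OpenGraph.sum, he]⟩
  exists_out v := by
    rcases v with v | v
    · obtain ⟨e, he⟩ := pl.exists_out v
      exact ⟨.inl e, by simp [OpenGraph.sum, he]⟩
    · obtain ⟨e, he⟩ := pl'.exists_out v
      exact ⟨.inr e, by simp [OpenGraph.sum, he]⟩
  irrefl e h := by
    rcases e with e | e
    · exact pl.irrefl e (Sum.lex_inl_inl.1 h)
    · exact pl'.irrefl e (Sum.lex_inr_inr.1 h)
  trans e f g h h' := by
    rcases h with h | h | h <;> rcases h' with h' | h' | h'
    · exact .inl (pl.trans _ _ _ h h')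
    · exact .sep _ _
    · exact .inr (pl'.trans _ _ _ h h')
    · exact .sep _ _
  total e f := by
    rcases e with e | e <;> rcases f with f | f
    · rcases pl.total e f with h | rfl | h
      · exact Or.inl (.inl h)
      · exact Or.inr (Or.inl rfl)
      · exact Or.inr (Or.inr (.inl h))
    · exact Or.inl (.sep _ _)
    · exact Or.inr (Or.inr (.sep _ _))
    · rcases pl'.total e f with h | rfl | h
      · exact Or.inl (.inr h)
      · exact Or.inr (Or.inl rfl)
      · exact Or.inr (Or.inr (.inr h))
  step e f h := by
    rcases sum_step h with ⟨e, f, rfl, rfl, s⟩ | ⟨e, f, rfl, rfl, s⟩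
    · exact .inl (pl.step _ _ s)
    · exact .inr (pl'.step _ _ s)
  between e f g p h h' := by
    rcases sum_path p with ⟨e, f, rfl, rfl, q⟩ | ⟨e, f, rfl, rfl, q⟩
    · rcases g with g | g
      · exact (pl.between _ _ _ q (Sum.lex_inl_inl.1 h) (Sum.lex_inl_inl.1 h')).imp
          sum_path_inl sum_path_inl
      · exact (Sum.lex_inr_inl h').elim
    · rcases g with g | g
      · exact (Sum.lex_inr_inl h).elim
      · exact (pl'.between _ _ _ q (Sum.lex_inr_inr.1 h) (Sum.lex_inr_inr.1 h')).imp
          sum_path_inr sum_path_inr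

theorem sum_fin_inl (e : S.E) (b : Bool) : (S.sum T).fin (.inl e) b = (S.fin e b).map .inl := by
  cases b <;> rfl

theorem sum_fin_inr (e : T.E) (b : Bool) : (S.sum T).fin (.inr e) b = (T.fin e b).map .inr := by
  cases b <;> rfl

theorem sum_unitary_inl (e : S.E) : (S.sum T).Unitary (.inl e) ↔ S.Unitary e := by
  simp [Unitary, sum]

theorem sum_unitary_inr (e : T.E) : (S.sum T).Unitary (.inr e) ↔ T.Unitary e := by
  simp [Unitary, sum]

theorem PresentsOrd.tensor {X Y : PlanarData} {ε : X.H → S.E} {ε' : Y.H → T.E}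
    (p : PresentsOrd X S r ε) (p' : PresentsOrd Y T r' ε') :
    PresentsOrd (X.tensor Y) (S.sum T) (Sum.Lex r r') (Sum.map ε ε') := by
  have hp : Presents (X.tensor Y).toGraphData (S.sum T) (Sum.map ε ε') := by
    refine ⟨?_, ?_, ?_, ?_, ?_⟩
    · rintro (h | h) (k | k) he hs
      · exact congrArg Sum.inl (p.inj h k (Sum.inl_injective he) hs)
      · cases he
      · cases he
      · exact congrArg Sum.inr (p'.inj h k (Sum.inr_injective he) hs)
    · rintro (e | e) b
      · have : (S.sum T).IsHalf (.inl e) b ↔ S.IsHalf e b := by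
          rw [IsHalf, IsHalf, sum_unitary_inl, sum_fin_inl]
          refine or_congr_left ?_
          cases S.fin e b <;> simp
        rw [this, ← p.half]
        constructor
        · rintro ⟨h | h, he, hs⟩
          · exact ⟨h, Sum.inl_injective he, hs⟩
          · cases he
        · rintro ⟨h, rfl, rfl⟩
          exact ⟨.inl h, rfl, rfl⟩
      · have : (S.sum T).IsHalf (.inr e) b ↔ T.IsHalf e b := by
          rw [IsHalf, IsHalf, sum_unitary_inr, sum_fin_inr]
          refine or_congr_left ?_
          cases T.fin e b <;> simp
        rw [this, ← p'.half]
        constructor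
        · rintro ⟨h | h, he, hs⟩
          · cases he
          · exact ⟨h, Sum.inr_injective he, hs⟩
        · rintro ⟨h, rfl, rfl⟩
          exact ⟨.inr h, rfl, rfl⟩
    · rintro (h | h) (k | k)
      · refine (p.near h k).trans ?_
        change _ ↔ (S.sum T).Near (.inl (ε h)) (X.sgn h) (.inl (ε k)) (X.sgn k)
        rw [Near, Near, sum_unitary_inl, sum_fin_inl, sum_fin_inl]
        refine or_congr ?_ (and_congr_right fun _ => Sum.inl_injective.eq_iff.symm)
        constructor
        · rintro ⟨v, h1, h2⟩
          exact ⟨.inl v, by simp [h1], by simp [h2]⟩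
        · rintro ⟨v, h1, h2⟩
          simp only [Option.map_eq_some_iff] at h1 h2
          obtain ⟨v, h1, rfl⟩ := h1
          obtain ⟨w, h2, h3⟩ := h2
          cases h3
          exact ⟨v, h1, h2⟩
      · refine iff_of_false id ?_
        change ¬ (S.sum T).Near (.inl (ε h)) (X.sgn h) (.inr (ε' k)) (Y.sgn k)
        rintro (⟨v, h1, h2⟩ | ⟨-, h⟩)
        · rw [sum_fin_inl, Option.map_eq_some_iff] at h1
          rw [sum_fin_inr, Option.map_eq_some_iff] at h2
          obtain ⟨v, h1, rfl⟩ := h1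
          obtain ⟨w, h2, h3⟩ := h2
          cases h3
        · cases h
      · refine iff_of_false id ?_
        change ¬ (S.sum T).Near (.inr (ε' h)) (Y.sgn h) (.inl (ε k)) (X.sgn k)
        rintro (⟨v, h1, h2⟩ | ⟨-, h⟩)
        · rw [sum_fin_inr, Option.map_eq_some_iff] at h1
          rw [sum_fin_inl, Option.map_eq_some_iff] at h2
          obtain ⟨v, h1, rfl⟩ := h1
          obtain ⟨w, h2, h3⟩ := h2
          cases h3
        · cases h
      · refine (p'.near h k).trans ?_
        change _ ↔ (S.sum T).Near (.inr (ε' h)) (Y.sgn h) (.inr (ε' k)) (Y.sgn k)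
        rw [Near, Near, sum_unitary_inr, sum_fin_inr, sum_fin_inr]
        refine or_congr ?_ (and_congr_right fun _ => Sum.inr_injective.eq_iff.symm)
        constructor
        · rintro ⟨v, h1, h2⟩
          exact ⟨.inr v, by simp [h1], by simp [h2]⟩
        · rintro ⟨v, h1, h2⟩
          simp only [Option.map_eq_some_iff] at h1 h2
          obtain ⟨v, h1, rfl⟩ := h1
          obtain ⟨w, h2, h3⟩ := h2
          cases h3
          exact ⟨v, h1, h2⟩
    · rintro (h | h)
      · exact congrArg Sum.inl (p.σ_edge h)
      · exact congrArg Sum.inr (p'.σ_edge h)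
    · rintro (h | h) ⟨k | k, he, hs⟩
      · exact p.σ_ne h ⟨k, Sum.inl_injective he, hs⟩
      · cases he
      · cases he
      · exact p'.σ_ne h ⟨k, Sum.inr_injective he, hs⟩
  refine ⟨hp, fun x y => ?_⟩
  constructor
  · rintro ⟨x', y', h1, h2, hl⟩
    rw [← (hp.edge_eq_iff x' x).1 h1, ← (hp.edge_eq_iff y' y).1 h2]
    rcases x' with h | h <;> rcases y' with k | k
    · exact .inl ((p.lt h k).1 hl)
    · exact .sep _ _
    · exact hl.elim
    · exact .inr ((p'.lt h k).1 hl)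
  · intro hl
    refine ⟨x, y, rfl, rfl, ?_⟩
    rcases x with h | h <;> rcases y with k | k
    · exact (p.lt h k).2 (Sum.lex_inl_inl.1 hl)
    · trivial
    · exact Sum.lex_inr_inl hl
    · exact (p'.lt h k).2 (Sum.lex_inr_inr.1 hl)

end OpenGraph

/-! ### Drawings side by side -/

namespace Drawing

variable {S T : OpenGraph} {r : S.E → S.E → Prop} {r' : T.E → T.E → Prop}

/-- Two drawings side by side. -/
def sum (D : Drawing S) (D' : Drawing T) : Drawing (S.sum T) where
  lo := D.lo
  hi := D.hi
  pt := Sum.elim (fun v => tau (-1) (D.pt v)) fun v => tau 1 (D'.pt v)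
  x := Sum.elim (fun e u => (D.x e u + -1) / 2) fun e u => (D'.x e u + 1) / 2

variable {D : Drawing S} {D' : Drawing T}

theorem sum_bot_inl (e : S.E) : (D.sum D').bot (.inl e) = D.bot e := by
  change ((S.src e).map Sum.inl).elim _ _ = _
  cases h : S.src e <;> simp [bot, h, sum, tau]

theorem sum_top_inl (e : S.E) : (D.sum D').top (.inl e) = D.top e := by
  change ((S.tgt e).map Sum.inl).elim _ _ = _
  cases h : S.tgt e <;> simp [top, h, sum, tau]

theorem sum_bot_inr (hlo : D.lo = D'.lo) (e : T.E) : (D.sum D').bot (.inr e) = D'.bot e := by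
  change ((T.src e).map Sum.inr).elim _ _ = _
  cases h : T.src e <;> simp [bot, h, sum, tau, hlo]

theorem sum_top_inr (hhi : D.hi = D'.hi) (e : T.E) : (D.sum D').top (.inr e) = D'.top e := by
  change ((T.tgt e).map Sum.inr).elim _ _ = _
  cases h : T.tgt e <;> simp [top, h, sum, tau, hhi]

theorem sum_toPlane (hlo : D.lo = D'.lo) (hhi : D.hi = D'.hi) :
    (D.sum D').toPlane = D.toPlane.tensor D'.toPlane := by
  have h1 : ∀ e u, (D.sum D').point (.inl e) u = tau (-1) (D.point e u) := fun _ _ => rfl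
  have h2 : ∀ e u, (D.sum D').point (.inr e) u = tau 1 (D'.point e u) := fun _ _ => rfl
  ext p
  · simp only [toPlane, PlaneGraph.tensor, mem_iUnion, mem_union, mem_image, arc]
    constructor
    · rintro ⟨e | e, u, hu, rfl⟩
      · rw [sum_bot_inl, sum_top_inl] at hu
        exact Or.inl ⟨_, ⟨e, u, hu, rfl⟩, rfl⟩
      · rw [sum_bot_inr hlo, sum_top_inr hhi] at hu
        exact Or.inr ⟨_, ⟨e, u, hu, rfl⟩, rfl⟩
    · rintro (⟨_, ⟨e, u, hu, rfl⟩, rfl⟩ | ⟨_, ⟨e, u, hu, rfl⟩, rfl⟩)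
      · exact ⟨.inl e, u, by rwa [sum_bot_inl, sum_top_inl], rfl⟩
      · exact ⟨.inr e, u, by rwa [sum_bot_inr hlo, sum_top_inr hhi], rfl⟩
  · simp only [toPlane, PlaneGraph.tensor, mem_union, mem_image, mem_ofPred_eq]
    constructor
    · rintro ⟨e | e, h⟩
      · rw [sum_bot_inl, sum_top_inl, h1, h1] at h
        rcases h with rfl | rfl
        · exact Or.inl ⟨_, ⟨e, Or.inl rfl⟩, rfl⟩
        · exact Or.inl ⟨_, ⟨e, Or.inr rfl⟩, rfl⟩
      · rw [sum_bot_inr hlo, sum_top_inr hhi, h2, h2] at h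
        rcases h with rfl | rfl
        · exact Or.inr ⟨_, ⟨e, Or.inl rfl⟩, rfl⟩
        · exact Or.inr ⟨_, ⟨e, Or.inr rfl⟩, rfl⟩
    · rintro (⟨_, ⟨e, rfl | rfl⟩, rfl⟩ | ⟨_, ⟨e, rfl | rfl⟩, rfl⟩)
      · exact ⟨.inl e, Or.inl (by rw [sum_bot_inl, h1])⟩
      · exact ⟨.inl e, Or.inr (by rw [sum_top_inl, h1])⟩
      · exact ⟨.inr e, Or.inl (by rw [sum_bot_inr hlo, h2])⟩
      · exact ⟨.inr e, Or.inr (by rw [sum_top_inr hhi, h2])⟩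

theorem x_mem_of_boxed (hb : ∀ p ∈ D.toPlane.carrier, p.1 ∈ Ioo (-1 : ℝ) 1) {e : S.E} {u : ℝ}
    (hu : u ∈ Icc (D.bot e) (D.top e)) : D.x e u ∈ Ioo (-1 : ℝ) 1 :=
  hb (D.point e u) (mem_iUnion.2 ⟨e, u, hu, rfl⟩)

theorem sum_boxed (hlo : D.lo = D'.lo) (hhi : D.hi = D'.hi)
    (hb : ∀ p ∈ D.toPlane.carrier, p.1 ∈ Ioo (-1 : ℝ) 1)
    (hb' : ∀ p ∈ D'.toPlane.carrier, p.1 ∈ Ioo (-1 : ℝ) 1) :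
    ∀ p ∈ (D.sum D').toPlane.carrier, p.1 ∈ Ioo (-1 : ℝ) 1 := by
  rw [sum_toPlane hlo hhi]
  rintro _ (⟨p, hp, rfl⟩ | ⟨p, hp, rfl⟩)
  · obtain ⟨h1, h2⟩ := hb p hp
    simp only [tau, mem_Ioo]
    constructor <;> linarith
  · obtain ⟨h1, h2⟩ := hb' p hp
    simp only [tau, mem_Ioo]
    constructor <;> linarith

/-- The boxes keep the first drawing at negative and the second at positive first coordinates, so
new coincidences cannot arise. -/
theorem IsValid.sum (hD : D.IsValid) (hD' : D'.IsValid) (hlo : D.lo = D'.lo) (hhi : D.hi = D'.hi)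
    (hb : ∀ p ∈ D.toPlane.carrier, p.1 ∈ Ioo (-1 : ℝ) 1)
    (hb' : ∀ p ∈ D'.toPlane.carrier, p.1 ∈ Ioo (-1 : ℝ) 1) : (D.sum D').IsValid where
  lt := hD.lt
  bounds v := by
    rcases v with v | v
    · exact hD.bounds v
    · change D.lo < (D'.pt v).2 ∧ (D'.pt v).2 < D.hi
      rw [hlo, hhi]; exact hD'.bounds v
  bot_lt_top e := by
    rcases e with e | e
    · rw [sum_bot_inl, sum_top_inl]; exact hD.bot_lt_top e
    · rw [sum_bot_inr hlo, sum_top_inr hhi]; exact hD'.bot_lt_top e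
  cont e := by
    rcases e with e | e
    · rw [sum_bot_inl, sum_top_inl]
      exact ((hD.cont e).add continuousOn_const).div_const 2
    · rw [sum_bot_inr hlo, sum_top_inr hhi]
      exact ((hD'.cont e).add continuousOn_const).div_const 2
  x_src e v h := by
    rcases e with e | e
    · obtain ⟨v, h1, rfl⟩ := Option.map_eq_some_iff.1 h
      exact congrArg (fun x => (x + -1) / 2) (hD.x_src e v h1)
    · obtain ⟨v, h1, rfl⟩ := Option.map_eq_some_iff.1 h
      exact congrArg (fun x => (x + 1) / 2) (hD'.x_src e v h1)
  x_tgt e v h := by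
    rcases e with e | e
    · obtain ⟨v, h1, rfl⟩ := Option.map_eq_some_iff.1 h
      exact congrArg (fun x => (x + -1) / 2) (hD.x_tgt e v h1)
    · obtain ⟨v, h1, rfl⟩ := Option.map_eq_some_iff.1 h
      exact congrArg (fun x => (x + 1) / 2) (hD'.x_tgt e v h1)
  disj e f u hne he hf hx := by
    rcases e with e | e <;> rcases f with f | f <;>
      simp only [sum_bot_inl, sum_top_inl, sum_bot_inr hlo, sum_top_inr hhi] at he hf
    · change (D.x e u + -1) / 2 = (D.x f u + -1) / 2 at hx
      obtain ⟨v, h1, h2, h3⟩ := hD.disj e f u (fun h => hne (congrArg _ h)) he hf (by linarith)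
      refine ⟨.inl v, h1.imp ?_ ?_, h2.imp ?_ ?_, h3⟩ <;>
      · intro h; simp [OpenGraph.sum, h]
    · have h1 := (x_mem_of_boxed hb he).2
      have h2 := (x_mem_of_boxed hb' hf).1
      change (D.x e u + -1) / 2 = (D'.x f u + 1) / 2 at hx
      linarith
    · have h1 := (x_mem_of_boxed hb' he).1
      have h2 := (x_mem_of_boxed hb hf).2
      change (D'.x e u + 1) / 2 = (D.x f u + -1) / 2 at hx
      linarith
    · change (D'.x e u + 1) / 2 = (D'.x f u + 1) / 2 at hx
      obtain ⟨v, h1, h2, h3⟩ := hD'.disj e f u (fun h => hne (congrArg _ h)) he hf (by linarith)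
      refine ⟨.inr v, h1.imp ?_ ?_, h2.imp ?_ ?_, h3⟩ <;>
      · intro h; simp [OpenGraph.sum, h]

theorem IsOrdered.sum (ho : D.IsOrdered r) (ho' : D'.IsOrdered r') (hlo : D.lo = D'.lo)
    (hhi : D.hi = D'.hi) (hb : ∀ p ∈ D.toPlane.carrier, p.1 ∈ Ioo (-1 : ℝ) 1)
    (hb' : ∀ p ∈ D'.toPlane.carrier, p.1 ∈ Ioo (-1 : ℝ) 1) :
    (D.sum D').IsOrdered (Sum.Lex r r') := by
  intro e f u h he hf
  rcases e with e | e <;> rcases f with f | f <;>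
    simp only [sum_bot_inl, sum_top_inl, sum_bot_inr hlo, sum_top_inr hhi] at he hf
  · have := ho e f u (Sum.lex_inl_inl.1 h) he hf
    change (D.x e u + -1) / 2 ≤ (D.x f u + -1) / 2
    linarith
  · have h1 := (x_mem_of_boxed hb he).2
    have h2 := (x_mem_of_boxed hb' hf).1
    change (D.x e u + -1) / 2 ≤ (D'.x f u + 1) / 2
    linarith
  · exact (Sum.lex_inr_inl h).elim
  · have := ho' e f u (Sum.lex_inr_inr.1 h) he hf
    change (D'.x e u + 1) / 2 ≤ (D'.x f u + 1) / 2
    linarith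

end Drawing

open GraphData

/-! ## Composition of open graphs -/

/-- Of the chosen partner of a glued half-edge only the specification is kept. This suffices,
because glued half-edges have the same edge and opposite signs. -/
theorem PlanarData.comp_σ_cases {X Y : PlanarData} (x : (Y.comp X).H) :
    (Glued X Y x.1 ((Y.comp X).σ x).1 ∨ Glued X Y ((Y.comp X).σ x).1 x.1) ∨
    ((¬ ∃ y : (Y.comp X).H, Glued X Y x.1 y.1 ∨ Glued X Y y.1 x.1) ∧
      ((Y.comp X).σ x).1 = Sum.map X.σ Y.σ x.1) ∨
    ((¬ ∃ y : (Y.comp X).H, Glued X Y x.1 y.1 ∨ Glued X Y y.1 x.1) ∧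
      Removed X Y (Sum.map X.σ Y.σ x.1) ∧ (Y.comp X).σ x = x) := by
  by_cases h1 : ∃ y : {x : X.H ⊕ Y.H // ¬ Removed X Y x}, Glued X Y x.1 y.1 ∨ Glued X Y y.1 x.1
  · have e : (Y.comp X).σ x = h1.choose := dif_pos h1
    rw [e]
    exact Or.inl h1.choose_spec
  · right
    by_cases h2 : ¬ Removed X Y (Sum.map X.σ Y.σ x.1)
    · have e : (Y.comp X).σ x = ⟨_, h2⟩ := (dif_neg h1).trans (dif_pos h2)
      exact Or.inl ⟨h1, congrArg Subtype.val e⟩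
    · exact Or.inr ⟨h1, not_not.1 h2, (dif_neg h1).trans (dif_neg h2)⟩

namespace OpenGraph

variable {S T : OpenGraph}

open Classical in
/-- The open graph in which every edge of `S` without target is continued by an edge of `T` without
source. -/
abbrev comp (m : {o : S.E // S.tgt o = none} ≃ {i : T.E // T.src i = none}) : OpenGraph where
  E := S.E ⊕ {f : T.E // T.src f ≠ none}
  V := S.V ⊕ T.V
  src := Sum.elim (fun e => (S.src e).map Sum.inl) fun f => (T.src f.1).map Sum.inr
  tgt := Sum.elim (fun e => if h : S.tgt e = none then (T.tgt (m ⟨e, h⟩).1).map Sum.inr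
    else (S.tgt e).map Sum.inl) fun f => (T.tgt f.1).map Sum.inr

variable (m : {o : S.E // S.tgt o = none} ≃ {i : T.E // T.src i = none})

open Classical in
/-- The edge of the composition that contains the edge `f` of the second graph. -/
def compSnd (f : T.E) : (comp m).E :=
  if h : T.src f = none then .inl (m.symm ⟨f, h⟩).1 else .inr ⟨f, h⟩

/-- The edges `e` and `f` are parts of the same edge of the composition. -/
def Glue (e : S.E) (f : T.E) : Prop := (Sum.inl e : (comp m).E) = compSnd m f

variable {m}

theorem compSnd_of_ne {f : T.E} (h : T.src f ≠ none) : compSnd m f = .inr ⟨f, h⟩ := dif_neg h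

theorem glue_iff {e : S.E} {f : T.E} : Glue m e f ↔ ∃ h : S.tgt e = none, (m ⟨e, h⟩).1 = f := by
  by_cases hf : T.src f = none
  · rw [Glue, compSnd, dif_pos hf]
    constructor
    · intro h
      have h := Sum.inl_injective h
      subst h
      exact ⟨(m.symm ⟨f, hf⟩).2, by simp⟩
    · rintro ⟨h, rfl⟩
      simp
  · rw [Glue, compSnd, dif_neg hf]
    refine iff_of_false (by simp) ?_
    rintro ⟨h, rfl⟩
    exact hf (m ⟨e, h⟩).2

theorem Glue.tgt {e : S.E} {f : T.E} (h : Glue m e f) : S.tgt e = none := (glue_iff.1 h).1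

theorem Glue.src {e : S.E} {f : T.E} (h : Glue m e f) : T.src f = none := by
  obtain ⟨ht, rfl⟩ := glue_iff.1 h
  exact (m ⟨e, ht⟩).2

theorem exists_glue_of_tgt {e : S.E} (h : S.tgt e = none) : ∃ f, Glue m e f :=
  ⟨_, glue_iff.2 ⟨h, rfl⟩⟩

theorem exists_glue_of_src {f : T.E} (h : T.src f = none) : ∃ e, Glue m e f :=
  ⟨_, glue_iff.2 ⟨(m.symm ⟨f, h⟩).2, by simp⟩⟩

theorem Glue.right_unique {e : S.E} {f f' : T.E} (h : Glue m e f) (h' : Glue m e f') : f = f' := by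
  obtain ⟨h, rfl⟩ := glue_iff.1 h
  obtain ⟨_, rfl⟩ := glue_iff.1 h'
  rfl

theorem Glue.left_unique {e e' : S.E} {f : T.E} (h : Glue m e f) (h' : Glue m e' f) : e = e' :=
  Sum.inl_injective (Eq.trans h (Eq.symm h'))

theorem compSnd_injective : Function.Injective (compSnd m) := by
  intro f f' h
  by_cases hf : T.src f = none
  · obtain ⟨e, he⟩ := exists_glue_of_src (m := m) hf
    exact he.right_unique (Eq.trans he h)
  · by_cases hf' : T.src f' = none
    · obtain ⟨e, he⟩ := exists_glue_of_src (m := m) hf'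
      exact (Glue.right_unique (Eq.trans he h.symm) he)
    · rw [compSnd_of_ne hf, compSnd_of_ne hf'] at h
      exact congrArg Subtype.val (Sum.inr_injective h)

theorem comp_cases (g : (comp m).E) :
    (∃ e, g = .inl e) ∨ ∃ f, T.src f ≠ none ∧ g = compSnd m f := by
  rcases g with e | ⟨f, hf⟩
  · exact Or.inl ⟨e, rfl⟩
  · exact Or.inr ⟨f, hf, (compSnd_of_ne hf).symm⟩

theorem comp_tgt_inl {e : S.E} (h : S.tgt e ≠ none) :
    (comp m).tgt (.inl e) = (S.tgt e).map .inl := dif_neg h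

theorem Glue.tgt_inl {e : S.E} {f : T.E} (h : Glue m e f) :
    (comp m).tgt (.inl e) = (T.tgt f).map .inr := by
  obtain ⟨ht, rfl⟩ := glue_iff.1 h
  exact dif_pos ht

theorem comp_tgt_snd (f : T.E) : (comp m).tgt (compSnd m f) = (T.tgt f).map .inr := by
  by_cases h : T.src f = none
  · obtain ⟨e, he⟩ := exists_glue_of_src (m := m) h
    exact Eq.trans (congrArg _ (Eq.symm he)) he.tgt_inl
  · rw [compSnd_of_ne h]; rfl

theorem comp_src_snd {f : T.E} (h : T.src f ≠ none) :
    (comp m).src (compSnd m f) = (T.src f).map .inr := by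
  rw [compSnd_of_ne h]; rfl

theorem comp_fin_inl {e : S.E} {b : Bool} {v : S.V} (h : S.fin e b = some v) :
    (comp m).fin (.inl e) b = some (.inl v) := by
  cases b
  · change (S.src e).map _ = _
    rw [show S.src e = some v from h]; rfl
  · have h : S.tgt e = some v := h
    change (comp m).tgt _ = _
    rw [comp_tgt_inl (by simp [h]), h]; rfl

theorem comp_fin_snd {f : T.E} {b : Bool} {v : T.V} (h : T.fin f b = some v) :
    (comp m).fin (compSnd m f) b = some (.inr v) := by
  cases b
  · have h : T.src f = some v := h
    change (comp m).src _ = _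
    rw [comp_src_snd (by simp [h]), h]; rfl
  · have h : T.tgt f = some v := h
    change (comp m).tgt _ = _
    rw [comp_tgt_snd, h]; rfl

theorem comp_fin_cases {g : (comp m).E} {b : Bool} {w : S.V ⊕ T.V} (h : (comp m).fin g b = some w) :
    (∃ e v, g = .inl e ∧ w = .inl v ∧ S.fin e b = some v) ∨
      ∃ f v, g = compSnd m f ∧ w = .inr v ∧ T.fin f b = some v := by
  rcases comp_cases g with ⟨e, rfl⟩ | ⟨f, hf, rfl⟩
  · cases b
    · obtain ⟨v, hv, rfl⟩ := Option.map_eq_some_iff.1 h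
      exact Or.inl ⟨e, v, rfl, rfl, hv⟩
    · by_cases ht : S.tgt e = none
      · obtain ⟨f, hf⟩ := exists_glue_of_tgt (m := m) ht
        have h := Eq.trans (Eq.symm hf.tgt_inl) h
        obtain ⟨v, hv, rfl⟩ := Option.map_eq_some_iff.1 h
        exact Or.inr ⟨f, v, hf, rfl, hv⟩
      · have h := Eq.trans (Eq.symm (comp_tgt_inl (m := m) ht)) h
        obtain ⟨v, hv, rfl⟩ := Option.map_eq_some_iff.1 h
        exact Or.inl ⟨e, v, rfl, rfl, hv⟩
  · cases b
    · have h := Eq.trans (Eq.symm (comp_src_snd (m := m) hf)) h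
      obtain ⟨v, hv, rfl⟩ := Option.map_eq_some_iff.1 h
      exact Or.inr ⟨f, v, rfl, rfl, hv⟩
    · have h := Eq.trans (Eq.symm (comp_tgt_snd (m := m) f)) h
      obtain ⟨v, hv, rfl⟩ := Option.map_eq_some_iff.1 h
      exact Or.inr ⟨f, v, rfl, rfl, hv⟩

theorem comp_unitary_inl {e : S.E} : (comp m).Unitary (.inl e) ↔
    S.Unitary e ∧ ∀ f, Glue m e f → T.tgt f = none := by
  have h1 : (comp m).src (.inl e) = none ↔ S.src e = none := Option.map_eq_none_iff
  constructor
  · rintro ⟨hs, ht⟩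
    have hte : S.tgt e = none := by
      by_contra hte
      rw [comp_tgt_inl hte] at ht
      exact hte (Option.map_eq_none_iff.1 ht)
    refine ⟨⟨h1.1 hs, hte⟩, fun f hf => ?_⟩
    rw [hf.tgt_inl] at ht
    exact Option.map_eq_none_iff.1 ht
  · rintro ⟨⟨hs, ht⟩, h⟩
    obtain ⟨f, hf⟩ := exists_glue_of_tgt (m := m) ht
    refine ⟨h1.2 hs, ?_⟩
    rw [hf.tgt_inl, h f hf]; rfl

theorem comp_unitary_snd {f : T.E} : (comp m).Unitary (compSnd m f) ↔
    T.Unitary f ∧ ∀ e, Glue m e f → S.src e = none := by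
  by_cases hs : T.src f = none
  · obtain ⟨e, he⟩ := exists_glue_of_src (m := m) hs
    have h2 : compSnd m f = .inl e := Eq.symm he
    rw [h2, comp_unitary_inl]
    constructor
    · rintro ⟨⟨h1, h2⟩, h3⟩
      refine ⟨⟨hs, h3 f he⟩, fun e' he' => ?_⟩
      rw [he'.left_unique he]; exact h1
    · rintro ⟨⟨-, h1⟩, h3⟩
      refine ⟨⟨h3 e he, he.tgt⟩, fun f' hf' => ?_⟩
      rw [hf'.right_unique he]; exact h1
  · refine iff_of_false (fun h => ?_) fun h => hs h.1.1
    have h := h.1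
    rw [comp_src_snd hs] at h
    exact hs (Option.map_eq_none_iff.1 h)

theorem comp_step_inl {e f : S.E} (h : S.Step e f) : (comp m).Step (.inl e) (.inl f) := by
  obtain ⟨v, h1, h2⟩ := h
  exact ⟨.inl v, comp_fin_inl (b := true) h1, comp_fin_inl (b := false) h2⟩

theorem comp_step_snd {e f : T.E} (h : T.Step e f) :
    (comp m).Step (compSnd m e) (compSnd m f) := by
  obtain ⟨v, h1, h2⟩ := h
  exact ⟨.inr v, comp_fin_snd (b := true) h1, comp_fin_snd (b := false) h2⟩

/-- No path returns from the second graph to the first: a composed edge with a part in `T` can end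
only at a vertex of `T`. -/
theorem comp_step_of_snd {f : T.E} {g : (comp m).E} (h : (comp m).Step (compSnd m f) g) :
    ∃ f', g = compSnd m f' ∧ T.Step f f' := by
  obtain ⟨w, h1, h2⟩ := h
  rw [comp_tgt_snd, Option.map_eq_some_iff] at h1
  obtain ⟨v, h1, rfl⟩ := h1
  rcases comp_fin_cases (b := false) h2 with ⟨e, v', -, h, -⟩ | ⟨f', v', rfl, h, h3⟩
  · cases h
  · cases h
    exact ⟨f', rfl, v, h1, h3⟩

theorem comp_step_to_inl {e : S.E} {g : (comp m).E} (h : (comp m).Step g (.inl e)) :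
    ∃ e', g = .inl e' ∧ S.Step e' e := by
  obtain ⟨w, h1, h2⟩ := h
  obtain ⟨v, h4, rfl⟩ := Option.map_eq_some_iff.1 h2
  rcases comp_fin_cases (b := true) h1 with ⟨e', v', rfl, h, h3⟩ | ⟨f', v', -, h, -⟩
  · cases h
    exact ⟨e', rfl, v, h3, h4⟩
  · cases h

theorem comp_path_inl {e f : S.E} (h : S.Path e f) : (comp m).Path (.inl e) (.inl f) :=
  Relation.ReflTransGen.lift (Sum.inl : S.E → (comp m).E) (fun _ _ => comp_step_inl) _ _ h

theorem comp_path_snd {e f : T.E} (h : T.Path e f) : (comp m).Path (compSnd m e) (compSnd m f) :=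
  Relation.ReflTransGen.lift (compSnd m) (fun _ _ => comp_step_snd) _ _ h

theorem comp_path_of_snd {f : T.E} {g : (comp m).E} (h : (comp m).Path (compSnd m f) g) :
    ∃ f', g = compSnd m f' ∧ T.Path f f' := by
  induction h with
  | refl => exact ⟨f, rfl, Path.refl f⟩
  | tail _ s ih =>
    obtain ⟨f', rfl, p⟩ := ih
    obtain ⟨f'', rfl, s'⟩ := comp_step_of_snd s
    exact ⟨f'', rfl, p.trans s'.path⟩

theorem comp_path_to_inl {e : S.E} {g : (comp m).E} (h : (comp m).Path g (.inl e)) :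
    ∃ e', g = .inl e' ∧ S.Path e' e := by
  induction h using Relation.ReflTransGen.head_induction_on with
  | refl => exact ⟨e, rfl, Path.refl e⟩
  | head s _ ih =>
    obtain ⟨f', rfl, q⟩ := ih
    obtain ⟨f'', rfl, s'⟩ := comp_step_to_inl s
    exact ⟨f'', rfl, s'.path.trans q⟩

theorem comp_path_inl_iff {e f : S.E} : (comp m).Path (.inl e) (.inl f) ↔ S.Path e f := by
  refine ⟨fun h => ?_, comp_path_inl⟩
  obtain ⟨e', h, p⟩ := comp_path_to_inl h
  cases h
  exact p

theorem comp_path_snd_iff {e f : T.E} :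
    (comp m).Path (compSnd m e) (compSnd m f) ↔ T.Path e f := by
  refine ⟨fun h => ?_, comp_path_snd⟩
  obtain ⟨e', h, p⟩ := comp_path_of_snd h
  rw [compSnd_injective h]
  exact p

/-- A path from the first graph into the second must use a grafted edge. Up to the first such edge
it runs in `S`, and from there on in `T`. -/
theorem exists_glue_of_comp_path {e : S.E} {f : T.E} (h : (comp m).Path (.inl e) (compSnd m f)) :
    ∃ o i, S.Path e o ∧ Glue m o i ∧ T.Path i f := by
  have key : ∀ g, (comp m).Path g (compSnd m f) → ∀ e, g = .inl e →
      ∃ o i, S.Path e o ∧ Glue m o i ∧ T.Path i f := by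
    intro g hg
    induction hg using Relation.ReflTransGen.head_induction_on with
    | refl => exact fun e h => ⟨e, f, Path.refl e, Eq.symm h, Path.refl f⟩
    | @head a c s p ih =>
      rintro e rfl
      by_cases ht : S.tgt e = none
      · obtain ⟨i, hi⟩ := exists_glue_of_tgt (m := m) ht
        refine ⟨e, i, Path.refl e, hi, (comp_path_snd_iff (m := m)).1 ?_⟩
        rw [← show _ = compSnd m i from hi]
        exact Relation.ReflTransGen.head s p
      · obtain ⟨w, h1, h2⟩ := s
        rw [comp_tgt_inl ht, Option.map_eq_some_iff] at h1
        obtain ⟨v, h1, rfl⟩ := h1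
        rcases comp_fin_cases (b := false) h2 with ⟨e', v', rfl, h, h3⟩ | ⟨f', v', -, h, -⟩
        · cases h
          obtain ⟨o, i, h4, h5⟩ := ih e' rfl
          exact ⟨o, i, (Step.path ⟨v, h1, h3⟩).trans h4, h5⟩
        · cases h
  exact key _ h e rfl

theorem IsFlow.comp (fl : S.IsFlow) (fl' : T.IsFlow) : (comp m).IsFlow where
  finite_E :=
    have := fl.finite_E
    have := fl'.finite_E
    inferInstanceAs (Finite (S.E ⊕ {f : T.E // T.src f ≠ none}))
  finite_V :=
    have := fl.finite_V
    have := fl'.finite_V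
    inferInstanceAs (Finite (S.V ⊕ T.V))
  exists_in v := by
    rcases v with v | v
    · obtain ⟨e, he⟩ := fl.exists_in v
      exact ⟨_, comp_fin_inl (b := true) he⟩
    · obtain ⟨e, he⟩ := fl'.exists_in v
      exact ⟨_, comp_fin_snd (b := true) he⟩
  exists_out v := by
    rcases v with v | v
    · obtain ⟨e, he⟩ := fl.exists_out v
      exact ⟨_, comp_fin_inl (b := false) he⟩
    · obtain ⟨e, he⟩ := fl'.exists_out v
      exact ⟨_, comp_fin_snd (b := false) he⟩

/-! ### The composition of presented graphs -/

namespace PresentsOrd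

variable {r : S.E → S.E → Prop} {r' : T.E → T.E → Prop} {X Y : PlanarData} {ε : X.H → S.E}
  {ε' : Y.H → T.E}

/-- The edge of the composition that contains a half-edge. -/
def glued (m : {o : S.E // S.tgt o = none} ≃ {i : T.E // T.src i = none}) (ε : X.H → S.E)
    (ε' : Y.H → T.E) : X.H ⊕ Y.H → (OpenGraph.comp m).E :=
  Sum.elim (fun h => .inl (ε h)) fun k => compSnd m (ε' k)

variable (p : PresentsOrd X S r ε) (p' : PresentsOrd Y T r' ε')
  (loop : ∀ e v, S.src e = some v → S.tgt e = some v → False)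
  (loop' : ∀ e v, T.src e = some v → T.tgt e = some v → False)
  (hm : ∀ o i, S.tgt o = none → T.src i = none → (Glue m o i ↔
    {o' | S.tgt o' = none ∧ r o' o}.ncard = {i' | T.src i' = none ∧ r' i' i}.ncard))
include p p' loop loop' hm

/-- Equality of positions among the legs is equality of positions among the edges with a free end,
which `hm` identifies with the matching `m`. -/
theorem match_iff (o : X.H) (i : Y.H) :
    PlanarData.Match X Y o i ↔ X.sgn o = false ∧ Y.sgn i = true ∧ Glue m (ε o) (ε' i) := by
  rw [PlanarData.Match, p.mem_outputs_iff loop, p'.mem_inputs_iff loop']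
  simp only [p.lt, p'.lt]
  rw [p.image_outputs loop (fun e => r e (ε o)), p'.image_inputs loop' (fun e => r' e (ε' i))]
  constructor
  · rintro ⟨⟨h1, h2⟩, ⟨h3, h4⟩, h5⟩
    exact ⟨h1, h3, (hm _ _ h2 h4).2 h5⟩
  · rintro ⟨h1, h2, h3⟩
    exact ⟨⟨h1, h3.tgt⟩, ⟨h2, h3.src⟩, (hm _ _ h3.tgt h3.src).1 h3⟩

/-- Only virtual half-edges disappear. The grafted half always does; the other half does too if the
partner ends at a vertex, where the half-edge of `Y` takes over. -/
theorem removed_inl_iff (h : X.H) : PlanarData.Removed X Y (.inl h) ↔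
    S.Unitary (ε h) ∧ (X.sgn h = false ∨ ∃ f, Glue m (ε h) f ∧ T.tgt f ≠ none) := by
  constructor
  · intro hr
    cases hr with
    | out_leg o i hmt hv =>
      rw [p.isVirtual_iff loop] at hv
      exact ⟨hv, Or.inl ((match_iff p p' loop loop' hm _ _).1 hmt).1⟩
    | out_end o i hmt hv hn =>
      rw [p.isVirtual_iff loop] at hv
      rw [p'.isVirtual_iff loop'] at hn
      have hg := ((match_iff p p' loop loop' hm _ _).1 hmt).2.2
      rw [p.σ_edge]
      exact ⟨hv, Or.inr ⟨_, hg, fun ht => hn ⟨hg.src, ht⟩⟩⟩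
  · rintro ⟨hu, hs | ⟨f, hf, ht⟩⟩
    · obtain ⟨f, hf⟩ := exists_glue_of_tgt (m := m) hu.2
      obtain ⟨k, rfl, hk⟩ := p'.exists_sgn_true hf.src
      exact .out_leg h k ((match_iff p p' loop loop' hm _ _).2 ⟨hs, hk, hf⟩)
        ((p.isVirtual_iff loop _).2 hu)
    · cases hs : X.sgn h with
      | false =>
        obtain ⟨k, rfl, hk⟩ := p'.exists_sgn_true hf.src
        exact .out_leg h k ((match_iff p p' loop loop' hm _ _).2 ⟨hs, hk, hf⟩)
          ((p.isVirtual_iff loop _).2 hu)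
      | true =>
        obtain ⟨k, rfl, hk⟩ := p'.exists_sgn_true hf.src
        have h1 := p.sgn_σ h (Or.inr hu)
        rw [hs] at h1
        have := PlanarData.Removed.out_end (X := X) (Y := Y) (X.σ h) k
          ((match_iff p p' loop loop' hm _ _).2 ⟨h1, hk, by rwa [p.σ_edge]⟩)
          ((p.isVirtual_iff loop _).2 (by rwa [p.σ_edge]))
          (fun hv => ht ((p'.isVirtual_iff loop' _).1 hv).2)
        rwa [p.involutive] at this

theorem removed_inr_iff (k : Y.H) : PlanarData.Removed X Y (.inr k) ↔
    T.Unitary (ε' k) ∧ (Y.sgn k = true ∨ ∃ e, Glue m e (ε' k) ∧ S.src e ≠ none) := by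
  constructor
  · intro hr
    cases hr with
    | in_leg o i hmt hv =>
      rw [p'.isVirtual_iff loop'] at hv
      exact ⟨hv, Or.inl ((match_iff p p' loop loop' hm _ _).1 hmt).2.1⟩
    | in_end o i hmt hn hv =>
      rw [p'.isVirtual_iff loop'] at hv
      rw [p.isVirtual_iff loop] at hn
      have hg := ((match_iff p p' loop loop' hm _ _).1 hmt).2.2
      rw [p'.σ_edge]
      exact ⟨hv, Or.inr ⟨_, hg, fun ht => hn ⟨ht, hg.tgt⟩⟩⟩
  · rintro ⟨hu, hs | ⟨f, hf, ht⟩⟩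
    · obtain ⟨f, hf⟩ := exists_glue_of_src (m := m) hu.1
      obtain ⟨h, rfl, hh⟩ := p.exists_sgn_false hf.tgt
      exact .in_leg h k ((match_iff p p' loop loop' hm _ _).2 ⟨hh, hs, hf⟩)
        ((p'.isVirtual_iff loop' _).2 hu)
    · cases hs : Y.sgn k with
      | true =>
        obtain ⟨h, rfl, hh⟩ := p.exists_sgn_false hf.tgt
        exact .in_leg h k ((match_iff p p' loop loop' hm _ _).2 ⟨hh, hs, hf⟩)
          ((p'.isVirtual_iff loop' _).2 hu)
      | false =>
        obtain ⟨h, rfl, hh⟩ := p.exists_sgn_false hf.tgt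
        have h1 := p'.sgn_σ k (Or.inr hu)
        rw [hs] at h1
        have := PlanarData.Removed.in_end (X := X) (Y := Y) h (Y.σ k)
          ((match_iff p p' loop loop' hm _ _).2 ⟨hh, h1, by rwa [p'.σ_edge]⟩)
          (fun hv => ht ((p.isVirtual_iff loop _).1 hv).1)
          ((p'.isVirtual_iff loop' _).2 (by rwa [p'.σ_edge]))
        rwa [p'.involutive] at this

theorem virtualGlued_iff (h : X.H) (k : Y.H) : PlanarData.VirtualGlued X Y (.inl h) (.inr k) ↔
    X.sgn h = true ∧ Y.sgn k = false ∧ S.Unitary (ε h) ∧ T.Unitary (ε' k) ∧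
      Glue m (ε h) (ε' k) := by
  constructor
  · intro hg
    cases hg with
    | mk o i hmt hv hv' =>
      rw [p.isVirtual_iff loop] at hv
      rw [p'.isVirtual_iff loop'] at hv'
      obtain ⟨h1, h2, h3⟩ := (match_iff p p' loop loop' hm _ _).1 hmt
      rw [p.sgn_σ _ (Or.inr hv), p'.sgn_σ _ (Or.inr hv'), h1, h2, p.σ_edge, p'.σ_edge]
      exact ⟨rfl, rfl, hv, hv', h3⟩
  · rintro ⟨h1, h2, h3, h4, h5⟩
    have := PlanarData.VirtualGlued.mk (X := X) (Y := Y) (X.σ h) (Y.σ k)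
      ((match_iff p p' loop loop' hm _ _).2
        ⟨by rw [p.sgn_σ _ (Or.inr h3), h1]; rfl, by rw [p'.sgn_σ _ (Or.inr h4), h2]; rfl,
          by rwa [p.σ_edge, p'.σ_edge]⟩)
      ((p.isVirtual_iff loop _).2 (by rwa [p.σ_edge]))
      ((p'.isVirtual_iff loop' _).2 (by rwa [p'.σ_edge]))
    rwa [p.involutive, p'.involutive] at this

/-- When both half-edges survive, the grafted edges are both virtual or both real, and in each case
the signs are forced. -/
theorem glued_of_glue {h : X.H} {k : Y.H} (hk : ¬ PlanarData.Removed X Y (.inl h))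
    (hk' : ¬ PlanarData.Removed X Y (.inr k)) (hg : Glue m (ε h) (ε' k)) :
    PlanarData.Glued X Y (.inl h) (.inr k) := by
  rw [removed_inl_iff p p' loop loop' hm] at hk
  rw [removed_inr_iff p p' loop loop' hm] at hk'
  push Not at hk hk'
  by_cases hu : S.Unitary (ε h)
  · obtain ⟨h1, h2⟩ := hk hu
    have hu' : T.Unitary (ε' k) := ⟨hg.src, h2 _ hg⟩
    exact .virt _ _ ((virtualGlued_iff p p' loop loop' hm _ _).2
      ⟨by simpa using h1, by simpa using (hk' hu').1, hu, hu', hg⟩)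
  · have hu' : ¬ T.Unitary (ε' k) := fun hu' => hu ⟨(hk' hu').2 _ hg, hg.tgt⟩
    have h1 : X.sgn h = false := by
      rcases p.isHalf h with ⟨v, hv⟩ | hh
      · cases hs : X.sgn h with
        | false => rfl
        | true =>
          rw [hs, fin_true, hg.tgt] at hv
          cases hv
      · exact (hu hh).elim
    have h2 : Y.sgn k = true := by
      rcases p'.isHalf k with ⟨v, hv⟩ | hh
      · cases hs : Y.sgn k with
        | true => rfl
        | false =>
          rw [hs, fin_false, hg.src] at hv
          cases hv
      · exact (hu' hh).elim
    exact .real _ _ ((match_iff p p' loop loop' hm _ _).2 ⟨h1, h2, hg⟩)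
      (fun hv => hu ((p.isVirtual_iff loop _).1 hv)) fun hv => hu' ((p'.isVirtual_iff loop' _).1 hv)

theorem glue_of_glued {x y : X.H ⊕ Y.H} (hg : PlanarData.Glued X Y x y) :
    ∃ h k, x = .inl h ∧ y = .inr k ∧ Glue m (ε h) (ε' k) ∧ Y.sgn k = !X.sgn h := by
  cases hg with
  | real o i hmt _ _ =>
    obtain ⟨h1, h2, h3⟩ := (match_iff p p' loop loop' hm _ _).1 hmt
    exact ⟨o, i, rfl, rfl, h3, by rw [h1, h2]; rfl⟩
  | virt x y hv =>
    cases hv with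
    | mk o i hmt hv hv' =>
      have h := (virtualGlued_iff p p' loop loop' hm _ _).1 (.mk o i hmt hv hv')
      exact ⟨_, _, rfl, rfl, h.2.2.2.2, by rw [h.1, h.2.1]; rfl⟩

/-- An upper end that a composed edge acquires in `T` is represented by a half-edge of `Y`; the
half-edge of `X` of the same sign, if there was one, has been removed. -/
theorem fin_inl_of_kept {h : X.H} (hk : ¬ PlanarData.Removed X Y (.inl h)) {w : S.V ⊕ T.V}
    (hw : (OpenGraph.comp m).fin (.inl (ε h)) (X.sgn h) = some w) :
    ∃ v, w = .inl v ∧ S.fin (ε h) (X.sgn h) = some v := by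
  rcases comp_fin_cases hw with ⟨e, v, h1, h2, h3⟩ | ⟨f, v, h1, h2, h3⟩
  · cases h1
    exact ⟨v, h2, h3⟩
  · exfalso
    have hg : Glue m (ε h) f := h1
    cases hs : X.sgn h with
    | false =>
      rw [hs, fin_false, hg.src] at h3
      cases h3
    | true =>
      rw [hs, fin_true] at h3
      rcases p.isHalf h with ⟨u, hu⟩ | hh
      · rw [hs, fin_true, hg.tgt] at hu
        cases hu
      · exact hk ((removed_inl_iff p p' loop loop' hm _).2 ⟨hh, Or.inr ⟨f, hg, by simp [h3]⟩⟩)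

theorem fin_snd_of_kept {k : Y.H} (hk : ¬ PlanarData.Removed X Y (.inr k)) {w : S.V ⊕ T.V}
    (hw : (OpenGraph.comp m).fin (compSnd m (ε' k)) (Y.sgn k) = some w) :
    ∃ v, w = .inr v ∧ T.fin (ε' k) (Y.sgn k) = some v := by
  rcases comp_fin_cases hw with ⟨e, v, h1, h2, h3⟩ | ⟨f, v, h1, h2, h3⟩
  · exfalso
    have hg : Glue m e (ε' k) := Eq.symm h1
    cases hs : Y.sgn k with
    | true =>
      rw [hs, fin_true, hg.tgt] at h3
      cases h3
    | false =>
      rw [hs, fin_false] at h3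
      rcases p'.isHalf k with ⟨u, hu⟩ | hh
      · rw [hs, fin_false, hg.src] at hu
        cases hu
      · exact hk ((removed_inr_iff p p' loop loop' hm _).2 ⟨hh, Or.inr ⟨e, hg, by simp [h3]⟩⟩)
  · cases compSnd_injective h1
    exact ⟨v, h2, h3⟩

theorem unitary_inl_of_kept {h : X.H} (hk : ¬ PlanarData.Removed X Y (.inl h)) :
    (OpenGraph.comp m).Unitary (.inl (ε h)) ↔ S.Unitary (ε h) := by
  rw [comp_unitary_inl, and_iff_left_iff_imp]
  intro hu f hf
  by_contra ht
  exact hk ((removed_inl_iff p p' loop loop' hm _).2 ⟨hu, Or.inr ⟨f, hf, ht⟩⟩)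

theorem unitary_snd_of_kept {k : Y.H} (hk : ¬ PlanarData.Removed X Y (.inr k)) :
    (OpenGraph.comp m).Unitary (compSnd m (ε' k)) ↔ T.Unitary (ε' k) := by
  rw [comp_unitary_snd, and_iff_left_iff_imp]
  intro hu f hf
  by_contra ht
  exact hk ((removed_inr_iff p p' loop loop' hm _).2 ⟨hu, Or.inr ⟨f, hf, ht⟩⟩)

theorem near_mixed_iff {h : X.H} {k : Y.H} (hk : ¬ PlanarData.Removed X Y (.inl h))
    (hk' : ¬ PlanarData.Removed X Y (.inr k)) :
    PlanarData.VirtualGlued X Y (.inl h) (.inr k) ↔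
      (OpenGraph.comp m).Near (.inl (ε h)) (X.sgn h) (compSnd m (ε' k)) (Y.sgn k) := by
  constructor
  · intro hv
    have hv := (virtualGlued_iff p p' loop loop' hm _ _).1 hv
    exact Or.inr ⟨(unitary_inl_of_kept p p' loop loop' hm hk).2 hv.2.2.1, hv.2.2.2.2⟩
  · rintro (⟨w, h1, h2⟩ | ⟨hu, hg⟩)
    · obtain ⟨v, rfl, -⟩ := fin_inl_of_kept p p' loop loop' hm hk h1
      obtain ⟨v', h3, -⟩ := fin_snd_of_kept p p' loop loop' hm hk' h2
      cases h3
    · have hg : Glue m (ε h) (ε' k) := hg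
      rw [comp_unitary_inl] at hu
      have hu' : T.Unitary (ε' k) := ⟨hg.src, hu.2 _ hg⟩
      rw [removed_inl_iff p p' loop loop' hm] at hk
      rw [removed_inr_iff p p' loop loop' hm] at hk'
      push Not at hk hk'
      exact (virtualGlued_iff p p' loop loop' hm _ _).2
        ⟨by simpa using (hk hu.1).1, by simpa using (hk' hu').1, hu.1, hu', hg⟩

/-- The rules of removal leave exactly one half-edge for every end of a composed edge that lies at a
vertex, and exactly two for a composed edge without ends. -/
theorem presents_comp :
    Presents (Y.comp X).toGraphData (OpenGraph.comp m) fun x => glued m ε ε' x.1 := by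
  have hedge : ∀ x y : {x : X.H ⊕ Y.H // ¬ PlanarData.Removed X Y x},
      PlanarData.Glued X Y x.1 y.1 ∨ PlanarData.Glued X Y y.1 x.1 →
        glued m ε ε' y.1 = glued m ε ε' x.1 ∧
          Sum.elim X.sgn Y.sgn y.1 = !Sum.elim X.sgn Y.sgn x.1 := by
    rintro x y (h | h)
    · obtain ⟨h, k, h1, h2, h3, h4⟩ := glue_of_glued p p' loop loop' hm h
      rw [h1, h2]
      exact ⟨Eq.symm h3, h4⟩
    · obtain ⟨h, k, h1, h2, h3, h4⟩ := glue_of_glued p p' loop loop' hm h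
      rw [h1, h2]
      exact ⟨h3, by simp [h4]⟩
  have hglue : ∀ h k (hk : ¬ PlanarData.Removed X Y (.inl h))
      (hk' : ¬ PlanarData.Removed X Y (.inr k)), glued m ε ε' (.inl h) = glued m ε ε' (.inr k) →
      PlanarData.Glued X Y (.inl h) (.inr k) :=
    fun h k hk hk' he => glued_of_glue p p' loop loop' hm hk hk' he
  refine ⟨?_, ?_, ?_, ?_, ?_⟩
  · rintro ⟨h | h, hk⟩ ⟨k | k, hk'⟩ he hs
    · exact Subtype.ext (congrArg Sum.inl (p.inj h k (Sum.inl_injective he) hs))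
    · have := (hedge ⟨_, hk⟩ ⟨_, hk'⟩ (Or.inl (hglue _ _ hk hk' he))).2
      change Y.sgn k = !X.sgn h at this
      change X.sgn h = Y.sgn k at hs
      rw [← hs] at this
      simp at this
    · have := (hedge ⟨_, hk'⟩ ⟨_, hk⟩ (Or.inl (hglue _ _ hk' hk he.symm))).2
      change Y.sgn h = !X.sgn k at this
      change Y.sgn h = X.sgn k at hs
      rw [hs] at this
      simp at this
    · exact Subtype.ext (congrArg Sum.inr (p'.inj h k (compSnd_injective he) hs))
  · intro g b
    constructor
    · rintro ⟨⟨h | h, hk⟩, rfl, rfl⟩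
      · change (OpenGraph.comp m).IsHalf (.inl (ε h)) (X.sgn h)
        rcases p.isHalf h with ⟨v, hv⟩ | hu
        · exact Or.inl ⟨_, comp_fin_inl hv⟩
        · exact Or.inr ((unitary_inl_of_kept p p' loop loop' hm hk).2 hu)
      · change (OpenGraph.comp m).IsHalf (compSnd m (ε' h)) (Y.sgn h)
        rcases p'.isHalf h with ⟨v, hv⟩ | hu
        · exact Or.inl ⟨_, comp_fin_snd hv⟩
        · exact Or.inr ((unitary_snd_of_kept p p' loop loop' hm hk).2 hu)
    · rintro (⟨w, hw⟩ | hu)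
      · rcases comp_fin_cases hw with ⟨e, v, rfl, -, h3⟩ | ⟨f, v, rfl, -, h3⟩
        · obtain ⟨h, rfl, rfl⟩ := (p.half e b).2 (Or.inl ⟨v, h3⟩)
          refine ⟨⟨.inl h, fun hr => ?_⟩, rfl, rfl⟩
          rw [((removed_inl_iff p p' loop loop' hm _).1 hr).1.fin] at h3
          cases h3
        · obtain ⟨k, rfl, rfl⟩ := (p'.half f b).2 (Or.inl ⟨v, h3⟩)
          refine ⟨⟨.inr k, fun hr => ?_⟩, rfl, rfl⟩
          rw [((removed_inr_iff p p' loop loop' hm _).1 hr).1.fin] at h3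
          cases h3
      · rcases comp_cases g with ⟨e, rfl⟩ | ⟨f, hf, rfl⟩
        · have hu2 := comp_unitary_inl.1 hu
          -- Of a composed edge without ends that arises by grafting, the half of sign `+` survives
          -- in `X` and the half of sign `-` in `Y`.
          cases b with
          | true =>
            obtain ⟨h, rfl, hs⟩ := (p.half e true).2 (Or.inr hu2.1)
            refine ⟨⟨.inl h, fun hr => ?_⟩, rfl, hs⟩
            rcases ((removed_inl_iff p p' loop loop' hm _).1 hr).2 with h1 | ⟨f, h1, h2⟩
            · simp [hs] at h1
            · exact h2 (hu2.2 f h1)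
          | false =>
            obtain ⟨i, hi⟩ := exists_glue_of_tgt (m := m) hu2.1.2
            obtain ⟨k, rfl, hs⟩ := (p'.half i false).2 (Or.inr ⟨hi.src, hu2.2 i hi⟩)
            refine ⟨⟨.inr k, fun hr => ?_⟩, Eq.symm hi, hs⟩
            rcases ((removed_inr_iff p p' loop loop' hm _).1 hr).2 with h1 | ⟨f, h1, h2⟩
            · simp [hs] at h1
            · rw [h1.left_unique hi] at h2
              exact h2 hu2.1.1
        · exact (hf (comp_unitary_snd.1 hu).1.1).elim
  · rintro ⟨h | h, hk⟩ ⟨k | k, hk'⟩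
    · change (X.P h k ∨ PlanarData.VirtualGlued X Y (.inl h) (.inl k) ∨
        PlanarData.VirtualGlued X Y (.inl k) (.inl h)) ↔
        (OpenGraph.comp m).Near (.inl (ε h)) (X.sgn h) (.inl (ε k)) (X.sgn k)
      have h1 : ∀ h k, ¬ PlanarData.VirtualGlued X Y (.inl h) (.inl k) := fun _ _ h => by cases h
      rw [or_iff_left (by simp [h1]), p.near]
      refine or_congr ⟨?_, ?_⟩ (and_congr (unitary_inl_of_kept p p' loop loop' hm hk).symm
        Sum.inl_injective.eq_iff.symm)
      · rintro ⟨v, h1, h2⟩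
        exact ⟨_, comp_fin_inl h1, comp_fin_inl h2⟩
      · rintro ⟨w, h1, h2⟩
        obtain ⟨v, rfl, h3⟩ := fin_inl_of_kept p p' loop loop' hm hk h1
        obtain ⟨v', h4, h5⟩ := fin_inl_of_kept p p' loop loop' hm hk' h2
        cases h4
        exact ⟨v, h3, h5⟩
    · change (False ∨ PlanarData.VirtualGlued X Y (.inl h) (.inr k) ∨
        PlanarData.VirtualGlued X Y (.inr k) (.inl h)) ↔
        (OpenGraph.comp m).Near (.inl (ε h)) (X.sgn h) (compSnd m (ε' k)) (Y.sgn k)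
      have h1 : ¬ PlanarData.VirtualGlued X Y (.inr k) (.inl h) := fun h => by cases h
      rw [false_or, or_iff_left h1]
      exact near_mixed_iff p p' loop loop' hm hk hk'
    · change (False ∨ PlanarData.VirtualGlued X Y (.inr h) (.inl k) ∨
        PlanarData.VirtualGlued X Y (.inl k) (.inr h)) ↔
        (OpenGraph.comp m).Near (compSnd m (ε' h)) (Y.sgn h) (.inl (ε k)) (X.sgn k)
      have h1 : ¬ PlanarData.VirtualGlued X Y (.inr h) (.inl k) := fun h => by cases h
      rw [false_or, or_iff_right h1, near_mixed_iff p p' loop loop' hm hk' hk]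
      constructor
      · rintro (⟨w, h1, h2⟩ | ⟨hu, he⟩)
        · exact Or.inl ⟨w, h2, h1⟩
        · exact Or.inr ⟨he ▸ hu, he.symm⟩
      · rintro (⟨w, h1, h2⟩ | ⟨hu, he⟩)
        · exact Or.inl ⟨w, h2, h1⟩
        · exact Or.inr ⟨he ▸ hu, he.symm⟩
    · change (Y.P h k ∨ PlanarData.VirtualGlued X Y (.inr h) (.inr k) ∨
        PlanarData.VirtualGlued X Y (.inr k) (.inr h)) ↔
        (OpenGraph.comp m).Near (compSnd m (ε' h)) (Y.sgn h) (compSnd m (ε' k)) (Y.sgn k)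
      have h1 : ∀ h k, ¬ PlanarData.VirtualGlued X Y (.inr h) (.inr k) := fun _ _ h => by cases h
      rw [or_iff_left (by simp [h1]), p'.near]
      refine or_congr ⟨?_, ?_⟩ (and_congr (unitary_snd_of_kept p p' loop loop' hm hk).symm
        compSnd_injective.eq_iff.symm)
      · rintro ⟨v, h1, h2⟩
        exact ⟨_, comp_fin_snd h1, comp_fin_snd h2⟩
      · rintro ⟨w, h1, h2⟩
        obtain ⟨v, rfl, h3⟩ := fin_snd_of_kept p p' loop loop' hm hk h1
        obtain ⟨v', h4, h5⟩ := fin_snd_of_kept p p' loop loop' hm hk' h2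
        cases h4
        exact ⟨v, h3, h5⟩
  · intro x
    rcases PlanarData.comp_σ_cases x with h | ⟨-, h⟩ | ⟨-, -, h⟩
    · exact (hedge x _ h).1
    · dsimp only
      rw [h]
      obtain ⟨k | k, hk⟩ := x
      · exact congrArg (Sum.inl : S.E → (OpenGraph.comp m).E) (p.σ_edge k)
      · exact congrArg (compSnd m) (p'.σ_edge k)
    · dsimp only
      rw [h]
  · rintro x ⟨y, hy, hs⟩
    change Sum.elim X.sgn Y.sgn y.1 = !Sum.elim X.sgn Y.sgn x.1 at hs
    change Sum.elim X.sgn Y.sgn ((Y.comp X).σ x).1 = !Sum.elim X.sgn Y.sgn x.1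
    -- A half-edge that is not glued can share its composed edge only with its old partner in the
    -- same graph.
    have same : (¬ ∃ y : {x : X.H ⊕ Y.H // ¬ PlanarData.Removed X Y x},
        PlanarData.Glued X Y x.1 y.1 ∨ PlanarData.Glued X Y y.1 x.1) →
        y.1 = Sum.map X.σ Y.σ x.1 := by
      intro hn
      obtain ⟨h | h, hk⟩ := x <;> obtain ⟨k | k, hk'⟩ := y
      · refine congrArg Sum.inl (p.inj _ _ ?_ ?_)
        · rw [p.σ_edge]; exact Sum.inl_injective hy
        · rw [p.σ_ne h ⟨k, Sum.inl_injective hy, hs⟩]; exact hs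
      · exact (hn ⟨⟨_, hk'⟩, Or.inl (hglue _ _ hk hk' hy.symm)⟩).elim
      · exact (hn ⟨⟨_, hk'⟩, Or.inr (hglue _ _ hk' hk hy)⟩).elim
      · refine congrArg Sum.inr (p'.inj _ _ ?_ ?_)
        · rw [p'.σ_edge]; exact compSnd_injective hy
        · rw [p'.σ_ne h ⟨k, compSnd_injective hy, hs⟩]; exact hs
    rcases PlanarData.comp_σ_cases x with h | ⟨h1, h⟩ | ⟨h1, h2, -⟩
    · exact (hedge x _ h).2
    · rw [h, ← same h1]; exact hs
    · rw [← same h1] at h2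
      exact (y.2 h2).elim

theorem traceFst_iff (x : X.H ⊕ Y.H) (h : X.H) :
    PlanarData.TraceFst X Y x (edge h) ↔ glued m ε ε' x = .inl (ε h) := by
  rcases x with h' | k
  · exact (p.edge_eq_iff h' h).trans Sum.inl_injective.eq_iff.symm
  · constructor
    · rintro ⟨o, i, hmt, h1, h2⟩
      have := ((match_iff p p' loop loop' hm _ _).1 hmt).2.2
      rw [(p'.edge_eq_iff _ _).1 h1, (p.edge_eq_iff _ _).1 h2] at this
      exact Eq.symm this
    · intro he
      have hg : Glue m (ε h) (ε' k) := Eq.symm he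
      obtain ⟨o, ho, hs⟩ := p.exists_sgn_false hg.tgt
      obtain ⟨i, hi, hs'⟩ := p'.exists_sgn_true hg.src
      exact ⟨o, i, (match_iff p p' loop loop' hm _ _).2 ⟨hs, hs', by rwa [ho, hi]⟩,
        (p'.edge_eq_iff _ _).2 hi, (p.edge_eq_iff _ _).2 ho⟩

theorem traceSnd_iff (x : X.H ⊕ Y.H) (k : Y.H) :
    PlanarData.TraceSnd X Y x (edge k) ↔ glued m ε ε' x = compSnd m (ε' k) := by
  rcases x with h | k'
  · constructor
    · rintro ⟨o, i, hmt, h1, h2⟩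
      have := ((match_iff p p' loop loop' hm _ _).1 hmt).2.2
      rw [(p.edge_eq_iff _ _).1 h1, (p'.edge_eq_iff _ _).1 h2] at this
      exact this
    · intro he
      have hg : Glue m (ε h) (ε' k) := he
      obtain ⟨o, ho, hs⟩ := p.exists_sgn_false hg.tgt
      obtain ⟨i, hi, hs'⟩ := p'.exists_sgn_true hg.src
      exact ⟨o, i, (match_iff p p' loop loop' hm _ _).2 ⟨hs, hs', by rwa [ho, hi]⟩,
        (p.edge_eq_iff _ _).2 ho, (p'.edge_eq_iff _ _).2 hi⟩
  · exact (p'.edge_eq_iff k' k).trans compSnd_injective.eq_iff.symm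

theorem before_iff (h : X.H) (k : Y.H) : PlanarData.Before X Y (edge h) (edge k) ↔
    ∃ o i, Glue m o i ∧ r (ε h) o ∧ r' i (ε' k) := by
  constructor
  · rintro ⟨o, i, hmt, h1, h2⟩
    exact ⟨_, _, ((match_iff p p' loop loop' hm _ _).1 hmt).2.2, (p.lt _ _).1 h1, (p'.lt _ _).1 h2⟩
  · rintro ⟨o, i, hg, h1, h2⟩
    obtain ⟨o, rfl, hs⟩ := p.exists_sgn_false hg.tgt
    obtain ⟨i, rfl, hs'⟩ := p'.exists_sgn_true hg.src
    exact ⟨o, i, (match_iff p p' loop loop' hm _ _).2 ⟨hs, hs', hg⟩, (p.lt _ _).2 h1,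
      (p'.lt _ _).2 h2⟩

/-- That the shuffle is an order is not checked directly. A grafted edge counts as an edge of both
graphs, so the clauses of `CompLT` overlap; they are consistent as soon as some relation `q` has the
three prescribed restrictions. -/
theorem comp {q : (OpenGraph.comp m).E → (OpenGraph.comp m).E → Prop}
    (hfst : ∀ e e', r e e' ↔ q (.inl e) (.inl e'))
    (hsnd : ∀ f f', r' f f' ↔ q (compSnd m f) (compSnd m f'))
    (hmix : ∀ e f, S.tgt e ≠ none → T.src f ≠ none →
      (q (.inl e) (compSnd m f) ↔ ∃ o i, Glue m o i ∧ r e o ∧ r' i f) ∧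
      (q (compSnd m f) (.inl e) ↔ ¬ ∃ o i, Glue m o i ∧ r e o ∧ r' i f)) :
    PresentsOrd (Y.comp X) (OpenGraph.comp m) q fun x => glued m ε ε' x.1 := by
  have hp := presents_comp p p' loop loop' hm
  have hF := traceFst_iff p p' loop loop' hm
  have hS := traceSnd_iff p p' loop loop' hm
  have hB := before_iff p p' loop loop' hm
  have hF' : ∀ x h, glued m ε ε' x = .inl (ε h) → (¬ ∃ f', PlanarData.TraceSnd X Y x f') →
      S.tgt (ε h) ≠ none := by
    intro x h hx hn ht
    obtain ⟨f, hf⟩ := exists_glue_of_tgt (m := m) ht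
    obtain ⟨k, rfl⟩ := p'.surjective f
    exact hn ⟨edge k, (hS x k).2 (hx.trans hf)⟩
  have hS' : ∀ x k, glued m ε ε' x = compSnd m (ε' k) → (¬ ∃ e', PlanarData.TraceFst X Y x e') →
      T.src (ε' k) ≠ none := by
    intro x k hx hn ht
    obtain ⟨e, he⟩ := exists_glue_of_src (m := m) ht
    obtain ⟨h, rfl⟩ := p.surjective e
    exact hn ⟨edge h, (hF x h).2 (hx.trans (Eq.symm he))⟩
  have key : ∀ x y, PlanarData.CompLT X Y x y ↔ q (glued m ε ε' x) (glued m ε ε' y) := by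
    intro x y
    constructor
    · intro hl
      cases hl with
      | fst e e' h1 h2 h3 =>
        obtain ⟨h, rfl⟩ := Quot.exists_rep e
        obtain ⟨h', rfl⟩ := Quot.exists_rep e'
        rw [(hF x h).1 h1, (hF y h').1 h2, ← hfst]
        exact (p.lt _ _).1 h3
      | snd f f' h1 h2 h3 =>
        obtain ⟨k, rfl⟩ := Quot.exists_rep f
        obtain ⟨k', rfl⟩ := Quot.exists_rep f'
        rw [(hS x k).1 h1, (hS y k').1 h2, ← hsnd]
        exact (p'.lt _ _).1 h3
      | fst_snd e f n1 n2 h1 h2 h3 =>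
        obtain ⟨h, rfl⟩ := Quot.exists_rep e
        obtain ⟨k, rfl⟩ := Quot.exists_rep f
        have h1 := (hF x h).1 h1
        have h2 := (hS y k).1 h2
        rw [h1, h2, (hmix _ _ (hF' x h h1 n1) (hS' y k h2 n2)).1]
        exact (hB h k).1 h3
      | snd_fst f e n1 n2 h1 h2 h3 =>
        obtain ⟨h, rfl⟩ := Quot.exists_rep e
        obtain ⟨k, rfl⟩ := Quot.exists_rep f
        have h1 := (hS x k).1 h1
        have h2 := (hF y h).1 h2
        rw [h1, h2, (hmix _ _ (hF' y h h2 n2) (hS' x k h1 n1)).2]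
        exact fun hb => h3 ((hB h k).2 hb)
    · intro hq
      have hcases : ∀ x, (∃ h, glued m ε ε' x = .inl (ε h)) ∨
          ∃ k, glued m ε ε' x = compSnd m (ε' k) := by
        rintro (h | k)
        · exact Or.inl ⟨h, rfl⟩
        · exact Or.inr ⟨k, rfl⟩
      -- If the two edges are neither both parts of `X` nor both parts of `Y`, one is an old edge of
      -- `X`, the other an old edge of `Y`, and neither is grafted.
      by_cases hA : (∃ h, glued m ε ε' x = .inl (ε h)) ∧ ∃ h, glued m ε ε' y = .inl (ε h)
      · obtain ⟨⟨h, hx⟩, h', hy⟩ := hA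
        rw [hx, hy, ← hfst] at hq
        exact .fst x y (edge h) (edge h') ((hF x h).2 hx) ((hF y h').2 hy) ((p.lt _ _).2 hq)
      by_cases hB' : (∃ k, glued m ε ε' x = compSnd m (ε' k)) ∧
          ∃ k, glued m ε ε' y = compSnd m (ε' k)
      · obtain ⟨⟨h, hx⟩, h', hy⟩ := hB'
        rw [hx, hy, ← hsnd] at hq
        exact .snd x y (edge h) (edge h') ((hS x h).2 hx) ((hS y h').2 hy) ((p'.lt _ _).2 hq)
      have nF : ∀ x, (¬ ∃ h, glued m ε ε' x = .inl (ε h)) →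
          ¬ ∃ e', PlanarData.TraceFst X Y x e' := by
        rintro x hn ⟨e, he⟩
        obtain ⟨h, rfl⟩ := Quot.exists_rep e
        exact hn ⟨h, (hF x h).1 he⟩
      have nS : ∀ x, (¬ ∃ k, glued m ε ε' x = compSnd m (ε' k)) →
          ¬ ∃ f', PlanarData.TraceSnd X Y x f' := by
        rintro x hn ⟨e, he⟩
        obtain ⟨h, rfl⟩ := Quot.exists_rep e
        exact hn ⟨h, (hS x h).1 he⟩
      rcases hcases x with ⟨h, hx⟩ | ⟨k, hx⟩ <;> rcases hcases y with ⟨h', hy⟩ | ⟨k', hy⟩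
      · exact (hA ⟨⟨h, hx⟩, h', hy⟩).elim
      · have n1 := nS x fun hn => hB' ⟨hn, k', hy⟩
        have n2 := nF y fun hn => hA ⟨⟨h, hx⟩, hn⟩
        rw [hx, hy, (hmix _ _ (hF' x h hx n1) (hS' y k' hy n2)).1] at hq
        exact .fst_snd x y (edge h) (edge k') n1 n2 ((hF x h).2 hx) ((hS y k').2 hy)
          ((hB h k').2 hq)
      · have n1 := nF x fun hn => hA ⟨hn, h', hy⟩
        have n2 := nS y fun hn => hB' ⟨⟨k, hx⟩, hn⟩
        rw [hx, hy, (hmix _ _ (hF' y h' hy n2) (hS' x k hx n1)).2] at hq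
        exact .snd_fst x y (edge k) (edge h') n1 n2 ((hS x k).2 hx) ((hF y h').2 hy)
          fun hb => hq ((hB h' k).1 hb)
      · exact (hB' ⟨⟨k, hx⟩, k', hy⟩).elim
  refine ⟨hp, fun x y => ?_⟩
  rw [← key]
  constructor
  · rintro ⟨x', y', h1, h2, hl⟩
    rw [key] at hl ⊢
    rwa [(hp.edge_eq_iff x' x).1 h1, (hp.edge_eq_iff y' y).1 h2] at hl
  · intro hl
    exact ⟨x, y, rfl, rfl, hl⟩

end PresentsOrd

end OpenGraph

open GraphData PlaneGraph

/-! ## Composition of drawings -/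

/-- The number of earlier elements of `A` is smaller than `A.ncard` and strictly increasing, so this
injection between sets of equal size is a bijection. -/
theorem exists_rank {E : Type*} [Finite E] {r : E → E → Prop} (irrefl : ∀ e, ¬ r e e)
    (trans : ∀ e f g, r e f → r f g → r e g) (total : ∀ e f, r e f ∨ e = f ∨ r f e) (A : Set E) :
    ∃ k : A ≃ Fin A.ncard, ∀ a, (k a : ℕ) = {x | x ∈ A ∧ r x a}.ncard := by
  have hlt : ∀ a ∈ A, ∀ b, r a b → {x | x ∈ A ∧ r x a}.ncard < {x | x ∈ A ∧ r x b}.ncard := by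
    intro a ha b hab
    refine ncard_lt_ncard ⟨fun x hx => ⟨hx.1, trans _ _ _ hx.2 hab⟩, fun h => ?_⟩
    exact irrefl a (h (show a ∈ {x | x ∈ A ∧ r x b} from ⟨ha, hab⟩)).2
  have hr : ∀ a : A, {x | x ∈ A ∧ r x a}.ncard < A.ncard := fun a =>
    ncard_lt_ncard ⟨fun x hx => hx.1, fun h => irrefl _ (h a.2).2⟩
  let k : A → Fin A.ncard := fun a => ⟨_, hr a⟩
  have := Fintype.ofFinite A
  refine ⟨Equiv.ofBijective k ((Fintype.bijective_iff_injective_and_card k).2 ⟨?_, ?_⟩),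
    fun a => rfl⟩
  · intro a b hab
    have hab : {x | x ∈ A ∧ r x a}.ncard = {x | x ∈ A ∧ r x b}.ncard := congrArg Fin.val hab
    rcases total a b with h | h | h
    · exact absurd hab (hlt a a.2 b h).ne
    · exact Subtype.ext h
    · exact absurd hab (hlt b b.2 a h).ne'
  · rw [Fintype.card_fin, ← Nat.card_eq_fintype_card, Nat.card_coe_set_eq]

namespace OpenGraph

variable {S T : OpenGraph} {r : S.E → S.E → Prop} {r' : T.E → T.E → Prop}

/-- The outputs of `S` and the inputs of `T` can be matched in their orders. -/
theorem exists_matching (pl : S.IsPlanar r) (pl' : T.IsPlanar r')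
    (hc : {e | S.tgt e = none}.ncard = {f | T.src f = none}.ncard) :
    ∃ m : {o : S.E // S.tgt o = none} ≃ {i : T.E // T.src i = none},
      ∀ o i, S.tgt o = none → T.src i = none → (Glue m o i ↔
        {o' | S.tgt o' = none ∧ r o' o}.ncard = {i' | T.src i' = none ∧ r' i' i}.ncard) := by
  have := pl.finite_E
  have := pl'.finite_E
  obtain ⟨k, hk⟩ := exists_rank pl.irrefl pl.trans pl.total {e | S.tgt e = none}
  obtain ⟨k', hk'⟩ := exists_rank pl'.irrefl pl'.trans pl'.total {f | T.src f = none}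
  refine ⟨k.trans ((finCongr hc).trans k'.symm), fun o i ho hi => ?_⟩
  have h1 := hk ⟨o, ho⟩
  have h2 := hk' ⟨i, hi⟩
  simp only [mem_ofPred_eq] at h1 h2
  rw [← h1, ← h2, glue_iff]
  constructor
  · rintro ⟨h, rfl⟩
    simp
  · intro h
    refine ⟨ho, ?_⟩
    have : finCongr hc (k ⟨o, ho⟩) = k' ⟨i, hi⟩ := Fin.ext h
    change (k'.symm (finCongr hc (k ⟨o, ho⟩))).1 = i
    rw [this, Equiv.symm_apply_apply]

/-- The position among the edges with a free end increases strictly with the order on both sides,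
and `m` preserves it. -/
theorem lt_of_glue (pl : S.IsPlanar r) (pl' : T.IsPlanar r')
    {m : {o : S.E // S.tgt o = none} ≃ {i : T.E // T.src i = none}}
    (hm : ∀ o i, S.tgt o = none → T.src i = none → (Glue m o i ↔
      {o' | S.tgt o' = none ∧ r o' o}.ncard = {i' | T.src i' = none ∧ r' i' i}.ncard))
    {o o' : S.E} {i i' : T.E} (h : Glue m o i) (h' : Glue m o' i') (hr : r o o') : r' i i' := by
  have := pl.finite_E
  have := pl'.finite_E
  have h1 : {x | S.tgt x = none ∧ r x o}.ncard < {x | S.tgt x = none ∧ r x o'}.ncard := by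
    refine ncard_lt_ncard ⟨fun x hx => ⟨hx.1, pl.trans _ _ _ hx.2 hr⟩, fun hs => ?_⟩
    exact pl.irrefl o (hs (show o ∈ {x | S.tgt x = none ∧ r x o'} from ⟨h.tgt, hr⟩)).2
  rw [(hm _ _ h.tgt h.src).1 h, (hm _ _ h'.tgt h'.src).1 h'] at h1
  rcases pl'.total i i' with q | rfl | q
  · exact q
  · exact (lt_irrefl _ h1).elim
  · refine absurd h1 (not_lt.2 (ncard_le_ncard fun x hx => ⟨hx.1, pl'.trans _ _ _ hx.2 q⟩))

end OpenGraph

namespace Drawing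

variable {S T : OpenGraph}

open OpenGraph (Glue compSnd)

open Classical in
/-- Composition of drawings between the levels `-1` and `1`. -/
def comp (m : {o : S.E // S.tgt o = none} ≃ {i : T.E // T.src i = none}) (D : Drawing S)
    (D' : Drawing T) : Drawing (OpenGraph.comp m) where
  lo := -1
  hi := 1
  pt := Sum.elim (fun v => gamma (-2) (D.pt v)) fun v => gamma 2 (D'.pt v)
  -- The three levels of the formula are the shrunk first drawing below `-1/3`, the connecting
  -- segment, and the shrunk second drawing above `1/3`. The value `0` lies outside the range of
  -- levels of its edge, since an edge of `S` with a target ends below `-1/3`.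
  x := Sum.elim (fun e u => if u ≤ -1 / 3 then D.x e (3 * u + 2) else
    if h : S.tgt e = none then
      if u ≤ 1 / 3 then (1 - 3 * u) / 2 * D.x e 1 + (1 + 3 * u) / 2 * D'.x (m ⟨e, h⟩).1 (-1)
      else D'.x (m ⟨e, h⟩).1 (3 * u - 2)
    else 0) fun f u => D'.x f.1 (3 * u - 2)

variable {m : {o : S.E // S.tgt o = none} ≃ {i : T.E // T.src i = none}} {D : Drawing S}
  {D' : Drawing T}

theorem comp_x_low (e : S.E) {u : ℝ} (hu : u ≤ -1 / 3) :
    (comp m D D').x (.inl e) u = D.x e (3 * u + 2) := if_pos hu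

theorem comp_x_mid {e : S.E} {f : T.E} (h : Glue m e f) {u : ℝ} (h1 : -1 / 3 ≤ u) (h2 : u ≤ 1 / 3) :
    (comp m D D').x (.inl e) u = (1 - 3 * u) / 2 * D.x e 1 + (1 + 3 * u) / 2 * D'.x f (-1) := by
  obtain ⟨ht, rfl⟩ := OpenGraph.glue_iff.1 h
  rcases h1.eq_or_lt with rfl | h1
  · rw [comp_x_low e le_rfl]
    norm_num
  · exact (if_neg (not_le.2 h1)).trans ((dif_pos ht).trans (if_pos h2))

theorem comp_x_high (f : T.E) {u : ℝ} (hu : 1 / 3 ≤ u) :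
    (comp m D D').x (compSnd m f) u = D'.x f (3 * u - 2) := by
  by_cases hs : T.src f = none
  · obtain ⟨e, he⟩ := OpenGraph.exists_glue_of_src (m := m) hs
    rw [show compSnd m f = .inl e from Eq.symm he]
    obtain ⟨ht, rfl⟩ := OpenGraph.glue_iff.1 he
    rcases hu.eq_or_lt with rfl | hu
    · rw [comp_x_mid he (by norm_num) le_rfl]
      norm_num
    · have h1 : ¬ u ≤ -1 / 3 := by linarith
      exact (if_neg h1).trans ((dif_pos ht).trans (if_neg (not_le.2 hu)))
  · rw [OpenGraph.compSnd_of_ne hs]; rfl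

theorem gamma_neg_point (e : S.E) (u : ℝ) :
    gamma (-2) (D.point e u) = (D.x e u, (u - 2) / 3) := by
  simp [gamma, point, sub_eq_add_neg]

theorem gamma_pos_point (f : T.E) (u : ℝ) :
    gamma 2 (D'.point f u) = (D'.x f u, (u + 2) / 3) := rfl

section Levels

variable (hlo : D.lo = -1) (hhi' : D'.hi = 1)

include hlo in
theorem comp_bot_inl (e : S.E) : (comp m D D').bot (.inl e) = (D.bot e - 2) / 3 := by
  cases h : S.src e with
  | none =>
    have : (OpenGraph.comp m).src (.inl e) = none := Option.map_eq_none_iff.2 h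
    rw [bot_of_none h, bot_of_none this, hlo]
    change (-1 : ℝ) = _
    norm_num
  | some v =>
    rw [bot_of_src h, bot_of_src (OpenGraph.comp_fin_inl (b := false) h), sub_eq_add_neg]
    rfl

theorem comp_bot_snd {f : T.E} (h : T.src f ≠ none) :
    (comp m D D').bot (compSnd m f) = (D'.bot f + 2) / 3 := by
  obtain ⟨v, hv⟩ := Option.ne_none_iff_exists'.1 h
  rw [bot_of_src hv, bot_of_src (OpenGraph.comp_fin_snd (b := false) hv)]
  rfl

theorem comp_top_inl {e : S.E} (h : S.tgt e ≠ none) :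
    (comp m D D').top (.inl e) = (D.top e - 2) / 3 := by
  obtain ⟨v, hv⟩ := Option.ne_none_iff_exists'.1 h
  rw [top_of_tgt hv, top_of_tgt (OpenGraph.comp_fin_inl (b := true) hv)]
  rw [sub_eq_add_neg]
  rfl

include hhi' in
theorem comp_top_snd (f : T.E) : (comp m D D').top (compSnd m f) = (D'.top f + 2) / 3 := by
  cases h : T.tgt f with
  | none =>
    have : (OpenGraph.comp m).tgt (compSnd m f) = none := by rw [OpenGraph.comp_tgt_snd, h]; rfl
    rw [top_of_none h, top_of_none this, hhi']
    change (1 : ℝ) = _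
    norm_num
  | some v =>
    rw [top_of_tgt h, top_of_tgt (OpenGraph.comp_fin_snd (b := true) h)]
    rfl

end Levels

section Valid

variable (hD : D.IsValid) (hD' : D'.IsValid) (hlo : D.lo = -1) (hhi : D.hi = 1) (hlo' : D'.lo = -1)
  (hhi' : D'.hi = 1)
include hD hD' hlo hhi hlo' hhi'

theorem comp_low_cases {g : (OpenGraph.comp m).E} {u : ℝ}
    (hu : u ∈ Icc ((comp m D D').bot g) ((comp m D D').top g)) (h : u ≤ -1 / 3) :
    ∃ e, g = .inl e ∧ 3 * u + 2 ∈ Icc (D.bot e) (D.top e) := by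
  rcases OpenGraph.comp_cases g with ⟨e, rfl⟩ | ⟨f, hf, rfl⟩
  · refine ⟨e, rfl, ?_, ?_⟩
    · have := hu.1
      rw [comp_bot_inl hlo] at this
      linarith
    · by_cases ht : S.tgt e = none
      · rw [top_of_none ht, hhi]; linarith
      · have := hu.2
        rw [comp_top_inl ht] at this
        linarith
  · have h1 := hu.1
    rw [comp_bot_snd hf] at h1
    have h2 := hD'.lo_le_bot f
    linarith

theorem comp_high_cases {g : (OpenGraph.comp m).E} {u : ℝ}
    (hu : u ∈ Icc ((comp m D D').bot g) ((comp m D D').top g)) (h : 1 / 3 ≤ u) :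
    ∃ f, g = compSnd m f ∧ 3 * u - 2 ∈ Icc (D'.bot f) (D'.top f) := by
  have key : ∀ f, g = compSnd m f → T.src f = none ∨ T.src f ≠ none →
      3 * u - 2 ∈ Icc (D'.bot f) (D'.top f) := by
    rintro f rfl hc
    refine ⟨?_, ?_⟩
    · rcases hc with hs | hs
      · rw [bot_of_none hs, hlo']; linarith
      · have := hu.1
        rw [comp_bot_snd hs] at this
        linarith
    · have := hu.2
      rw [comp_top_snd hhi'] at this
      linarith
  rcases OpenGraph.comp_cases g with ⟨e, rfl⟩ | ⟨f, hf, rfl⟩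
  · by_cases ht : S.tgt e = none
    · obtain ⟨f, hf⟩ := OpenGraph.exists_glue_of_tgt (m := m) ht
      exact ⟨f, hf, key f hf (em _)⟩
    · have h1 := hu.2
      rw [comp_top_inl ht] at h1
      have h2 := hD.top_le_hi e
      linarith
  · exact ⟨f, rfl, key f rfl (em _)⟩

theorem comp_mid_cases {g : (OpenGraph.comp m).E} {u : ℝ}
    (hu : u ∈ Icc ((comp m D D').bot g) ((comp m D D').top g)) (h1 : -1 / 3 < u) (h2 : u < 1 / 3) :
    ∃ e f, g = .inl e ∧ Glue m e f := by
  rcases OpenGraph.comp_cases g with ⟨e, rfl⟩ | ⟨f, hf, rfl⟩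
  · by_cases ht : S.tgt e = none
    · obtain ⟨f, hf⟩ := OpenGraph.exists_glue_of_tgt (m := m) ht
      exact ⟨e, f, rfl, hf⟩
    · have h1 := hu.2
      rw [comp_top_inl ht] at h1
      have h2 := hD.top_le_hi e
      linarith
  · have h1 := hu.1
    rw [comp_bot_snd hf] at h1
    have h2 := hD'.lo_le_bot f
    linarith

theorem comp_mem_glue {e : S.E} {f : T.E} (h : Glue m e f) {u : ℝ}
    (h1 : (D.bot e - 2) / 3 ≤ u) (h2 : u ≤ (D'.top f + 2) / 3) :
    u ∈ Icc ((comp m D D').bot (.inl e)) ((comp m D D').top (.inl e)) := by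
  refine ⟨by rwa [comp_bot_inl hlo], ?_⟩
  rw [show (Sum.inl e : (OpenGraph.comp m).E) = compSnd m f from h, comp_top_snd hhi']
  exact h2

theorem comp_low_mem {e : S.E} {u : ℝ} (hu : 3 * u + 2 ∈ Icc (D.bot e) (D.top e)) :
    u ∈ Icc ((comp m D D').bot (.inl e)) ((comp m D D').top (.inl e)) ∧ u ≤ -1 / 3 := by
  have h1 := hD.top_le_hi e
  have hle : u ≤ -1 / 3 := by linarith [hu.2]
  refine ⟨?_, hle⟩
  by_cases ht : S.tgt e = none
  · obtain ⟨f, hf⟩ := OpenGraph.exists_glue_of_tgt (m := m) ht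
    have h2 := hD'.lo_le_bot f
    have h3 := hD'.bot_lt_top f
    exact comp_mem_glue hD hD' hlo hhi hlo' hhi' hf (by linarith [hu.1]) (by linarith)
  · rw [comp_bot_inl hlo, comp_top_inl ht]
    constructor <;> linarith [hu.1, hu.2]

theorem comp_high_mem {f : T.E} {u : ℝ} (hu : 3 * u - 2 ∈ Icc (D'.bot f) (D'.top f)) :
    u ∈ Icc ((comp m D D').bot (compSnd m f)) ((comp m D D').top (compSnd m f)) ∧ 1 / 3 ≤ u := by
  have h1 := hD'.lo_le_bot f
  have hle : 1 / 3 ≤ u := by linarith [hu.1]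
  refine ⟨?_, hle⟩
  by_cases ht : T.src f = none
  · obtain ⟨e, he⟩ := OpenGraph.exists_glue_of_src (m := m) ht
    have h2 := hD.top_le_hi e
    have h3 := hD.bot_lt_top e
    rw [show compSnd m f = .inl e from Eq.symm he]
    exact comp_mem_glue hD hD' hlo hhi hlo' hhi' he (by linarith) (by linarith [hu.2])
  · rw [comp_bot_snd ht, comp_top_snd hhi']
    constructor <;> linarith [hu.1, hu.2]

theorem comp_mid_mem {e : S.E} {f : T.E} (h : Glue m e f) {u : ℝ} (h1 : -1 / 3 ≤ u)
    (h2 : u ≤ 1 / 3) : u ∈ Icc ((comp m D D').bot (.inl e)) ((comp m D D').top (.inl e)) := by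
  have h3 := hD'.lo_le_bot f
  have h4 := hD'.bot_lt_top f
  have h5 := hD.top_le_hi e
  have h6 := hD.bot_lt_top e
  exact comp_mem_glue hD hD' hlo hhi hlo' hhi' h (by linarith) (by linarith)

theorem comp_pt_inl (v : S.V) :
    3 * ((comp m D D').pt (.inl v)).2 + 2 = (D.pt v).2 ∧ ((comp m D D').pt (.inl v)).2 < -1 / 3 := by
  have := (hD.bounds v).2
  change 3 * (((D.pt v).2 + -2) / 3) + 2 = _ ∧ ((D.pt v).2 + -2) / 3 < _
  constructor <;> linarith

theorem comp_pt_inr (v : T.V) :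
    3 * ((comp m D D').pt (.inr v)).2 - 2 = (D'.pt v).2 ∧ 1 / 3 < ((comp m D D').pt (.inr v)).2 := by
  have := (hD'.bounds v).1
  change 3 * (((D'.pt v).2 + 2) / 3) - 2 = _ ∧ _ < ((D'.pt v).2 + 2) / 3
  constructor <;> linarith

theorem comp_x_pt {g : (OpenGraph.comp m).E} {w : S.V ⊕ T.V} {b : Bool}
    (h : (OpenGraph.comp m).fin g b = some w) :
    (comp m D D').x g ((comp m D D').pt w).2 = ((comp m D D').pt w).1 := by
  rcases OpenGraph.comp_fin_cases h with ⟨e, v, rfl, rfl, hv⟩ | ⟨f, v, rfl, rfl, hv⟩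
  · obtain ⟨h1, h2⟩ := comp_pt_inl (m := m) hD hD' hlo hhi hlo' hhi' v
    rw [comp_x_low e h2.le, h1]
    cases b
    · exact hD.x_src e v hv
    · exact hD.x_tgt e v hv
  · obtain ⟨h1, h2⟩ := comp_pt_inr (m := m) hD hD' hlo hhi hlo' hhi' v
    rw [comp_x_high f h2.le, h1]
    cases b
    · exact hD'.x_src f v hv
    · exact hD'.x_tgt f v hv

theorem comp_cont (g : (OpenGraph.comp m).E) : ContinuousOn ((comp m D D').x g)
    (Icc ((comp m D D').bot g) ((comp m D D').top g)) := by
  have hlow : ∀ e, ContinuousOn ((comp m D D').x (.inl e))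
      {u | 3 * u + 2 ∈ Icc (D.bot e) (D.top e)} := fun e => by
    refine ((hD.cont e).comp (f := fun u : ℝ => 3 * u + 2) (by fun_prop) fun u hu => hu).congr ?_
    intro u hu
    exact comp_x_low e (comp_low_mem (m := m) hD hD' hlo hhi hlo' hhi' hu).2
  have hhigh : ∀ f, ContinuousOn ((comp m D D').x (compSnd m f))
      {u | 3 * u - 2 ∈ Icc (D'.bot f) (D'.top f)} := fun f => by
    refine ((hD'.cont f).comp (f := fun u : ℝ => 3 * u - 2) (by fun_prop) fun u hu => hu).congr ?_
    intro u hu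
    exact comp_x_high f (comp_high_mem (m := m) hD hD' hlo hhi hlo' hhi' hu).2
  have hall : ∀ e f, Glue m e f → ContinuousOn ((comp m D D').x (.inl e))
      (Icc ((comp m D D').bot (.inl e)) ((comp m D D').top (.inl e))) := by
    intro e f h
    have hmid : ContinuousOn ((comp m D D').x (.inl e)) (Icc (-1 / 3) (1 / 3)) := by
      refine ContinuousOn.congr (f := fun u =>
        (1 - 3 * u) / 2 * D.x e 1 + (1 + 3 * u) / 2 * D'.x f (-1)) (by fun_prop) ?_
      intro u hu
      exact comp_x_mid h hu.1 hu.2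
    have h2 := hhigh f
    rw [← show Sum.inl e = compSnd m f from h] at h2
    have c1 : IsClosed {u : ℝ | 3 * u + 2 ∈ Icc (D.bot e) (D.top e)} :=
      isClosed_Icc.preimage (by fun_prop)
    have c2 : IsClosed {u : ℝ | 3 * u - 2 ∈ Icc (D'.bot f) (D'.top f)} :=
      isClosed_Icc.preimage (by fun_prop)
    -- The three zones are closed, and their formulas agree at `-1/3` and `1/3`.
    refine (((hlow e).union_of_isClosed hmid c1 isClosed_Icc).union_of_isClosed h2
      (c1.union isClosed_Icc) c2).mono ?_
    intro u hu
    have h3 := bot_of_none (D := D') h.src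
    have h4 := top_of_none (D := D) h.tgt
    have h5 := hu.1
    have h6 := hu.2
    rw [comp_bot_inl hlo] at h5
    rw [show (Sum.inl e : (OpenGraph.comp m).E) = compSnd m f from h, comp_top_snd hhi'] at h6
    rcases le_total u (-1 / 3) with h7 | h7
    · exact Or.inl (Or.inl ⟨by linarith, by linarith⟩)
    · rcases le_total u (1 / 3) with h8 | h8
      · exact Or.inl (Or.inr ⟨h7, h8⟩)
      · exact Or.inr ⟨by linarith, by linarith⟩
  rcases OpenGraph.comp_cases g with ⟨e, rfl⟩ | ⟨f, hf, rfl⟩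
  · by_cases ht : S.tgt e = none
    · obtain ⟨f, hf⟩ := OpenGraph.exists_glue_of_tgt (m := m) ht
      exact hall e f hf
    · refine (hlow e).mono fun u hu => ?_
      rw [comp_bot_inl hlo, comp_top_inl ht] at hu
      constructor <;> linarith [hu.1, hu.2]
  · refine (hhigh f).mono fun u hu => ?_
    rw [comp_bot_snd hf, comp_top_snd hhi'] at hu
    constructor <;> linarith [hu.1, hu.2]

variable {r : S.E → S.E → Prop} {r' : T.E → T.E → Prop} (pl : S.IsPlanar r) (pl' : T.IsPlanar r')
  (ho : D.IsOrdered r) (ho' : D'.IsOrdered r')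
  (hm : ∀ o i, S.tgt o = none → T.src i = none → (Glue m o i ↔
    {o' | S.tgt o' = none ∧ r o' o}.ncard = {i' | T.src i' = none ∧ r' i' i}.ncard))
include pl pl' ho ho' hm

/-- The segments join points of equal position, so both of their ends are in the same left-to-right
order, and so are the convex combinations. -/
theorem comp_mid_lt {o o' : S.E} {i i' : T.E} (h : Glue m o i) (h' : Glue m o' i') (hr : r o o')
    {u : ℝ} (h1 : -1 / 3 < u) (h2 : u < 1 / 3) :
    (comp m D D').x (.inl o) u < (comp m D D').x (.inl o') u := by
  rw [comp_x_mid h h1.le h2.le, comp_x_mid h' h1.le h2.le]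
  have e1 := (hD.x_hi_lt_iff pl ho h.tgt h'.tgt).2 hr
  have e2 := (hD'.x_lo_lt_iff pl' ho' h.src h'.src).2 (OpenGraph.lt_of_glue pl pl' hm h h' hr)
  rw [hhi] at e1
  rw [hlo'] at e2
  have c1 : 0 < (1 - 3 * u) / 2 := by linarith
  have c2 : 0 < (1 + 3 * u) / 2 := by linarith
  exact add_lt_add (mul_lt_mul_of_pos_left e1 c1) (mul_lt_mul_of_pos_left e2 c2)

/-- In the lower and in the upper zone coincidences come from the two drawings, and between the
zones there are none by `comp_mid_lt`. -/
theorem IsValid.comp : (Drawing.comp m D D').IsValid where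
  lt := by
    change (-1 : ℝ) < 1
    norm_num
  bounds v := by
    rcases v with v | v
    · have h1 := (hD.bounds v).1
      have h2 := comp_pt_inl (m := m) hD hD' hlo hhi hlo' hhi' v
      change -1 < _ ∧ _ < (1 : ℝ)
      constructor <;> linarith [h2.1, h2.2]
    · have h1 := (hD'.bounds v).2
      have h2 := comp_pt_inr (m := m) hD hD' hlo hhi hlo' hhi' v
      change -1 < _ ∧ _ < (1 : ℝ)
      constructor <;> linarith [h2.1, h2.2]
  bot_lt_top g := by
    rcases OpenGraph.comp_cases g with ⟨e, rfl⟩ | ⟨f, hf, rfl⟩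
    · have h1 := hD.bot_lt_top e
      have h2 := hD.top_le_hi e
      rw [comp_bot_inl hlo]
      by_cases ht : S.tgt e = none
      · obtain ⟨f, hf⟩ := OpenGraph.exists_glue_of_tgt (m := m) ht
        have h3 := hD'.bot_lt_top f
        have h4 := hD'.lo_le_bot f
        rw [show (Sum.inl e : (OpenGraph.comp m).E) = compSnd m f from hf, comp_top_snd hhi']
        linarith
      · rw [comp_top_inl ht]
        linarith
    · have h3 := hD'.bot_lt_top f
      rw [comp_bot_snd hf, comp_top_snd hhi']
      linarith
  cont := comp_cont hD hD' hlo hhi hlo' hhi'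
  x_src e v h := comp_x_pt hD hD' hlo hhi hlo' hhi' (b := false) h
  x_tgt e v h := comp_x_pt hD hD' hlo hhi hlo' hhi' (b := true) h
  disj g g' u hne hg hg' hx := by
    rcases le_or_gt u (-1 / 3) with hu | hu
    · obtain ⟨e, rfl, he⟩ := comp_low_cases hD hD' hlo hhi hlo' hhi' hg hu
      obtain ⟨f, rfl, hf⟩ := comp_low_cases hD hD' hlo hhi hlo' hhi' hg' hu
      rw [comp_x_low e hu, comp_x_low f hu] at hx
      obtain ⟨v, h1, h2, h3⟩ := hD.disj e f _ (fun h => hne (congrArg _ h)) he hf hx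
      refine ⟨.inl v, ?_, ?_, ?_⟩
      · exact h1.imp (OpenGraph.comp_fin_inl (b := false)) (OpenGraph.comp_fin_inl (b := true))
      · exact h2.imp (OpenGraph.comp_fin_inl (b := false)) (OpenGraph.comp_fin_inl (b := true))
      · have := (comp_pt_inl (m := m) hD hD' hlo hhi hlo' hhi' v).1
        linarith
    rcases le_or_gt (1 / 3) u with hu' | hu'
    · obtain ⟨e, rfl, he⟩ := comp_high_cases hD hD' hlo hhi hlo' hhi' hg hu'
      obtain ⟨f, rfl, hf⟩ := comp_high_cases hD hD' hlo hhi hlo' hhi' hg' hu'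
      rw [comp_x_high e hu', comp_x_high f hu'] at hx
      obtain ⟨v, h1, h2, h3⟩ := hD'.disj e f _ (fun h => hne (congrArg _ h)) he hf hx
      refine ⟨.inr v, ?_, ?_, ?_⟩
      · exact h1.imp (OpenGraph.comp_fin_snd (b := false)) (OpenGraph.comp_fin_snd (b := true))
      · exact h2.imp (OpenGraph.comp_fin_snd (b := false)) (OpenGraph.comp_fin_snd (b := true))
      · have := (comp_pt_inr (m := m) hD hD' hlo hhi hlo' hhi' v).1
        linarith
    · obtain ⟨e, i, rfl, he⟩ := comp_mid_cases hD hD' hlo hhi hlo' hhi' hg hu hu'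
      obtain ⟨f, j, rfl, hf⟩ := comp_mid_cases hD hD' hlo hhi hlo' hhi' hg' hu hu'
      rcases pl.total e f with h | rfl | h
      · exact absurd hx (comp_mid_lt hD hD' hlo hhi hlo' hhi' pl pl' ho ho' hm he hf h hu hu').ne
      · exact absurd rfl hne
      · exact absurd hx (comp_mid_lt hD hD' hlo hhi hlo' hhi' pl pl' ho ho' hm hf he h hu hu').ne'

omit hD' hlo hlo' hhi' pl' ho' hm in
theorem atLevel_hi (p : ℝ × ℝ) :
    p ∈ D.toPlane.atLevel 1 ↔ ∃ e, S.tgt e = none ∧ p = D.point e 1 := by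
  constructor
  · rintro ⟨hp, h⟩
    obtain ⟨e, u, hu, rfl⟩ := mem_iUnion.1 hp
    obtain rfl : u = 1 := h
    have h1 : D.top e = D.hi := le_antisymm (hD.top_le_hi e) (by rw [hhi]; exact hu.2)
    exact ⟨e, (hD.top_eq_hi_iff e).1 h1, rfl⟩
  · rintro ⟨e, he, rfl⟩
    refine ⟨mem_iUnion.2 ⟨e, 1, ?_, rfl⟩, rfl⟩
    have h1 := hD.bot_lt_top e
    have h2 := top_of_none (D := D) he
    constructor <;> linarith

omit hD hlo hhi hhi' pl ho hm in
theorem atLevel_lo (p : ℝ × ℝ) :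
    p ∈ D'.toPlane.atLevel (-1) ↔ ∃ f, T.src f = none ∧ p = D'.point f (-1) := by
  constructor
  · rintro ⟨hp, h⟩
    obtain ⟨e, u, hu, rfl⟩ := mem_iUnion.1 hp
    obtain rfl : u = -1 := h
    have h1 : D'.bot e = D'.lo := le_antisymm (by rw [hlo']; exact hu.1) (hD'.lo_le_bot e)
    exact ⟨e, (hD'.bot_eq_lo_iff e).1 h1, rfl⟩
  · rintro ⟨e, he, rfl⟩
    refine ⟨mem_iUnion.2 ⟨e, -1, ?_, rfl⟩, rfl⟩
    have h1 := hD'.bot_lt_top e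
    have h2 := bot_of_none (D := D') he
    constructor <;> linarith

omit hD' hlo hlo' hhi' pl' ho' hm in
theorem ncard_left_hi {e : S.E} (he : S.tgt e = none) :
    {p | p ∈ D.toPlane.atLevel 1 ∧ p.1 < (D.point e 1).1}.ncard =
      {e' | S.tgt e' = none ∧ r e' e}.ncard := by
  refine (ncard_congr (fun e' _ => D.point e' 1) ?_ ?_ ?_).symm
  · rintro e' ⟨h1, h2⟩
    refine ⟨(atLevel_hi hD hhi pl ho _).2 ⟨e', h1, rfl⟩, ?_⟩
    have := (hD.x_hi_lt_iff pl ho h1 he).2 h2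
    rwa [hhi] at this
  · rintro e' f ⟨h1, -⟩ ⟨h2, -⟩ h
    refine hD.eq_of_point_top_eq h1 h2 ?_
    rw [hhi]
    exact congrArg Prod.fst h
  · rintro p ⟨hp, hlt⟩
    obtain ⟨e', h1, rfl⟩ := (atLevel_hi hD hhi pl ho _).1 hp
    refine ⟨e', ⟨h1, (hD.x_hi_lt_iff pl ho h1 he).1 ?_⟩, rfl⟩
    rw [hhi]
    exact hlt

omit hD hlo hhi hhi' pl ho hm in
theorem ncard_left_lo {f : T.E} (hf : T.src f = none) :
    {p | p ∈ D'.toPlane.atLevel (-1) ∧ p.1 < (D'.point f (-1)).1}.ncard =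
      {f' | T.src f' = none ∧ r' f' f}.ncard := by
  refine (ncard_congr (fun e' _ => D'.point e' (-1)) ?_ ?_ ?_).symm
  · rintro e' ⟨h1, h2⟩
    refine ⟨(atLevel_lo hD' hlo' pl' ho' _).2 ⟨e', h1, rfl⟩, ?_⟩
    have := (hD'.x_lo_lt_iff pl' ho' h1 hf).2 h2
    rwa [hlo'] at this
  · rintro e' f ⟨h1, -⟩ ⟨h2, -⟩ h
    refine hD'.eq_of_point_bot_eq h1 h2 ?_
    rw [hlo']
    exact congrArg Prod.fst h
  · rintro p ⟨hp, hlt⟩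
    obtain ⟨e', h1, rfl⟩ := (atLevel_lo hD' hlo' pl' ho' _).1 hp
    refine ⟨e', ⟨h1, (hD'.x_lo_lt_iff pl' ho' h1 hf).1 ?_⟩, rfl⟩
    rw [hlo']
    exact hlt

theorem mem_connectors_iff (p : ℝ × ℝ) : p ∈ connectors D.toPlane D'.toPlane ↔
    ∃ e f, Glue m e f ∧ ∃ u, -1 / 3 ≤ u ∧ u ≤ 1 / 3 ∧ p = (comp m D D').point (.inl e) u := by
  have hpt : ∀ {e f}, Glue m e f → ∀ u, -1 / 3 ≤ u → u ≤ 1 / 3 → (comp m D D').point (.inl e) u =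
      ((1 - 3 * u) / 2) • gamma (-2) (D.point e 1) + ((1 + 3 * u) / 2) • gamma 2 (D'.point f (-1)) := by
    intro e f h u h1 h2
    rw [gamma_neg_point, gamma_pos_point]
    refine Prod.ext ?_ ?_
    · exact comp_x_mid h h1 h2
    · change u = (1 - 3 * u) / 2 * ((1 - 2) / 3) + (1 + 3 * u) / 2 * ((-1 + 2) / 3)
      ring
  constructor
  · rintro ⟨p, hp, q, hq, hc, hz⟩
    obtain ⟨e, he, rfl⟩ := (atLevel_hi hD hhi pl ho _).1 hp
    obtain ⟨f, hf, rfl⟩ := (atLevel_lo hD' hlo' pl' ho' _).1 hq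
    have hg : Glue m e f := by
      rw [hm e f he hf, ← ncard_left_hi hD hhi pl ho he, ← ncard_left_lo hD' hlo' pl' ho' hf]
      exact hc
    obtain ⟨a, b, ha, hb, hab, rfl⟩ := hz
    -- The ends of the segment are at the levels `-1/3` and `1/3`, so the point with weights `a` and
    -- `b` is at level `(b - a) / 3`.
    refine ⟨e, f, hg, (b - a) / 3, by linarith, by linarith, ?_⟩
    rw [hpt hg _ (by linarith) (by linarith)]
    congr 2 <;> linarith
  · rintro ⟨e, f, hg, u, h1, h2, rfl⟩
    refine ⟨_, (atLevel_hi hD hhi pl ho _).2 ⟨e, hg.tgt, rfl⟩, _,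
      (atLevel_lo hD' hlo' pl' ho' _).2 ⟨f, hg.src, rfl⟩, ?_, ?_⟩
    · have := (hm e f hg.tgt hg.src).1 hg
      rw [← ncard_left_hi hD hhi pl ho hg.tgt, ← ncard_left_lo hD' hlo' pl' ho' hg.src] at this
      exact this
    · exact ⟨(1 - 3 * u) / 2, (1 + 3 * u) / 2, by linarith, by linarith, by ring,
        (hpt hg u h1 h2).symm⟩

omit pl pl' ho ho' hm in
theorem comp_point_low (e : S.E) {u : ℝ} (hu : u ≤ -1 / 3) :
    (comp m D D').point (.inl e) u = gamma (-2) (D.point e (3 * u + 2)) := by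
  rw [gamma_neg_point]
  refine Prod.ext (comp_x_low e hu) ?_
  change u = (3 * u + 2 - 2) / 3
  ring

omit pl pl' ho ho' hm in
theorem comp_point_high (f : T.E) {u : ℝ} (hu : 1 / 3 ≤ u) :
    (comp m D D').point (compSnd m f) u = gamma 2 (D'.point f (3 * u - 2)) := by
  rw [gamma_pos_point]
  refine Prod.ext (comp_x_high f hu) ?_
  change u = (3 * u - 2 + 2) / 3
  ring

theorem comp_carrier : (comp m D D').toPlane.carrier = (D'.toPlane.comp D.toPlane).carrier := by
  ext p
  constructor
  · intro hp
    obtain ⟨g, u, hu, rfl⟩ := mem_iUnion.1 hp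
    rcases le_or_gt u (-1 / 3) with h1 | h1
    · obtain ⟨e, rfl, he⟩ := comp_low_cases hD hD' hlo hhi hlo' hhi' hu h1
      rw [comp_point_low hD hD' hlo hhi hlo' hhi' e h1]
      exact Or.inl (Or.inl ⟨_, mem_iUnion.2 ⟨e, _, he, rfl⟩, rfl⟩)
    rcases le_or_gt (1 / 3) u with h2 | h2
    · obtain ⟨f, rfl, hf⟩ := comp_high_cases hD hD' hlo hhi hlo' hhi' hu h2
      rw [comp_point_high hD hD' hlo hhi hlo' hhi' f h2]
      exact Or.inr ⟨_, mem_iUnion.2 ⟨f, _, hf, rfl⟩, rfl⟩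
    · obtain ⟨e, f, rfl, hg⟩ := comp_mid_cases hD hD' hlo hhi hlo' hhi' hu h1 h2
      exact Or.inl (Or.inr ((mem_connectors_iff hD hD' hlo hhi hlo' hhi' pl pl' ho ho' hm _).2
        ⟨e, f, hg, u, h1.le, h2.le, rfl⟩))
  · rintro ((⟨p, hp, rfl⟩ | hp) | ⟨p, hp, rfl⟩)
    · obtain ⟨e, u, hu, rfl⟩ := mem_iUnion.1 hp
      have hu' : 3 * ((u - 2) / 3) + 2 = u := by ring
      obtain ⟨h1, h2⟩ := comp_low_mem (m := m) hD hD' hlo hhi hlo' hhi' (u := (u - 2) / 3)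
        (hu'.symm ▸ hu)
      have := comp_point_low (m := m) hD hD' hlo hhi hlo' hhi' e h2
      rw [hu'] at this
      rw [← this]
      exact mem_iUnion.2 ⟨_, _, h1, rfl⟩
    · obtain ⟨e, f, hg, u, h1, h2, rfl⟩ :=
        (mem_connectors_iff hD hD' hlo hhi hlo' hhi' pl pl' ho ho' hm _).1 hp
      exact mem_iUnion.2 ⟨_, _, comp_mid_mem hD hD' hlo hhi hlo' hhi' hg h1 h2, rfl⟩
    · obtain ⟨e, u, hu, rfl⟩ := mem_iUnion.1 hp
      have hu' : 3 * ((u + 2) / 3) - 2 = u := by ring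
      obtain ⟨h1, h2⟩ := comp_high_mem (m := m) hD hD' hlo hhi hlo' hhi' (u := (u + 2) / 3)
        (hu'.symm ▸ hu)
      have := comp_point_high (m := m) hD hD' hlo hhi hlo' hhi' e h2
      rw [hu'] at this
      rw [← this]
      exact mem_iUnion.2 ⟨_, _, h1, rfl⟩

theorem comp_toPlane : (comp m D D').toPlane = D'.toPlane.comp D.toPlane := by
  have hL := IsValid.comp hD hD' hlo hhi hlo' hhi' pl pl' ho ho' hm
  have fl := OpenGraph.IsFlow.comp (m := m) pl.toIsFlow pl'.toIsFlow
  -- Inner and outer nodes are compared separately: the former are the positions of the vertices,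
  -- the latter the points at the levels `-1` and `1`. The points that are joined by the segments
  -- are no longer nodes.
  have hnodes : (comp m D D').toPlane.nodes = (comp m D D').toPlane.inner (-1) 1 ∪
      (comp m D D').toPlane.outer (-1) 1 := by
    rw [PlaneGraph.inner, sdiff_union_of_subset]
    exact (hL.isLeveled fl).outer_subset
  have hin := hL.inner_eq fl
  have hin1 := hD.inner_eq pl.toIsFlow
  have hin2 := hD'.inner_eq pl'.toIsFlow
  rw [hlo, hhi] at hin1
  rw [hlo', hhi'] at hin2
  change (comp m D D').toPlane.inner (-1) 1 = range (Sum.elim _ _) at hin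
  rw [Sum.elim_range] at hin
  have hcar := comp_carrier hD hD' hlo hhi hlo' hhi' pl pl' ho ho' hm
  ext1
  · exact hcar
  · rw [hnodes, hin]
    change _ = gamma (-2) '' (D.toPlane.inner (-1) 1) ∪ gamma 2 '' (D'.toPlane.inner (-1) 1) ∪
      (gamma (-2) '' D.toPlane.atLevel (-1) ∪ gamma 2 '' D'.toPlane.atLevel 1)
    rw [hin1, hin2, ← range_comp, ← range_comp]
    refine congrArg₂ _ rfl ?_
    ext p
    constructor
    · rintro ⟨hp, h | h⟩
      · obtain ⟨g, u, hu, rfl⟩ := mem_iUnion.1 hp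
        obtain rfl : u = -1 := h
        obtain ⟨e, rfl, he⟩ := comp_low_cases hD hD' hlo hhi hlo' hhi' hu (by norm_num)
        left
        rw [comp_point_low hD hD' hlo hhi hlo' hhi' e (by norm_num)]
        exact ⟨_, ⟨mem_iUnion.2 ⟨e, _, he, rfl⟩, by simp only [point_snd]; norm_num⟩, rfl⟩
      · obtain ⟨g, u, hu, rfl⟩ := mem_iUnion.1 hp
        obtain rfl : u = 1 := h
        obtain ⟨e, rfl, he⟩ := comp_high_cases hD hD' hlo hhi hlo' hhi' hu (by norm_num)
        right
        rw [comp_point_high hD hD' hlo hhi hlo' hhi' e (by norm_num)]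
        exact ⟨_, ⟨mem_iUnion.2 ⟨e, _, he, rfl⟩, by simp only [point_snd]; norm_num⟩, rfl⟩
    · rintro (⟨p, ⟨hp, h⟩, rfl⟩ | ⟨p, ⟨hp, h⟩, rfl⟩)
      · refine ⟨?_, Or.inl ?_⟩
        · rw [hcar]
          exact Or.inl (Or.inl ⟨p, hp, rfl⟩)
        · simp only [gamma, h]; norm_num
      · refine ⟨?_, Or.inr ?_⟩
        · rw [hcar]
          exact Or.inr ⟨p, hp, rfl⟩
        · simp only [gamma, h]; norm_num

omit pl pl' ho ho' hm in
theorem comp_boxed (hb : ∀ p ∈ D.toPlane.carrier, p.1 ∈ Ioo (-1 : ℝ) 1)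
    (hb' : ∀ p ∈ D'.toPlane.carrier, p.1 ∈ Ioo (-1 : ℝ) 1) :
    ∀ p ∈ (comp m D D').toPlane.carrier, p.1 ∈ Ioo (-1 : ℝ) 1 := by
  intro p hp
  obtain ⟨g, u, hu, rfl⟩ := mem_iUnion.1 hp
  change (comp m D D').x g u ∈ _
  rcases le_or_gt u (-1 / 3) with h1 | h1
  · obtain ⟨e, rfl, he⟩ := comp_low_cases hD hD' hlo hhi hlo' hhi' hu h1
    rw [comp_x_low e h1]
    exact x_mem_of_boxed hb he
  rcases le_or_gt (1 / 3) u with h2 | h2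
  · obtain ⟨f, rfl, hf⟩ := comp_high_cases hD hD' hlo hhi hlo' hhi' hu h2
    rw [comp_x_high f h2]
    exact x_mem_of_boxed hb' hf
  · obtain ⟨e, f, rfl, hg⟩ := comp_mid_cases hD hD' hlo hhi hlo' hhi' hu h1 h2
    rw [comp_x_mid hg h1.le h2.le]
    have m1 := x_mem_of_boxed hb (hD.top_mem e)
    have m2 := x_mem_of_boxed hb' (hD'.bot_mem f)
    rw [top_of_none hg.tgt, hhi] at m1
    rw [bot_of_none hg.src, hlo'] at m2
    have := (convex_Ioo (-1 : ℝ) 1) m1 m2 (a := (1 - 3 * u) / 2) (b := (1 + 3 * u) / 2)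
      (by linarith) (by linarith) (by ring)
    exact this

end Valid

/-! ### The order of the composition -/

/-- The drawing displays the order of the outgoing edges of every vertex and of the edges without
source, and these determine a planar order. -/
theorem IsValid.order_unique {r r' : S.E → S.E → Prop} (hD : D.IsValid) (pl : S.IsPlanar r)
    (pl' : S.IsPlanar r') (ho : D.IsOrdered r) (ho' : D.IsOrdered r') (e f : S.E) :
    r e f ↔ r' e f :=
  pl.unique_of_out pl'
    (fun e f v he hf h => by
      rwa [← hD.leftAbove_iff pl' ho' he hf, hD.leftAbove_iff pl ho he hf])
    (fun e f he hf h => by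
      rwa [← hD.x_lo_lt_iff pl' ho' he hf, hD.x_lo_lt_iff pl ho he hf]) e f

section Order

variable (hD : D.IsValid) (hD' : D'.IsValid) (hlo : D.lo = -1) (hhi : D.hi = 1) (hlo' : D'.lo = -1)
  (hhi' : D'.hi = 1) {r : S.E → S.E → Prop} {r' : T.E → T.E → Prop} (pl : S.IsPlanar r)
  (pl' : T.IsPlanar r') (ho : D.IsOrdered r) (ho' : D'.IsOrdered r')
  {q : (OpenGraph.comp m).E → (OpenGraph.comp m).E → Prop} (plq : (OpenGraph.comp m).IsPlanar q)
  (hoq : (comp m D D').IsOrdered q)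
include hD hD' hlo hhi hlo' hhi' pl pl' ho ho' plq hoq

/-- Composed paths between edges of `S` are paths in `S`, so the restriction of `q` is a planar
order. As `D` reappears in the lower zone, `D` is ordered by it, and `order_unique` applies. -/
theorem comp_order_inl (e f : S.E) : r e f ↔ q (.inl e) (.inl f) := by
  refine hD.order_unique (r' := fun e f => q (.inl e) (.inl f)) pl ?_ ho ?_ e f
  · exact
      { toIsFlow := pl.toIsFlow
        irrefl := fun e => plq.irrefl _
        trans := fun e f g => plq.trans _ _ _
        total := fun e f => by
          rw [← Sum.inl_injective.eq_iff]
          exact plq.total _ _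
        step := fun e f h => plq.step _ _ (OpenGraph.comp_step_inl h)
        between := fun a b c p h1 h2 => by
          rw [← OpenGraph.comp_path_inl_iff (m := m), ← OpenGraph.comp_path_inl_iff (m := m)]
          exact plq.between _ _ _ (OpenGraph.comp_path_inl p) h1 h2 }
  · intro e f u h he hf
    have hu : 3 * ((u - 2) / 3) + 2 = u := by ring
    obtain ⟨h1, h2⟩ := comp_low_mem (m := m) hD hD' hlo hhi hlo' hhi' (u := (u - 2) / 3)
      (hu.symm ▸ he)
    obtain ⟨h3, -⟩ := comp_low_mem (m := m) hD hD' hlo hhi hlo' hhi' (u := (u - 2) / 3)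
      (hu.symm ▸ hf)
    have := hoq _ _ _ h h1 h3
    rwa [comp_x_low e h2, comp_x_low f h2, hu] at this

theorem comp_order_snd (e f : T.E) : r' e f ↔ q (compSnd m e) (compSnd m f) := by
  refine hD'.order_unique (r' := fun e f => q (compSnd m e) (compSnd m f)) pl' ?_ ho' ?_ e f
  · exact
      { toIsFlow := pl'.toIsFlow
        irrefl := fun e => plq.irrefl _
        trans := fun e f g => plq.trans _ _ _
        total := fun e f => by
          rw [← (OpenGraph.compSnd_injective (m := m)).eq_iff]
          exact plq.total _ _
        step := fun e f h => plq.step _ _ (OpenGraph.comp_step_snd h)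
        between := fun a b c p h1 h2 => by
          rw [← OpenGraph.comp_path_snd_iff (m := m), ← OpenGraph.comp_path_snd_iff (m := m)]
          exact plq.between _ _ _ (OpenGraph.comp_path_snd p) h1 h2 }
  · intro e f u h he hf
    have hu : 3 * ((u + 2) / 3) - 2 = u := by ring
    obtain ⟨h1, h2⟩ := comp_high_mem (m := m) hD hD' hlo hhi hlo' hhi' (u := (u + 2) / 3)
      (hu.symm ▸ he)
    obtain ⟨h3, -⟩ := comp_high_mem (m := m) hD hD' hlo hhi hlo' hhi' (u := (u + 2) / 3)
      (hu.symm ▸ hf)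
    have := hoq _ _ _ h h1 h3
    rwa [comp_x_high e h2, comp_x_high f h2, hu] at this

/-- Let `e` precede `f`, and let a path lead from `e` up to an output `o` glued to `i`. If `f`
preceded `i`, it would lie between the ends of this path. By P2 there would be a path from `f` to
`i`, which is impossible as `i` has no source in `T` and `f` has one, or a path from `e` to `f`,
which passes through another grafted edge that serves instead of `o`. -/
theorem comp_order_mixed {e : S.E} {f : T.E} (he : S.tgt e ≠ none) (hf : T.src f ≠ none) :
    (q (.inl e) (compSnd m f) ↔ ∃ o i, Glue m o i ∧ r e o ∧ r' i f) ∧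
      (q (compSnd m f) (.inl e) ↔ ¬ ∃ o i, Glue m o i ∧ r e o ∧ r' i f) := by
  have h1 := comp_order_inl hD hD' hlo hhi hlo' hhi' pl pl' ho ho' plq hoq
  have h2 := comp_order_snd hD hD' hlo hhi hlo' hhi' pl pl' ho ho' plq hoq
  have hne : ∀ o, S.tgt o = none → ∀ p : S.Path e o, r e o := fun o ho p => by
    rcases pl.of_path p with rfl | h
    · exact (he ho).elim
    · exact h
  have hne' : ∀ i, T.src i = none → ∀ p : T.Path i f, r' i f := fun i hi p => by
    rcases pl'.of_path p with rfl | h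
    · exact (hf hi).elim
    · exact h
  have key : q (.inl e) (compSnd m f) ↔ ∃ o i, Glue m o i ∧ r e o ∧ r' i f := by
    constructor
    · intro h
      have hp : (OpenGraph.comp m).Path (.inl e) (compSnd m f) →
          ∃ o i, Glue m o i ∧ r e o ∧ r' i f := fun p => by
        obtain ⟨o, i, p1, hg, p2⟩ := OpenGraph.exists_glue_of_comp_path p
        exact ⟨o, i, hg, hne o hg.tgt p1, hne' i hg.src p2⟩
      obtain ⟨o, hot, p⟩ := pl.exists_output e
      obtain ⟨i, hg⟩ := OpenGraph.exists_glue_of_tgt (m := m) hot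
      rcases pl'.total i f with h3 | rfl | h3
      · exact ⟨o, i, hg, hne o hot p, h3⟩
      · exact (hf hg.src).elim
      · rw [h2, ← show Sum.inl o = compSnd m i from hg] at h3
        rcases plq.between _ _ _ (OpenGraph.comp_path_inl p) h h3 with p1 | p1
        · rw [show Sum.inl o = compSnd m i from hg, OpenGraph.comp_path_snd_iff] at p1
          rw [p1.eq_of_src hg.src] at hf
          exact (hf hg.src).elim
        · exact hp p1
    · rintro ⟨o, i, hg, h3, h4⟩
      rw [h1] at h3
      rw [h2, ← show Sum.inl o = compSnd m i from hg] at h4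
      exact plq.trans _ _ _ h3 h4
  refine ⟨key, ?_⟩
  rw [← key]
  constructor
  · exact fun h h' => plq.asymm h h'
  · intro h
    rcases plq.total (.inl e) (compSnd m f) with h3 | h3 | h3
    · exact (h h3).elim
    · exact (he (OpenGraph.Glue.tgt (m := m) h3)).elim
    · exact h3

end Order

end Drawing

open GraphData OpenGraph

/-! ## Planar graphs and plane graphs -/

namespace Drawing

variable {S S' : OpenGraph} {r : S.E → S.E → Prop} {r' : S'.E → S'.E → Prop}

/-- The transport of a drawing along an isomorphism. -/
def pullback (i : Iso S r S' r') (D : Drawing S') : Drawing S where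
  lo := D.lo
  hi := D.hi
  pt v := D.pt (i.onV v)
  x e := D.x (i.onE e)

variable (i : Iso S r S' r') {D : Drawing S'}

theorem pullback_bot (e : S.E) : (pullback i D).bot e = D.bot (i.onE e) := by
  rw [bot, bot, i.src]
  cases S.src e <;> rfl

theorem pullback_top (e : S.E) : (pullback i D).top e = D.top (i.onE e) := by
  rw [top, top, i.tgt]
  cases S.tgt e <;> rfl

theorem IsValid.pullback (hD : D.IsValid) : (pullback i D).IsValid where
  lt := hD.lt
  bounds v := hD.bounds _
  bot_lt_top e := by rw [pullback_bot, pullback_top]; exact hD.bot_lt_top _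
  cont e := by rw [pullback_bot, pullback_top]; exact hD.cont _
  x_src e v h := hD.x_src _ _ (by rw [i.src, h]; rfl)
  x_tgt e v h := hD.x_tgt _ _ (by rw [i.tgt, h]; rfl)
  disj e f u hne he hf hx := by
    rw [pullback_bot, pullback_top] at he hf
    obtain ⟨w, h1, h2, h3⟩ := hD.disj _ _ u (fun h => hne (i.onE.injective h)) he hf hx
    obtain ⟨v, rfl⟩ := i.onV.surjective w
    have hinc : ∀ e, S'.Inc (i.onE e) (i.onV v) → S.Inc e v := by
      intro e h
      simpa [Inc, i.src, i.tgt] using h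
    exact ⟨v, hinc e h1, hinc f h2, h3⟩

theorem IsOrdered.pullback (ho : D.IsOrdered r') : (pullback i D).IsOrdered r := by
  intro e f u h he hf
  rw [pullback_bot, pullback_top] at he hf
  exact ho _ _ u ((i.lt _ _).1 h) he hf

theorem pullback_toPlane : (pullback i D).toPlane = D.toPlane := by
  have hp : ∀ e u, (pullback i D).point e u = D.point (i.onE e) u := fun _ _ => rfl
  have ha : ∀ e, (pullback i D).arc e = D.arc (i.onE e) := fun e => by
    rw [arc, arc, pullback_bot, pullback_top]; rfl
  ext p
  · simp only [toPlane, ha]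
    rw [i.onE.surjective.iUnion_comp D.arc]
  · simp only [toPlane, mem_ofPred_eq, pullback_bot, pullback_top, hp]
    exact i.onE.surjective.exists (p := fun e => p = D.point e (D.bot e) ∨ p = D.point e (D.top e))
      |>.symm

theorem IsValid.toLeveled_pullback (hD : D.IsValid) (fl : S.IsFlow) (fl' : S'.IsFlow) :
    (hD.pullback i).toLeveled fl = hD.toLeveled fl' := by
  have h := pullback_toPlane i (D := D)
  have key : ∀ (G G' : PlaneGraph) (a b : ℝ) (h1 : G.IsLeveled a b) (h2 : G'.IsLeveled a b),
      G = G' → (⟨G, a, b, h1⟩ : LeveledGraph) = ⟨G', a, b, h2⟩ := by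
    rintro G _ a b h1 h2 rfl
    rfl
  exact key _ _ _ _ _ _ h

/-- The boxed graph of a drawing in the box. -/
def IsValid.toBoxed {D : Drawing S} (hD : D.IsValid) (fl : S.IsFlow) (hlo : D.lo = -1)
    (hhi : D.hi = 1) (hb : ∀ p ∈ D.toPlane.carrier, p.1 ∈ Ioo (-1 : ℝ) 1) : BoxedGraph where
  toLeveledGraph := hD.toLeveled fl
  lo_eq := hlo
  hi_eq := hhi
  boxed := hb

end Drawing

/-! ### Planar graphs underlying plane graphs -/

namespace PlanarGraph

/-- The combinatorial planar graph `X` is the underlying combinatorial graph of `G`. -/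
def Underlies (X : PlanarGraph) (G : LeveledGraph) : Prop :=
  ∃ φ : X.H ≃ G.toGraphData.H, G.IsIdentification X φ

end PlanarGraph

open PlanarGraph

theorem LeveledGraph.exists_planar_drawing (G : LeveledGraph) :
    ∃ (S : OpenGraph) (r : S.E → S.E → Prop) (pl : S.IsPlanar r) (D : Drawing S) (hD : D.IsValid),
      D.IsOrdered r ∧ hD.toLeveled pl.toIsFlow = G := by
  obtain ⟨S, fl, D, hD, rfl⟩ := G.exists_drawing
  exact ⟨S, D.order, hD.isPlanar_order fl, D, hD, hD.isOrdered_order fl, rfl⟩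

namespace Drawing.IsValid

variable {S : OpenGraph} {r : S.E → S.E → Prop} {D : Drawing S}

theorem underlies_iff (hD : D.IsValid) (pl : S.IsPlanar r) (ho : D.IsOrdered r) (X : PlanarGraph) :
    X.Underlies (hD.toLeveled pl.toIsFlow) ↔ ∃ ε : X.H → S.E, PresentsOrd X.toPlanarData S r ε :=
  ⟨fun ⟨_, hφ⟩ => hD.exists_presentsOrd pl ho hφ, fun ⟨_, p⟩ => hD.exists_isIdentification pl ho p⟩

end Drawing.IsValid

namespace PlanarGraph

theorem Underlies.of_deforms {X : PlanarGraph} {G K : LeveledGraph} (h : X.Underlies G)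
    (d : Deforms G K) : X.Underlies K := by
  obtain ⟨S, r, pl, D, hD, ho, rfl⟩ := G.exists_planar_drawing
  obtain ⟨S', r', pl', D', hD', ho', rfl⟩ := K.exists_planar_drawing
  obtain ⟨i⟩ := Drawing.exists_iso_of_deforms pl pl' hD hD' ho ho' d
  obtain ⟨ε, p⟩ := (hD.underlies_iff pl ho X).1 h
  exact (hD'.underlies_iff pl' ho' X).2 ⟨_, p.map_iso i⟩

/-- Two presentations of `X` have isomorphic open graphs; along this isomorphism both plane graphs
become ordered drawings of the same open graph. -/
theorem Underlies.deforms {X : PlanarGraph} {G K : LeveledGraph} (h : X.Underlies G)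
    (h' : X.Underlies K) : Deforms G K := by
  obtain ⟨S, r, pl, D, hD, ho, rfl⟩ := G.exists_planar_drawing
  obtain ⟨S', r', pl', D', hD', ho', rfl⟩ := K.exists_planar_drawing
  obtain ⟨ε, p⟩ := (hD.underlies_iff pl ho X).1 h
  obtain ⟨ε', p'⟩ := (hD'.underlies_iff pl' ho' X).1 h'
  obtain ⟨i, -⟩ := p.exists_iso p'.toPresents (r := r) (r' := r') pl pl' fun h k => by rw [← p.lt, p'.lt]
  have := Drawing.deforms pl hD (hD'.pullback i) ho (ho'.pullback i)
  rwa [hD'.toLeveled_pullback i pl.toIsFlow pl'.toIsFlow] at this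

theorem Underlies.iso {X Y : PlanarGraph} {G : LeveledGraph} (h : X.Underlies G)
    (h' : Y.Underlies G) : X.toPlanarData.Iso Y.toPlanarData := by
  obtain ⟨S, r, pl, D, hD, ho, rfl⟩ := G.exists_planar_drawing
  obtain ⟨ε, p⟩ := (hD.underlies_iff pl ho X).1 h
  obtain ⟨ε', p'⟩ := (hD.underlies_iff pl ho Y).1 h'
  exact p.iso p'

theorem Underlies.of_iso {X Y : PlanarGraph} {G : LeveledGraph} (h : Y.Underlies G)
    (i : X.toPlanarData.Iso Y.toPlanarData) : X.Underlies G := by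
  obtain ⟨S, r, pl, D, hD, ho, rfl⟩ := G.exists_planar_drawing
  obtain ⟨ε, p⟩ := (hD.underlies_iff pl ho Y).1 h
  exact (hD.underlies_iff pl ho X).2 (p.of_iso i)

theorem exists_boxed (X : PlanarGraph) : ∃ G : BoxedGraph, X.Underlies G.toLeveledGraph := by
  obtain ⟨S, r, ε, pl, p⟩ := PlanarData.exists_presentsOrd X.isPlanar
  obtain ⟨D, hD, ho, hlo, hhi, hb⟩ := Drawing.exists_boxed pl
  exact ⟨hD.toBoxed pl.toIsFlow hlo hhi hb, (hD.underlies_iff pl ho X).2 ⟨ε, p⟩⟩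

theorem exists_underlies (G : LeveledGraph) : ∃ X : PlanarGraph, X.Underlies G := by
  obtain ⟨S, r, pl, D, hD, ho, rfl⟩ := G.exists_planar_drawing
  have p := hD.presents pl.toIsFlow
  let Z : PlanarData :=
    { toGraphData := (hD.toLeveled pl.toIsFlow).toGraphData
      lt := fun e f => ∃ h k, edge h = e ∧ edge k = f ∧
        r (hD.edgeOf pl.toIsFlow h) (hD.edgeOf pl.toIsFlow k) }
  have pZ : PresentsOrd Z S r (hD.edgeOf pl.toIsFlow) := ⟨p, fun h k =>
    ⟨fun ⟨h', k', h1, h2, h3⟩ => by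
      rwa [(p.edge_eq_iff _ _).1 h1, (p.edge_eq_iff _ _).1 h2] at h3,
    fun h1 => ⟨h, k, rfl, rfl, h1⟩⟩⟩
  exact ⟨⟨Z, pZ.isPlanar pl⟩, (hD.underlies_iff pl ho _).2 ⟨_, pZ⟩⟩

theorem Underlies.ncard_eq {X : PlanarGraph} {G : LeveledGraph} (h : X.Underlies G) :
    X.inputs.ncard = G.dom.ncard ∧ X.outputs.ncard = G.cod.ncard := by
  obtain ⟨S, r, pl, D, hD, ho, rfl⟩ := G.exists_planar_drawing
  obtain ⟨ε, p⟩ := (hD.underlies_iff pl ho X).1 h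
  have h1 := p.image_inputs (fun _ _ => pl.src_ne_tgt) fun _ => True
  have h2 := p.image_outputs (fun _ _ => pl.src_ne_tgt) fun _ => True
  simp only [and_true, ofPred_mem_eq] at h1 h2
  rw [h1, h2, hD.dom_eq, hD.cod_eq, ncard_image_of_injective _ hD.openArc_injective,
    ncard_image_of_injective _ hD.openArc_injective]
  exact ⟨rfl, rfl⟩

theorem Underlies.tensor {X Y : PlanarGraph} {G K : BoxedGraph} (h : X.Underlies G.toLeveledGraph)
    (h' : Y.Underlies K.toLeveledGraph) : ∃ (Z : PlanarGraph) (L : BoxedGraph),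
      Z.toPlanarData = X.toPlanarData.tensor Y.toPlanarData ∧
      L.toPlaneGraph = G.toPlaneGraph.tensor K.toPlaneGraph ∧ Z.Underlies L.toLeveledGraph := by
  obtain ⟨G, hlo, hhi, hb⟩ := G
  obtain ⟨K, hlo', hhi', hb'⟩ := K
  obtain ⟨S, r, pl, D, hD, ho, rfl⟩ := G.exists_planar_drawing
  obtain ⟨S', r', pl', D', hD', ho', rfl⟩ := K.exists_planar_drawing
  obtain ⟨ε, p⟩ := (hD.underlies_iff pl ho X).1 h
  obtain ⟨ε', p'⟩ := (hD'.underlies_iff pl' ho' Y).1 h'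
  have elo : D.lo = D'.lo := hlo.trans hlo'.symm
  have ehi : D.hi = D'.hi := hhi.trans hhi'.symm
  have hL := hD.sum hD' elo ehi hb hb'
  have plL := pl.sum pl'
  have pZ := p.tensor p'
  exact ⟨⟨_, pZ.isPlanar plL⟩,
    hL.toBoxed plL.toIsFlow hlo hhi (Drawing.sum_boxed elo ehi hb hb'), rfl,
    Drawing.sum_toPlane elo ehi,
    (hL.underlies_iff plL (ho.sum ho' elo ehi hb hb') _).2 ⟨_, pZ⟩⟩

theorem Underlies.comp {X Y : PlanarGraph} {G K : BoxedGraph} (h : X.Underlies G.toLeveledGraph)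
    (h' : Y.Underlies K.toLeveledGraph) (hc : X.outputs.ncard = Y.inputs.ncard) :
    ∃ (Z : PlanarGraph) (L : BoxedGraph), Z.toPlanarData = Y.toPlanarData.comp X.toPlanarData ∧
      L.toPlaneGraph = K.toPlaneGraph.comp G.toPlaneGraph ∧ Z.Underlies L.toLeveledGraph := by
  obtain ⟨G, hlo, hhi, hb⟩ := G
  obtain ⟨K, hlo', hhi', hb'⟩ := K
  obtain ⟨S, r, pl, D, hD, ho, rfl⟩ := G.exists_planar_drawing
  obtain ⟨S', r', pl', D', hD', ho', rfl⟩ := K.exists_planar_drawing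
  obtain ⟨ε, p⟩ := (hD.underlies_iff pl ho X).1 h
  obtain ⟨ε', p'⟩ := (hD'.underlies_iff pl' ho' Y).1 h'
  have loop : ∀ e v, S.src e = some v → S.tgt e = some v → False := fun _ _ => pl.src_ne_tgt
  have loop' : ∀ e v, S'.src e = some v → S'.tgt e = some v → False := fun _ _ => pl'.src_ne_tgt
  have h1 := p.image_outputs loop fun _ => True
  have h2 := p'.image_inputs loop' fun _ => True
  simp only [and_true, ofPred_mem_eq] at h1 h2
  rw [h1, h2] at hc
  obtain ⟨m, hm⟩ := exists_matching pl pl' hc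
  have hL := Drawing.IsValid.comp hD hD' hlo hhi hlo' hhi' pl pl' ho ho' hm
  have fl := IsFlow.comp (m := m) pl.toIsFlow pl'.toIsFlow
  -- The composite graph gets its planar order from its drawing; the comparison results below show
  -- that it is the shuffled order.
  have plL := hL.isPlanar_order fl
  have hoL := hL.isOrdered_order fl
  have pZ := PresentsOrd.comp p p' loop loop' hm
    (Drawing.comp_order_inl hD hD' hlo hhi hlo' hhi' pl pl' ho ho' plL hoL)
    (Drawing.comp_order_snd hD hD' hlo hhi hlo' hhi' pl pl' ho ho' plL hoL)
    (fun _ _ => Drawing.comp_order_mixed hD hD' hlo hhi hlo' hhi' pl pl' ho ho' plL hoL)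
  exact ⟨⟨_, pZ.isPlanar plL⟩,
    hL.toBoxed fl rfl rfl (Drawing.comp_boxed hD hD' hlo hhi hlo' hhi' hb hb'), rfl,
    Drawing.comp_toPlane hD hD' hlo hhi hlo' hhi' pl pl' ho ho' hm,
    (hL.underlies_iff plL hoL _).2 ⟨_, pZ⟩⟩

end PlanarGraph

/-- The bijection between planar graphs and plane graphs. -/
theorem exists_classEquiv : ∃ Φ : PlanarClass ≃ PlaneClass, ∀ (X : PlanarGraph) (G : LeveledGraph),
    Φ ⟦X⟧ = ⟦G⟧ ↔ X.Underlies G := by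
  choose g hg using PlanarGraph.exists_boxed
  choose k hk using PlanarGraph.exists_underlies
  refine ⟨⟨Quotient.lift (fun X => ⟦(g X).toLeveledGraph⟧) fun X Y hXY =>
      Quotient.sound ((hg X).deforms ((hg Y).of_iso hXY)),
    Quotient.lift (fun G => ⟦k G⟧) fun G K hGK =>
      Quotient.sound (((hk G).of_deforms hGK).iso (hk K)), ?_, ?_⟩, fun X G => ⟨fun h => ?_,
    fun h => Quotient.sound ((hg X).deforms h)⟩⟩
  · intro c
    induction c using Quotient.inductionOn with
    | h X => exact Quotient.sound ((hk _).iso (hg X))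
  · intro c
    induction c using Quotient.inductionOn with
    | h G => exact Quotient.sound ((hg _).deforms (hk G))
  · exact (hg X).of_deforms (Quotient.exact h)

end TensorCalc

end

open TensorCalc in
theorem theorem3p6p1 :
    ∃! Φ : PlanarClass ≃ PlaneClass,
      (∀ (X : PlanarGraph) (G : LeveledGraph),
        Φ ⟦X⟧ = ⟦G⟧ ↔ ∃ φ : X.H ≃ G.toGraphData.H, G.IsIdentification X φ) ∧
      (∀ (X : PlanarGraph) (G : LeveledGraph), Φ ⟦X⟧ = ⟦G⟧ →
        X.inputs.ncard = G.dom.ncard ∧ X.outputs.ncard = G.cod.ncard) ∧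
      (∀ c : PlaneClass, ∃ G : BoxedGraph, ⟦G.toLeveledGraph⟧ = c) ∧
      (∀ (X Y : PlanarGraph) (G K : BoxedGraph),
        Φ ⟦X⟧ = ⟦G.toLeveledGraph⟧ → Φ ⟦Y⟧ = ⟦K.toLeveledGraph⟧ →
        ∃ (Z : PlanarGraph) (L : BoxedGraph),
          Z.toPlanarData = X.toPlanarData.tensor Y.toPlanarData ∧
          L.toPlaneGraph = G.toPlaneGraph.tensor K.toPlaneGraph ∧
          Φ ⟦Z⟧ = ⟦L.toLeveledGraph⟧) ∧
      (∀ (X Y : PlanarGraph) (G K : BoxedGraph),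
        Φ ⟦X⟧ = ⟦G.toLeveledGraph⟧ → Φ ⟦Y⟧ = ⟦K.toLeveledGraph⟧ →
        X.outputs.ncard = Y.inputs.ncard →
        ∃ (Z : PlanarGraph) (L : BoxedGraph),
          Z.toPlanarData = Y.toPlanarData.comp X.toPlanarData ∧
          L.toPlaneGraph = K.toPlaneGraph.comp G.toPlaneGraph ∧
          Φ ⟦Z⟧ = ⟦L.toLeveledGraph⟧) := by
  obtain ⟨Φ, hΦ⟩ := exists_classEquiv
  refine ⟨Φ, ⟨hΦ, fun X G h => ((hΦ X G).1 h).ncard_eq, fun c => ?_, fun X Y G K h h' => ?_,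
    fun X Y G K h h' hc => ?_⟩, fun Ψ hΨ => ?_⟩
  · obtain ⟨d, rfl⟩ := Φ.surjective c
    induction d using Quotient.inductionOn with
    | h X =>
      obtain ⟨G, hG⟩ := X.exists_boxed
      exact ⟨G, ((hΦ X G.toLeveledGraph).2 hG).symm⟩
  · obtain ⟨Z, L, h1, h2, h3⟩ := ((hΦ _ _).1 h).tensor ((hΦ _ _).1 h')
    exact ⟨Z, L, h1, h2, (hΦ _ _).2 h3⟩
  · obtain ⟨Z, L, h1, h2, h3⟩ := ((hΦ _ _).1 h).comp ((hΦ _ _).1 h') hc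
    exact ⟨Z, L, h1, h2, (hΦ _ _).2 h3⟩
  -- The first property alone determines the map, because every planar graph underlies some plane
  -- graph.
  · ext c
    induction c using Quotient.inductionOn with
    | h X =>
      obtain ⟨G, hG⟩ := X.exists_boxed
      exact ((hΨ.1 X G.toLeveledGraph).2 hG).trans ((hΦ X G.toLeveledGraph).2 hG).symm
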